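/- Let $Q$ be a finite-dimensional (Hausdorff, second countable) smooth manifold with a nonholonomic system given by a Riemannian metric $\kappa$, a potential $U\in C^\infty(Q)$ and a regular smooth distribution $D\subseteq TQ$ of admissible velocities. Let $\mathcal M=\kappa^\sharp(D)\subset T^*Q$ be the constraint submanifold, with $\kappa^\sharp(v)=\kappa(v,\cdot)$, projection $\tau:\mathcal M\to Q$ and inclusion $\iota$; let $\mathcal H_{\mathcal M}$ be the restriction to $\mathcal M$ of $\mathcal H(q,p)=\tfrac12|p|_\kappa^2+U(q)$, let $\Theta_Q$ be the Liouville 1-form of $T^*Q$, $\Theta_{\mathcal M}=\iota^*\Theta_Q$, $\Omega_{\mathcal M}=\iota^*(-d\Theta_Q)$, and $\mathcal C=\{v\in T\mathcal M: T\tau(v)\in D\}$. The nonholonomic vector field $X_{nh}$ is the section of $\mathcal C$ with $\mathbf i_{X_{nh}}\Omega_{\mathcal M}|_{\mathcal C}=d\mathcal H_{\mathcal M}|_{\mathcal C}$, and the nonholonomic bivector $\pi_{nh}$ is defined by: $\pi_{nh}^\sharp(\alpha)=-X$ iff $X\in\mathcal C$ and $\mathbf i_X\Omega_{\mathcal M}|_{\mathcal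 C}=\alpha|_{\mathcal C}$. (For a bivector $\pi$, $\beta(\pi^\sharp\alpha)=\pi(\alpha,\beta)$ and $\{f,g\}=\pi(df,dg)$.) The gauge transformation of $\pi$ by a 2-form $B$ is defined when $\mathrm{Id}+B^\flat\circ\pi^\sharp$ is invertible, where $B^\flat(X)=\mathbf i_XB$, and is the bivector with $\pi_B^\sharp=\pi^\sharp\circ(\mathrm{Id}+B^\flat\circ\pi^\sharp)^{-1}$. Let a Lie group $G$ with Lie algebra $\mathfrak g$ act smoothly, freely and properly on $Q$, preserving $\kappa$, $U$ and $D$; it acts on $\mathcal M$ by the cotangent lift. Write $\xi_{\mathcal M}$ for the infinitesimal generators, $V$ and $\mathcal V$ for the tangent distributions to the orbits in $Q$ and $\mathcal M$, and $\rho:\mathcal M\to\mathcal M/G$ for the orbit projection onto the quotient manifold. Let $W\subseteq V$ be a $G$-invariant smooth distribution with $TQ=D\oplus W$ (so $TQ=D+V$), and let $\mathcal W=(T\tau|_{\mathcal V})^{-1}(W)$, so that $T\mathcal M=\mathcal C\oplus\mathcal W$ with projections $P_{\mathcal C},P_{\mathcal W}$. Define the $\mathfrak g$-valued forms $\mathcal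 A_{\mathcal W}$ by $\mathcal A_{\mathcal W}(v)=\xi\iff P_{\mathcal W}(v)=\xi_{\mathcal M}$, and $\mathcal K_{\mathcal W}(X,Y)=d\mathcal A_{\mathcal W}(P_{\mathcal C}X,P_{\mathcal C}Y)$, and the momentum map $\langle\mathcal J,\eta\rangle=\Theta_{\mathcal M}(\eta_{\mathcal M})$. Let $B$ be a smooth $G$-invariant 2-form on $\mathcal M$ such that $\mathbf i_ZB=0$ for all $Z\in\mathcal W$, such that $\mathrm{Id}+B^\flat\circ\pi_{nh}^\sharp$ is invertible and $\mathbf i_{X_{nh}}B=0$ (that is, $B$ defines a dynamical gauge transformation $\pi_B$ of $\pi_{nh}$), and such that $B+\langle\mathcal J,\mathcal K_{\mathcal W}\rangle$ is basic for $\rho$ (that is, $G$-invariant and annihilated by $\mathcal V$). Then: 1. $X_{nh}$, $\pi_{nh}$ and $\mathcal A_{\mathcal W}$ are well defined; the gauge transformation $\pi_{\mathcal J\mathcal K}$ of $\pi_{nh}$ by $-\langle\mathcal J,\mathcal K_{\mathcal W}\rangle$ is defined; there is a smooth 2-form $\mathcal B$ on $\mathcal M/G$ with $\rho^*\mathcal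 B=B+\langle\mathcal J,\mathcal K_{\mathcal W}\rangle$; and $\pi_{\mathcal J\mathcal K}$ and $\pi_B$ reduce to smooth bivector fields $\Lambda$ and $\pi^B_{red}$ on $\mathcal M/G$, i.e. $\Lambda^\sharp(\alpha)=T\rho\,\pi_{\mathcal J\mathcal K}^\sharp(\rho^*\alpha)$ and $(\pi^B_{red})^\sharp(\alpha)=T\rho\,\pi_B^\sharp(\rho^*\alpha)$. 2. The bivector $\pi^B_{red}$ describes the reduced dynamics: $\mathcal H_{\mathcal M}=\mathcal H_{red}\circ\rho$ for a smooth function $\mathcal H_{red}$ on $\mathcal M/G$, and $(\pi^B_{red})^\sharp(d\mathcal H_{red})=-T\rho(X_{nh})$. Moreover $\mathrm{Id}+\mathcal B^\flat\circ\Lambda^\sharp$ is invertible and $\pi^B_{red}$ is the gauge transformation of $\Lambda$ by $\mathcal B$. 3. Suppose in addition that the vertical-symmetry condition holds: there is a subspace $\mathfrak g_W\subseteq\mathfrak g$ with $\mathcal W_m=\{\xi_{\mathcal M}(m):\xi\in\mathfrak g_W\}$ for all $m\in\mathcal M$. Then $\Lambda$ is a Poisson structure and $\pi^B_{red}$ is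 $\phi$-twisted Poisson for the closed 3-form $\phi=-d\mathcal B$, i.e. $\{f,\{g,h\}\}+\{g,\{h,f\}\}+\{h,\{f,g\}\}=\phi(X_f,X_g,X_h)$ for the bracket of $\pi_{red}^B$, with $X_f=-(\pi^B_{red})^\sharp(df)$. 4. Under the vertical-symmetry condition, let $\mathfrak g_{\mathcal S}|_m=\{\xi\in\mathfrak g:\xi_{\mathcal M}(m)\in\mathcal C_m\cap\mathcal V_m\}$ and let the nonholonomic momentum map be $\langle\mathcal J^{nh}(m),\xi\rangle=\Theta_{\mathcal M}(\xi_{\mathcal M}(m))$ for $\xi\in\mathfrak g_{\mathcal S}|_m$. Then $\mathfrak g=\mathfrak g_{\mathcal S}|_m\oplus\mathfrak g_W$ for every $m$; and if $P_{\mathfrak g_{\mathcal S}}$ denotes the projection onto $\mathfrak g_{\mathcal S}$, then for every $\eta\in\mathfrak g$ the function $\langle\mathcal J^{nh},P_{\mathfrak g_{\mathcal S}}(\eta)\rangle$ on $\mathcal M$ is smooth and is constant along the integral curves of $X_{nh}$. -/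

import Mathlib

open scoped Manifold ContDiff Topology

noncomputable section

/-! ### Differential forms on manifolds -/

section Forms

variable {E : Type*} [NormedAddCommGroup E] [NormedSpace ℝ E]
  {H : Type*} [TopologicalSpace H] (I : ModelWithCorners ℝ E H)
  {E' : Type*} [NormedAddCommGroup E'] [NormedSpace ℝ E']
  {H' : Type*} [TopologicalSpace H'] (I' : ModelWithCorners ℝ E' H')
  {V : Type*} [NormedAddCommGroup V] [NormedSpace ℝ V]

/-- Pointwise `V`-valued `k`-forms on `M` (smoothness is the separate predicate
`DForm.IsSmooth`). -/
abbrev DForm (M : Type*) [TopologicalSpace M] [ChartedSpace H M] (k : ℕ)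
    (V : Type*) [NormedAddCommGroup V] [NormedSpace ℝ V] : Type _ :=
  ∀ x : M, TangentSpace I x [⋀^Fin k]→L[ℝ] V

variable {M : Type*} [TopologicalSpace M] [ChartedSpace H M]
  {N : Type*} [TopologicalSpace N] [ChartedSpace H' N] {k : ℕ}

/-- The pullback `f^* α`. -/
def DForm.pullback (f : M → N) (α : DForm I' N k V) : DForm I M k V :=
  fun x => (α (f x)).compContinuousLinearMap (mfderiv I I' f x)

/-- The expression of `α` in the chart at `x₀`: its pullback by the inverse of the chart. -/
def DForm.inChart (α : DForm I M k V) (x₀ : M) : E → E [⋀^Fin k]→L[ℝ] V :=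
  fun y => (α ((extChartAt I x₀).symm y)).compContinuousLinearMap
    (mfderiv 𝓘(ℝ, E) I (extChartAt I x₀).symm y)

/-- Smooth forms: smooth in every chart (of a manifold without boundary). -/
def DForm.IsSmooth (α : DForm I M k V) : Prop :=
  ∀ x₀ : M, ContDiffOn ℝ ∞ (DForm.inChart I α x₀) (extChartAt I x₀).target

/-- The exterior derivative, computed in charts, with the normalisation
`dα(X, Y) = X(α(Y)) - Y(α(X)) - α([X, Y])`. -/
def DForm.d (α : DForm I M k V) : DForm I M (k + 1) V :=
  fun x => (extDeriv (DForm.inChart I α x) (extChartAt I x x)).compContinuousLinearMap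
    (mfderiv I 𝓘(ℝ, E) (extChartAt I x) x)

/-- The differential of a function, as a covector at each point. -/
def diffAt (f : M → ℝ) (x : M) : TangentSpace I x →L[ℝ] ℝ := mfderiv I 𝓘(ℝ, ℝ) f x

/-- `u ↦ i_u B = B(u, ·)` for an alternating bilinear form `B` on a vector space. -/
def altFlat (B : E [⋀^Fin 2]→L[ℝ] ℝ) : E →L[ℝ] E →L[ℝ] ℝ :=
  ((ContinuousAlternatingMap.ofSubsingletonLIE (𝕜 := ℝ) (E := E) (F := ℝ) (0 : Fin 1)).symm.toContinuousLinearEquiv :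
    (E [⋀^Fin 1]→L[ℝ] ℝ) →L[ℝ] (E →L[ℝ] ℝ)).comp B.curryLeft

theorem altFlat_apply (B : E [⋀^Fin 2]→L[ℝ] ℝ) (u v : E) : altFlat B u v = B ![u, v] := by
  have : (fun _ : Fin 1 => v) = ![v] := by ext i; simp
  change B (Matrix.vecCons u (fun _ : Fin 1 => v)) = _
  rw [this]

/-- The map `B♭ : T_x M → T_x^* M`, `B♭(u) = i_u B`. -/
def DForm.flat (B : DForm I M 2 ℝ) (x : M) :
    TangentSpace I x →L[ℝ] TangentSpace I x →L[ℝ] ℝ :=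
  altFlat (E := E) (B x)

end Forms

/-! ### Bivector fields, almost Poisson brackets and gauge transformations -/

section Bivectors

variable {E : Type*} [NormedAddCommGroup E] [NormedSpace ℝ E]
  {H : Type*} [TopologicalSpace H] (I : ModelWithCorners ℝ E H)
  {E' : Type*} [NormedAddCommGroup E'] [NormedSpace ℝ E']
  {H' : Type*} [TopologicalSpace H'] (I' : ModelWithCorners ℝ E' H')

/-- A family of maps `π♯ : T_x^* M → T_x M`; the corresponding bilinear map on covectors is
`π(α, β) = β(π♯ α)`. It is a bivector field if `IsBivectorField` holds. -/
abbrev SharpField (M : Type*) [TopologicalSpace M] [ChartedSpace H M] : Type _ :=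
  ∀ x : M, (TangentSpace I x →L[ℝ] ℝ) →L[ℝ] TangentSpace I x

variable {M : Type*} [TopologicalSpace M] [ChartedSpace H M]
  {N : Type*} [TopologicalSpace N] [ChartedSpace H' N]

/-- `π` is a smooth bivector field: it is skew-symmetric and has smooth components
`π(φ^* a, φ^* b)` in each chart `φ`. -/
structure IsBivectorField (π : SharpField I M) : Prop where
  skew : ∀ (x : M) (α β : TangentSpace I x →L[ℝ] ℝ), β (π x α) = -α (π x β)
  smooth : ∀ (x₀ : M) (a b : E →L[ℝ] ℝ),
    ContDiffOn ℝ ∞ (fun y : E =>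
      let x := (extChartAt I x₀).symm y
      let Dφ : TangentSpace I x →L[ℝ] E := mfderiv I 𝓘(ℝ, E) (extChartAt I x₀) x
      (b.comp Dφ) (π x (a.comp Dφ))) (extChartAt I x₀).target

/-- The bracket `{f, g} = π(df, dg)`. -/
def SharpField.bracket (π : SharpField I M) (f g : M → ℝ) : M → ℝ :=
  fun x => diffAt I g x (π x (diffAt I f x))

/-- `{f, {g, h}} + {g, {h, f}} + {h, {f, g}}`. -/
def SharpField.jacobiator (π : SharpField I M) (f g h : M → ℝ) : M → ℝ :=
  fun x => π.bracket I f (π.bracket I g h) x + π.bracket I g (π.bracket I h f) x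
    + π.bracket I h (π.bracket I f g) x

/-- A Poisson structure: a bivector field whose bracket satisfies the Jacobi identity. -/
def IsPoisson (π : SharpField I M) : Prop :=
  IsBivectorField I π ∧ ∀ f g h : M → ℝ, ContMDiff I 𝓘(ℝ, ℝ) ∞ f → ContMDiff I 𝓘(ℝ, ℝ) ∞ g →
    ContMDiff I 𝓘(ℝ, ℝ) ∞ h → ∀ x, π.jacobiator I f g h x = 0

/-- A `φ`-twisted Poisson structure: `φ` is a closed 3-form and the Jacobiator of `f, g, h` is
`φ(X_f, X_g, X_h)` with `X_f = {·, f} = -π♯(df)`, that is, `½[π, π] = π♯(φ)`. -/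
def IsTwistedPoisson (π : SharpField I M) (φ : DForm I M 3 ℝ) : Prop :=
  IsBivectorField I π ∧ DForm.IsSmooth I φ ∧ (∀ x, DForm.d I φ x = 0) ∧
    ∀ f g h : M → ℝ, ContMDiff I 𝓘(ℝ, ℝ) ∞ f → ContMDiff I 𝓘(ℝ, ℝ) ∞ g →
      ContMDiff I 𝓘(ℝ, ℝ) ∞ h → ∀ x, π.jacobiator I f g h x =
        φ x ![-π x (diffAt I f x), -π x (diffAt I g x), -π x (diffAt I h x)]

/-- The endomorphism `Id + B♭ ∘ π♯` of `T_x^* M`. -/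
def gaugeEndo (π : SharpField I M) (B : DForm I M 2 ℝ) (x : M) :
    (TangentSpace I x →L[ℝ] ℝ) →L[ℝ] (TangentSpace I x →L[ℝ] ℝ) :=
  ContinuousLinearMap.id ℝ _ + (B.flat I x).comp (π x)

/-- `B` defines a gauge transformation of `π`: `Id + B♭ ∘ π♯` is invertible. -/
def GaugeDefined (π : SharpField I M) (B : DForm I M 2 ℝ) : Prop :=
  ∀ x, (gaugeEndo I π B x).IsInvertible

/-- The gauge transformation of `π` by `B`: `π_B♯ = π♯ ∘ (Id + B♭ ∘ π♯)⁻¹`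
(meaningful if `GaugeDefined` holds). -/
def SharpField.gauge (π : SharpField I M) (B : DForm I M 2 ℝ) : SharpField I M :=
  fun x => (π x).comp (gaugeEndo I π B x).inverse

/-- `π'` is the push-forward (reduction) of `π` along `ρ`: `Tρ ∘ π♯ ∘ ρ^* = π'♯`. -/
def IsReduction (ρ : M → N) (π : SharpField I M) (π' : SharpField I' N) : Prop :=
  ∀ (m : M) (α : TangentSpace I' (ρ m) →L[ℝ] ℝ),
    mfderiv I I' ρ m (π m (α.comp (mfderiv I I' ρ m))) = π' (ρ m) α

end Bivectors

/-! ### Distributions, infinitesimal generators, the cotangent bundle -/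

section Basic

variable {E : Type*} [NormedAddCommGroup E] [NormedSpace ℝ E]
  {Q : Type*} [TopologicalSpace Q] [ChartedSpace E Q]

/-- Smooth (regular) distributions: locally spanned by a smooth frame. -/
def IsSmoothDistribution [IsManifold 𝓘(ℝ, E) ∞ Q]
    (D : ∀ q : Q, Submodule ℝ (TangentSpace 𝓘(ℝ, E) q)) : Prop :=
  ∀ q₀ : Q, ∃ u ∈ 𝓝 q₀, ∃ (k : ℕ) (X : Fin k → ∀ q : Q, TangentSpace 𝓘(ℝ, E) q),
    (∀ i, ContMDiffOn 𝓘(ℝ, E) 𝓘(ℝ, E).tangent ∞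
      (fun q => (⟨q, X i q⟩ : TangentBundle 𝓘(ℝ, E) Q)) u) ∧
    ∀ q ∈ u, LinearIndependent ℝ (fun i => X i q) ∧
      Submodule.span ℝ (Set.range fun i => X i q) = D q

/-- The linear map `ξ ↦ ξ_X(x)` from the Lie algebra of `G` to `T_x X`, where `ξ_X` is the
infinitesimal generator: the derivative at `1` of the orbit map `g ↦ g • x`. The Lie algebra
`T_1 G` is, as in Mathlib, the model space `EG`. -/
def infGen (EG : Type*) [NormedAddCommGroup EG] [NormedSpace ℝ EG]
    (G : Type*) [TopologicalSpace G] [ChartedSpace EG G] [Group G]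
    {X : Type*} [TopologicalSpace X] [ChartedSpace E X] [MulAction G X] (x : X) :
    EG →L[ℝ] TangentSpace 𝓘(ℝ, E) x :=
  (mfderiv 𝓘(ℝ, EG) 𝓘(ℝ, E) (fun g : G => g • x) 1 : EG →L[ℝ] E)

variable (E Q) in
/-- The cotangent bundle `T^*Q`. -/
abbrev CotangentBundle [IsManifold 𝓘(ℝ, E) ∞ Q] : Type _ :=
  Bundle.TotalSpace (E →L[ℝ] ℝ) (fun q : Q => TangentSpace 𝓘(ℝ, E) q →L[ℝ] ℝ)

variable (E) in
/-- The model of the cotangent bundle. -/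
abbrev cotModel : ModelWithCorners ℝ (E × (E →L[ℝ] ℝ)) (ModelProd E (E →L[ℝ] ℝ)) :=
  𝓘(ℝ, E).prod 𝓘(ℝ, E →L[ℝ] ℝ)

variable [IsManifold 𝓘(ℝ, E) ∞ Q]

variable (E Q) in
/-- The Liouville 1-form of `T^*Q`: `Θ_Q(w) = m(Tτ_Q w)` for `w ∈ T_m(T^*Q)`. -/
def liouvilleForm : DForm (cotModel E) (CotangentBundle E Q) 1 ℝ :=
  fun m => ContinuousAlternatingMap.ofSubsingleton ℝ _ ℝ (0 : Fin 1)
    (m.2.comp (mfderiv (cotModel E) 𝓘(ℝ, E)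
      (Bundle.TotalSpace.proj : CotangentBundle E Q → Q) m))

variable (E Q) in
/-- The canonical 2-form of `T^*Q`: `Ω_Q = -dΘ_Q`. -/
def canonicalForm : DForm (cotModel E) (CotangentBundle E Q) 2 ℝ :=
  -DForm.d (cotModel E) (liouvilleForm E Q)

/-- The cotangent lift of the diffeomorphism `q ↦ g • q`: `(q, p) ↦ (g • q, p ∘ (T_q g)⁻¹)`. -/
def cotangentLift {G : Type*} [Group G] [MulAction G Q] (g : G) (m : CotangentBundle E Q) :
    CotangentBundle E Q :=
  ⟨g • m.proj, m.2.comp (mfderiv 𝓘(ℝ, E) 𝓘(ℝ, E) (fun q : Q => g • q) m.proj).inverse⟩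

end Basic

/-! ### Nonholonomic systems with symmetries -/

/-- A nonholonomic system on `Q`: a Riemannian metric (the kinetic energy metric `κ`), a potential
energy `U`, and a constraint distribution `D`. The Lagrangian is `½κ(v, v) - U(q)`. -/
structure NonholonomicSystem (E : Type*) [NormedAddCommGroup E] [NormedSpace ℝ E]
    (Q : Type*) [TopologicalSpace Q] [ChartedSpace E Q] [IsManifold 𝓘(ℝ, E) ∞ Q] where
  metric : Bundle.ContMDiffRiemannianMetric 𝓘(ℝ, E) ∞ E (fun q : Q => TangentSpace 𝓘(ℝ, E) q)
  potential : Q → ℝ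
  potential_smooth : ContMDiff 𝓘(ℝ, E) 𝓘(ℝ, ℝ) ∞ potential
  D : ∀ q : Q, Submodule ℝ (TangentSpace 𝓘(ℝ, E) q)
  D_smooth : IsSmoothDistribution D

namespace NonholonomicSystem

variable {E : Type*} [NormedAddCommGroup E] [NormedSpace ℝ E]
  {Q : Type*} [TopologicalSpace Q] [ChartedSpace E Q] [IsManifold 𝓘(ℝ, E) ∞ Q]

/-- The Hamiltonian `½|p|² + U(q)` on `T^*Q`, with `|p|² = p(v)` for `v` the inverse Legendre
transform of `p`, that is, `κ(v, ·) = p`. -/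
def hamiltonian (S : NonholonomicSystem E Q) (m : CotangentBundle E Q) : ℝ :=
  1 / 2 * m.2 ((S.metric.inner m.proj).inverse m.2) + S.potential m.proj

/-- The constraint submanifold `𝓜 = Leg(D) ⊆ T^*Q`, where `Leg(v) = κ(v, ·)`. -/
abbrev M (S : NonholonomicSystem E Q) : Type _ :=
  {m : CotangentBundle E Q // ∃ v ∈ S.D m.proj, S.metric.inner m.proj v = m.2}

/-- `G`, acting smoothly on `Q`, is a symmetry group of `S`: it preserves the Lagrangian (that is,
metric and potential) and the constraints. -/
class IsSymmetry (S : NonholonomicSystem E Q) (G : Type*) [Group G] [MulAction G Q] : Prop where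
  contMDiff_smul : ∀ g : G, ContMDiff 𝓘(ℝ, E) 𝓘(ℝ, E) ∞ (fun q : Q => g • q)
  metric_invariant : ∀ (g : G) (q : Q) (u v : TangentSpace 𝓘(ℝ, E) q),
    S.metric.inner (g • q) (mfderiv 𝓘(ℝ, E) 𝓘(ℝ, E) (fun q : Q => g • q) q u)
      (mfderiv 𝓘(ℝ, E) 𝓘(ℝ, E) (fun q : Q => g • q) q v) = S.metric.inner q u v
  potential_invariant : ∀ (g : G) (q : Q), S.potential (g • q) = S.potential q
  D_invariant : ∀ (g : G) (q : Q), ∀ v ∈ S.D q,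
    mfderiv 𝓘(ℝ, E) 𝓘(ℝ, E) (fun q : Q => g • q) q v ∈ S.D (g • q)

section Action

theorem mdiff_smul (S : NonholonomicSystem E Q) {G : Type*} [Group G] [MulAction G Q]
    [S.IsSymmetry G] (g : G) (q : Q) :
    MDifferentiableAt 𝓘(ℝ, E) 𝓘(ℝ, E) (fun q : Q => g • q) q :=
  (IsSymmetry.contMDiff_smul (S := S) g).mdifferentiableAt (by simp)

theorem mfderiv_mul_smul (S : NonholonomicSystem E Q) {G : Type*} [Group G] [MulAction G Q]
    [S.IsSymmetry G] (g h : G) (q : Q) :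
    (mfderiv 𝓘(ℝ, E) 𝓘(ℝ, E) (fun q : Q => (g * h) • q) q : E →L[ℝ] E) =
      (mfderiv 𝓘(ℝ, E) 𝓘(ℝ, E) (fun q : Q => g • q) (h • q) : E →L[ℝ] E).comp
        (mfderiv 𝓘(ℝ, E) 𝓘(ℝ, E) (fun q : Q => h • q) q : E →L[ℝ] E) := by
  have : (fun q : Q => (g * h) • q) = (fun q : Q => g • q) ∘ (fun q : Q => h • q) := by
    ext q; simp [mul_smul]
  rw [this]
  exact mfderiv_comp q (S.mdiff_smul g (h • q)) (S.mdiff_smul h q)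

theorem mfderiv_one_smul (_S : NonholonomicSystem E Q) {G : Type*} [Group G] [MulAction G Q]
    (q : Q) :
    (mfderiv 𝓘(ℝ, E) 𝓘(ℝ, E) (fun q : Q => (1 : G) • q) q : E →L[ℝ] E) =
      ContinuousLinearMap.id ℝ E := by
  have : (fun q : Q => (1 : G) • q) = id := by ext q; simp
  rw [this]
  exact mfderiv_id

theorem isInvertible_mfderiv_smul (S : NonholonomicSystem E Q) {G : Type*} [Group G]
    [MulAction G Q] [S.IsSymmetry G] (g : G) (q : Q) :
    ContinuousLinearMap.IsInvertible
      (mfderiv 𝓘(ℝ, E) 𝓘(ℝ, E) (fun q : Q => g • q) q : E →L[ℝ] E) := by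
  have h1 := S.mfderiv_mul_smul g⁻¹ g q
  have h2 := S.mfderiv_mul_smul g g⁻¹ (g • q)
  rw [inv_mul_cancel, S.mfderiv_one_smul] at h1
  rw [mul_inv_cancel, S.mfderiv_one_smul, inv_smul_smul] at h2
  exact ContinuousLinearMap.IsInvertible.of_inverse h2.symm h1.symm

theorem cotangentLift_mem (S : NonholonomicSystem E Q) {G : Type*} [Group G] [MulAction G Q]
    [S.IsSymmetry G] (g : G) (m : S.M) :
    ∃ v ∈ S.D (cotangentLift g m.1).proj,
      S.metric.inner (cotangentLift g m.1).proj v = (cotangentLift g m.1).2 := by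
  obtain ⟨m, v, hv, hm⟩ := m
  refine ⟨mfderiv 𝓘(ℝ, E) 𝓘(ℝ, E) (fun q : Q => g • q) m.proj v,
    IsSymmetry.D_invariant g _ v hv, ?_⟩
  have hinv := S.isInvertible_mfderiv_smul g m.proj
  change _ = m.2.comp (mfderiv 𝓘(ℝ, E) 𝓘(ℝ, E) (fun q : Q => g • q) m.proj).inverse
  refine Eq.trans ?_ (congrArg (fun p : E →L[ℝ] ℝ => p.comp (ContinuousLinearMap.inverse
    (mfderiv 𝓘(ℝ, E) 𝓘(ℝ, E) (fun q : Q => g • q) m.proj : E →L[ℝ] E))) hm)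
  ext w
  have hw : mfderiv 𝓘(ℝ, E) 𝓘(ℝ, E) (fun q : Q => g • q) m.proj
      ((mfderiv 𝓘(ℝ, E) 𝓘(ℝ, E) (fun q : Q => g • q) m.proj).inverse w) = w :=
    hinv.self_apply_inverse w
  have := IsSymmetry.metric_invariant (S := S) g m.proj v
    ((mfderiv 𝓘(ℝ, E) 𝓘(ℝ, E) (fun q : Q => g • q) m.proj).inverse w)
  rw [hw] at this
  exact this

theorem comp_inverse_id {E : Type*} [NormedAddCommGroup E] [NormedSpace ℝ E] (p : E →L[ℝ] ℝ) :
    p.comp (ContinuousLinearMap.id ℝ E).inverse = p := by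
  rw [ContinuousLinearMap.inverse_id]
  rfl

theorem comp_inverse_comp {E : Type*} [NormedAddCommGroup E] [NormedSpace ℝ E] (p : E →L[ℝ] ℝ)
    (S T : E →L[ℝ] E) (hT : T.IsInvertible) :
    p.comp (S.comp T).inverse = (p.comp T.inverse).comp S.inverse := by
  rw [hT.inverse_comp_of_right, ContinuousLinearMap.comp_assoc]

theorem cotangent_ext {m m' : CotangentBundle E Q} (h : m.proj = m'.proj)
    (h2 : (m.2 : E →L[ℝ] ℝ) = (m'.2 : E →L[ℝ] ℝ)) : m = m' := by
  obtain ⟨q, p⟩ := m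
  obtain ⟨q', p'⟩ := m'
  obtain rfl : q = q' := h
  exact congrArg (Bundle.TotalSpace.mk q) h2

/-- The action of `G` on `𝓜`: the restriction of the cotangent lift of the action on `Q`. -/
instance instMulActionM (S : NonholonomicSystem E Q) {G : Type*} [Group G] [MulAction G Q]
    [S.IsSymmetry G] : MulAction G S.M where
  smul g m := ⟨cotangentLift g m.1, S.cotangentLift_mem g m⟩
  one_smul m := by
    apply Subtype.ext
    refine cotangent_ext (one_smul G m.1.proj) ?_
    refine (congrArg (fun T : E →L[ℝ] E => (m.1.2 : E →L[ℝ] ℝ).comp T.inverse)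
      (S.mfderiv_one_smul (G := G) m.1.proj)).trans ?_
    exact comp_inverse_id (E := E) m.1.2
  mul_smul g h m := by
    apply Subtype.ext
    refine cotangent_ext (mul_smul g h m.1.proj) ?_
    refine (congrArg (fun T : E →L[ℝ] E => (m.1.2 : E →L[ℝ] ℝ).comp T.inverse)
      (S.mfderiv_mul_smul g h m.1.proj)).trans ?_
    exact comp_inverse_comp (E := E) m.1.2 _ _ (S.isInvertible_mfderiv_smul h m.1.proj)

end Action

/-! #### Geometry of `𝓜`

`EM` is the model space of the manifold `𝓜`, `EG` that of the Lie group `G`. -/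

section Geometry

variable (S : NonholonomicSystem E Q) (EM : Type*) [NormedAddCommGroup EM] [NormedSpace ℝ EM]
  [ChartedSpace EM S.M]

/-- The projection `τ : 𝓜 → Q`. -/
def tau (m : S.M) : Q := m.1.proj

/-- The restriction `H_𝓜` of the Hamiltonian to `𝓜`. -/
def hamM (m : S.M) : ℝ := S.hamiltonian m.1

/-- `Θ_𝓜 = ι^* Θ_Q`, with `ι : 𝓜 → T^*Q` the inclusion. -/
def thetaM : DForm 𝓘(ℝ, EM) S.M 1 ℝ :=
  DForm.pullback 𝓘(ℝ, EM) (cotModel E) (Subtype.val : S.M → CotangentBundle E Q)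
    (liouvilleForm E Q)

/-- `Ω_𝓜 = ι^* Ω_Q`. -/
def omegaM : DForm 𝓘(ℝ, EM) S.M 2 ℝ :=
  DForm.pullback 𝓘(ℝ, EM) (cotModel E) (Subtype.val : S.M → CotangentBundle E Q)
    (canonicalForm E Q)

/-- The derivative `T_m τ : T_m 𝓜 → T_{τ(m)} Q`. -/
def dTau (m : S.M) : TangentSpace 𝓘(ℝ, EM) m →L[ℝ] TangentSpace 𝓘(ℝ, E) (S.tau m) :=
  mfderiv 𝓘(ℝ, EM) 𝓘(ℝ, E) S.tau m

/-- The constraint distribution on `𝓜`: `𝓒_m = {v ∈ T_m 𝓜 : Tτ(v) ∈ D}`. -/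
def distC (m : S.M) : Submodule ℝ (TangentSpace 𝓘(ℝ, EM) m) :=
  (S.D (S.tau m)).comap (S.dTau EM m).toLinearMap

open Classical in
/-- The nonholonomic vector field: the unique section of `𝓒` with
`i_{X_nh} Ω_𝓜 |_𝓒 = dH_𝓜 |_𝓒`. -/
def nhField (m : S.M) : TangentSpace 𝓘(ℝ, EM) m :=
  if h : ∃ X ∈ S.distC EM m, ∀ Y ∈ S.distC EM m,
      S.omegaM EM m ![X, Y] = diffAt 𝓘(ℝ, EM) S.hamM m Y
  then h.choose else 0

open Classical in
/-- The nonholonomic bivector `π_nh` defined by `𝓒` and `Ω_𝓜`: `π_nh♯(α) = -X` if and only if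
`X ∈ 𝓒` and `i_X Ω_𝓜 |_𝓒 = α |_𝓒`. -/
def nhSharp : SharpField 𝓘(ℝ, EM) S.M := fun m =>
  if h : ∃ P : (TangentSpace 𝓘(ℝ, EM) m →L[ℝ] ℝ) →L[ℝ] TangentSpace 𝓘(ℝ, EM) m,
      ∀ α X, (X ∈ S.distC EM m ∧ ∀ Y ∈ S.distC EM m, S.omegaM EM m ![X, Y] = α Y) ↔ P α = -X
  then h.choose else 0

variable (EG : Type*) [NormedAddCommGroup EG] [NormedSpace ℝ EG]
  (G : Type*) [TopologicalSpace G] [ChartedSpace EG G] [Group G] [MulAction G Q]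

/-- `W` is a `G`-invariant vertical complement of `D` in `TQ`: a smooth `G`-invariant
distribution with `TQ = D ⊕ W` and `W ⊆ V`, where `V` is the tangent distribution to the orbits.
Its existence is equivalent to the dimension assumption `TQ = D + V`. -/
structure IsVerticalComplement (W : ∀ q : Q, Submodule ℝ (TangentSpace 𝓘(ℝ, E) q)) : Prop where
  smooth : IsSmoothDistribution W
  isCompl : ∀ q, IsCompl (S.D q) (W q)
  vertical : ∀ q, ∀ w ∈ W q, ∃ ξ : EG, infGen EG G q ξ = w
  invariant : ∀ (g : G) (q : Q), ∀ w ∈ W q,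
    mfderiv 𝓘(ℝ, E) 𝓘(ℝ, E) (fun q : Q => g • q) q w ∈ W (g • q)

variable [S.IsSymmetry G]

/-- The vertical space `𝓥_m = T_m(Orb(m)) = {ξ_𝓜(m)}`. -/
def vertM (m : S.M) : Submodule ℝ (TangentSpace 𝓘(ℝ, EM) m) :=
  LinearMap.range (infGen EG G m : EG →L[ℝ] TangentSpace 𝓘(ℝ, EM) m).toLinearMap

/-- The vertical complement `𝓦 = (Tτ|_𝓥)⁻¹(W)` of `𝓒` in `T𝓜` induced by `W`. -/
def distW (W : ∀ q : Q, Submodule ℝ (TangentSpace 𝓘(ℝ, E) q)) (m : S.M) :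
    Submodule ℝ (TangentSpace 𝓘(ℝ, EM) m) :=
  S.vertM EM EG G m ⊓ (W (S.tau m)).comap (S.dTau EM m).toLinearMap

open Classical in
/-- The `𝔤`-valued 1-form `𝓐_𝓦`: `𝓐_𝓦(v) = ξ` if and only if `P_𝓦(v) = ξ_𝓜(m)`, where `P_𝓦` is
the projection of `T𝓜 = 𝓒 ⊕ 𝓦` onto `𝓦` (so `w = P_𝓦(v)` means `w ∈ 𝓦` and `v - w ∈ 𝓒`). -/
def connW (W : ∀ q : Q, Submodule ℝ (TangentSpace 𝓘(ℝ, E) q)) (m : S.M) :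
    TangentSpace 𝓘(ℝ, EM) m →L[ℝ] EG :=
  if h : ∃ A : TangentSpace 𝓘(ℝ, EM) m →L[ℝ] EG, ∀ v ξ,
      A v = ξ ↔ (infGen EG G m ξ ∈ S.distW EM EG G W m ∧ v - infGen EG G m ξ ∈ S.distC EM m)
  then h.choose else 0

/-- The projection `P_𝓒 : T𝓜 → 𝓒` along `𝓦`, `P_𝓒(v) = v - (𝓐_𝓦(v))_𝓜`. -/
def projC (W : ∀ q : Q, Submodule ℝ (TangentSpace 𝓘(ℝ, E) q)) (m : S.M) :
    TangentSpace 𝓘(ℝ, EM) m →L[ℝ] TangentSpace 𝓘(ℝ, EM) m :=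
  ContinuousLinearMap.id ℝ _ - (infGen EG G m).comp (S.connW EM EG G W m)

/-- The `𝓦`-curvature `𝓚_𝓦(X, Y) = d𝓐_𝓦(P_𝓒 X, P_𝓒 Y)`. -/
def curvW (W : ∀ q : Q, Submodule ℝ (TangentSpace 𝓘(ℝ, E) q)) : DForm 𝓘(ℝ, EM) S.M 2 EG :=
  fun m => (DForm.d 𝓘(ℝ, EM) (fun m' : S.M =>
    ContinuousAlternatingMap.ofSubsingleton ℝ _ EG (0 : Fin 1) (S.connW EM EG G W m')) m
    ).compContinuousLinearMap (S.projC EM EG G W m)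

/-- The momentum map `𝓙 : 𝓜 → 𝔤^*`, `⟨𝓙(m), η⟩ = Θ_𝓜(η_𝓜(m))`. -/
def momentum (m : S.M) : EG →L[ℝ] ℝ :=
  ((ContinuousAlternatingMap.ofSubsingleton ℝ _ ℝ (0 : Fin 1)).symm (S.thetaM EM m)).comp
    (infGen EG G m)

/-- The 2-form `⟨𝓙, 𝓚_𝓦⟩`. -/
def formJK (W : ∀ q : Q, Submodule ℝ (TangentSpace 𝓘(ℝ, E) q)) : DForm 𝓘(ℝ, EM) S.M 2 ℝ :=
  fun m => (S.momentum EM EG G m).compContinuousAlternatingMap (S.curvW EM EG G W m)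

/-- The gauge transformation `π_𝓙𝓚` of `π_nh` by the 2-form `-⟨𝓙, 𝓚_𝓦⟩`. -/
def sharpJK (W : ∀ q : Q, Submodule ℝ (TangentSpace 𝓘(ℝ, E) q)) : SharpField 𝓘(ℝ, EM) S.M :=
  (S.nhSharp EM).gauge 𝓘(ℝ, EM) (-S.formJK EM EG G W)

/-- `G`-invariance of a 2-form on `𝓜`. -/
def IsInvariantForm (B : DForm 𝓘(ℝ, EM) S.M 2 ℝ) : Prop :=
  ∀ g : G, DForm.pullback 𝓘(ℝ, EM) 𝓘(ℝ, EM) (fun m : S.M => g • m) B = B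

/-- A 2-form on `𝓜` is basic for the orbit projection: it is `G`-invariant and annihilated by the
vectors tangent to the orbits. -/
def IsBasicForm (B : DForm 𝓘(ℝ, EM) S.M 2 ℝ) : Prop :=
  S.IsInvariantForm EM G B ∧ ∀ (m : S.M), ∀ Z ∈ S.vertM EM EG G m, ∀ v, B m ![Z, v] = 0

/-- `B` defines a dynamical gauge transformation of `π_nh`: the gauge transformation is defined
and `i_{X_nh} B = 0`. -/
def IsDynamicalGauge (B : DForm 𝓘(ℝ, EM) S.M 2 ℝ) : Prop :=
  GaugeDefined 𝓘(ℝ, EM) (S.nhSharp EM) B ∧ ∀ (m : S.M) v, B m ![S.nhField EM m, v] = 0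

/-- The vertical-symmetry condition: `𝓦_m = {ξ_𝓜(m) : ξ ∈ 𝔤_W}` for all `m`. -/
def VerticalSymmetry (W : ∀ q : Q, Submodule ℝ (TangentSpace 𝓘(ℝ, E) q))
    (gW : Submodule ℝ EG) : Prop :=
  ∀ m : S.M, S.distW EM EG G W m =
    gW.map (infGen EG G m : EG →L[ℝ] TangentSpace 𝓘(ℝ, EM) m).toLinearMap

/-- The fibre at `m` of `𝔤_𝓢`: those `ξ ∈ 𝔤` with `ξ_𝓜(m) ∈ 𝓢_m = 𝓒_m ∩ 𝓥_m`. -/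
def algS (m : S.M) : Submodule ℝ EG :=
  (S.distC EM m ⊓ S.vertM EM EG G m).comap
    (infGen EG G m : EG →L[ℝ] TangentSpace 𝓘(ℝ, EM) m).toLinearMap

/-- The nonholonomic momentum map `𝓙^nh(m) ∈ (𝔤_𝓢|_m)^*`, `⟨𝓙^nh(m), ξ⟩ = Θ_𝓜(ξ_𝓜(m))`. -/
def nhMomentum (m : S.M) : S.algS EM EG G m →ₗ[ℝ] ℝ :=
  (S.momentum EM EG G m).toLinearMap.domRestrict (S.algS EM EG G m)

/-- The reduced space `𝓜 / G`, with the quotient topology. -/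
abbrev Reduced (S : NonholonomicSystem E Q) (G : Type*) [Group G] [MulAction G Q]
    [S.IsSymmetry G] : Type _ :=
  MulAction.orbitRel.Quotient G S.M

/-- The orbit projection `ρ : 𝓜 → 𝓜 / G`. -/
def rho (m : S.M) : S.Reduced G := Quotient.mk _ m

end Geometry

end NonholonomicSystem

end

/-! The proof works with pairs `(C, w)`: a subspace and a 2-form that is nondegenerate on it. Such a
pair determines its sharp map. The nonholonomic bivector is the sharp map of (𝓒, Ω_𝓜), and a gauge
transformation by `b` replaces the pair by (𝓒, Ω_𝓜 - b) (`IsSharp.gauge`). Invariance, composition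
of gauge transformations and the effect on dH_𝓜 thus become statements about 2-forms tested on 𝓒.

The form 𝓐_𝓦 is the pullback by τ of a form on Q (`connForm_eq`), so ⟨𝓙, 𝓚_𝓦⟩ is semibasic for τ.
Subtracting a semibasic form from Ω_𝓜 keeps it nondegenerate on 𝓒, because the metric is positive
(`nondegOn_omegaM_sub`); hence π_𝓙𝓚 is defined. Gauging π_nh by B is the same as gauging π_𝓙𝓚 by B +
⟨𝓙, 𝓚_𝓦⟩ (`nhGauge_neg_add`). This last form is basic, hence equal to ρ^*𝓑, and gauging by a
pullback commutes with reduction (`IsReduction.gauge`). That basic forms descend requires ker Tρ to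
consist of infinitesimal generators, which is drawn from freeness and properness
(`exists_infGen_eq_of_tangentD_eq_zero`). The condition i_{X_nh} B = 0 keeps X_nh the Hamiltonian
vector field of H_𝓜 after gauging.

For the Jacobi identity, expand 0 = dΩ_𝓜(X_f, X_g, X_h) for G-invariant functions. The fields lie in
𝓒 = ker 𝓐_𝓦, so 𝓐_𝓦([X_f, X_g]) = -d𝓐_𝓦(X_f, X_g), and the vertical part of the bracket contributes
through i_{ξ_𝓜} Ω_𝓜 = d⟨𝓙, ξ⟩. Under vertical symmetry 𝓐_𝓦(ξ_𝓜) = ξ is constant for ξ ∈ 𝔤_W, so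
i_{ξ_𝓜} d𝓐_𝓦 vanishes on 𝓒. Together with d(d𝓐_𝓦) = 0, this assembles the vertical contributions
into d⟨𝓙, 𝓚_𝓦⟩. The Jacobiator is therefore given by -d(B + ⟨𝓙, 𝓚_𝓦⟩) (`jacobi_chart`,
`jacobi_nhGauge`), which is ρ^*(-d𝓑); the choice B = -⟨𝓙, 𝓚_𝓦⟩ gives the Poisson case.

The conserved functions are ⟨𝓙, η - 𝓐_𝓦(η_𝓜)⟩. The derivative along X_nh has two terms. The first is
-dH_𝓜(ζ_𝓜) with ζ_𝓜 ∈ 𝓒 and vanishes by invariance of H_𝓜; the second is ⟨𝓙, 𝓚_𝓦⟩(η_𝓜, X_nh) =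
-B(η_𝓜, X_nh) = 0 (`tangentD_reduced_momentum_nhField`). -/

set_option linter.unusedSectionVars false

noncomputable section

/-! ### Calculus of alternating forms on normed spaces -/

section AltCalculus

variable {E F G : Type*} [NormedAddCommGroup E] [NormedSpace ℝ E]
  [NormedAddCommGroup F] [NormedSpace ℝ F] [NormedAddCommGroup G] [NormedSpace ℝ G] {k : ℕ}

/-- Antisymmetrisation as a continuous linear map. -/
def alternatizationCLM (k : ℕ) (E G : Type*) [NormedAddCommGroup E] [NormedSpace ℝ E]
    [NormedAddCommGroup G] [NormedSpace ℝ G] :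
    ContinuousMultilinearMap ℝ (fun _ : Fin k => E) G →L[ℝ] E [⋀^Fin k]→L[ℝ] G where
  toFun f := ContinuousMultilinearMap.alternatization f
  map_add' f g := map_add _ f g
  map_smul' c f := by
    ext v
    simp [ContinuousMultilinearMap.alternatization_apply_apply, Finset.smul_sum, smul_comm c]
  cont := by
    rw [ContinuousAlternatingMap.isEmbedding_toContinuousMultilinearMap.continuous_iff]
    have : (ContinuousAlternatingMap.toContinuousMultilinearMap ∘
        fun f : ContinuousMultilinearMap ℝ (fun _ : Fin k => E) G =>
          ContinuousMultilinearMap.alternatization f) =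
        fun f => ∑ σ : Equiv.Perm (Fin k), Equiv.Perm.sign σ •
          ContinuousMultilinearMap.domDomCongrₗᵢ ℝ E G σ f := by
      ext f v
      simp only [Function.comp_apply, ContinuousAlternatingMap.coe_toContinuousMultilinearMap,
        ContinuousMultilinearMap.alternatization_apply_apply, sum_apply]
      rfl
    change Continuous (ContinuousAlternatingMap.toContinuousMultilinearMap ∘
        fun f : ContinuousMultilinearMap ℝ (fun _ : Fin k => E) G =>
          ContinuousMultilinearMap.alternatization f)
    rw [this]
    refine continuous_finsetSum _ fun σ _ => ?_
    exact (LinearIsometryEquiv.continuous _).const_smul _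

theorem alternatizationCLM_toContinuousMultilinearMap (f : E [⋀^Fin k]→L[ℝ] G) :
    alternatizationCLM k E G f.toContinuousMultilinearMap = (k.factorial : ℝ) • f := by
  ext v
  change ContinuousMultilinearMap.alternatization f.toContinuousMultilinearMap v = _
  rw [ContinuousMultilinearMap.alternatization_apply_apply]
  have : ∀ σ : Equiv.Perm (Fin k),
      Equiv.Perm.sign σ • f.toContinuousMultilinearMap (v ∘ σ) = f v := by
    intro σ
    change Equiv.Perm.sign σ • f.toAlternatingMap (v ∘ σ) = _
    rw [AlternatingMap.map_perm, smul_smul, Int.units_mul_self, one_smul]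
    rfl
  rw [Finset.sum_congr rfl fun σ _ => this σ]
  simp [Fintype.card_perm, Nat.cast_smul_eq_nsmul]

/-- For multilinear maps, precomposition is smooth in both arguments. An alternating map is the
antisymmetrisation of its underlying multilinear map divided by `k!`, and antisymmetrisation is
continuous linear, so smoothness transfers. -/
theorem contDiff_alternating_compContinuousLinearMap {n : WithTop ℕ∞} :
    ContDiff ℝ n (fun p : (F [⋀^Fin k]→L[ℝ] G) × (E →L[ℝ] F) =>
      p.1.compContinuousLinearMap p.2) := by
  have key : (fun p : (F [⋀^Fin k]→L[ℝ] G) × (E →L[ℝ] F) => p.1.compContinuousLinearMap p.2) =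
      fun p => (k.factorial : ℝ)⁻¹ • alternatizationCLM k E G
        (p.1.toContinuousMultilinearMap.compContinuousLinearMap fun _ => p.2) := by
    ext1 p
    have := alternatizationCLM_toContinuousMultilinearMap (p.1.compContinuousLinearMap p.2)
    rw [eq_inv_smul_iff₀ (by positivity), ← this]
    rfl
  rw [key]
  have h1 : ContDiff ℝ n (fun p : (∀ _ : Fin k, E →L[ℝ] F) ×
      ContinuousMultilinearMap ℝ (fun _ : Fin k => F) G => p.2.compContinuousLinearMap p.1) :=
    ((ContinuousMultilinearMap.compContinuousLinearMapContinuousMultilinear ℝ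
      (fun _ : Fin k => E) (fun _ => F) G).contDiff.comp contDiff_fst).clm_apply contDiff_snd
  have h2 : ContDiff ℝ n (fun p : (F [⋀^Fin k]→L[ℝ] G) × (E →L[ℝ] F) =>
      ((fun _ : Fin k => p.2), p.1.toContinuousMultilinearMap)) := by
    refine ContDiff.prodMk (contDiff_pi.2 fun _ => contDiff_snd) ?_
    have : ContDiff ℝ n (fun f : F [⋀^Fin k]→L[ℝ] G => f.toContinuousMultilinearMap) :=
      ContinuousLinearMap.contDiff (E := F [⋀^Fin k]→L[ℝ] G)
        (F := ContinuousMultilinearMap ℝ (fun _ : Fin k => F) G)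
        (ContinuousAlternatingMap.toContinuousMultilinearMapCLM ℝ)
    exact this.comp contDiff_fst
  have h3 : ContDiff ℝ n (fun p : (F [⋀^Fin k]→L[ℝ] G) × (E →L[ℝ] F) => alternatizationCLM k E G
      (p.1.toContinuousMultilinearMap.compContinuousLinearMap fun _ => p.2)) :=
    (alternatizationCLM k E G).contDiff.comp (h1.comp h2)
  exact h3.const_smul _

theorem ContDiffAt.alternating_comp {X : Type*} [NormedAddCommGroup X] [NormedSpace ℝ X]
    {n : WithTop ℕ∞} {a : X → F [⋀^Fin k]→L[ℝ] G} {g : X → E →L[ℝ] F} {x : X}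
    (ha : ContDiffAt ℝ n a x) (hg : ContDiffAt ℝ n g x) :
    ContDiffAt ℝ n (fun x => (a x).compContinuousLinearMap (g x)) x :=
  ContDiffAt.comp (g := fun p : (F [⋀^Fin k]→L[ℝ] G) × (E →L[ℝ] F) =>
    p.1.compContinuousLinearMap p.2) x
    contDiff_alternating_compContinuousLinearMap.contDiffAt (ha.prodMk hg)

theorem minSmoothness_two_le : minSmoothness ℝ 2 ≤ (∞ : WithTop ℕ∞) := by
  rw [minSmoothness_of_isRCLikeNormedField]
  exact WithTop.coe_le_coe.2 (le_top : (2 : ℕ∞) ≤ ⊤)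

theorem contDiffAt_extDeriv {a : E → E [⋀^Fin k]→L[ℝ] G} {x : E} (ha : ContDiffAt ℝ ∞ a x) :
    ContDiffAt ℝ ∞ (extDeriv a) x := by
  have h : ContDiffAt ℝ ∞ (fderiv ℝ a) x := ha.fderiv_right (by simp)
  exact (ContinuousAlternatingMap.alternatizeUncurryFinCLM ℝ E G).contDiff.contDiffAt.comp x h

theorem extDeriv_apply_two {a : E → E [⋀^Fin 1]→L[ℝ] G} {x : E} (ha : DifferentiableAt ℝ a x)
    (u v : E) :
    extDeriv a x ![u, v] = fderiv ℝ (fun y => a y ![v]) x u - fderiv ℝ (fun y => a y ![u]) x v := by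
  have h0 : (0 : Fin 2).removeNth ![u, v] = ![v] := by
    ext j; fin_cases j; rfl
  have h1 : (1 : Fin 2).removeNth ![u, v] = ![u] := by
    ext j; fin_cases j; rfl
  rw [extDeriv_apply ha, Fin.sum_univ_two, h0, h1]
  simp [sub_eq_add_neg]

end AltCalculus

/-! ### The exterior derivative on manifolds -/

section FormCalculus

variable {E : Type*} [NormedAddCommGroup E] [NormedSpace ℝ E]
  {H : Type*} [TopologicalSpace H] {I : ModelWithCorners ℝ E H} [I.Boundaryless]
  {E' : Type*} [NormedAddCommGroup E'] [NormedSpace ℝ E']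
  {H' : Type*} [TopologicalSpace H'] {I' : ModelWithCorners ℝ E' H'} [I'.Boundaryless]
  {V : Type*} [NormedAddCommGroup V] [NormedSpace ℝ V]
  {M : Type*} [TopologicalSpace M] [ChartedSpace H M] [IsManifold I ∞ M]
  {N : Type*} [TopologicalSpace N] [ChartedSpace H' N] [IsManifold I' ∞ N] {k : ℕ}

omit [I.Boundaryless] [IsManifold I ∞ M] in
theorem DForm.apply_congr (α : DForm I M k V) {x y : M} (h : x = y) (v : Fin k → E) :
    (α x : E [⋀^Fin k]→L[ℝ] V) v = (α y : E [⋀^Fin k]→L[ℝ] V) v := by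
  subst h; rfl

variable (I) in
theorem contMDiffAt_extChartAt_symm {x₀ : M} {y : E} (hy : y ∈ (extChartAt I x₀).target) :
    ContMDiffAt 𝓘(ℝ, E) I ∞ (extChartAt I x₀).symm y :=
  (contMDiffOn_extChartAt_symm x₀).contMDiffAt ((isOpen_extChartAt_target x₀).mem_nhds hy)

variable (I) in
theorem mfderiv_extChartAt_symm_comp {x₀ x : M} (hx : x ∈ (extChartAt I x₀).source) :
    (mfderiv 𝓘(ℝ, E) I (extChartAt I x₀).symm (extChartAt I x₀ x) : E →L[ℝ] E).comp
      (mfderiv I 𝓘(ℝ, E) (extChartAt I x₀) x : E →L[ℝ] E) = ContinuousLinearMap.id ℝ E := by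
  have : IsManifold I 1 M := .of_le (n := ∞) (by simp)
  have := mfderivWithin_extChartAt_symm_comp_mfderiv_extChartAt' (I := I) hx
  rwa [I.range_eq_univ, mfderivWithin_univ] at this

variable (I) in
theorem mfderiv_extChartAt_comp_symm {x₀ x : M} (hx : x ∈ (extChartAt I x₀).source) :
    (mfderiv I 𝓘(ℝ, E) (extChartAt I x₀) x : E →L[ℝ] E).comp
      (mfderiv 𝓘(ℝ, E) I (extChartAt I x₀).symm (extChartAt I x₀ x) : E →L[ℝ] E) =
      ContinuousLinearMap.id ℝ E := by
  have : IsManifold I 1 M := .of_le (n := ∞) (by simp)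
  have := mfderiv_extChartAt_comp_mfderivWithin_extChartAt_symm' (I := I) hx
  rwa [I.range_eq_univ, mfderivWithin_univ] at this

omit [I'.Boundaryless] in
theorem contDiffAt_localExpr {f : M → N} {x₀ : M} {n₀ : N} {y : E}
    (hy : y ∈ (extChartAt I x₀).target)
    (hf : ContMDiffAt I I' ∞ f ((extChartAt I x₀).symm y))
    (hn : f ((extChartAt I x₀).symm y) ∈ (extChartAt I' n₀).source) :
    ContDiffAt ℝ ∞ (fun y => extChartAt I' n₀ (f ((extChartAt I x₀).symm y))) y := by
  rw [← contMDiffAt_iff_contDiffAt]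
  refine ContMDiffAt.comp (I' := I') y (contMDiffAt_extChartAt' (by simpa using hn)) ?_
  exact hf.comp y (contMDiffAt_extChartAt_symm I hy)

/-- Inserting the chart of `N` at `n₀` and its inverse between `α` and `f` turns a pullback on
manifolds into a pullback on the model spaces by the coordinate expression of `f`. All later facts
on pullbacks and `d` reduce to normed spaces in this way. -/
theorem DForm.inChart_pullback {f : M → N} (α : DForm I' N k V) {x₀ : M} {n₀ : N} {y : E}
    (hy : y ∈ (extChartAt I x₀).target)
    (hf : MDifferentiableAt I I' f ((extChartAt I x₀).symm y))
    (hn : f ((extChartAt I x₀).symm y) ∈ (extChartAt I' n₀).source) :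
    DForm.inChart I (DForm.pullback I I' f α) x₀ y =
      (DForm.inChart I' α n₀ (extChartAt I' n₀ (f ((extChartAt I x₀).symm y)))
        ).compContinuousLinearMap
        (fderiv ℝ (fun y => extChartAt I' n₀ (f ((extChartAt I x₀).symm y))) y) := by
  have hs := contMDiffAt_extChartAt_symm I hy
  have hfs : MDifferentiableAt 𝓘(ℝ, E) I' (fun y => f ((extChartAt I x₀).symm y)) y :=
    hf.comp y (hs.mdifferentiableAt (by simp))
  have e1 : (mfderiv 𝓘(ℝ, E) I' (fun y => f ((extChartAt I x₀).symm y)) y : E →L[ℝ] E') =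
      (mfderiv I I' f ((extChartAt I x₀).symm y) : E →L[ℝ] E').comp
        (mfderiv 𝓘(ℝ, E) I (extChartAt I x₀).symm y : E →L[ℝ] E) :=
    mfderiv_comp y hf (hs.mdifferentiableAt (by simp))
  have e2 : (mfderiv 𝓘(ℝ, E) 𝓘(ℝ, E')
        (fun y => extChartAt I' n₀ (f ((extChartAt I x₀).symm y))) y : E →L[ℝ] E') =
      (mfderiv I' 𝓘(ℝ, E') (extChartAt I' n₀) (f ((extChartAt I x₀).symm y)) : E' →L[ℝ] E').comp
        (mfderiv 𝓘(ℝ, E) I' (fun y => f ((extChartAt I x₀).symm y)) y : E →L[ℝ] E') :=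
    mfderiv_comp y ((contMDiffAt_extChartAt' (n := ∞) (by simpa using hn)).mdifferentiableAt
      (by simp)) hfs
  rw [mfderiv_eq_fderiv] at e2
  have e3 : ∀ v : E, (mfderiv 𝓘(ℝ, E') I' (extChartAt I' n₀).symm
      (extChartAt I' n₀ (f ((extChartAt I x₀).symm y))) : E' →L[ℝ] E')
      (fderiv ℝ (fun y => extChartAt I' n₀ (f ((extChartAt I x₀).symm y))) y v) =
      (mfderiv I I' f ((extChartAt I x₀).symm y) : E →L[ℝ] E')
        ((mfderiv 𝓘(ℝ, E) I (extChartAt I x₀).symm y : E →L[ℝ] E) v) := by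
    intro v
    rw [e2, e1]
    exact DFunLike.congr_fun (mfderiv_extChartAt_symm_comp I' hn) _
  ext v
  change (α (f ((extChartAt I x₀).symm y)) : E' [⋀^Fin k]→L[ℝ] V) (fun i =>
      (mfderiv I I' f ((extChartAt I x₀).symm y) : E →L[ℝ] E')
        ((mfderiv 𝓘(ℝ, E) I (extChartAt I x₀).symm y : E →L[ℝ] E) (v i))) =
    (α ((extChartAt I' n₀).symm (extChartAt I' n₀ (f ((extChartAt I x₀).symm y)))) :
      E' [⋀^Fin k]→L[ℝ] V) (fun i => (mfderiv 𝓘(ℝ, E') I' (extChartAt I' n₀).symm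
      (extChartAt I' n₀ (f ((extChartAt I x₀).symm y))) : E' →L[ℝ] E')
      (fderiv ℝ (fun y => extChartAt I' n₀ (f ((extChartAt I x₀).symm y))) y (v i)))
  simp only [e3]
  exact α.apply_congr ((extChartAt I' n₀).left_inv hn).symm _

/-- Smoothness of a form at a point. -/
def DForm.SmoothAt (α : DForm I M k V) (x : M) : Prop :=
  ContDiffAt ℝ ∞ (DForm.inChart I α x) (extChartAt I x x)

omit [I.Boundaryless] [IsManifold I ∞ M] in
theorem DForm.pullback_id (α : DForm I M k V) : DForm.pullback I I id α = α := by
  funext x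
  change (α x).compContinuousLinearMap (mfderiv I I id x) = α x
  rw [mfderiv_id]
  rfl

theorem DForm.inChart_eventuallyEq_pullback {f : M → N} (α : DForm I' N k V) {x₀ : M} {n₀ : N}
    {y : E} (hy : y ∈ (extChartAt I x₀).target)
    (hf : ContMDiffAt I I' ∞ f ((extChartAt I x₀).symm y))
    (hn : f ((extChartAt I x₀).symm y) ∈ (extChartAt I' n₀).source) :
    DForm.inChart I (DForm.pullback I I' f α) x₀ =ᶠ[𝓝 y] fun y =>
      (DForm.inChart I' α n₀ (extChartAt I' n₀ (f ((extChartAt I x₀).symm y)))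
        ).compContinuousLinearMap
        (fderiv ℝ (fun y => extChartAt I' n₀ (f ((extChartAt I x₀).symm y))) y) := by
  have h1M : IsManifold I 1 M := .of_le (n := ∞) (by simp)
  have h1N : IsManifold I' 1 N := .of_le (n := ∞) (by simp)
  have hs : ContinuousAt (extChartAt I x₀).symm y :=
    (contMDiffAt_extChartAt_symm I hy).continuousAt
  have hf1 : ∀ᶠ x in 𝓝 ((extChartAt I x₀).symm y), ContMDiffAt I I' 1 f x :=
    (contMDiffAt_iff_contMDiffAt_nhds (by simp)).1 (ContMDiffAt.of_le hf (by simp))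
  filter_upwards [(isOpen_extChartAt_target x₀).mem_nhds hy, hs.eventually hf1,
    (hf.continuousAt.comp hs).eventually ((isOpen_extChartAt_source n₀).mem_nhds hn)]
    with y' h1 h2 h3
  exact DForm.inChart_pullback α h1 (h2.mdifferentiableAt (by simp)) h3

theorem DForm.SmoothAt.contDiffAt_inChart_pullback {f : M → N} {α : DForm I' N k V} {x₀ : M}
    {y : E} (hy : y ∈ (extChartAt I x₀).target)
    (hf : ContMDiffAt I I' ∞ f ((extChartAt I x₀).symm y))
    (hα : α.SmoothAt (f ((extChartAt I x₀).symm y))) :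
    ContDiffAt ℝ ∞ (DForm.inChart I (DForm.pullback I I' f α) x₀) y := by
  have hn := mem_extChartAt_source (I := I') (f ((extChartAt I x₀).symm y))
  have hloc := contDiffAt_localExpr hy hf hn
  refine ContDiffAt.congr_of_eventuallyEq ?_ (DForm.inChart_eventuallyEq_pullback α hy hf hn)
  have hα' : ContDiffAt ℝ ∞ (DForm.inChart I' α (f ((extChartAt I x₀).symm y)))
    (extChartAt I' (f ((extChartAt I x₀).symm y)) (f ((extChartAt I x₀).symm y))) := hα
  exact ContDiffAt.alternating_comp
    (ContDiffAt.comp (f := fun y' => extChartAt I' (f ((extChartAt I x₀).symm y))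
      (f ((extChartAt I x₀).symm y'))) y hα' hloc) (hloc.fderiv_right (by simp))

/-- This is the pullback statement for `f = id`, whose coordinate expressions are the transition
maps. It frees `SmoothAt` from the preferred chart used in its definition. -/
theorem DForm.SmoothAt.contDiffAt_inChart {α : DForm I M k V} {x₀ : M} {y : E}
    (hy : y ∈ (extChartAt I x₀).target) (hα : α.SmoothAt ((extChartAt I x₀).symm y)) :
    ContDiffAt ℝ ∞ (DForm.inChart I α x₀) y := by
  have := DForm.SmoothAt.contDiffAt_inChart_pullback (f := id) hy contMDiffAt_id hα
  rwa [DForm.pullback_id] at this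

theorem DForm.isSmooth_iff {α : DForm I M k V} : DForm.IsSmooth I α ↔ ∀ x, α.SmoothAt x := by
  refine ⟨fun h x => (h x).contDiffAt (extChartAt_target_mem_nhds x), fun h x₀ y hy => ?_⟩
  exact ((h _).contDiffAt_inChart hy).contDiffWithinAt

theorem DForm.SmoothAt.pullback {f : M → N} {α : DForm I' N k V} {x : M}
    (hf : ContMDiffAt I I' ∞ f x) (hα : α.SmoothAt (f x)) :
    (DForm.pullback I I' f α).SmoothAt x := by
  have := DForm.SmoothAt.contDiffAt_inChart_pullback (f := f) (α := α) (x₀ := x)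
    (mem_extChartAt_target (I := I) x) (by rwa [extChartAt_to_inv]) (by rwa [extChartAt_to_inv])
  exact this

theorem DForm.inChart_congr {α β : DForm I M k V} {x₀ : M} {y : E}
    (hy : y ∈ (extChartAt I x₀).target)
    (h : ∀ᶠ x in 𝓝 ((extChartAt I x₀).symm y), α x = β x) :
    DForm.inChart I α x₀ =ᶠ[𝓝 y] DForm.inChart I β x₀ := by
  filter_upwards [(contMDiffAt_extChartAt_symm I hy).continuousAt.eventually h] with y' h'
  simp only [DForm.inChart, h']

theorem DForm.SmoothAt.congr {α β : DForm I M k V} {x : M} (hβ : β.SmoothAt x)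
    (h : ∀ᶠ x' in 𝓝 x, α x' = β x') : α.SmoothAt x :=
  ContDiffAt.congr_of_eventuallyEq hβ
    (DForm.inChart_congr (mem_extChartAt_target x) (by rwa [extChartAt_to_inv]))

theorem DForm.d_congr {α β : DForm I M k V} {x : M} (h : ∀ᶠ x' in 𝓝 x, α x' = β x') :
    DForm.d I α x = DForm.d I β x := by
  have := DForm.inChart_congr (I := I) (mem_extChartAt_target x) (by rwa [extChartAt_to_inv])
  simp only [DForm.d, this.extDeriv_eq]

/-- In every chart, `d` is given by the exterior derivative on the model space; moreover `d`
commutes with pullbacks. -/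
theorem DForm.inChart_d_pullback {f : M → N} {α : DForm I' N k V} {x₀ : M} {y : E}
    (hy : y ∈ (extChartAt I x₀).target)
    (hf : ContMDiffAt I I' ∞ f ((extChartAt I x₀).symm y))
    (hα : α.SmoothAt (f ((extChartAt I x₀).symm y))) :
    extDeriv (DForm.inChart I (DForm.pullback I I' f α) x₀) y =
      DForm.inChart I (DForm.pullback I I' f (DForm.d I' α)) x₀ y := by
  have hn := mem_extChartAt_source (I := I') (f ((extChartAt I x₀).symm y))
  have hloc := contDiffAt_localExpr hy hf hn
  rw [(DForm.inChart_eventuallyEq_pullback α hy hf hn).extDeriv_eq]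
  have hd : DifferentiableAt ℝ (DForm.inChart I' α (f ((extChartAt I x₀).symm y)))
      (extChartAt I' (f ((extChartAt I x₀).symm y)) (f ((extChartAt I x₀).symm y))) :=
    ContDiffAt.differentiableAt hα (by simp)
  refine (extDeriv_pullback (r := ∞) (f := fun y' => extChartAt I' (f ((extChartAt I x₀).symm y))
      (f ((extChartAt I x₀).symm y'))) hd hloc minSmoothness_two_le).trans ?_
  have hs := contMDiffAt_extChartAt_symm I hy
  have e1 : (mfderiv 𝓘(ℝ, E) I' (fun y => f ((extChartAt I x₀).symm y)) y : E →L[ℝ] E') =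
      (mfderiv I I' f ((extChartAt I x₀).symm y) : E →L[ℝ] E').comp
        (mfderiv 𝓘(ℝ, E) I (extChartAt I x₀).symm y : E →L[ℝ] E) :=
    mfderiv_comp y (hf.mdifferentiableAt (by simp)) (hs.mdifferentiableAt (by simp))
  have e2 : (mfderiv 𝓘(ℝ, E) 𝓘(ℝ, E')
        (fun y' => extChartAt I' (f ((extChartAt I x₀).symm y)) (f ((extChartAt I x₀).symm y'))) y
          : E →L[ℝ] E') =
      (mfderiv I' 𝓘(ℝ, E') (extChartAt I' (f ((extChartAt I x₀).symm y)))
        (f ((extChartAt I x₀).symm y)) : E' →L[ℝ] E').comp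
        (mfderiv 𝓘(ℝ, E) I' (fun y => f ((extChartAt I x₀).symm y)) y : E →L[ℝ] E') :=
    mfderiv_comp y ((contMDiffAt_extChartAt (n := ∞)).mdifferentiableAt (by simp))
      ((hf.comp y hs).mdifferentiableAt (by simp))
  rw [mfderiv_eq_fderiv] at e2
  rw [e2, e1]
  rfl

/-- Again `f = id`: the definition of `DForm.d` uses a different chart at every point, and
naturality under the transition maps shows that a single chart suffices. -/
theorem DForm.inChart_d {α : DForm I M k V} {x₀ : M} {y : E}
    (hy : y ∈ (extChartAt I x₀).target) (hα : α.SmoothAt ((extChartAt I x₀).symm y)) :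
    DForm.inChart I (DForm.d I α) x₀ y = extDeriv (DForm.inChart I α x₀) y := by
  have := DForm.inChart_d_pullback (f := id) hy contMDiffAt_id hα
  rw [DForm.pullback_id, DForm.pullback_id] at this
  exact this.symm

theorem DForm.inChart_apply (α : DForm I M k V) {x₀ x : M} (hx : x ∈ (extChartAt I x₀).source)
    (v : Fin k → E) :
    (DForm.inChart I α x₀ (extChartAt I x₀ x) : E [⋀^Fin k]→L[ℝ] V)
      (fun i => (mfderiv I 𝓘(ℝ, E) (extChartAt I x₀) x : E →L[ℝ] E) (v i)) =
      (α x : E [⋀^Fin k]→L[ℝ] V) v := by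
  change (α ((extChartAt I x₀).symm (extChartAt I x₀ x)) : E [⋀^Fin k]→L[ℝ] V) (fun i =>
    (mfderiv 𝓘(ℝ, E) I (extChartAt I x₀).symm (extChartAt I x₀ x) : E →L[ℝ] E)
      ((mfderiv I 𝓘(ℝ, E) (extChartAt I x₀) x : E →L[ℝ] E) (v i))) = _
  have : ∀ i, (mfderiv 𝓘(ℝ, E) I (extChartAt I x₀).symm (extChartAt I x₀ x) : E →L[ℝ] E)
      ((mfderiv I 𝓘(ℝ, E) (extChartAt I x₀) x : E →L[ℝ] E) (v i)) = v i := fun i =>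
    DFunLike.congr_fun (mfderiv_extChartAt_symm_comp I hx) (v i)
  simp only [this]
  exact α.apply_congr ((extChartAt I x₀).left_inv hx) v

theorem DForm.ext_inChart {α β : DForm I M k V} {x₀ x : M} (hx : x ∈ (extChartAt I x₀).source)
    (h : DForm.inChart I α x₀ (extChartAt I x₀ x) = DForm.inChart I β x₀ (extChartAt I x₀ x)) :
    α x = β x := by
  apply ContinuousAlternatingMap.ext
  intro v
  exact (α.inChart_apply hx v).symm.trans ((by rw [h]) : _ = _) |>.trans (β.inChart_apply hx v)

/-- `d` commutes with pullbacks. -/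
theorem DForm.d_pullback {f : M → N} {α : DForm I' N k V} {x : M}
    (hf : ContMDiffAt I I' ∞ f x) (hα : α.SmoothAt (f x)) :
    DForm.d I (DForm.pullback I I' f α) x = DForm.pullback I I' f (DForm.d I' α) x := by
  have hx := mem_extChartAt_target (I := I) x
  refine DForm.ext_inChart (mem_extChartAt_source (I := I) x) ?_
  rw [DForm.inChart_d hx, DForm.inChart_d_pullback hx]
  · rwa [extChartAt_to_inv]
  · rwa [extChartAt_to_inv]
  · rw [extChartAt_to_inv]
    exact DForm.SmoothAt.pullback hf hα

theorem DForm.IsSmooth.smoothAt {α : DForm I M k V} (h : DForm.IsSmooth I α) (x : M) :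
    α.SmoothAt x := DForm.isSmooth_iff.1 h x

theorem DForm.IsSmooth.d {α : DForm I M k V} (h : DForm.IsSmooth I α) :
    DForm.IsSmooth I (DForm.d I α) := by
  intro x₀ y hy
  refine (ContDiffAt.congr_of_eventuallyEq
    (contDiffAt_extDeriv ((h.smoothAt _).contDiffAt_inChart hy)) ?_).contDiffWithinAt
  filter_upwards [(isOpen_extChartAt_target x₀).mem_nhds hy] with y' hy'
  exact DForm.inChart_d hy' (h.smoothAt _)

theorem DForm.d_d {α : DForm I M k V} (h : DForm.IsSmooth I α) (x : M) :
    DForm.d I (DForm.d I α) x = 0 := by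
  have hx := mem_extChartAt_target (I := I) x
  refine DForm.ext_inChart (β := 0) (mem_extChartAt_source (I := I) x) ?_
  rw [DForm.inChart_d hx (h.d.smoothAt _)]
  -- Equality on a neighbourhood is needed, since the chart expression of `d α` is differentiated
  -- once more.
  have : DForm.inChart I (DForm.d I α) x =ᶠ[𝓝 (extChartAt I x x)]
      extDeriv (DForm.inChart I α x) := by
    filter_upwards [(isOpen_extChartAt_target x).mem_nhds hx] with y' hy'
    exact DForm.inChart_d hy' (h.smoothAt _)
  rw [this.extDeriv_eq, extDeriv_extDeriv_apply (r := ∞) ((h.smoothAt _).contDiffAt_inChart hx)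
    minSmoothness_two_le]
  rfl

theorem DForm.IsSmooth.pullback {f : M → N} {α : DForm I' N k V} (hf : ContMDiff I I' ∞ f)
    (hα : DForm.IsSmooth I' α) : DForm.IsSmooth I (DForm.pullback I I' f α) :=
  DForm.isSmooth_iff.2 fun x => DForm.SmoothAt.pullback (hf x) (hα.smoothAt _)

omit [I.Boundaryless] [IsManifold I ∞ M] in
theorem DForm.IsSmooth.add {α β : DForm I M k V} (hα : DForm.IsSmooth I α)
    (hβ : DForm.IsSmooth I β) : DForm.IsSmooth I (α + β) :=
  fun x₀ => (hα x₀).add (hβ x₀)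

omit [I.Boundaryless] [IsManifold I ∞ M] in
theorem DForm.IsSmooth.neg {α : DForm I M k V} (hα : DForm.IsSmooth I α) :
    DForm.IsSmooth I (-α) :=
  fun x₀ => (hα x₀).neg

/-- On a vector space, `d` is the usual exterior derivative. -/
theorem DForm.d_model (α : DForm 𝓘(ℝ, E) E k V) (x : E) :
    DForm.d 𝓘(ℝ, E) α x = extDeriv (fun y => (α y : E [⋀^Fin k]→L[ℝ] V)) x := by
  have h : DForm.inChart 𝓘(ℝ, E) α x = fun y => (α y : E [⋀^Fin k]→L[ℝ] V) := by
    funext y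
    ext v
    change (α y : E [⋀^Fin k]→L[ℝ] V)
      (fun i => (mfderiv 𝓘(ℝ, E) 𝓘(ℝ, E) (id : E → E) y : E →L[ℝ] E) (v i)) = _
    rw [mfderiv_id]
    rfl
  ext v
  change extDeriv (DForm.inChart 𝓘(ℝ, E) α x) x
    (fun i => (mfderiv 𝓘(ℝ, E) 𝓘(ℝ, E) (id : E → E) x : E →L[ℝ] E) (v i)) = _
  rw [h, mfderiv_id]
  rfl

theorem DForm.smoothAt_model {α : DForm 𝓘(ℝ, E) E k V} {x : E} :
    α.SmoothAt x ↔ ContDiffAt ℝ ∞ (show E → E [⋀^Fin k]→L[ℝ] V from α) x := by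
  have h : DForm.inChart 𝓘(ℝ, E) α x = fun y => (α y : E [⋀^Fin k]→L[ℝ] V) := by
    funext y
    ext v
    change (α y : E [⋀^Fin k]→L[ℝ] V)
      (fun i => (mfderiv 𝓘(ℝ, E) 𝓘(ℝ, E) (id : E → E) y : E →L[ℝ] E) (v i)) = _
    rw [mfderiv_id]
    rfl
  rw [DForm.SmoothAt, h]
  rfl

end FormCalculus

/-! ### Linear algebra of a subspace with a nondegenerate 2-form -/

section SharpAlgebra

variable {E : Type*} [NormedAddCommGroup E] [NormedSpace ℝ E]

/-- `P` is the sharp map of the pair `(C, w)`: `P α = -X` iff `X ∈ C` and `i_X w = α` on `C`. -/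
def IsSharp (C : Submodule ℝ E) (w : E [⋀^Fin 2]→L[ℝ] ℝ) (P : (E →L[ℝ] ℝ) →L[ℝ] E) : Prop :=
  ∀ α X, (X ∈ C ∧ ∀ Y ∈ C, w ![X, Y] = α Y) ↔ P α = -X

/-- The restriction of `w` to `C` is nondegenerate. -/
def NondegOn (C : Submodule ℝ E) (w : E [⋀^Fin 2]→L[ℝ] ℝ) : Prop :=
  ∀ X ∈ C, (∀ Y ∈ C, w ![X, Y] = 0) → X = 0

theorem two_form_swap (w : E [⋀^Fin 2]→L[ℝ] ℝ) (u v : E) : w ![u, v] = -w ![v, u] := by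
  have h : w (![u, v] ∘ Equiv.swap (0 : Fin 2) 1) = -w ![u, v] :=
    w.toAlternatingMap.map_swap ![u, v] (i := 0) (j := 1) (by simp)
  have h2 : (![u, v] ∘ Equiv.swap (0 : Fin 2) 1) = ![v, u] := by
    ext i; fin_cases i <;> simp
  rw [← h2, h, neg_neg]

/-- Nondegeneracy makes X ↦ i_X w from `C` to its dual injective, hence bijective by dimension. The
sharp map is minus the inverse, applied to the restriction of a covector to `C`. -/
theorem exists_isSharp [FiniteDimensional ℝ E] {C : Submodule ℝ E} {w : E [⋀^Fin 2]→L[ℝ] ℝ}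
    (h : NondegOn C w) : ∃ P, IsSharp C w P := by
  let f : C →ₗ[ℝ] Module.Dual ℝ C :=
    { toFun := fun X => ((altFlat w X : E →L[ℝ] ℝ).toLinearMap).domRestrict C
      map_add' := fun X Y => by ext Z; simp
      map_smul' := fun c X => by ext Z; simp }
  have hf : ∀ X Y : C, f X Y = w ![(X : E), (Y : E)] := fun X Y => altFlat_apply w X Y
  have hinj : Function.Injective f := by
    rw [← LinearMap.ker_eq_bot, LinearMap.ker_eq_bot']
    intro X hX
    apply Subtype.ext
    refine h X X.2 fun Y hY => ?_
    rw [← hf X ⟨Y, hY⟩, hX]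
    rfl
  let e : C ≃ₗ[ℝ] Module.Dual ℝ C :=
    LinearEquiv.ofInjectiveOfFinrankEq f hinj (Subspace.dual_finrank_eq).symm
  have he : ∀ X, e X = f X := fun X => rfl
  let P : (E →L[ℝ] ℝ) →ₗ[ℝ] E :=
    { toFun := fun α => -((e.symm (α.toLinearMap.domRestrict C) : C) : E)
      map_add' := fun α β => by
        rw [← neg_add, ← Submodule.coe_add, ← map_add]
        rfl
      map_smul' := fun c α => by
        rw [RingHom.id_apply, smul_neg, ← Submodule.coe_smul, ← map_smul]
        rfl }
  refine ⟨LinearMap.toContinuousLinearMap P, fun α X => ?_⟩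
  change _ ↔ -((e.symm (α.toLinearMap.domRestrict C) : C) : E) = -X
  rw [neg_inj]
  constructor
  · rintro ⟨hX, hXY⟩
    have : e ⟨X, hX⟩ = α.toLinearMap.domRestrict C := by
      ext Y
      rw [he, hf]
      exact hXY Y Y.2
    rw [← this, LinearEquiv.symm_apply_apply]
  · intro hX
    subst hX
    refine ⟨Subtype.coe_prop _, fun Y hY => ?_⟩
    rw [← hf _ ⟨Y, hY⟩, ← he, LinearEquiv.apply_symm_apply]
    rfl

namespace IsSharp

variable {C : Submodule ℝ E} {w : E [⋀^Fin 2]→L[ℝ] ℝ} {P : (E →L[ℝ] ℝ) →L[ℝ] E}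

theorem neg_mem (h : IsSharp C w P) (α : E →L[ℝ] ℝ) : -P α ∈ C :=
  ((h α (-P α)).2 (neg_neg _).symm).1

theorem apply_eq (h : IsSharp C w P) (α : E →L[ℝ] ℝ) {Y : E} (hY : Y ∈ C) :
    w ![-P α, Y] = α Y :=
  ((h α (-P α)).2 (neg_neg _).symm).2 Y hY

theorem nondegOn (h : IsSharp C w P) : NondegOn C w := by
  intro X hX hXY
  have := (h 0 X).1 ⟨hX, fun Y hY => by simpa using hXY Y hY⟩
  simpa using this.symm

theorem skew (h : IsSharp C w P) (α β : E →L[ℝ] ℝ) : β (P α) = -α (P β) := by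
  have h1 := h.apply_eq α (h.neg_mem β)
  have h2 := h.apply_eq β (h.neg_mem α)
  rw [two_form_swap, h1] at h2
  rw [map_neg, map_neg, neg_neg] at h2
  rw [h2, neg_neg]

end IsSharp

theorem isInvertible_of_injective [FiniteDimensional ℝ E] {T : E →L[ℝ] E}
    (h : Function.Injective T) : T.IsInvertible := by
  let e := LinearEquiv.ofInjectiveEndo T.toLinearMap h
  exact ⟨e.toContinuousLinearEquiv, by ext x; rfl⟩

variable {C : Submodule ℝ E} {w b : E [⋀^Fin 2]→L[ℝ] ℝ} {P : (E →L[ℝ] ℝ) →L[ℝ] E}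

/-- If α + i_{Pα} b = 0, then X = -Pα lies in `C` and i_X (w - b) vanishes on `C`. So X = 0, and
then α = 0. Injectivity is enough on the finite-dimensional dual. -/
theorem IsSharp.gauge_isInvertible [FiniteDimensional ℝ E] (h : IsSharp C w P)
    (hb : NondegOn C (w - b)) :
    (ContinuousLinearMap.id ℝ _ + (altFlat b).comp P).IsInvertible := by
  refine isInvertible_of_injective ?_
  rw [injective_iff_map_eq_zero]
  intro α hα
  have hα' : ∀ Y, α Y + b ![P α, Y] = 0 := fun Y => by
    have := DFunLike.congr_fun hα Y
    rwa [← altFlat_apply]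
  have h0 : -P α = 0 := by
    refine hb _ (h.neg_mem α) fun Y hY => ?_
    have h1 := h.apply_eq α hY
    have h2 := hα' Y
    have h3 : b ![-P α, Y] = -b ![P α, Y] := by
      rw [← altFlat_apply, ← altFlat_apply]; simp
    change w ![-P α, Y] - b ![-P α, Y] = 0
    rw [h1, h3]; linarith
  ext Y
  have := hα' Y
  rw [neg_eq_zero.1 h0, ← altFlat_apply] at this
  simpa using this

/-- On `C`, the equation i_X (w - b) = α reads i_X w = α + i_X b, that is, P(α + i_X b) = -X, and
then `T` sends α + i_X b to α. Gauged bivectors are handled through the pair `(C, w - b)` from here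
on, without reference to the inverse endomorphism. -/
theorem IsSharp.gauge (h : IsSharp C w P)
    (hb : (ContinuousLinearMap.id ℝ _ + (altFlat b).comp P).IsInvertible) :
    IsSharp C (w - b) (P.comp (ContinuousLinearMap.id ℝ _ + (altFlat b).comp P).inverse) := by
  set T := ContinuousLinearMap.id ℝ _ + (altFlat b).comp P with hT
  have hTapp : ∀ β, T β = β + altFlat b (P β) := fun β => rfl
  intro α X
  constructor
  · rintro ⟨hX, hXY⟩
    have h1 : P (α + altFlat b X) = -X := by
      refine (h _ X).1 ⟨hX, fun Y hY => ?_⟩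
      have := hXY Y hY
      change w ![X, Y] - b ![X, Y] = α Y at this
      change _ = α Y + altFlat b X Y
      rw [altFlat_apply]; linarith
    have h2 : T (α + altFlat b X) = α := by
      rw [hTapp, h1, map_neg]; abel
    have h3 : T.inverse α = α + altFlat b X := by
      conv_lhs => rw [← h2]
      exact hb.inverse_apply_self _
    change P (T.inverse α) = -X
    rw [h3, h1]
  · intro hX
    change P (T.inverse α) = -X at hX
    obtain ⟨h1, h2⟩ := (h _ X).2 hX
    refine ⟨h1, fun Y hY => ?_⟩
    have h3 : T (T.inverse α) = α := hb.self_apply_inverse α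
    rw [hTapp, hX] at h3
    have h4 := DFunLike.congr_fun h3 Y
    change T.inverse α Y + altFlat b (-X) Y = α Y at h4
    have h5 := h2 Y hY
    change w ![X, Y] - b ![X, Y] = α Y
    rw [map_neg] at h4
    change T.inverse α Y + -altFlat b X Y = α Y at h4
    rw [altFlat_apply] at h4
    linarith

/-- The sharp map of `(C, w)` is unchanged by transport along an isomorphism. -/
theorem IsSharp.transport {E' : Type*} [NormedAddCommGroup E'] [NormedSpace ℝ E']
    (h : IsSharp C w P) {S : E →L[ℝ] E'} {T : E' →L[ℝ] E}
    (hST : ∀ v, S (T v) = v) (hTS : ∀ v, T (S v) = v) :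
    IsSharp (C.comap T.toLinearMap) (w.compContinuousLinearMap T)
      (S.comp (P.comp ((ContinuousLinearMap.compL ℝ E E' ℝ).flip S))) := by
  intro α X
  have h1 := h (α.comp S) (T X)
  have e1 : (X ∈ C.comap T.toLinearMap ∧ ∀ Y ∈ C.comap T.toLinearMap,
      w.compContinuousLinearMap T ![X, Y] = α Y) ↔
      (T X ∈ C ∧ ∀ Y ∈ C, w ![T X, Y] = α.comp S Y) := by
    refine and_congr Iff.rfl ⟨fun H Y hY => ?_, fun H Y hY => ?_⟩
    · have := H (S Y) (by change T (S Y) ∈ C; rwa [hTS])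
      rw [ContinuousLinearMap.comp_apply, ← this, ContinuousAlternatingMap.compContinuousLinearMap_apply]
      congr 1
      ext i; fin_cases i <;> simp [hTS]
    · have := H (T Y) hY
      rw [ContinuousLinearMap.comp_apply, hST] at this
      rw [← this, ContinuousAlternatingMap.compContinuousLinearMap_apply]
      congr 1
      ext i; fin_cases i <;> simp
  rw [e1, h1]
  change _ ↔ S (P (α.comp S)) = -X
  constructor
  · intro H; rw [H, map_neg, hST]
  · intro H; rw [← hTS (P (α.comp S)), H, map_neg]

end SharpAlgebra

/-! ### Smooth dependence of the sharp map on the subspace and the 2-form. -/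

section SharpSmooth

variable {E : Type*} [NormedAddCommGroup E] [NormedSpace ℝ E] [FiniteDimensional ℝ E]

/-- An auxiliary inner product on a finite-dimensional space. -/
def auxInner (E : Type*) [NormedAddCommGroup E] [NormedSpace ℝ E] [FiniteDimensional ℝ E] :
    E →L[ℝ] E →L[ℝ] ℝ :=
  (innerSL ℝ).bilinearComp (toEuclidean (E := E)).toContinuousLinearMap
    (toEuclidean (E := E)).toContinuousLinearMap

theorem auxInner_self_eq_zero {v : E} (h : auxInner E v v = 0) : v = 0 := by
  have : inner ℝ (toEuclidean v) (toEuclidean v) = 0 := h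
  rw [inner_self_eq_zero] at this
  simpa using this

variable {X : Type*} [NormedAddCommGroup X] [NormedSpace ℝ X]

theorem ContDiffAt.clm_inverse_of_injective {F : Type*} [NormedAddCommGroup F] [NormedSpace ℝ F]
    [FiniteDimensional ℝ F] {L : X → E →L[ℝ] F} {x : X} {n : WithTop ℕ∞} (hL : ContDiffAt ℝ n L x)
    (hx : (L x).IsInvertible) : ContDiffAt ℝ n (fun y => (L y).inverse) x := by
  have : CompleteSpace E := FiniteDimensional.complete ℝ E
  obtain ⟨e, he⟩ := hx
  have := contDiffAt_map_inverse (n := n) e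
  rw [he] at this
  exact this.comp x hL

/-- A linear map is recovered, continuously and linearly, from its values on a basis. Smoothness of
operator-valued maps can therefore be checked vector by vector. -/
theorem exists_clm_reconstruction (E F : Type*) [NormedAddCommGroup E] [NormedSpace ℝ E]
    [FiniteDimensional ℝ E] [NormedAddCommGroup F] [NormedSpace ℝ F] :
    ∃ (d : ℕ) (b : Fin d → E) (Φ : (Fin d → F) →L[ℝ] E →L[ℝ] F),
      ∀ T : E →L[ℝ] F, Φ (fun i => T (b i)) = T := by
  let d := Module.finrank ℝ E
  have hd : d = Module.finrank ℝ (Fin d → ℝ) := (Module.finrank_fin_fun ℝ).symm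
  let e₁ := ContinuousLinearEquiv.ofFinrankEq hd
  let e₂ := (e₁.arrowCongr (1 : F ≃L[ℝ] F)).trans (ContinuousLinearEquiv.piRing (Fin d))
  exact ⟨d, fun i => e₁.symm (Pi.single i 1), e₂.symm, fun T => e₂.symm_apply_apply T⟩

theorem contDiffAt_clm_of_apply {F : Type*} [NormedAddCommGroup F] [NormedSpace ℝ F]
    {L : X → E →L[ℝ] F} {x : X} {n : WithTop ℕ∞} (h : ∀ u, ContDiffAt ℝ n (fun y => L y u) x) :
    ContDiffAt ℝ n L x := by
  obtain ⟨d, b, Φ, hΦ⟩ := exists_clm_reconstruction E F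
  have : L = fun y => Φ (fun i => L y (b i)) := funext fun y => (hΦ _).symm
  rw [this]
  exact Φ.contDiff.contDiffAt.comp x (contDiffAt_pi.2 fun i => h (b i))

theorem contDiffAt_clm_of_apply₂ {E₂ F : Type*} [NormedAddCommGroup E₂] [NormedSpace ℝ E₂]
    [FiniteDimensional ℝ E₂] [NormedAddCommGroup F] [NormedSpace ℝ F]
    {L : X → E →L[ℝ] E₂ →L[ℝ] F} {x : X} {n : WithTop ℕ∞}
    (h : ∀ u v, ContDiffAt ℝ n (fun y => L y u v) x) : ContDiffAt ℝ n L x :=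
  contDiffAt_clm_of_apply fun u => contDiffAt_clm_of_apply fun v => h u v

/-- The subspace moves with the point, so the map to be inverted is first extended to all of `E`.
With q = 1 - p, the form L(u, v) = w(pu, pv) + ⟨qu, qv⟩ is nondegenerate on `E` for an auxiliary
inner product. The sharp map is -L⁻¹ applied to α ∘ p, and inversion of operators is smooth. -/
theorem contDiffAt_sharp {w : X → E [⋀^Fin 2]→L[ℝ] ℝ} {p : X → E →L[ℝ] E}
    {C : X → Submodule ℝ E} {P : X → (E →L[ℝ] ℝ) →L[ℝ] E} {x : X}
    (hw : ContDiffAt ℝ ∞ w x) (hp : ContDiffAt ℝ ∞ p x)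
    (hpC : ∀ᶠ y in 𝓝 x, ∀ v, p y v ∈ C y) (hpid : ∀ᶠ y in 𝓝 x, ∀ v ∈ C y, p y v = v)
    (hP : ∀ᶠ y in 𝓝 x, IsSharp (C y) (w y) (P y)) : ContDiffAt ℝ ∞ P x := by
  let q : X → E →L[ℝ] E := fun y => ContinuousLinearMap.id ℝ E - p y
  let L : X → E →L[ℝ] E →L[ℝ] ℝ := fun y =>
    (altFlat (w y)).bilinearComp (p y) (p y) + (auxInner E).bilinearComp (q y) (q y)
  have hLapp : ∀ y u v, L y u v = w y ![p y u, p y v] + auxInner E (q y u) (q y v) := by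
    intro y u v
    change altFlat (w y) (p y u) (p y v) + _ = _
    rw [altFlat_apply]; rfl
  have hq : ContDiffAt ℝ ∞ q x := contDiffAt_const.sub hp
  have hL : ContDiffAt ℝ ∞ L x := by
    have h1 : ContDiffAt ℝ ∞ (fun y => altFlat (w y)) x := by
      have : ContDiff ℝ ∞ (fun w : E [⋀^Fin 2]→L[ℝ] ℝ => altFlat w) := by
        rw [contDiff_clm_apply_iff]
        intro u
        rw [contDiff_clm_apply_iff]
        intro v
        simp only [altFlat_apply]
        exact (ContinuousAlternatingMap.apply ℝ E ℝ ![u, v]).contDiff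
      exact this.contDiffAt.comp x hw
    refine ContDiffAt.add ?_ ?_
    · refine contDiffAt_clm_of_apply₂ fun u v => ?_
      exact ((h1.clm_apply (hp.clm_apply contDiffAt_const)).clm_apply
        (hp.clm_apply contDiffAt_const))
    · refine contDiffAt_clm_of_apply₂ fun u v => ?_
      exact ((contDiffAt_const (c := auxInner E)).clm_apply
        (hq.clm_apply contDiffAt_const)).clm_apply (hq.clm_apply contDiffAt_const)
  have hinj : ∀ᶠ y in 𝓝 x, Function.Injective (L y) := by
    filter_upwards [hpC, hpid, hP] with y h1 h2 h3
    rw [injective_iff_map_eq_zero]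
    intro u hu
    have hu' : ∀ v, w y ![p y u, p y v] + auxInner E (q y u) (q y v) = 0 := fun v => by
      rw [← hLapp, hu]; rfl
    have hqC : ∀ v ∈ C y, q y v = 0 := fun v hv => by
      change v - p y v = 0
      rw [h2 v hv, sub_self]
    -- Testing against `C` removes the inner-product term and leaves `w`, which is nondegenerate
    -- there. Testing against `u` itself then disposes of the `q`-part.
    have hpu : p y u = 0 := by
      refine h3.nondegOn _ (h1 u) fun Y hY => ?_
      have := hu' Y
      rwa [hqC Y hY, map_zero, add_zero, h2 Y hY] at this
    have hqu : q y u = 0 := by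
      refine auxInner_self_eq_zero ?_
      have := hu' u
      rw [hpu, ← altFlat_apply] at this
      simpa using this
    have : u = q y u + p y u := by change u = u - p y u + p y u; abel
    rw [this, hpu, hqu, add_zero]
  have hinv : ∀ᶠ y in 𝓝 x, (L y).IsInvertible := by
    filter_upwards [hinj] with y hy
    have hfr : Module.finrank ℝ E = Module.finrank ℝ (E →L[ℝ] ℝ) := by
      rw [← (LinearMap.toContinuousLinearMap (𝕜 := ℝ) (E := E) (F' := ℝ)).finrank_eq]
      exact Subspace.dual_finrank_eq.symm
    let e := LinearEquiv.ofInjectiveOfFinrankEq (L y).toLinearMap hy hfr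
    exact ⟨e.toContinuousLinearEquiv, by ext1 u; rfl⟩
  have hmain : P =ᶠ[𝓝 x] fun y =>
      -((L y).inverse.comp ((ContinuousLinearMap.compL ℝ E E ℝ).flip (p y))) := by
    filter_upwards [hpC, hpid, hP, hinv, hinj] with y h1 h2 h3 h4 h5
    ext1 α
    change P y α = -((L y).inverse (α.comp (p y)))
    refine (h3 α _).1 ?_
    set Z := (L y).inverse (α.comp (p y)) with hZ
    have hLZ : L y Z = α.comp (p y) := h4.self_apply_inverse _
    have hLZ' : ∀ v, w y ![p y Z, p y v] + auxInner E (q y Z) (q y v) = α (p y v) := fun v => by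
      rw [← hLapp, hLZ]; rfl
    have hpq : ∀ v, p y (q y v) = 0 := fun v => by
      change p y (v - p y v) = 0
      rw [map_sub, h2 _ (h1 v), sub_self]
    have hqq : ∀ v, q y (q y v) = q y v := fun v => by
      change q y v - p y (q y v) = q y v
      rw [hpq, sub_zero]
    -- Testing against `q Z`, on which both `p` and the right-hand side vanish, forces the solution
    -- into `C`.
    have hqZ : q y Z = 0 := by
      refine auxInner_self_eq_zero ?_
      have := hLZ' (q y Z)
      rw [hpq, hqq, ← altFlat_apply] at this
      simpa using this
    have hpZ : p y Z = Z := (sub_eq_zero.1 (show Z - p y Z = 0 from hqZ)).symm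
    refine ⟨hpZ ▸ h1 Z, fun Y hY => ?_⟩
    have := hLZ' Y
    rwa [hpZ, h2 Y hY, hqZ, map_zero, ContinuousLinearMap.zero_apply, add_zero] at this
  refine ContDiffAt.congr_of_eventuallyEq ?_ hmain
  refine ContDiffAt.neg ?_
  exact (hL.clm_inverse_of_injective hinv.self_of_nhds).clm_comp
    (contDiffAt_clm_of_apply fun α => contDiffAt_const.clm_comp hp)

end SharpSmooth

/-! ### Smooth fields of sharp maps on a manifold -/

section SharpManifold

variable {E : Type*} [NormedAddCommGroup E] [NormedSpace ℝ E]
  {M : Type*} [TopologicalSpace M] [ChartedSpace E M] [IsManifold 𝓘(ℝ, E) ∞ M]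

/-- The bracket of smooth functions near `x` is smooth near `x`. -/
def SharpField.SmoothAt (π : SharpField 𝓘(ℝ, E) M) (x : M) : Prop :=
  ∀ f g : M → ℝ, ContMDiffAt 𝓘(ℝ, E) 𝓘(ℝ, ℝ) ∞ f x → ContMDiffAt 𝓘(ℝ, E) 𝓘(ℝ, ℝ) ∞ g x →
    ContMDiffAt 𝓘(ℝ, E) 𝓘(ℝ, ℝ) ∞ (π.bracket 𝓘(ℝ, E) f g) x

theorem contMDiffAt_extChartAt_source {x₀ x : M} (hx : x ∈ (extChartAt 𝓘(ℝ, E) x₀).source) :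
    ContMDiffAt 𝓘(ℝ, E) 𝓘(ℝ, E) ∞ (extChartAt 𝓘(ℝ, E) x₀) x :=
  contMDiffAt_extChartAt' (by rwa [extChartAt_source] at hx)

theorem diffAt_clm_comp_extChartAt {x₀ x : M} (hx : x ∈ (extChartAt 𝓘(ℝ, E) x₀).source)
    (a : E →L[ℝ] ℝ) :
    diffAt 𝓘(ℝ, E) (a ∘ extChartAt 𝓘(ℝ, E) x₀) x =
      a.comp (mfderiv 𝓘(ℝ, E) 𝓘(ℝ, E) (extChartAt 𝓘(ℝ, E) x₀) x : E →L[ℝ] E) := by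
  have h := mfderiv_comp (I := 𝓘(ℝ, E)) (I' := 𝓘(ℝ, E)) (I'' := 𝓘(ℝ, ℝ)) x
    (a.differentiableAt.mdifferentiableAt (x := extChartAt 𝓘(ℝ, E) x₀ x))
    ((contMDiffAt_extChartAt_source hx).mdifferentiableAt (by simp))
  rw [mfderiv_eq_fderiv, a.fderiv] at h
  exact h

/-- The components of a bivector in a chart are brackets of linear functions of the coordinates.
These functions are smooth only on the chart domain, which is why `SmoothAt` is stated for functions
smooth at a single point. -/
theorem isBivectorField_of_smoothAt {π : SharpField 𝓘(ℝ, E) M}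
    (hskew : ∀ (x : M) (α β : TangentSpace 𝓘(ℝ, E) x →L[ℝ] ℝ), β (π x α) = -α (π x β))
    (h : ∀ x, π.SmoothAt x) : IsBivectorField 𝓘(ℝ, E) π := by
  refine ⟨hskew, fun x₀ a b y hy => ?_⟩
  have hs := (extChartAt 𝓘(ℝ, E) x₀).map_target hy
  have h1 := h _ _ _ (a.contDiff.contMDiff.contMDiffAt.comp _ (contMDiffAt_extChartAt_source hs))
    (b.contDiff.contMDiff.contMDiffAt.comp _ (contMDiffAt_extChartAt_source hs))
  have h2 := (h1.comp y (contMDiffAt_extChartAt_symm 𝓘(ℝ, E) hy)).contDiffAt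
  refine (h2.congr_of_eventuallyEq ?_).contDiffWithinAt
  filter_upwards [(isOpen_extChartAt_target x₀).mem_nhds hy] with z hz
  have hz' := (extChartAt 𝓘(ℝ, E) x₀).map_target hz
  change _ = diffAt 𝓘(ℝ, E) (b ∘ extChartAt 𝓘(ℝ, E) x₀) _
    (π _ (diffAt 𝓘(ℝ, E) (a ∘ extChartAt 𝓘(ℝ, E) x₀) _))
  rw [diffAt_clm_comp_extChartAt hz', diffAt_clm_comp_extChartAt hz']

/-- The derivative of the inverse of the chart at `x₀`. -/
def chartSymmD (x₀ : M) (y : E) : E →L[ℝ] E :=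
  mfderiv 𝓘(ℝ, E) 𝓘(ℝ, E) (extChartAt 𝓘(ℝ, E) x₀).symm y

/-- The expression of a field of sharp maps in the chart at `x₀`. -/
def SharpField.inChart (π : SharpField 𝓘(ℝ, E) M) (x₀ : M) (y : E) : (E →L[ℝ] ℝ) →L[ℝ] E :=
  let x := (extChartAt 𝓘(ℝ, E) x₀).symm y
  let Dφ : E →L[ℝ] E := mfderiv 𝓘(ℝ, E) 𝓘(ℝ, E) (extChartAt 𝓘(ℝ, E) x₀) x
  Dφ.comp ((π x : (E →L[ℝ] ℝ) →L[ℝ] E).comp ((ContinuousLinearMap.compL ℝ E E ℝ).flip Dφ))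

/-- The expression in the chart at `x₀` of a field of endomorphisms of the tangent spaces. -/
def endoInChart (p : ∀ x : M, TangentSpace 𝓘(ℝ, E) x →L[ℝ] TangentSpace 𝓘(ℝ, E) x) (x₀ : M)
    (y : E) : E →L[ℝ] E :=
  let x := (extChartAt 𝓘(ℝ, E) x₀).symm y
  (mfderiv 𝓘(ℝ, E) 𝓘(ℝ, E) (extChartAt 𝓘(ℝ, E) x₀) x : E →L[ℝ] E).comp
    ((p x : E →L[ℝ] E).comp
      (mfderiv 𝓘(ℝ, E) 𝓘(ℝ, E) (extChartAt 𝓘(ℝ, E) x₀).symm y : E →L[ℝ] E))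

theorem ContMDiffAt.contDiffAt_comp_extChartAt_symm {F : Type*} [NormedAddCommGroup F]
    [NormedSpace ℝ F] {n : WithTop ℕ∞} (hn : n ≤ ∞) {f : M → F} {x₀ x : M}
    (hx : x ∈ (extChartAt 𝓘(ℝ, E) x₀).source)
    (hf : ContMDiffAt 𝓘(ℝ, E) 𝓘(ℝ, F) n f x) :
    ContDiffAt ℝ n (f ∘ (extChartAt 𝓘(ℝ, E) x₀).symm) (extChartAt 𝓘(ℝ, E) x₀ x) := by
  have h1 := (contMDiffAt_extChartAt_symm 𝓘(ℝ, E)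
    ((extChartAt 𝓘(ℝ, E) x₀).map_source hx)).of_le hn
  refine ContMDiffAt.contDiffAt (ContMDiffAt.comp _ ?_ h1)
  rwa [(extChartAt 𝓘(ℝ, E) x₀).left_inv hx]

theorem mfderiv_eq_fderiv_comp {F : Type*} [NormedAddCommGroup F] [NormedSpace ℝ F] {f : M → F}
    {x₀ x : M} (hx : x ∈ (extChartAt 𝓘(ℝ, E) x₀).source)
    (hf : MDifferentiableAt 𝓘(ℝ, E) 𝓘(ℝ, F) f x) :
    (mfderiv 𝓘(ℝ, E) 𝓘(ℝ, F) f x : E →L[ℝ] F) =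
      (fderiv ℝ (f ∘ (extChartAt 𝓘(ℝ, E) x₀).symm) (extChartAt 𝓘(ℝ, E) x₀ x)).comp
      (mfderiv 𝓘(ℝ, E) 𝓘(ℝ, E) (extChartAt 𝓘(ℝ, E) x₀) x : E →L[ℝ] E) := by
  have hy := (extChartAt 𝓘(ℝ, E) x₀).map_source hx
  have hs : MDifferentiableAt 𝓘(ℝ, E) 𝓘(ℝ, E) (extChartAt 𝓘(ℝ, E) x₀).symm
    (extChartAt 𝓘(ℝ, E) x₀ x) := (contMDiffAt_extChartAt_symm 𝓘(ℝ, E) hy).mdifferentiableAt (by simp)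
  have hf' : MDifferentiableAt 𝓘(ℝ, E) 𝓘(ℝ, F) f
      ((extChartAt 𝓘(ℝ, E) x₀).symm (extChartAt 𝓘(ℝ, E) x₀ x)) := by
    rwa [(extChartAt 𝓘(ℝ, E) x₀).left_inv hx]
  have h := mfderiv_comp (I := 𝓘(ℝ, E)) (I' := 𝓘(ℝ, E)) (I'' := 𝓘(ℝ, F)) x
    (hf'.comp _ hs) ((contMDiffAt_extChartAt_source hx).mdifferentiableAt (by simp))
  rw [mfderiv_eq_fderiv] at h
  refine Eq.trans ?_ h
  refine Filter.EventuallyEq.mfderiv_eq ?_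
  filter_upwards [(isOpen_extChartAt_source x₀).mem_nhds hx] with z hz
  exact congrArg f ((extChartAt 𝓘(ℝ, E) x₀).left_inv hz).symm

theorem diffAt_eq_fderiv_comp {f : M → ℝ} {x₀ x : M} (hx : x ∈ (extChartAt 𝓘(ℝ, E) x₀).source)
    (hf : MDifferentiableAt 𝓘(ℝ, E) 𝓘(ℝ, ℝ) f x) :
    (diffAt 𝓘(ℝ, E) f x : E →L[ℝ] ℝ) =
      (fderiv ℝ (f ∘ (extChartAt 𝓘(ℝ, E) x₀).symm) (extChartAt 𝓘(ℝ, E) x₀ x)).comp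
      (mfderiv 𝓘(ℝ, E) 𝓘(ℝ, E) (extChartAt 𝓘(ℝ, E) x₀) x : E →L[ℝ] E) :=
  mfderiv_eq_fderiv_comp hx hf

theorem ContMDiffAt.eventually_mdifferentiableAt {F : Type*} [NormedAddCommGroup F]
    [NormedSpace ℝ F] {f : M → F} {x : M} (hf : ContMDiffAt 𝓘(ℝ, E) 𝓘(ℝ, F) ∞ f x) :
    ∀ᶠ z in 𝓝 x, MDifferentiableAt 𝓘(ℝ, E) 𝓘(ℝ, F) f z := by
  have : IsManifold 𝓘(ℝ, E) 1 M := IsManifold.of_le (n := ∞) (by simp)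
  have h := contMDiffAt_iff_contMDiffAt_nhds (by simp) |>.1 (ContMDiffAt.of_le hf (m := 1) (by simp))
  filter_upwards [h] with z hz
  exact hz.mdifferentiableAt (by simp)

theorem SharpField.bracket_eventuallyEq {π : SharpField 𝓘(ℝ, E) M} {x₀ x : M} {f g : M → ℝ}
    (hx : x ∈ (extChartAt 𝓘(ℝ, E) x₀).source)
    (hf : ContMDiffAt 𝓘(ℝ, E) 𝓘(ℝ, ℝ) ∞ f x) (hg : ContMDiffAt 𝓘(ℝ, E) 𝓘(ℝ, ℝ) ∞ g x) :
    ∀ᶠ z in 𝓝 x, π.bracket 𝓘(ℝ, E) f g z =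
      fderiv ℝ (g ∘ (extChartAt 𝓘(ℝ, E) x₀).symm) (extChartAt 𝓘(ℝ, E) x₀ z)
        (π.inChart x₀ (extChartAt 𝓘(ℝ, E) x₀ z)
          (fderiv ℝ (f ∘ (extChartAt 𝓘(ℝ, E) x₀).symm) (extChartAt 𝓘(ℝ, E) x₀ z))) := by
  filter_upwards [hf.eventually_mdifferentiableAt, hg.eventually_mdifferentiableAt,
    (isOpen_extChartAt_source x₀).mem_nhds hx] with z h1 h2 h3
  change diffAt 𝓘(ℝ, E) g z (π z (diffAt 𝓘(ℝ, E) f z)) = _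
  rw [diffAt_eq_fderiv_comp h3 h1, diffAt_eq_fderiv_comp h3 h2]
  unfold SharpField.inChart
  rw [(extChartAt 𝓘(ℝ, E) x₀).left_inv h3]
  rfl

theorem SharpField.smoothAt_of_inChart {π : SharpField 𝓘(ℝ, E) M} {x₀ x : M}
    (hx : x ∈ (extChartAt 𝓘(ℝ, E) x₀).source)
    (h : ContDiffAt ℝ ∞ (π.inChart x₀) (extChartAt 𝓘(ℝ, E) x₀ x)) : π.SmoothAt x := by
  intro f g hf hg
  refine ContMDiffAt.congr_of_eventuallyEq ?_ (SharpField.bracket_eventuallyEq hx hf hg)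
  have hf' := (hf.contDiffAt_comp_extChartAt_symm le_rfl hx).fderiv_right (m := ∞) (by simp)
  have hg' := (hg.contDiffAt_comp_extChartAt_symm le_rfl hx).fderiv_right (m := ∞) (by simp)
  exact (hg'.clm_apply (h.clm_apply hf')).contMDiffAt.comp x (contMDiffAt_extChartAt_source hx)

theorem isSharp_inChart {π : SharpField 𝓘(ℝ, E) M} {x₀ : M} {y : E}
    {C : ∀ x : M, Submodule ℝ (TangentSpace 𝓘(ℝ, E) x)} {w : DForm 𝓘(ℝ, E) M 2 ℝ}
    (hy : y ∈ (extChartAt 𝓘(ℝ, E) x₀).target)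
    (h : IsSharp (E := E) (C ((extChartAt 𝓘(ℝ, E) x₀).symm y)) (w ((extChartAt 𝓘(ℝ, E) x₀).symm y))
      (π ((extChartAt 𝓘(ℝ, E) x₀).symm y))) :
    IsSharp ((C ((extChartAt 𝓘(ℝ, E) x₀).symm y) : Submodule ℝ E).comap
      (chartSymmD x₀ y).toLinearMap)
      (DForm.inChart 𝓘(ℝ, E) w x₀ y) (π.inChart x₀ y) := by
  have hs := (extChartAt 𝓘(ℝ, E) x₀).map_target hy
  have h1 := mfderiv_extChartAt_symm_comp 𝓘(ℝ, E) hs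
  have h2 := mfderiv_extChartAt_comp_symm 𝓘(ℝ, E) hs
  rw [(extChartAt 𝓘(ℝ, E) x₀).right_inv hy] at h1 h2
  exact h.transport (E' := E)
    (S := (mfderiv 𝓘(ℝ, E) 𝓘(ℝ, E) (extChartAt 𝓘(ℝ, E) x₀) _ : E →L[ℝ] E))
    (T := chartSymmD x₀ y)
    (fun v => DFunLike.congr_fun h2 v) (fun v => DFunLike.congr_fun h1 v)

theorem SharpField.contDiffAt_inChart [FiniteDimensional ℝ E] {π : SharpField 𝓘(ℝ, E) M}
    {x₀ : M} {y : E}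
    {C : ∀ x : M, Submodule ℝ (TangentSpace 𝓘(ℝ, E) x)} {w : DForm 𝓘(ℝ, E) M 2 ℝ}
    {p : ∀ x : M, TangentSpace 𝓘(ℝ, E) x →L[ℝ] TangentSpace 𝓘(ℝ, E) x}
    (hy : y ∈ (extChartAt 𝓘(ℝ, E) x₀).target)
    (hw : DForm.IsSmooth 𝓘(ℝ, E) w) (hp : ContDiffAt ℝ ∞ (endoInChart p x₀) y)
    (hpC : ∀ x v, p x v ∈ C x) (hpid : ∀ x, ∀ v ∈ C x, p x v = v)
    (h : ∀ x, IsSharp (E := E) (C x) (w x) (π x)) : ContDiffAt ℝ ∞ (π.inChart x₀) y := by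
  have hy' := (isOpen_extChartAt_target (I := 𝓘(ℝ, E)) x₀).mem_nhds hy
  refine contDiffAt_sharp (w := DForm.inChart 𝓘(ℝ, E) w x₀) (p := endoInChart p x₀)
    (C := fun y => (C ((extChartAt 𝓘(ℝ, E) x₀).symm y) : Submodule ℝ E).comap
      (chartSymmD x₀ y).toLinearMap)
    ((hw x₀).contDiffAt hy') hp ?_ ?_ ?_
  · filter_upwards [hy'] with z hz v
    have hs := (extChartAt 𝓘(ℝ, E) x₀).map_target hz
    have h1 := mfderiv_extChartAt_symm_comp 𝓘(ℝ, E) hs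
    rw [(extChartAt 𝓘(ℝ, E) x₀).right_inv hz] at h1
    have h2 := DFunLike.congr_fun h1 (p _ (mfderiv 𝓘(ℝ, E) 𝓘(ℝ, E) (extChartAt 𝓘(ℝ, E) x₀).symm z v))
    have h3 := hpC _ (mfderiv 𝓘(ℝ, E) 𝓘(ℝ, E) (extChartAt 𝓘(ℝ, E) x₀).symm z v)
    exact (congrArg (fun u : E => u ∈ (C ((extChartAt 𝓘(ℝ, E) x₀).symm z) : Submodule ℝ E)) h2).mpr h3
  · filter_upwards [hy'] with z hz v hv
    have hs := (extChartAt 𝓘(ℝ, E) x₀).map_target hz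
    have h1 := mfderiv_extChartAt_comp_symm 𝓘(ℝ, E) hs
    rw [(extChartAt 𝓘(ℝ, E) x₀).right_inv hz] at h1
    have h2 := DFunLike.congr_fun h1 v
    have h3 := hpid _ _ hv
    exact (congrArg (fun u : E => (mfderiv 𝓘(ℝ, E) 𝓘(ℝ, E) (extChartAt 𝓘(ℝ, E) x₀)
      ((extChartAt 𝓘(ℝ, E) x₀).symm z) : E →L[ℝ] E) u) h3).trans h2
  · filter_upwards [hy'] with z hz
    exact isSharp_inChart hz (h _)

end SharpManifold

/-! ### Forms and derivatives on the model spaces -/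

section Model

variable {E₁ E₂ E₃ : Type*} [NormedAddCommGroup E₁] [NormedSpace ℝ E₁]
  [NormedAddCommGroup E₂] [NormedSpace ℝ E₂] [NormedAddCommGroup E₃] [NormedSpace ℝ E₃]
  {H₁ H₂ H₃ : Type*} [TopologicalSpace H₁] [TopologicalSpace H₂] [TopologicalSpace H₃]
  (I₁ : ModelWithCorners ℝ E₁ H₁) (I₂ : ModelWithCorners ℝ E₂ H₂) (I₃ : ModelWithCorners ℝ E₃ H₃)
  {X Y Z : Type*} [TopologicalSpace X] [ChartedSpace H₁ X] [TopologicalSpace Y] [ChartedSpace H₂ Y]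
  [TopologicalSpace Z] [ChartedSpace H₃ Z]
  {V : Type*} [NormedAddCommGroup V] [NormedSpace ℝ V] {k : ℕ}

/-- The derivative of a map between manifolds, as a linear map between the model spaces. -/
def tangentD (f : X → Y) (x : X) : E₁ →L[ℝ] E₂ := mfderiv I₁ I₂ f x

variable {I₁ I₂ I₃}

/-- The value of a form, as an alternating map on the model space. -/
def DForm.val (α : DForm I₁ X k V) (x : X) : E₁ [⋀^Fin k]→L[ℝ] V := α x

theorem DForm.val_congr (α : DForm I₁ X k V) {x y : X} (h : x = y) : α.val x = α.val y := by
  rw [h]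

theorem DForm.ext_val {α β : DForm I₁ X k V} {x : X} (h : ∀ v, α.val x v = β.val x v) : α x = β x :=
  ContinuousAlternatingMap.ext h

theorem tangentD_comp {g : Y → Z} {f : X → Y} {x : X} (hg : MDifferentiableAt I₂ I₃ g (f x))
    (hf : MDifferentiableAt I₁ I₂ f x) :
    tangentD I₁ I₃ (fun x => g (f x)) x = (tangentD I₂ I₃ g (f x)).comp (tangentD I₁ I₂ f x) :=
  mfderiv_comp x hg hf

theorem tangentD_comp_apply {g : Y → Z} {f : X → Y} {x : X}
    (hg : MDifferentiableAt I₂ I₃ g (f x)) (hf : MDifferentiableAt I₁ I₂ f x) (v : E₁) :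
    tangentD I₁ I₃ (fun x => g (f x)) x v = tangentD I₂ I₃ g (f x) (tangentD I₁ I₂ f x v) :=
  DFunLike.congr_fun (tangentD_comp hg hf) v

theorem tangentD_congr {f g : X → Y} {x : X} (h : f =ᶠ[𝓝 x] g) :
    tangentD I₁ I₂ f x = tangentD I₁ I₂ g x := h.mfderiv_eq

theorem tangentD_id (x : X) : tangentD I₁ I₁ (fun x => x) x = ContinuousLinearMap.id ℝ E₁ :=
  mfderiv_id

theorem tangentD_const (y : Y) (x : X) : tangentD I₁ I₂ (fun _ => y) x = 0 :=
  mfderiv_const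

theorem tangentD_eq_fderiv (f : E₁ → E₂) (x : E₁) :
    tangentD 𝓘(ℝ, E₁) 𝓘(ℝ, E₂) f x = fderiv ℝ f x := mfderiv_eq_fderiv

theorem comp_cons_one {A A' : Type*} (f : A → A') (a : A) :
    (fun i : Fin 1 => f (![a] i)) = ![f a] := by
  ext i; fin_cases i; rfl

theorem comp_cons_two {A A' : Type*} (f : A → A') (a b : A) :
    (fun i : Fin 2 => f (![a, b] i)) = ![f a, f b] := by
  ext i; fin_cases i <;> rfl

theorem comp_cons_three {A A' : Type*} (f : A → A') (a b c : A) :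
    (fun i : Fin 3 => f (![a, b, c] i)) = ![f a, f b, f c] := by
  ext i; fin_cases i <;> rfl

theorem DForm.pullback_val (f : X → Y) (α : DForm I₂ Y k V) (x : X) (v : Fin k → E₁) :
    (DForm.pullback I₁ I₂ f α).val x v = α.val (f x) (fun i => tangentD I₁ I₂ f x (v i)) := rfl

theorem DForm.pullback_val_one (f : X → Y) (α : DForm I₂ Y 1 V) (x : X) (u : E₁) :
    (DForm.pullback I₁ I₂ f α).val x ![u] = α.val (f x) ![tangentD I₁ I₂ f x u] := by
  rw [DForm.pullback_val, comp_cons_one (tangentD I₁ I₂ f x)]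

theorem DForm.pullback_val_two (f : X → Y) (α : DForm I₂ Y 2 V) (x : X) (u v : E₁) :
    (DForm.pullback I₁ I₂ f α).val x ![u, v] =
      α.val (f x) ![tangentD I₁ I₂ f x u, tangentD I₁ I₂ f x v] := by
  rw [DForm.pullback_val, comp_cons_two (tangentD I₁ I₂ f x)]

theorem DForm.pullback_val_three (f : X → Y) (α : DForm I₂ Y 3 V) (x : X) (u v w : E₁) :
    (DForm.pullback I₁ I₂ f α).val x ![u, v, w] =
      α.val (f x) ![tangentD I₁ I₂ f x u, tangentD I₁ I₂ f x v, tangentD I₁ I₂ f x w] := by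
  rw [DForm.pullback_val, comp_cons_three (tangentD I₁ I₂ f x)]

end Model

/-! ### Infinitesimal generators of smooth actions -/

section Generators

variable {E : Type*} [NormedAddCommGroup E] [NormedSpace ℝ E]
  {M : Type*} [TopologicalSpace M] [ChartedSpace E M] [IsManifold 𝓘(ℝ, E) ∞ M]
  {EG : Type*} [NormedAddCommGroup EG] [NormedSpace ℝ EG]
  {G : Type*} [TopologicalSpace G] [ChartedSpace EG G] [Group G] [LieGroup 𝓘(ℝ, EG) ∞ G]
  [MulAction G M] [ContMDiffSMul 𝓘(ℝ, EG) 𝓘(ℝ, E) ∞ G M]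

variable (EG G) in
/-- The action in charts: `(s, y) ↦ χ⁻¹(s) • φ⁻¹(y)` with `χ` the chart of `G` at `1` and `φ` the
chart of `M` at `x₀`. -/
def actChart (x₀ : M) (p : EG × E) : M :=
  (extChartAt 𝓘(ℝ, EG) (1 : G)).symm p.1 • (extChartAt 𝓘(ℝ, E) x₀).symm p.2

omit [IsManifold 𝓘(ℝ, E) ∞ M] in
theorem contMDiff_smul_const (EG : Type*) [NormedAddCommGroup EG] [NormedSpace ℝ EG]
    {G : Type*} [TopologicalSpace G] [ChartedSpace EG G] [Group G] [MulAction G M]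
    [ContMDiffSMul 𝓘(ℝ, EG) 𝓘(ℝ, E) ∞ G M] (g : G) : ContMDiff 𝓘(ℝ, E) 𝓘(ℝ, E) ∞ (fun m : M => g • m) :=
  (contMDiff_smul (I := 𝓘(ℝ, EG)) (I' := 𝓘(ℝ, E)) (n := ∞) (G := G) (M := M)).comp
    (contMDiff_const.prodMk contMDiff_id)

omit [IsManifold 𝓘(ℝ, E) ∞ M] [LieGroup 𝓘(ℝ, EG) ∞ G] in
theorem contMDiff_smul_orbit (m : M) : ContMDiff 𝓘(ℝ, EG) 𝓘(ℝ, E) ∞ (fun g : G => g • m) :=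
  (contMDiff_smul (I := 𝓘(ℝ, EG)) (I' := 𝓘(ℝ, E)) (n := ∞) (G := G) (M := M)).comp
    (contMDiff_id.prodMk contMDiff_const)

theorem contMDiffAt_actChart {x₀ : M} {p : EG × E}
    (h1 : p.1 ∈ (extChartAt 𝓘(ℝ, EG) (1 : G)).target)
    (h2 : p.2 ∈ (extChartAt 𝓘(ℝ, E) x₀).target) :
    ContMDiffAt 𝓘(ℝ, EG × E) 𝓘(ℝ, E) ∞ (actChart EG G x₀) p := by
  have e1 : ContMDiffAt 𝓘(ℝ, EG × E) 𝓘(ℝ, EG) ∞ 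
      (fun p : EG × E => (extChartAt 𝓘(ℝ, EG) (1 : G)).symm p.1) p :=
    (contMDiffAt_extChartAt_symm 𝓘(ℝ, EG) h1).comp p contDiff_fst.contMDiff.contMDiffAt
  have e2 : ContMDiffAt 𝓘(ℝ, EG × E) 𝓘(ℝ, E) ∞ 
      (fun p : EG × E => (extChartAt 𝓘(ℝ, E) x₀).symm p.2) p :=
    (contMDiffAt_extChartAt_symm 𝓘(ℝ, E) h2).comp p contDiff_snd.contMDiff.contMDiffAt
  exact e1.smul e2

variable (EG G) in
/-- The derivative at `1` of the chart of `G`. -/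
def chartD_one : EG →L[ℝ] EG := mfderiv 𝓘(ℝ, EG) 𝓘(ℝ, EG) (extChartAt 𝓘(ℝ, EG) (1 : G)) 1

/-- The derivative of `actChart` carries the constant field `(chartD_one EG G ξ, 0)` to the
generator of ξ at the points over the unit. Constant fields on `EG × E` commute, so working there
avoids Lie brackets and flows. -/
theorem mfderiv_actChart_inl {x₀ : M} {y : E} (hy : y ∈ (extChartAt 𝓘(ℝ, E) x₀).target) (ξ : EG) :
    tangentD 𝓘(ℝ, EG × E) 𝓘(ℝ, E) (actChart EG G x₀) (extChartAt 𝓘(ℝ, EG) (1 : G) 1, y)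
      (chartD_one EG G ξ, 0) =
    infGen EG G ((extChartAt 𝓘(ℝ, E) x₀).symm y) ξ := by
  have h0 : extChartAt 𝓘(ℝ, EG) (1 : G) 1 ∈ (extChartAt 𝓘(ℝ, EG) (1 : G)).target :=
    mem_extChartAt_target _
  have hA : MDifferentiableAt 𝓘(ℝ, EG × E) 𝓘(ℝ, E) (actChart EG G x₀)
      (extChartAt 𝓘(ℝ, EG) (1 : G) 1, y) :=
    (contMDiffAt_actChart (G := G) h0 hy).mdifferentiableAt (by simp)
  have hc : MDifferentiableAt 𝓘(ℝ, EG) 𝓘(ℝ, EG) (extChartAt 𝓘(ℝ, EG) (1 : G)) 1 :=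
    (contMDiffAt_extChartAt_source (mem_extChartAt_source _)).mdifferentiableAt (n := ∞) (by simp)
  have hi : HasFDerivAt (fun s : EG => (s, y)) (ContinuousLinearMap.inl ℝ EG E)
    (extChartAt 𝓘(ℝ, EG) (1 : G) 1) := hasFDerivAt_prodMk_left _ _
  have h1 : HasMFDerivAt 𝓘(ℝ, EG) 𝓘(ℝ, E)
      (fun g : G => actChart EG G x₀ (extChartAt 𝓘(ℝ, EG) (1 : G) g, y)) 1 _ :=
    HasMFDerivAt.comp (f := fun g : G => (extChartAt 𝓘(ℝ, EG) (1 : G) g, y)) (1 : G) hA.hasMFDerivAt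
      (HasMFDerivAt.comp (f := fun g : G => extChartAt 𝓘(ℝ, EG) (1 : G) g) (1 : G) hi.hasMFDerivAt
        hc.hasMFDerivAt)
  have h2 : (fun g : G => actChart EG G x₀ (extChartAt 𝓘(ℝ, EG) (1 : G) g, y)) =ᶠ[𝓝 1]
      fun g : G => g • (extChartAt 𝓘(ℝ, E) x₀).symm y := by
    filter_upwards [(isOpen_extChartAt_source (I := 𝓘(ℝ, EG)) (1 : G)).mem_nhds
      (mem_extChartAt_source _)] with g hg
    simp only [actChart]
    rw [(extChartAt 𝓘(ℝ, EG) (1 : G)).left_inv hg]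
  have h3 := h2.mfderiv_eq (I := 𝓘(ℝ, EG)) (I' := 𝓘(ℝ, E))
  rw [h1.mfderiv] at h3
  exact DFunLike.congr_fun h3 ξ

theorem mfderiv_actChart_inr {x₀ : M} {s : EG} {y : E} 
    (hs : s ∈ (extChartAt 𝓘(ℝ, EG) (1 : G)).target)
    (hy : y ∈ (extChartAt 𝓘(ℝ, E) x₀).target) (v : E) :
    tangentD 𝓘(ℝ, EG × E) 𝓘(ℝ, E) (actChart EG G x₀) (s, y) (0, v) =
    tangentD 𝓘(ℝ, E) 𝓘(ℝ, E) (fun m : M => (extChartAt 𝓘(ℝ, EG) (1 : G)).symm s • m)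
      ((extChartAt 𝓘(ℝ, E) x₀).symm y) (chartSymmD x₀ y v) := by
  have hA : MDifferentiableAt 𝓘(ℝ, EG × E) 𝓘(ℝ, E) (actChart EG G x₀) (s, y) :=
    (contMDiffAt_actChart (G := G) hs hy).mdifferentiableAt (by simp)
  have hi : HasFDerivAt (fun y : E => (s, y)) (ContinuousLinearMap.inr ℝ EG E) y :=
    hasFDerivAt_prodMk_right _ _
  have h1 := hA.hasMFDerivAt.comp _ hi.hasMFDerivAt
  have hg : MDifferentiableAt 𝓘(ℝ, E) 𝓘(ℝ, E)
      (fun m : M => (extChartAt 𝓘(ℝ, EG) (1 : G)).symm s • m) ((extChartAt 𝓘(ℝ, E) x₀).symm y) :=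
    (contMDiff_smul_const EG _).contMDiffAt.mdifferentiableAt (by simp)
  have h2 := hg.hasMFDerivAt.comp y
    ((contMDiffAt_extChartAt_symm 𝓘(ℝ, E) hy).mdifferentiableAt (by simp)).hasMFDerivAt
  exact DFunLike.congr_fun (hasMFDerivAt_unique h1 h2) v

variable (EG G) in
/-- The infinitesimal generators in the chart at `x₀`. -/
def infGenInChart (x₀ : M) (y : E) : EG →L[ℝ] E :=
  (mfderiv 𝓘(ℝ, E) 𝓘(ℝ, E) (extChartAt 𝓘(ℝ, E) x₀) ((extChartAt 𝓘(ℝ, E) x₀).symm y) :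
    E →L[ℝ] E).comp (infGen EG G ((extChartAt 𝓘(ℝ, E) x₀).symm y) : EG →L[ℝ] E)

theorem contDiffAt_infGenInChart {x₀ : M} {y : E} (hy : y ∈ (extChartAt 𝓘(ℝ, E) x₀).target) :
    ContDiffAt ℝ ∞ (infGenInChart EG G x₀) y := by
  have h0 : extChartAt 𝓘(ℝ, EG) (1 : G) 1 ∈ (extChartAt 𝓘(ℝ, EG) (1 : G)).target :=
    mem_extChartAt_target _
  have hone : (extChartAt 𝓘(ℝ, EG) (1 : G)).symm (extChartAt 𝓘(ℝ, EG) (1 : G) 1) = 1 :=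
    (extChartAt 𝓘(ℝ, EG) (1 : G)).left_inv (mem_extChartAt_source _)
  have hval : ∀ z, actChart EG G x₀ (extChartAt 𝓘(ℝ, EG) (1 : G) 1, z) =
      (extChartAt 𝓘(ℝ, E) x₀).symm z := fun z => by
    simp only [actChart, hone, one_smul]
  let h : EG × E → E := fun p => extChartAt 𝓘(ℝ, E) x₀ (actChart EG G x₀ p)
  have hφ : ∀ z ∈ (extChartAt 𝓘(ℝ, E) x₀).target, ContMDiffAt 𝓘(ℝ, E) 𝓘(ℝ, E) ∞
      (extChartAt 𝓘(ℝ, E) x₀) (actChart EG G x₀ (extChartAt 𝓘(ℝ, EG) (1 : G) 1, z)) := by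
    intro z hz
    rw [hval]
    exact contMDiffAt_extChartAt_source ((extChartAt 𝓘(ℝ, E) x₀).map_target hz)
  have hh : ContDiffAt ℝ ∞ h (extChartAt 𝓘(ℝ, EG) (1 : G) 1, y) :=
    ((hφ y hy).comp _ (contMDiffAt_actChart (G := G) h0 hy)).contDiffAt
  have hh' : ContDiffAt ℝ ∞ (fun z : E => ((fderiv ℝ h (extChartAt 𝓘(ℝ, EG) (1 : G) 1, z)).comp
      (ContinuousLinearMap.inl ℝ EG E)).comp (chartD_one EG G)) y := by
    refine (ContDiffAt.clm_comp ?_ contDiffAt_const).clm_comp contDiffAt_const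
    exact (hh.fderiv_right (m := ∞) (by simp)).comp y (contDiff_prodMk_right _).contDiffAt
  refine hh'.congr_of_eventuallyEq ?_
  filter_upwards [(isOpen_extChartAt_target x₀).mem_nhds hy] with z hz
  ext ξ
  have e1 := mfderiv_comp (I := 𝓘(ℝ, EG × E)) (I' := 𝓘(ℝ, E)) (I'' := 𝓘(ℝ, E))
    (extChartAt 𝓘(ℝ, EG) (1 : G) 1, z) ((hφ z hz).mdifferentiableAt (by simp))
    ((contMDiffAt_actChart (G := G) h0 hz).mdifferentiableAt (by simp))
  rw [mfderiv_eq_fderiv] at e1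
  have e2 := DFunLike.congr_fun e1 (chartD_one EG G ξ, (0 : E))
  refine Eq.trans ?_ e2.symm
  change _ = (mfderiv 𝓘(ℝ, E) 𝓘(ℝ, E) (extChartAt 𝓘(ℝ, E) x₀) (actChart EG G x₀
      (extChartAt 𝓘(ℝ, EG) (1 : G) 1, z)) : E →L[ℝ] E)
    (tangentD 𝓘(ℝ, EG × E) 𝓘(ℝ, E) (actChart EG G x₀) (extChartAt 𝓘(ℝ, EG) (1 : G) 1, z)
      (chartD_one EG G ξ, 0))
  rw [mfderiv_actChart_inl hz, hval]
  rfl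

/-- Suppose ξ_M(m) = 0. The relation (gh) • m = g • (h • m) shows that the orbit map of `m` kills
the left-invariant field of ξ at every g. Its integral curve γ through 1 then gives a curve γ(t) • m
of zero velocity, so γ(t) • m = m near 0 by uniqueness of integral curves. Freeness yields γ = 1
near 0, and hence ξ = 0. -/
theorem injective_infGen [FiniteDimensional ℝ EG] 
    (hfree : ∀ (g : G) (m : M), g • m = m → g = 1) (m : M) :
    Function.Injective (infGen (E := E) EG G m) := by
  have hL3 : LieGroup 𝓘(ℝ, EG) (minSmoothness ℝ 3) G :=
    LieGroup.of_le (n := ∞) (by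
      rw [minSmoothness_of_isRCLikeNormedField]; exact WithTop.coe_le_coe.2 le_top)
  have hc : CompleteSpace EG := FiniteDimensional.complete ℝ EG
  have h1M : IsManifold 𝓘(ℝ, E) 1 M := .of_le (n := ∞) (by simp)
  have h1G : IsManifold 𝓘(ℝ, EG) 1 G := .of_le (n := ∞) (by simp)
  refine (injective_iff_map_eq_zero (infGen (E := E) EG G m)).2 fun ξ hξ => ?_
  obtain ⟨γ, hγ0, hγ⟩ := exists_isMIntegralCurveAt_of_contMDiffAt_boundaryless (I := 𝓘(ℝ, EG))
    (v := mulInvariantVectorField (I := 𝓘(ℝ, EG)) (G := G) ξ) (x₀ := 1) 0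
    (contMDiffAt_mulInvariantVectorField ξ |>.of_le (by simp))
  have hconst : ∀ g : G, HasMFDerivAt 𝓘(ℝ, EG) 𝓘(ℝ, E) (fun h : G => h • m) g
      (mfderiv 𝓘(ℝ, EG) 𝓘(ℝ, E) (fun h : G => h • m) g) := fun g =>
    ((contMDiff_smul_orbit m).contMDiffAt.mdifferentiableAt (n := ∞) (by simp)).hasMFDerivAt
  have hzero : ∀ g : G, (mfderiv 𝓘(ℝ, EG) 𝓘(ℝ, E) (fun h : G => h • m) g : EG →L[ℝ] E)
      (mulInvariantVectorField (I := 𝓘(ℝ, EG)) (G := G) ξ g) = 0 := by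
    intro g
    have hmul : HasMFDerivAt 𝓘(ℝ, EG) 𝓘(ℝ, EG) (fun h : G => g * h) 1
        (mfderiv 𝓘(ℝ, EG) 𝓘(ℝ, EG) (fun h : G => g * h) 1) :=
      (contMDiff_mul_left.contMDiffAt.mdifferentiableAt (n := ∞) (by simp)).hasMFDerivAt
    have h1 := HasMFDerivAt.comp (f := fun h : G => g * h) (1 : G) (hconst (g * 1)) hmul
    have h2 : HasMFDerivAt 𝓘(ℝ, E) 𝓘(ℝ, E) (fun x : M => g • x) ((1 : G) • m)
        (mfderiv 𝓘(ℝ, E) 𝓘(ℝ, E) (fun x : M => g • x) ((1 : G) • m)) :=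
      ((contMDiff_smul_const EG g).contMDiffAt.mdifferentiableAt (n := ∞) (by simp)).hasMFDerivAt
    have h3 := HasMFDerivAt.comp (f := fun h : G => h • m) (1 : G) h2 (hconst 1)
    have h4 : (fun h : G => h • m) ∘ (fun h : G => g * h) =
        (fun x : M => g • x) ∘ (fun h : G => h • m) := by
      funext h; simp [mul_smul]
    rw [h4] at h1
    have h5 := DFunLike.congr_fun (hasMFDerivAt_unique h1 h3) ξ
    have h6 : mfderiv 𝓘(ℝ, EG) 𝓘(ℝ, E) (fun h : G => h • m) 1 ξ = 0 := hξ
    change (mfderiv 𝓘(ℝ, EG) 𝓘(ℝ, E) (fun h : G => h • m) (g * 1) : EG →L[ℝ] E)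
      (mulInvariantVectorField (I := 𝓘(ℝ, EG)) (G := G) ξ g) =
      (mfderiv 𝓘(ℝ, E) 𝓘(ℝ, E) (fun x : M => g • x) ((1 : G) • m) : E →L[ℝ] E)
        (mfderiv 𝓘(ℝ, EG) 𝓘(ℝ, E) (fun h : G => h • m) 1 ξ) at h5
    rw [h6, map_zero, mul_one] at h5
    exact h5
  have hcurve : IsMIntegralCurveAt (I := 𝓘(ℝ, E)) (fun t => γ t • m) 
      (fun x : M => (0 : TangentSpace 𝓘(ℝ, E) x)) 0 := by
    filter_upwards [hγ] with t ht
    have h1 := HasMFDerivAt.comp (f := γ) t (hconst (γ t)) ht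
    refine h1.congr_mfderiv ?_
    refine ContinuousLinearMap.ext_ring ?_
    change (mfderiv 𝓘(ℝ, EG) 𝓘(ℝ, E) (fun h : G => h • m) (γ t) : EG →L[ℝ] E)
      ((1 : ℝ) • (mulInvariantVectorField (I := 𝓘(ℝ, EG)) (G := G) ξ (γ t) : EG)) =
      (1 : ℝ) • (0 : E)
    rw [one_smul, smul_zero]
    exact hzero (γ t)
  have heq := isMIntegralCurveAt_eventuallyEq_of_contMDiffAt_boundaryless
    (γ := fun t => γ t • m) (γ' := fun _ => m)
    (v := fun x : M => (0 : TangentSpace 𝓘(ℝ, E) x)) (t₀ := (0 : ℝ))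
    ((Bundle.contMDiff_zeroSection ℝ (TangentSpace 𝓘(ℝ, E) : M → Type _)).contMDiffAt) hcurve
    ((isMIntegralCurve_const rfl).isMIntegralCurveAt 0) (by simp [hγ0])
  have hγ1 : γ =ᶠ[𝓝 0] fun _ => 1 := heq.mono fun t ht => hfree _ _ ht
  have h7 := hγ.hasMFDerivAt
  have h8 := (hasMFDerivAt_const (I := 𝓘(ℝ, ℝ)) (I' := 𝓘(ℝ, EG)) (1 : G) (0 : ℝ)).congr_of_eventuallyEq
    hγ1
  have h9 := DFunLike.congr_fun (hasMFDerivAt_unique h7 h8) 1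
  rw [hγ0] at h9
  have h10 : mulInvariantVectorField (I := 𝓘(ℝ, EG)) (G := G) ξ 1 = ξ := by
    have : (fun h : G => 1 * h) = id := by funext h; simp
    have h11 := mfderiv_id (I := 𝓘(ℝ, EG)) (x := (1 : G))
    rw [← this] at h11
    exact DFunLike.congr_fun h11 ξ
  rw [h10] at h9
  exact (one_smul ℝ (ξ : EG)).symm.trans h9

theorem extChartAt_one_symm :
    (extChartAt 𝓘(ℝ, EG) (1 : G)).symm (extChartAt 𝓘(ℝ, EG) (1 : G) 1) = 1 :=
  (extChartAt 𝓘(ℝ, EG) (1 : G)).left_inv (mem_extChartAt_source _)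

theorem actChart_one (x₀ : M) (y : E) :
    actChart EG G x₀ (extChartAt 𝓘(ℝ, EG) (1 : G) 1, y) = (extChartAt 𝓘(ℝ, E) x₀).symm y := by
  simp only [actChart, extChartAt_one_symm, one_smul]

variable {V : Type*} [NormedAddCommGroup V] [NormedSpace ℝ V]

/-- In the chart at `x₀`, the function `m ↦ α(ξ_M(m))`. -/
theorem pullback_actChart_inl (α : DForm 𝓘(ℝ, E) M 1 V) {x₀ : M} {y : E}
    (hy : y ∈ (extChartAt 𝓘(ℝ, E) x₀).target) (ξ : EG) :
    (DForm.pullback 𝓘(ℝ, EG × E) 𝓘(ℝ, E) (actChart EG G x₀) α).val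
      (extChartAt 𝓘(ℝ, EG) (1 : G) 1, y) ![(chartD_one EG G ξ, 0)] =
    α.val ((extChartAt 𝓘(ℝ, E) x₀).symm y)
      ![infGen EG G ((extChartAt 𝓘(ℝ, E) x₀).symm y) ξ] := by
  rw [DForm.pullback_val_one, mfderiv_actChart_inl hy, α.val_congr (actChart_one x₀ y)]

theorem contMDiffAt_apply_infGen {α : DForm 𝓘(ℝ, E) M 1 V} {x : M} (hα : α.SmoothAt x) (ξ : EG) :
    ContMDiffAt 𝓘(ℝ, E) 𝓘(ℝ, V) ∞ (fun m => α.val m ![infGen (E := E) EG G m ξ]) x := by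
  have h0 : extChartAt 𝓘(ℝ, EG) (1 : G) 1 ∈ (extChartAt 𝓘(ℝ, EG) (1 : G)).target :=
    mem_extChartAt_target _
  have hx := mem_extChartAt_source (I := 𝓘(ℝ, E)) x
  have hy := (extChartAt 𝓘(ℝ, E) x).map_source hx
  -- After pulling back to `EG × E` the generator becomes a constant vector, so only the smoothness
  -- of the pulled-back form matters.
  have hβ := DForm.SmoothAt.pullback (I := 𝓘(ℝ, EG × E)) (contMDiffAt_actChart (G := G) h0 hy)
    (α := α) (by rwa [actChart_one, (extChartAt 𝓘(ℝ, E) x).left_inv hx])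
  rw [DForm.smoothAt_model] at hβ
  have h1 : ContDiffAt ℝ ∞ (fun y : E =>
      (DForm.pullback 𝓘(ℝ, EG × E) 𝓘(ℝ, E) (actChart EG G x) α).val
        (extChartAt 𝓘(ℝ, EG) (1 : G) 1, y) ![(chartD_one EG G ξ, 0)])
      (extChartAt 𝓘(ℝ, E) x x) :=
    ((ContinuousAlternatingMap.apply ℝ (EG × E) V
      ![(chartD_one EG G ξ, (0 : E))]).contDiff.contDiffAt).comp _
      (hβ.comp _ (contDiff_prodMk_right _).contDiffAt)
  refine (h1.contMDiffAt.comp x (contMDiffAt_extChartAt_source hx)).congr_of_eventuallyEq ?_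
  filter_upwards [(isOpen_extChartAt_source (I := 𝓘(ℝ, E)) x).mem_nhds hx] with z hz
  have := pullback_actChart_inl (G := G) α ((extChartAt 𝓘(ℝ, E) x).map_source hz) ξ
  rw [(extChartAt 𝓘(ℝ, E) x).left_inv hz] at this
  exact this.symm

/-- Cartan's formula for `ξ_M` and a form that is invariant in the direction `v`. -/
theorem DForm.d_apply_infGen {α : DForm 𝓘(ℝ, E) M 1 V} {x : M} (hα : α.SmoothAt x) (ξ : EG) (v : E)
    (hinv : ∀ g : G, α.val (g • x) ![tangentD 𝓘(ℝ, E) 𝓘(ℝ, E) (fun m : M => g • m) x v] =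
      α.val x ![v]) :
    (DForm.d 𝓘(ℝ, E) α).val x ![infGen EG G x ξ, v] =
      -tangentD 𝓘(ℝ, E) 𝓘(ℝ, V) (fun m => α.val m ![infGen (E := E) EG G m ξ]) x v := by
  set s₀ := extChartAt 𝓘(ℝ, EG) (1 : G) 1 with hs₀
  have h0 : s₀ ∈ (extChartAt 𝓘(ℝ, EG) (1 : G)).target := mem_extChartAt_target _
  have hx := mem_extChartAt_source (I := 𝓘(ℝ, E)) x
  set φ := extChartAt 𝓘(ℝ, E) x with hφ
  have hy := φ.map_source hx
  have hx' : φ.symm (φ x) = x := φ.left_inv hx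
  have hact : actChart EG G x (s₀, φ x) = x := by rw [hs₀, actChart_one, ← hφ, hx']
  set β := DForm.pullback 𝓘(ℝ, EG × E) 𝓘(ℝ, E) (actChart (E := E) EG G x) α with hβdef
  have hα' : α.SmoothAt (actChart EG G x (s₀, φ x)) := by rwa [hact]
  have hA := contMDiffAt_actChart (EG := EG) (G := G) (p := (s₀, φ x)) h0 hy
  have hβ := DForm.SmoothAt.pullback (I := 𝓘(ℝ, EG × E)) hA hα'
  rw [DForm.smoothAt_model] at hβ
  have hd := DForm.d_pullback hA hα'
  rw [DForm.d_model] at hd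
  set w : E := tangentD 𝓘(ℝ, E) 𝓘(ℝ, E) φ x v with hw
  have hwv : chartSymmD x (φ x) w = v := 
    DFunLike.congr_fun (mfderiv_extChartAt_symm_comp 𝓘(ℝ, E) hx) v
  have hd1 : extDeriv β.val (s₀, φ x) ![(chartD_one EG G ξ, (0 : E)), ((0 : EG), w)] =
      (DForm.pullback 𝓘(ℝ, EG × E) 𝓘(ℝ, E) (actChart EG G x) (DForm.d 𝓘(ℝ, E) α)).val (s₀, φ x)
        ![(chartD_one EG G ξ, (0 : E)), ((0 : EG), w)] :=
    DFunLike.congr_fun hd ![(chartD_one EG G ξ, (0 : E)), ((0 : EG), w)]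
  have hβd : DifferentiableAt ℝ β.val (s₀, φ x) := hβ.differentiableAt (by simp)
  have hβa : ∀ u : EG × E, DifferentiableAt ℝ (fun p => β.val p ![u]) (s₀, φ x) := fun u =>
    (ContinuousAlternatingMap.apply ℝ (EG × E) V ![u]).differentiableAt.comp _ hβd
  -- Both vectors are constant on `EG × E`, so `d` is a difference of two directional derivatives,
  -- with no bracket term.
  rw [extDeriv_apply_two hβd, DForm.pullback_val_two, hs₀,
    mfderiv_actChart_inl hy, ← hs₀, mfderiv_actChart_inr h0 hy, hwv, DForm.val_congr _ hact] at hd1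
  have e0 : (extChartAt 𝓘(ℝ, EG) (1 : G)).symm s₀ = 1 := extChartAt_one_symm
  have e1 : tangentD 𝓘(ℝ, E) 𝓘(ℝ, E)
      (fun m : M => (extChartAt 𝓘(ℝ, EG) (1 : G)).symm s₀ • m) (φ.symm (φ x)) v = v := by
    simp only [e0, one_smul, tangentD_id]
    rfl
  rw [e1, hx'] at hd1
  -- In the group direction the pulled-back form is evaluated on translates of `v`, where `hinv`
  -- makes it constant.
  have e2 : fderiv ℝ (fun p => β.val p ![((0 : EG), w)]) (s₀, φ x) (chartD_one EG G ξ, 0) = 0 := by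
    have h1 : HasFDerivAt (fun s : EG => β.val (s, φ x) ![((0 : EG), w)])
        ((fderiv ℝ (fun p => β.val p ![((0 : EG), w)]) (s₀, φ x)).comp
          (ContinuousLinearMap.inl ℝ EG E)) s₀ :=
      HasFDerivAt.comp (g := fun p => β.val p ![((0 : EG), w)]) (f := fun s : EG => (s, φ x)) s₀
        (hβa _).hasFDerivAt (hasFDerivAt_prodMk_left _ _)
    have h2 : (fun s : EG => β.val (s, φ x) ![((0 : EG), w)]) =ᶠ[𝓝 s₀] fun _ => α.val x ![v] := by
      filter_upwards [(isOpen_extChartAt_target (I := 𝓘(ℝ, EG)) (1 : G)).mem_nhds h0] with s hs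
      rw [hβdef, DForm.pullback_val_one, mfderiv_actChart_inr hs hy, hwv]
      simp only [actChart]
      rw [← hφ, hx']
      exact hinv _
    have h3 := h1.unique ((hasFDerivAt_const _ _).congr_of_eventuallyEq h2)
    exact DFunLike.congr_fun h3 (chartD_one EG G ξ)
  have hf := contMDiffAt_apply_infGen (EG := EG) (G := G) hα ξ
  -- In the manifold direction the group coordinate stays at the unit, so what is differentiated is
  -- the function α(ξ_M).
  have e3 : fderiv ℝ (fun p => β.val p ![(chartD_one EG G ξ, (0 : E))]) (s₀, φ x) ((0 : EG), w) =
      tangentD 𝓘(ℝ, E) 𝓘(ℝ, V) (fun m => α.val m ![infGen (E := E) EG G m ξ]) x v := by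
    have h1 : HasFDerivAt (fun y : E => β.val (s₀, y) ![(chartD_one EG G ξ, (0 : E))])
        ((fderiv ℝ (fun p => β.val p ![(chartD_one EG G ξ, (0 : E))]) (s₀, φ x)).comp
          (ContinuousLinearMap.inr ℝ EG E)) (φ x) :=
      HasFDerivAt.comp (g := fun p => β.val p ![(chartD_one EG G ξ, (0 : E))])
        (f := fun y : E => (s₀, y)) (φ x) (hβa _).hasFDerivAt (hasFDerivAt_prodMk_right _ _)
    have h2 : (fun y : E => β.val (s₀, y) ![(chartD_one EG G ξ, (0 : E))]) =ᶠ[𝓝 (φ x)]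
        (fun m => α.val m ![infGen (E := E) EG G m ξ]) ∘ φ.symm := by
      filter_upwards [(isOpen_extChartAt_target (I := 𝓘(ℝ, E)) x).mem_nhds hy] with y hy
      exact pullback_actChart_inl α hy ξ
    have h3 := mfderiv_eq_fderiv_comp hx (hf.mdifferentiableAt (by simp))
    have h4 := DFunLike.congr_fun h3 v
    refine Eq.trans ?_ h4.symm
    rw [← hφ, ← h2.fderiv_eq, h1.fderiv]
    rfl
  rw [e2, e3, zero_sub] at hd1
  exact hd1.symm

end Generators

/-! ### Submersions -/

section Submersion

open Manifold

variable {E : Type*} [NormedAddCommGroup E] [NormedSpace ℝ E]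
  {M : Type*} [TopologicalSpace M] [ChartedSpace E M]
  {EP : Type*} [NormedAddCommGroup EP] [NormedSpace ℝ EP]
  {N : Type*} [TopologicalSpace N] [ChartedSpace EP N]

theorem OpenPartialHomeomorph.contMDiffAt_extend_symm_model [IsManifold 𝓘(ℝ, E) ∞ M]
    {e : OpenPartialHomeomorph M E} (he : e ∈ IsManifold.maximalAtlas 𝓘(ℝ, E) ∞ M) {y : E}
    (hy : y ∈ (e.extend 𝓘(ℝ, E)).target) :
    ContMDiffAt 𝓘(ℝ, E) 𝓘(ℝ, E) ∞ (e.extend 𝓘(ℝ, E)).symm y := by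
  have h := contMDiffOn_extend_symm he
  have e1 : (𝓘(ℝ, E) : E → E) '' e.target = (e.extend 𝓘(ℝ, E)).target := by
    ext z; simp
  rw [e1] at h
  exact h.contMDiffAt ((e.isOpen_extend_target).mem_nhds hy)

variable [IsManifold 𝓘(ℝ, E) ∞ M] [IsManifold 𝓘(ℝ, EP) ∞ N]

/-- Local smooth sections of a submersion, and curves in its fibres. -/
theorem Manifold.IsSubmersionAt.exists_section_and_curve {ρ : M → N} {m : M}
    (h : IsSubmersionAt 𝓘(ℝ, E) 𝓘(ℝ, EP) ∞ ρ m) :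
    (∃ σ : N → M, σ (ρ m) = m ∧ ContMDiffAt 𝓘(ℝ, EP) 𝓘(ℝ, E) ∞ σ (ρ m) ∧
      ∀ᶠ n in 𝓝 (ρ m), ρ (σ n) = n) ∧
    ∀ v : E, tangentD 𝓘(ℝ, E) 𝓘(ℝ, EP) ρ m v = 0 → ∃ c : ℝ → M, c 0 = m ∧
      HasMFDerivAt 𝓘(ℝ, ℝ) 𝓘(ℝ, E) c 0 (ContinuousLinearMap.toSpanSingleton ℝ v) ∧
      ∀ᶠ t in 𝓝 0, ρ (c t) = ρ m := by
  set d := h.domChart.extend 𝓘(ℝ, E) with hd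
  set c := h.codChart.extend 𝓘(ℝ, EP) with hc
  have hmd : m ∈ d.source := by
    rw [hd, OpenPartialHomeomorph.extend_source]; exact h.mem_domChart_source
  have hdt : ∀ y ∈ d.target, ContMDiffAt 𝓘(ℝ, E) 𝓘(ℝ, E) ∞ d.symm y := fun y hy =>
    OpenPartialHomeomorph.contMDiffAt_extend_symm_model h.domChart_mem_maximalAtlas hy
  have hdm : ContMDiffAt 𝓘(ℝ, E) 𝓘(ℝ, E) ∞ d m :=
    OpenPartialHomeomorph.contMDiffAt_extend h.domChart_mem_maximalAtlas h.mem_domChart_source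
  have hcm : ContMDiffAt 𝓘(ℝ, EP) 𝓘(ℝ, EP) ∞ c (ρ m) :=
    OpenPartialHomeomorph.contMDiffAt_extend h.codChart_mem_maximalAtlas h.mem_codChart_source
  have hdo : IsOpen d.target := h.domChart.isOpen_extend_target
  have hw : ∀ y ∈ d.target, c (ρ (d.symm y)) = (h.equiv y).1 := h.writtenInCharts
  have hsrc : ∀ y ∈ d.target, ρ (d.symm y) ∈ c.source := fun y hy => by
    rw [hc, OpenPartialHomeomorph.extend_source]
    refine h.source_subset_preimage_source ?_
    have := d.map_target hy
    rwa [hd, OpenPartialHomeomorph.extend_source] at this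
  have hdmt := d.map_source hmd
  have hdd : d.symm (d m) = m := d.left_inv hmd
  have hwm : c (ρ m) = (h.equiv (d m)).1 := by rw [← hw _ hdmt, hdd]
  constructor
  -- In adapted coordinates the submersion is a linear projection. The section keeps the fibre
  -- coordinate of `m` and lets the base coordinate vary.
  · let j : N → E := fun n => h.equiv.symm (c n, (h.equiv (d m)).2)
    have hjm : j (ρ m) = d m := by
      change h.equiv.symm (c (ρ m), (h.equiv (d m)).2) = d m
      rw [hwm]; exact h.equiv.symm_apply_apply _
    have hj : ContMDiffAt 𝓘(ℝ, EP) 𝓘(ℝ, E) ∞ j (ρ m) := by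
      have : ContDiff ℝ ∞ (fun y : EP => h.equiv.symm (y, (h.equiv (d m)).2)) :=
        h.equiv.symm.contDiff.comp (contDiff_id.prodMk contDiff_const)
      exact this.contMDiff.contMDiffAt.comp _ hcm
    refine ⟨fun n => d.symm (j n), (congrArg d.symm hjm).trans hdd, ?_, ?_⟩
    · refine ContMDiffAt.comp (ρ m) (g := d.symm) ?_ hj
      rw [hjm]; exact hdt _ hdmt
    · have h1 : ∀ᶠ n in 𝓝 (ρ m), j n ∈ d.target := by
        refine hj.continuousAt.eventually_mem ?_
        rw [hjm]; exact hdo.mem_nhds hdmt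
      have h2 : ∀ᶠ n in 𝓝 (ρ m), n ∈ c.source := by
        rw [hc, OpenPartialHomeomorph.extend_source]
        exact h.codChart.open_source.mem_nhds h.mem_codChart_source
      filter_upwards [h1, h2] with n hn1 hn2
      refine c.injOn (hsrc _ hn1) hn2 ?_
      rw [hw _ hn1]
      change (h.equiv (h.equiv.symm (c n, (h.equiv (d m)).2))).1 = c n
      rw [ContinuousLinearEquiv.apply_symm_apply]
  · intro v hv
    set w : E := tangentD 𝓘(ℝ, E) 𝓘(ℝ, E) d m v with hwdef
    have hρ : MDifferentiableAt 𝓘(ℝ, E) 𝓘(ℝ, EP) ρ m :=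
      h.isSubmersionAtOfComplement_complement.contMDiffAt.mdifferentiableAt (by simp)
    -- A vector in the kernel has no base component in adapted coordinates, so the straight line in
    -- its direction stays in the fibre.
    have hw0 : (h.equiv w).1 = 0 := by
      have e1 := tangentD_comp_apply (g := c) (f := ρ) (hcm.mdifferentiableAt (by simp)) hρ v
      rw [hv, map_zero] at e1
      have e2 : (fun x => c (ρ x)) =ᶠ[𝓝 m] fun x =>
          ((ContinuousLinearMap.fst ℝ EP h.complement).comp
            h.equiv.toContinuousLinearMap) (d x) := by
        have : d.source ∈ 𝓝 m := by
          rw [hd]; exact h.domChart.extend_source_mem_nhds h.mem_domChart_source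
        filter_upwards [this] with x hx
        rw [← d.left_inv hx, hw _ (d.map_source hx), d.left_inv hx]
        rfl
      rw [tangentD_congr e2] at e1
      have e3 := tangentD_comp_apply (I₃ := 𝓘(ℝ, EP))
        (g := (ContinuousLinearMap.fst ℝ EP h.complement).comp h.equiv.toContinuousLinearMap)
        (f := d) (x := m) (ContinuousLinearMap.mdifferentiableAt _)
        (hdm.mdifferentiableAt (by simp)) v
      rw [e1, tangentD_eq_fderiv, ContinuousLinearMap.fderiv] at e3
      exact e3.symm
    have hdv : tangentD 𝓘(ℝ, E) 𝓘(ℝ, E) d.symm (d m) w = v := by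
      have e1 := tangentD_comp_apply (g := d.symm) (f := d) (x := m)
        ((hdt _ hdmt).mdifferentiableAt (by simp)) (hdm.mdifferentiableAt (by simp)) v
      have e2 : (fun x => d.symm (d x)) =ᶠ[𝓝 m] fun x => x := by
        have : d.source ∈ 𝓝 m := by
          rw [hd]; exact h.domChart.extend_source_mem_nhds h.mem_domChart_source
        filter_upwards [this] with x hx
        exact d.left_inv hx
      rw [tangentD_congr e2, tangentD_id] at e1
      exact e1.symm
    have hl : HasFDerivAt (fun t : ℝ => d m + t • w) (ContinuousLinearMap.toSpanSingleton ℝ w) 0 :=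
      ((ContinuousLinearMap.toSpanSingleton ℝ w).hasFDerivAt).const_add (d m)
    have h0 : d m + (0 : ℝ) • w = d m := by simp
    refine ⟨fun t => d.symm (d m + t • w), (congrArg d.symm h0).trans hdd, ?_, ?_⟩
    · have h1 : MDifferentiableAt 𝓘(ℝ, E) 𝓘(ℝ, E) d.symm (d m + (0 : ℝ) • w) := by
        rw [h0]; exact (hdt _ hdmt).mdifferentiableAt (by simp)
      have h2 := HasMFDerivAt.comp (f := fun t : ℝ => d m + t • w) (0 : ℝ) h1.hasMFDerivAt
        hl.hasMFDerivAt
      refine h2.congr_mfderiv ?_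
      refine ContinuousLinearMap.ext_ring ?_
      change tangentD 𝓘(ℝ, E) 𝓘(ℝ, E) d.symm (d m + (0 : ℝ) • w) ((1 : ℝ) • w) = (1 : ℝ) • v
      rw [h0, one_smul, one_smul, hdv]
    · have h1 : ∀ᶠ t : ℝ in 𝓝 0, d m + t • w ∈ d.target := by
        refine hl.continuousAt.eventually_mem ?_
        rw [h0]; exact hdo.mem_nhds hdmt
      filter_upwards [h1] with t ht
      refine c.injOn (hsrc _ ht) ?_ ?_
      · have := hsrc _ hdmt
        rwa [hdd] at this
      · rw [hw _ ht, map_add, map_smul, Prod.fst_add, Prod.smul_fst, hw0, smul_zero, add_zero, hwm]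

/-- Composing `f` with a left inverse of `L` gives a local diffeomorphism. The merely continuous
curve `s` is recovered from the differentiable curve `f ∘ s` by its local inverse, so `s` is itself
differentiable and the chain rule applies. -/
theorem mem_range_of_hasStrictFDerivAt {A B : Type*} [NormedAddCommGroup A] [NormedSpace ℝ A]
    [FiniteDimensional ℝ A] [NormedAddCommGroup B] [NormedSpace ℝ B] [FiniteDimensional ℝ B]
    {f : A → B} {L : A →L[ℝ] B} {s₀ : A} (hf : HasStrictFDerivAt f L s₀)
    (hL : Function.Injective L) {s : ℝ → A} (hs0 : s 0 = s₀) (hs : ContinuousAt s 0) {X : B}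
    (hX : HasDerivAt (fun t => f (s t)) X 0) : X ∈ Set.range L := by
  have hcA : CompleteSpace A := FiniteDimensional.complete ℝ A
  obtain ⟨R, hR⟩ := LinearMap.exists_leftInverse_of_injective L.toLinearMap
    (LinearMap.ker_eq_bot.2 hL)
  let R' : B →L[ℝ] A := LinearMap.toContinuousLinearMap R
  have hRL : R'.comp L = (ContinuousLinearEquiv.refl ℝ A : A →L[ℝ] A) := by
    ext v; exact DFunLike.congr_fun hR v
  have h1 : HasStrictFDerivAt (fun a => R' (f a)) (ContinuousLinearEquiv.refl ℝ A : A →L[ℝ] A) s₀ := by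
    rw [← hRL]; exact R'.hasStrictFDerivAt.comp s₀ hf
  have h2 := h1.to_localInverse.hasFDerivAt
  have h3 : s =ᶠ[𝓝 0] fun t => h1.localInverse _ _ _ (R' (f (s t))) := by
    have := hs.tendsto
    rw [hs0] at this
    filter_upwards [this.eventually h1.eventually_left_inverse] with t ht
    exact ht.symm
  have h4 : DifferentiableAt ℝ (fun t => R' (f (s t))) 0 :=
    R'.differentiableAt.comp 0 hX.differentiableAt
  have h5 : DifferentiableAt ℝ s 0 := by
    refine DifferentiableAt.congr_of_eventuallyEq ?_ h3
    refine DifferentiableAt.comp (0 : ℝ) (f := fun t => R' (f (s t))) ?_ h4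
    rw [hs0]; exact h2.differentiableAt
  have h6 : HasDerivAt (fun t => f (s t)) (L (deriv s 0)) 0 := by
    refine HasFDerivAt.comp_hasDerivAt (0 : ℝ) (l := f) ?_ h5.hasDerivAt
    rw [hs0]; exact hf.hasFDerivAt
  exact ⟨_, h6.unique hX⟩

/-- Restricted to the closed slice G × {q}, the proper map (g, q) ↦ (g • q, q) is closed, and by
freeness injective; hence it is a closed embedding. The result converts continuity of g(t) • q into
continuity of g(t). -/
theorem isInducing_orbit_of_properSMul {G Q : Type*} [Group G] [TopologicalSpace G]
    [TopologicalSpace Q] [T2Space Q] [MulAction G Q] [ProperSMul G Q]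
    (hfree : ∀ (g : G) (q : Q), g • q = q → g = 1) (q : Q) :
    Topology.IsInducing (fun g : G => g • q) := by
  have h1 : IsProperMap (fun g : G => (g • q, q)) :=
    (ProperSMul.isProperMap_smul_pair (G := G) (X := Q)).comp
      (Topology.IsClosedEmbedding.isProperMap (f := fun g : G => (g, q)) (by
        refine Topology.IsClosedEmbedding.of_continuous_injective_isClosedMap (by fun_prop)
          (fun a b h => (Prod.ext_iff.1 h).1) fun s hs => ?_
        have : (fun g : G => (g, q)) '' s = s ×ˢ {q} := by
          ext ⟨a, b⟩
          simp only [Set.mem_image, Prod.mk.injEq, Set.mem_prod, Set.mem_singleton_iff]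
          exact ⟨fun ⟨x, hx, h1, h2⟩ => ⟨h1 ▸ hx, h2.symm⟩, fun ⟨h1, h2⟩ => ⟨a, h1, rfl, h2.symm⟩⟩
        rw [this]
        exact hs.prod isClosed_singleton))
  have h2 : Topology.IsInducing (fun g : G => (g • q, q)) := by
    refine (Topology.IsClosedEmbedding.of_continuous_injective_isClosedMap h1.continuous
      (fun a b h => ?_) h1.isClosedMap).isInducing
    have h3 : a • q = b • q := (Prod.ext_iff.1 h).1
    have h4 := hfree (b⁻¹ * a) q (by rw [mul_smul, h3, inv_smul_smul])
    exact (inv_mul_eq_one.1 h4).symm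
  exact Topology.IsInducing.of_comp (f := fun g : G => g • q) (g := fun x : Q => (x, q))
    (continuous_fst.comp h1.continuous) (by fun_prop) h2

variable {EG : Type*} [NormedAddCommGroup EG] [NormedSpace ℝ EG]
  {G : Type*} [TopologicalSpace G] [ChartedSpace EG G] [Group G] [LieGroup 𝓘(ℝ, EG) ∞ G]
  [MulAction G M] [ContMDiffSMul 𝓘(ℝ, EG) 𝓘(ℝ, E) ∞ G M]

/-- The kernel of the derivative of the orbit projection consists of infinitesimal generators. -/
theorem exists_infGen_eq_of_tangentD_eq_zero [FiniteDimensional ℝ E] [FiniteDimensional ℝ EG]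
    (hfree : ∀ (g : G) (m : M), g • m = m → g = 1) {ρ : M → N} {m : M}
    (h : IsSubmersionAt 𝓘(ℝ, E) 𝓘(ℝ, EP) ∞ ρ m) (hρ : ∀ m', ρ m' = ρ m → ∃ g : G, g • m = m')
    (hind : Topology.IsInducing (fun g : G => g • m)) {v : E}
    (hv : tangentD 𝓘(ℝ, E) 𝓘(ℝ, EP) ρ m v = 0) : ∃ ξ : EG, infGen (E := E) EG G m ξ = v := by
  classical
  obtain ⟨c, hc0, hc, hcρ⟩ := h.exists_section_and_curve.2 v hv
  -- A curve in the fibre through `m` lies in the orbit, so c(t) = g(t) • m near 0; the value 1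
  -- elsewhere is irrelevant. The choice is only known to be continuous at 0, because the orbit map
  -- is inducing.
  let g : ℝ → G := fun t => if ht : ρ (c t) = ρ m then (hρ _ ht).choose else 1
  have hg : ∀ t, ρ (c t) = ρ m → g t • m = c t := fun t ht => by
    simp only [g, dif_pos ht]; exact (hρ _ ht).choose_spec
  have hg0 : g 0 = 1 := hfree _ m (by rw [hg 0 (by rw [hc0]), hc0])
  have hgc : ContinuousAt g 0 := by
    rw [hind.continuousAt_iff]
    exact hc.continuousAt.congr (hcρ.mono fun t ht => (hg t ht).symm)
  set φ := extChartAt 𝓘(ℝ, E) m with hφ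
  set χ := extChartAt 𝓘(ℝ, EG) (1 : G) with hχ
  have hm := mem_extChartAt_source (I := 𝓘(ℝ, E)) m
  have h1 := mem_extChartAt_source (I := 𝓘(ℝ, EG)) (1 : G)
  have hy := φ.map_source hm
  have hact : actChart EG G m (χ 1, φ m) = m := by rw [hχ, actChart_one, ← hφ, φ.left_inv hm]
  have hA : ContMDiffAt 𝓘(ℝ, EG × E) 𝓘(ℝ, E) ∞ (actChart EG G m) (χ 1, φ m) :=
    contMDiffAt_actChart (G := G) (χ.map_source h1) hy
  have hφd : ContMDiffAt 𝓘(ℝ, E) 𝓘(ℝ, E) ∞ φ (actChart EG G m (χ 1, φ m)) := by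
    rw [hact]; exact contMDiffAt_extChartAt_source hm
  have hF : ContDiffAt ℝ ∞ (fun p : EG × E => φ (actChart EG G m p)) (χ 1, φ m) :=
    (hφd.comp _ hA).contDiffAt
  -- This is the orbit map in charts. It is an immersion at the unit since the generators are
  -- injective, so the velocity of c lies in its range.
  let f : EG → E := fun s => φ (actChart EG G m (s, φ m))
  have hf : ContDiffAt ℝ ∞ f (χ 1) := ContDiffAt.comp (f := fun s : EG => (s, φ m)) (χ 1) hF
      (contDiff_prodMk_left _).contDiffAt
  have hL : ∀ ξ, fderiv ℝ f (χ 1) (chartD_one EG G ξ) =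
      tangentD 𝓘(ℝ, E) 𝓘(ℝ, E) φ m (infGen (E := E) EG G m ξ) := by
    intro ξ
    have e1 : HasFDerivAt f ((fderiv ℝ (fun p : EG × E => φ (actChart EG G m p)) (χ 1, φ m)).comp
        (ContinuousLinearMap.inl ℝ EG E)) (χ 1) :=
      HasFDerivAt.comp (f := fun s : EG => (s, φ m)) (χ 1)
        (hF.differentiableAt (by simp)).hasFDerivAt (hasFDerivAt_prodMk_left _ _)
    have e2 := tangentD_comp_apply (hφd.mdifferentiableAt (by simp))
      (hA.mdifferentiableAt (by simp)) (chartD_one EG G ξ, (0 : E))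
    rw [tangentD_eq_fderiv, hχ, mfderiv_actChart_inl hy, ← hχ, hact] at e2
    rw [e1.fderiv]
    refine e2.trans ?_
    rw [← hφ, φ.left_inv hm]
  have hsurj : ∀ u : EG, ∃ ξ, chartD_one EG G ξ = u := fun u =>
    ⟨_, DFunLike.congr_fun (mfderiv_extChartAt_comp_symm 𝓘(ℝ, EG) h1) u⟩
  have hφinj : Function.Injective (tangentD 𝓘(ℝ, E) 𝓘(ℝ, E) φ m) :=
    Function.LeftInverse.injective (g := chartSymmD m (φ m)) fun u =>
      DFunLike.congr_fun (mfderiv_extChartAt_symm_comp 𝓘(ℝ, E) hm) u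
  have hLinj : Function.Injective (fderiv ℝ f (χ 1)) := by
    rw [injective_iff_map_eq_zero]
    intro u hu
    obtain ⟨ξ, rfl⟩ := hsurj u
    rw [hL, ← map_zero (tangentD 𝓘(ℝ, E) 𝓘(ℝ, E) φ m)] at hu
    have h2 := injective_infGen (E := E) hfree m (a₁ := ξ) (a₂ := 0)
      ((hφinj hu).trans (map_zero _).symm)
    rw [h2, map_zero]
  have hχc : ContinuousAt χ (g 0) := by rw [hg0]; exact continuousAt_extChartAt (1 : G)
  have hX : HasDerivAt (fun t => f (χ (g t))) (tangentD 𝓘(ℝ, E) 𝓘(ℝ, E) φ m v) 0 := by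
    have e0 : HasMFDerivAt 𝓘(ℝ, E) 𝓘(ℝ, E) φ (c 0)
        (mfderiv 𝓘(ℝ, E) 𝓘(ℝ, E) φ (c 0)) := by
      rw [hc0]
      exact ((contMDiffAt_extChartAt_source hm).mdifferentiableAt (n := ∞) (by simp)).hasMFDerivAt
    have e1 : HasFDerivAt (fun t => φ (c t)) ((tangentD 𝓘(ℝ, E) 𝓘(ℝ, E) φ (c 0)).comp
        (ContinuousLinearMap.toSpanSingleton ℝ v)) 0 :=
      hasMFDerivAt_iff_hasFDerivAt.1 (HasMFDerivAt.comp (f := c) (0 : ℝ) e0 hc)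
    have e2 : HasDerivAt (fun t => φ (c t)) (tangentD 𝓘(ℝ, E) 𝓘(ℝ, E) φ (c 0) ((1 : ℝ) • v)) 0 :=
      e1.hasDerivAt
    rw [one_smul, hc0] at e2
    refine e2.congr_of_eventuallyEq ?_
    have e3 : ∀ᶠ t in 𝓝 (0 : ℝ), g t ∈ χ.source := by
      refine hgc.eventually_mem ?_
      rw [hg0]; exact (isOpen_extChartAt_source (1 : G)).mem_nhds h1
    filter_upwards [hcρ, e3] with t ht1 ht2
    simp only [f, actChart]
    rw [← hχ, ← hφ, χ.left_inv ht2, φ.left_inv hm, hg t ht1]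
  obtain ⟨u, hu⟩ := mem_range_of_hasStrictFDerivAt (s := fun t => χ (g t))
    (hf.hasStrictFDerivAt (by simp)) hLinj (by simp only [hg0])
    (ContinuousAt.comp hχc hgc) hX
  obtain ⟨ξ, rfl⟩ := hsurj u
  exact ⟨ξ, hφinj ((hL ξ).symm.trans hu)⟩

end Submersion

/-! ### Descent along a surjective submersion -/

section Descent

open Manifold

variable {E : Type*} [NormedAddCommGroup E] [NormedSpace ℝ E]
  {M : Type*} [TopologicalSpace M] [ChartedSpace E M] [IsManifold 𝓘(ℝ, E) ∞ M]
  {EP : Type*} [NormedAddCommGroup EP] [NormedSpace ℝ EP]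
  {N : Type*} [TopologicalSpace N] [ChartedSpace EP N] [IsManifold 𝓘(ℝ, EP) ∞ N] {ρ : M → N}

/-- Near ρ(m), `f` equals `f ∘ ρ` composed with a smooth local section of ρ. -/
theorem contMDiffAt_of_comp_submersion {A : Type*} [NormedAddCommGroup A] [NormedSpace ℝ A]
    {f : N → A} {m : M} (hρ : IsSubmersionAt 𝓘(ℝ, E) 𝓘(ℝ, EP) ∞ ρ m)
    (hf : ContMDiffAt 𝓘(ℝ, E) 𝓘(ℝ, A) ∞ (fun x => f (ρ x)) m) :
    ContMDiffAt 𝓘(ℝ, EP) 𝓘(ℝ, A) ∞ f (ρ m) := by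
  obtain ⟨σ, hσm, hσ, hρσ⟩ := hρ.exists_section_and_curve.1
  refine (ContMDiffAt.comp (ρ m) (g := fun x => f (ρ x)) (f := σ) (by rwa [hσm]) hσ
    ).congr_of_eventuallyEq ?_
  filter_upwards [hρσ] with n hn
  simp only [Function.comp_apply, hn]

theorem Manifold.IsSubmersionAt.contMDiffAt_self {m : M}
    (hρ : IsSubmersionAt 𝓘(ℝ, E) 𝓘(ℝ, EP) ∞ ρ m) : ContMDiffAt 𝓘(ℝ, E) 𝓘(ℝ, EP) ∞ ρ m :=
  hρ.isSubmersionAtOfComplement_complement.contMDiffAt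

theorem Manifold.IsSubmersionAt.mdifferentiableAt_self {m : M}
    (hρ : IsSubmersionAt 𝓘(ℝ, E) 𝓘(ℝ, EP) ∞ ρ m) : MDifferentiableAt 𝓘(ℝ, E) 𝓘(ℝ, EP) ρ m :=
  hρ.contMDiffAt_self.mdifferentiableAt (by simp)

/-- A section that is smooth at a point is a right inverse to first order. -/
theorem tangentD_comp_section {n : N} {σ : N → M}
    (hρ : MDifferentiableAt 𝓘(ℝ, E) 𝓘(ℝ, EP) ρ (σ n))
    (hσ : MDifferentiableAt 𝓘(ℝ, EP) 𝓘(ℝ, E) σ n) (h : ∀ᶠ n' in 𝓝 n, ρ (σ n') = n') (w : EP) :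
    tangentD 𝓘(ℝ, E) 𝓘(ℝ, EP) ρ (σ n) (tangentD 𝓘(ℝ, EP) 𝓘(ℝ, E) σ n w) = w := by
  rw [← tangentD_comp_apply hρ hσ, tangentD_congr (g := fun n => n) h, tangentD_id]
  rfl

theorem Manifold.IsSubmersionAt.exists_rightInverse {m : M}
    (hρ : IsSubmersionAt 𝓘(ℝ, E) 𝓘(ℝ, EP) ∞ ρ m) :
    ∃ R : EP →L[ℝ] E, ∀ w, tangentD 𝓘(ℝ, E) 𝓘(ℝ, EP) ρ m (R w) = w := by
  obtain ⟨σ, hσm, hσ, hρσ⟩ := hρ.exists_section_and_curve.1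
  refine ⟨tangentD 𝓘(ℝ, EP) 𝓘(ℝ, E) σ (ρ m), fun w => ?_⟩
  have := tangentD_comp_section (n := ρ m) (σ := σ) (by rw [hσm]; exact hρ.mdifferentiableAt_self)
    (hσ.mdifferentiableAt (by simp)) hρσ w
  rwa [hσm] at this

theorem eventually_mdifferentiableAt_of_contMDiffAt {f : N → M} {n : N}
    (hf : ContMDiffAt 𝓘(ℝ, EP) 𝓘(ℝ, E) ∞ f n) :
    ∀ᶠ z in 𝓝 n, MDifferentiableAt 𝓘(ℝ, EP) 𝓘(ℝ, E) f z := by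
  have : IsManifold 𝓘(ℝ, E) 1 M := IsManifold.of_le (n := ∞) (by simp)
  have : IsManifold 𝓘(ℝ, EP) 1 N := IsManifold.of_le (n := ∞) (by simp)
  have h := contMDiffAt_iff_contMDiffAt_nhds (by simp) |>.1
    (ContMDiffAt.of_le hf (m := 1) (by simp))
  filter_upwards [h] with z hz
  exact hz.mdifferentiableAt (by simp)

/-- A 2-form that only depends on the projections of its arguments is a pullback. -/
theorem DForm.exists_descent (hρ : IsSubmersion 𝓘(ℝ, E) 𝓘(ℝ, EP) ∞ ρ)
    (hsurj : Function.Surjective ρ) {b : DForm 𝓘(ℝ, E) M 2 ℝ} (hb : DForm.IsSmooth 𝓘(ℝ, E) b)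
    (hbas : ∀ (m m' : M) (u v u' v' : E), ρ m = ρ m' →
      tangentD 𝓘(ℝ, E) 𝓘(ℝ, EP) ρ m u = tangentD 𝓘(ℝ, E) 𝓘(ℝ, EP) ρ m' u' →
      tangentD 𝓘(ℝ, E) 𝓘(ℝ, EP) ρ m v = tangentD 𝓘(ℝ, E) 𝓘(ℝ, EP) ρ m' v' →
      b.val m ![u, v] = b.val m' ![u', v']) :
    ∃ BB : DForm 𝓘(ℝ, EP) N 2 ℝ, DForm.IsSmooth 𝓘(ℝ, EP) BB ∧
      DForm.pullback 𝓘(ℝ, E) 𝓘(ℝ, EP) ρ BB = b := by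
  choose R hR using fun m => (hρ.isSubmersionAt m).exists_rightInverse
  choose s hs using hsurj
  -- The base points and right inverses are chosen pointwise, with no regularity. The hypothesis
  -- `hbas` makes the value independent of them, so near each point `BB` is also the pullback of `b`
  -- by a smooth section.
  let BB : DForm 𝓘(ℝ, EP) N 2 ℝ := fun n => (b.val (s n)).compContinuousLinearMap (R (s n))
  have hBB : ∀ (n : N) (m : M) (u v : E), ρ m = n → BB.val n
      ![tangentD 𝓘(ℝ, E) 𝓘(ℝ, EP) ρ m u, tangentD 𝓘(ℝ, E) 𝓘(ℝ, EP) ρ m v] = b.val m ![u, v] := by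
    intro n m u v hm
    change b.val (s n) (fun i => R (s n) (![tangentD 𝓘(ℝ, E) 𝓘(ℝ, EP) ρ m u,
      tangentD 𝓘(ℝ, E) 𝓘(ℝ, EP) ρ m v] i)) = _
    rw [comp_cons_two (R (s n))]
    exact hbas _ _ _ _ _ _ (by rw [hs, hm]) (hR _ _) (hR _ _)
  have hpull : DForm.pullback 𝓘(ℝ, E) 𝓘(ℝ, EP) ρ BB = b := by
    funext m
    refine DForm.ext_val fun v => ?_
    have e : v = ![v 0, v 1] := by ext i; fin_cases i <;> rfl
    rw [e, DForm.pullback_val_two, hBB _ _ _ _ rfl]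
  refine ⟨BB, ?_, hpull⟩
  rw [DForm.isSmooth_iff]
  intro n
  obtain ⟨m, rfl⟩ : ∃ m, ρ m = n := ⟨s n, hs n⟩
  obtain ⟨σ, hσm, hσ, hρσ⟩ := (hρ.isSubmersionAt m).exists_section_and_curve.1
  refine DForm.SmoothAt.congr (DForm.SmoothAt.pullback (α := b) hσ (hb.smoothAt _)) ?_
  filter_upwards [eventually_mdifferentiableAt_of_contMDiffAt hσ, hρσ.eventually_nhds]
    with n hn1 hn2
  refine DForm.ext_val fun v => ?_
  have e : v = ![v 0, v 1] := by ext i; fin_cases i <;> rfl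
  rw [e, DForm.pullback_val_two, ← hBB n (σ n) _ _ hn2.self_of_nhds,
    tangentD_comp_section (hρ.isSubmersionAt _).mdifferentiableAt_self hn1 hn2,
    tangentD_comp_section (hρ.isSubmersionAt _).mdifferentiableAt_self hn1 hn2]

/-- The value of a field of sharp maps, as a map between the model spaces. -/
def SharpField.val (π : SharpField 𝓘(ℝ, E) M) (x : M) : (E →L[ℝ] ℝ) →L[ℝ] E := π x

/-- The bracket of two covectors `α`, `β` at `ρ m`, lifted to `m`. -/
theorem exists_isReduction (hsurj : Function.Surjective ρ) {π : SharpField 𝓘(ℝ, E) M}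
    (hπ : ∀ (m m' : M) (α : EP →L[ℝ] ℝ), ρ m = ρ m' →
      tangentD 𝓘(ℝ, E) 𝓘(ℝ, EP) ρ m (π.val m (α.comp (tangentD 𝓘(ℝ, E) 𝓘(ℝ, EP) ρ m))) =
      tangentD 𝓘(ℝ, E) 𝓘(ℝ, EP) ρ m' (π.val m' (α.comp (tangentD 𝓘(ℝ, E) 𝓘(ℝ, EP) ρ m')))) :
    ∃ Λ : SharpField 𝓘(ℝ, EP) N, IsReduction 𝓘(ℝ, E) 𝓘(ℝ, EP) ρ π Λ := by
  choose s hs using hsurj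
  let T : N → E →L[ℝ] EP := fun n => tangentD 𝓘(ℝ, E) 𝓘(ℝ, EP) ρ (s n)
  exact ⟨fun n => (T n).comp ((π.val (s n)).comp
    ((ContinuousLinearMap.compL ℝ E EP ℝ).flip (T n))), fun m α => hπ m _ α (hs _).symm⟩

theorem diffAt_comp {f : N → ℝ} {m : M} (hρ : MDifferentiableAt 𝓘(ℝ, E) 𝓘(ℝ, EP) ρ m)
    (hf : MDifferentiableAt 𝓘(ℝ, EP) 𝓘(ℝ, ℝ) f (ρ m)) :
    diffAt 𝓘(ℝ, E) (fun x => f (ρ x)) m =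
      (diffAt 𝓘(ℝ, EP) f (ρ m)).comp (mfderiv 𝓘(ℝ, E) 𝓘(ℝ, EP) ρ m) :=
  mfderiv_comp m hf hρ

theorem IsReduction.bracket {π : SharpField 𝓘(ℝ, E) M} {Λ : SharpField 𝓘(ℝ, EP) N}
    (h : IsReduction 𝓘(ℝ, E) 𝓘(ℝ, EP) ρ π Λ) {f g : N → ℝ} {m : M}
    (hρ : MDifferentiableAt 𝓘(ℝ, E) 𝓘(ℝ, EP) ρ m)
    (hf : MDifferentiableAt 𝓘(ℝ, EP) 𝓘(ℝ, ℝ) f (ρ m))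
    (hg : MDifferentiableAt 𝓘(ℝ, EP) 𝓘(ℝ, ℝ) g (ρ m)) :
    Λ.bracket 𝓘(ℝ, EP) f g (ρ m) =
      π.bracket 𝓘(ℝ, E) (fun x => f (ρ x)) (fun x => g (ρ x)) m := by
  unfold SharpField.bracket
  rw [diffAt_comp hρ hf, diffAt_comp hρ hg, ← h]
  rfl

theorem IsReduction.smoothAt (hρ : IsSubmersion 𝓘(ℝ, E) 𝓘(ℝ, EP) ∞ ρ)
    {π : SharpField 𝓘(ℝ, E) M} {Λ : SharpField 𝓘(ℝ, EP) N}
    (h : IsReduction 𝓘(ℝ, E) 𝓘(ℝ, EP) ρ π Λ) {m : M} (hsm : π.SmoothAt m) :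
    Λ.SmoothAt (ρ m) := by
  intro f g hf hg
  refine contMDiffAt_of_comp_submersion (hρ.isSubmersionAt m) ?_
  have hρm := (hρ.isSubmersionAt m).contMDiffAt_self
  refine (hsm _ _ (hf.comp m hρm) (hg.comp m hρm)).congr_of_eventuallyEq ?_
  filter_upwards [hρm.continuousAt.eventually hf.eventually_mdifferentiableAt,
    hρm.continuousAt.eventually hg.eventually_mdifferentiableAt] with x h1 h2
  exact h.bracket (hρ.isSubmersionAt x).mdifferentiableAt_self h1 h2

theorem IsReduction.isBivectorField (hρ : IsSubmersion 𝓘(ℝ, E) 𝓘(ℝ, EP) ∞ ρ)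
    (hsurj : Function.Surjective ρ) {π : SharpField 𝓘(ℝ, E) M} {Λ : SharpField 𝓘(ℝ, EP) N}
    (h : IsReduction 𝓘(ℝ, E) 𝓘(ℝ, EP) ρ π Λ)
    (hskew : ∀ (m : M) (α β : E →L[ℝ] ℝ), β (π.val m α) = -α (π.val m β))
    (hsm : ∀ m, π.SmoothAt m) : IsBivectorField 𝓘(ℝ, EP) Λ := by
  refine isBivectorField_of_smoothAt (fun n α β => ?_) fun n => ?_
  · obtain ⟨m, rfl⟩ := hsurj n
    rw [← h, ← h]
    exact hskew m (α.comp (mfderiv 𝓘(ℝ, E) 𝓘(ℝ, EP) ρ m)) (β.comp (mfderiv 𝓘(ℝ, E) 𝓘(ℝ, EP) ρ m))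
  · obtain ⟨m, rfl⟩ := hsurj n
    exact h.smoothAt hρ (hsm m)

/-- Because the form upstairs is a pullback, ρ^* intertwines the gauge endomorphisms of `Λ` and `π`.
It is injective on covectors, so invertibility passes down, and the inverses are intertwined as
well. -/
theorem IsReduction.gauge [FiniteDimensional ℝ EP] (hρ : IsSubmersion 𝓘(ℝ, E) 𝓘(ℝ, EP) ∞ ρ)
    (hsurj : Function.Surjective ρ) {π : SharpField 𝓘(ℝ, E) M} {Λ : SharpField 𝓘(ℝ, EP) N}
    (h : IsReduction 𝓘(ℝ, E) 𝓘(ℝ, EP) ρ π Λ) {BB : DForm 𝓘(ℝ, EP) N 2 ℝ}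
    (hG : GaugeDefined 𝓘(ℝ, E) π (DForm.pullback 𝓘(ℝ, E) 𝓘(ℝ, EP) ρ BB)) :
    GaugeDefined 𝓘(ℝ, EP) Λ BB ∧ IsReduction 𝓘(ℝ, E) 𝓘(ℝ, EP) ρ
      (π.gauge 𝓘(ℝ, E) (DForm.pullback 𝓘(ℝ, E) 𝓘(ℝ, EP) ρ BB)) (Λ.gauge 𝓘(ℝ, EP) BB) := by
  set b := DForm.pullback 𝓘(ℝ, E) 𝓘(ℝ, EP) ρ BB with hb
  let T : M → E →L[ℝ] EP := fun m => tangentD 𝓘(ℝ, E) 𝓘(ℝ, EP) ρ m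
  let A : M → (E →L[ℝ] ℝ) →L[ℝ] (E →L[ℝ] ℝ) := fun m => gaugeEndo 𝓘(ℝ, E) π b m
  let A' : N → (EP →L[ℝ] ℝ) →L[ℝ] (EP →L[ℝ] ℝ) := fun n => gaugeEndo 𝓘(ℝ, EP) Λ BB n
  have hA : ∀ m, (A m).IsInvertible := hG
  have hred : ∀ m (α : EP →L[ℝ] ℝ), T m (π.val m (α.comp (T m))) = Λ.val (ρ m) α := h
  have hcomm : ∀ m (α : EP →L[ℝ] ℝ), A m (α.comp (T m)) = (A' (ρ m) α).comp (T m) := by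
    intro m α
    ext v
    change α (T m v) + altFlat (b.val m) (π.val m (α.comp (T m))) v =
      α (T m v) + altFlat (BB.val (ρ m)) (Λ.val (ρ m) α) (T m v)
    rw [altFlat_apply, altFlat_apply, hb, DForm.pullback_val_two, ← hred]
  have hTsurj : ∀ m, Function.Surjective (T m) := fun m => by
    obtain ⟨R, hR⟩ := (hρ.isSubmersionAt m).exists_rightInverse
    exact fun w => ⟨R w, hR w⟩
  have hA' : ∀ n, (A' n).IsInvertible := by
    intro n
    obtain ⟨m, rfl⟩ := hsurj n
    refine isInvertible_of_injective ((injective_iff_map_eq_zero _).2 fun α hα => ?_)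
    have h1 := hcomm m α
    rw [hα, ContinuousLinearMap.zero_comp] at h1
    have h2 : α.comp (T m) = 0 := by
      rw [← (hA m).inverse_apply_self (α.comp (T m)), h1, map_zero]
    ext w
    obtain ⟨v, rfl⟩ := hTsurj m w
    exact DFunLike.congr_fun h2 v
  have key : ∀ m (α : EP →L[ℝ] ℝ), T m (π.val m ((A m).inverse (α.comp (T m)))) =
      Λ.val (ρ m) ((A' (ρ m)).inverse α) := by
    intro m α
    set β := (A' (ρ m)).inverse α with hβ
    have hα : A' (ρ m) β = α := (hA' (ρ m)).self_apply_inverse α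
    rw [← hred, ← hα, ← hcomm, (hA m).inverse_apply_self]
  exact ⟨hA', key⟩

end Descent

theorem contDiff_ofSubsingleton {X F V : Type*} [NormedAddCommGroup X] [NormedSpace ℝ X]
    [NormedAddCommGroup F] [NormedSpace ℝ F] [NormedAddCommGroup V] [NormedSpace ℝ V]
    {n : WithTop ℕ∞} {f : X → F →L[ℝ] V} (hf : ContDiff ℝ n f) :
    ContDiff ℝ n (fun x => ContinuousAlternatingMap.ofSubsingleton ℝ F V (0 : Fin 1) (f x)) :=
  (ContinuousLinearMap.contDiff (E := F →L[ℝ] V) (F := F [⋀^Fin 1]→L[ℝ] V)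
    (ContinuousAlternatingMap.ofSubsingletonLIE (𝕜 := ℝ) (E := F) (F := V)
      (0 : Fin 1)).toContinuousLinearEquiv.toContinuousLinearMap).comp hf

/-! ### Coordinates on the cotangent bundle -/

section Cotangent

variable {E : Type*} [NormedAddCommGroup E] [NormedSpace ℝ E]
  {Q : Type*} [TopologicalSpace Q] [ChartedSpace E Q] [IsManifold 𝓘(ℝ, E) ∞ Q]
  {A : Type*} [NormedAddCommGroup A] [NormedSpace ℝ A] {H : Type*} [TopologicalSpace H]
  {J : ModelWithCorners ℝ A H} {X : Type*} [TopologicalSpace X] [ChartedSpace H X]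

/-- The momentum coordinates on `T^*Q` given by the chart of `Q` at `q₀`. -/
def cotCoord (q₀ : Q) (m : CotangentBundle E Q) : E →L[ℝ] ℝ :=
  (show E →L[ℝ] ℝ from m.2).comp (chartSymmD q₀ (extChartAt 𝓘(ℝ, E) q₀ m.proj))

/-- The smooth structure of T^*Q comes from bundle trivialisations; their fibre coordinate is the
covector composed with the derivative of the inverse chart. -/
theorem inCoordinates_eq_cotCoord {q₀ : Q} {m : CotangentBundle E Q}
    (hm : m.proj ∈ (extChartAt 𝓘(ℝ, E) q₀).source) :
    ContinuousLinearMap.inCoordinates E (TangentSpace 𝓘(ℝ, E)) ℝ (fun _ : Q => ℝ) q₀ m.proj q₀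
      m.proj m.2 = cotCoord q₀ m := by
  have : IsManifold 𝓘(ℝ, E) 1 Q := IsManifold.of_le (n := ∞) (by simp)
  have h1 := TangentBundle.symmL_trivializationAt (I := 𝓘(ℝ, E)) (x₀ := q₀) (x := m.proj)
    (by rwa [extChartAt_source] at hm)
  rw [ModelWithCorners.range_eq_univ, mfderivWithin_univ] at h1
  ext v
  change (Bundle.Trivialization.continuousLinearMapAt ℝ
    (trivializationAt ℝ (Bundle.Trivial Q ℝ) q₀) m.proj) (m.2
    (Bundle.Trivialization.symmL ℝ (trivializationAt E (TangentSpace 𝓘(ℝ, E)) q₀) m.proj v)) = _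
  have h2 : Bundle.Trivialization.continuousLinearMapAt ℝ
      (Bundle.Trivial.trivialization Q ℝ) m.proj = ContinuousLinearMap.id ℝ ℝ :=
    Bundle.Trivial.continuousLinearMapAt_trivialization ℝ Q ℝ m.proj
  refine (DFunLike.congr_fun h2 _).trans ?_
  exact congrArg (show E →L[ℝ] ℝ from m.2) (DFunLike.congr_fun h1 v)

/-- Smoothness of a map into `T^*Q` in terms of base and momentum coordinates. -/
theorem contMDiffAt_cotangent_iff {f : X → CotangentBundle E Q} {x : X} :
    ContMDiffAt J (cotModel E) ∞ f x ↔ ContMDiffAt J 𝓘(ℝ, E) ∞ (fun x' => (f x').proj) x ∧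
      ContMDiffAt J 𝓘(ℝ, E →L[ℝ] ℝ) ∞ (fun x' => cotCoord (f x).proj (f x')) x := by
  rw [contMDiffAt_hom_bundle]
  refine and_congr_right fun h => ?_
  have : (fun x' => ContinuousLinearMap.inCoordinates E (TangentSpace 𝓘(ℝ, E)) ℝ (fun _ : Q => ℝ)
      (f x).proj (f x').proj (f x).proj (f x').proj (f x').2) =ᶠ[𝓝 x]
      fun x' => cotCoord (f x).proj (f x') := by
    filter_upwards [h.continuousAt.eventually_mem
      ((isOpen_extChartAt_source (I := 𝓘(ℝ, E)) (f x).proj).mem_nhds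
      (mem_extChartAt_source _))] with x' hx'
    exact inCoordinates_eq_cotCoord hx'
  exact ⟨fun h => h.congr_of_eventuallyEq this.symm, fun h => h.congr_of_eventuallyEq this⟩

/-- The coordinates `(y, p)` on `T^*Q` given by the chart of `Q` at `q₀`. -/
def cotChart (q₀ : Q) (m : CotangentBundle E Q) : E × (E →L[ℝ] ℝ) :=
  (extChartAt 𝓘(ℝ, E) q₀ m.proj, cotCoord q₀ m)

theorem contMDiffAt_cotChart_comp {f : X → CotangentBundle E Q} {x : X}
    (hf : ContMDiffAt J (cotModel E) ∞ f x) :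
    ContMDiffAt J 𝓘(ℝ, E × (E →L[ℝ] ℝ)) ∞ (fun x' => cotChart (f x).proj (f x')) x := by
  obtain ⟨h1, h2⟩ := contMDiffAt_cotangent_iff.1 hf
  exact ContMDiffAt.prodMk_space ((contMDiffAt_extChartAt_source (mem_extChartAt_source _)).comp x h1)
    h2

theorem contMDiffAt_cotChart (m : CotangentBundle E Q) :
    ContMDiffAt (cotModel E) 𝓘(ℝ, E × (E →L[ℝ] ℝ)) ∞ (cotChart m.proj) m :=
  contMDiffAt_cotChart_comp contMDiffAt_id

variable (E) in
/-- The Liouville form `p dy` on `E × E^*`. -/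
def modelLiouville : DForm 𝓘(ℝ, E × (E →L[ℝ] ℝ)) (E × (E →L[ℝ] ℝ)) 1 ℝ := fun z =>
  ContinuousAlternatingMap.ofSubsingleton ℝ (E × (E →L[ℝ] ℝ)) ℝ (0 : Fin 1)
    (z.2.comp (ContinuousLinearMap.fst ℝ E (E →L[ℝ] ℝ)))

theorem modelLiouville_val (z w : E × (E →L[ℝ] ℝ)) :
    (modelLiouville E).val z ![w] = z.2 w.1 := rfl

theorem contDiff_modelLiouville : ContDiff ℝ ∞ (modelLiouville E).val := by
  have h : ContDiff ℝ ∞ fun z : E × (E →L[ℝ] ℝ) =>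
      z.2.comp (ContinuousLinearMap.fst ℝ E (E →L[ℝ] ℝ)) := contDiff_snd.clm_comp contDiff_const
  exact contDiff_ofSubsingleton h

theorem modelLiouville_d (z u v : E × (E →L[ℝ] ℝ)) :
    (DForm.d 𝓘(ℝ, E × (E →L[ℝ] ℝ)) (modelLiouville E)).val z ![u, v] = u.2 v.1 - v.2 u.1 := by
  have h := DForm.d_model (modelLiouville E) z
  have h2 : (DForm.d 𝓘(ℝ, E × (E →L[ℝ] ℝ)) (modelLiouville E)).val z =
    extDeriv (modelLiouville E).val z := h
  rw [h2, extDeriv_apply_two (contDiff_modelLiouville.contDiffAt.differentiableAt (by simp))]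
  have h3 : ∀ a b : E × (E →L[ℝ] ℝ),
      fderiv ℝ (fun y => (modelLiouville E).val y ![a]) z b = b.2 a.1 := by
    intro a b
    have : (fun y : E × (E →L[ℝ] ℝ) => (modelLiouville E).val y ![a]) =
      fun y => ((ContinuousLinearMap.apply ℝ ℝ a.1).comp
        (ContinuousLinearMap.snd ℝ E (E →L[ℝ] ℝ))) y := rfl
    rw [this, ContinuousLinearMap.fderiv]
    rfl
  rw [h3, h3]

/-- In cotangent coordinates the Liouville form is p dy: the chart derivative in dy cancels the
inverse-chart derivative in p. Smoothness of Θ_Q and the coordinate form dy ∧ dp of Ω_Q both follow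
from this. -/
theorem liouvilleForm_eventuallyEq (m₀ : CotangentBundle E Q) :
    ∀ᶠ m in 𝓝 m₀, liouvilleForm E Q m = DForm.pullback (cotModel E) 𝓘(ℝ, E × (E →L[ℝ] ℝ))
      (cotChart m₀.proj) (modelLiouville E) m := by
  have hF := contMDiffAt_cotChart m₀
  have h1 : ∀ᶠ m in 𝓝 m₀, MDifferentiableAt (cotModel E) 𝓘(ℝ, E × (E →L[ℝ] ℝ))
      (cotChart m₀.proj) m := by
    have h := contMDiffAt_iff_contMDiffAt_nhds (by simp) |>.1
      (ContMDiffAt.of_le hF (m := 1) (by simp))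
    exact h.mono fun m hm => hm.mdifferentiableAt (by simp)
  have hp : ContMDiff (cotModel E) 𝓘(ℝ, E) ∞ (Bundle.TotalSpace.proj : CotangentBundle E Q → Q) :=
    Bundle.contMDiff_proj _
  filter_upwards [h1, hp.continuous.continuousAt.eventually_mem
      ((isOpen_extChartAt_source (I := 𝓘(ℝ, E)) m₀.proj).mem_nhds
      (mem_extChartAt_source _))] with m hm1 hm2
  refine DForm.ext_val fun v => ?_
  have e : v = ![v 0] := by funext i; fin_cases i; rfl
  rw [e, DForm.pullback_val_one, modelLiouville_val]
  have e1 : (tangentD (cotModel E) 𝓘(ℝ, E × (E →L[ℝ] ℝ)) (cotChart m₀.proj) m (v 0)).1 =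
      tangentD 𝓘(ℝ, E) 𝓘(ℝ, E) (extChartAt 𝓘(ℝ, E) m₀.proj) m.proj
        (tangentD (cotModel E) 𝓘(ℝ, E) (Bundle.TotalSpace.proj : CotangentBundle E Q → Q) m
          (v 0)) := by
    rw [← tangentD_comp_apply ((contMDiffAt_extChartAt_source hm2).mdifferentiableAt (by simp))
      (hp.contMDiffAt.mdifferentiableAt (by simp))]
    have := tangentD_comp_apply (I₃ := 𝓘(ℝ, E)) (g := ContinuousLinearMap.fst ℝ E (E →L[ℝ] ℝ))
      (f := cotChart m₀.proj) (x := m)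
      (ContinuousLinearMap.mdifferentiableAt _) hm1 (v 0)
    rw [tangentD_eq_fderiv, ContinuousLinearMap.fderiv] at this
    exact this.symm
  rw [e1]
  have e2 := DFunLike.congr_fun (mfderiv_extChartAt_symm_comp 𝓘(ℝ, E) hm2)
    (tangentD (cotModel E) 𝓘(ℝ, E) (Bundle.TotalSpace.proj : CotangentBundle E Q → Q) m (v 0))
  exact (congrArg (show E →L[ℝ] ℝ from m.2) e2).symm

theorem smoothAt_liouvilleForm (m : CotangentBundle E Q) : (liouvilleForm E Q).SmoothAt m :=
  DForm.SmoothAt.congr (DForm.SmoothAt.pullback (contMDiffAt_cotChart m)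
    (DForm.smoothAt_model.2 contDiff_modelLiouville.contDiffAt)) (liouvilleForm_eventuallyEq m)

theorem isSmooth_liouvilleForm : DForm.IsSmooth (cotModel E) (liouvilleForm E Q) :=
  DForm.isSmooth_iff.2 smoothAt_liouvilleForm

theorem canonicalForm_val (m : CotangentBundle E Q) (u v : E × (E →L[ℝ] ℝ)) :
    (canonicalForm E Q).val m ![u, v] =
      (tangentD (cotModel E) 𝓘(ℝ, E × (E →L[ℝ] ℝ)) (cotChart m.proj) m v).2
        (tangentD (cotModel E) 𝓘(ℝ, E × (E →L[ℝ] ℝ)) (cotChart m.proj) m u).1 -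
      (tangentD (cotModel E) 𝓘(ℝ, E × (E →L[ℝ] ℝ)) (cotChart m.proj) m u).2
        (tangentD (cotModel E) 𝓘(ℝ, E × (E →L[ℝ] ℝ)) (cotChart m.proj) m v).1 := by
  have h1 : (DForm.d (cotModel E) (liouvilleForm E Q)).val m = (DForm.pullback (cotModel E) _
      (cotChart m.proj) (DForm.d _ (modelLiouville E))).val m :=
    (DForm.d_congr (liouvilleForm_eventuallyEq m)).trans (DForm.d_pullback (contMDiffAt_cotChart m)
      (DForm.smoothAt_model.2 contDiff_modelLiouville.contDiffAt))
  change -(DForm.d (cotModel E) (liouvilleForm E Q)).val m ![u, v] = _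
  rw [h1, DForm.pullback_val_two, modelLiouville_d, neg_sub]

end Cotangent

/-! ### Projections defined by smooth distributions -/

section Frames

variable {X E : Type*} [NormedAddCommGroup X] [NormedSpace ℝ X] [NormedAddCommGroup E]
  [NormedSpace ℝ E]

/-- The linear combinations `(a, b) ↦ ∑ aᵢ fᵢ + ∑ bⱼ gⱼ`. -/
def frameMap {k l : ℕ} (f : Fin k → E) (g : Fin l → E) : (Fin k → ℝ) × (Fin l → ℝ) →L[ℝ] E :=
  (∑ i, ((ContinuousLinearMap.proj i).comp (ContinuousLinearMap.fst ℝ _ _)).smulRight (f i)) +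
    ∑ j, ((ContinuousLinearMap.proj j).comp (ContinuousLinearMap.snd ℝ _ _)).smulRight (g j)

theorem frameMap_apply {k l : ℕ} (f : Fin k → E) (g : Fin l → E) (a : (Fin k → ℝ) × (Fin l → ℝ)) :
    frameMap f g a = ∑ i, a.1 i • f i + ∑ j, a.2 j • g j := by
  simp [frameMap, ContinuousLinearMap.sum_apply]

/-- Let T be the map sending coefficients to combinations of the two frames. It is invertible at
`x`, hence nearby, and the projection is T ∘ pr₁ ∘ T⁻¹, which is smooth because the frames are. -/
theorem contDiffAt_projection_of_frames [FiniteDimensional ℝ E] {k l : ℕ} {f : Fin k → X → E}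
    {g : Fin l → X → E} {x : X} {p : X → E →L[ℝ] E} (hf : ∀ i, ContDiffAt ℝ ∞ (f i) x)
    (hg : ∀ j, ContDiffAt ℝ ∞ (g j) x)
    (hlf : LinearIndependent ℝ (fun i => f i x)) (hlg : LinearIndependent ℝ (fun j => g j x))
    (hc : IsCompl (Submodule.span ℝ (Set.range fun i => f i x))
      (Submodule.span ℝ (Set.range fun j => g j x)))
    (hpf : ∀ᶠ y in 𝓝 x, ∀ i, p y (f i y) = f i y) (hpg : ∀ᶠ y in 𝓝 x, ∀ j, p y (g j y) = 0) :
    ContDiffAt ℝ ∞ p x := by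
  let T : X → (Fin k → ℝ) × (Fin l → ℝ) →L[ℝ] E := fun y => frameMap (fun i => f i y) fun j => g j y
  have hT : ContDiffAt ℝ ∞ T x := by
    refine contDiffAt_clm_of_apply fun a => ?_
    simp only [T, frameMap_apply]
    exact (ContDiffAt.sum fun i _ => contDiffAt_const.smul (hf i)).add
      (ContDiffAt.sum fun j _ => contDiffAt_const.smul (hg j))
  have hTx : (T x).IsInvertible := by
    have hinj : Function.Injective (T x) := by
      rw [injective_iff_map_eq_zero]
      intro a ha
      rw [frameMap_apply] at ha
      have h1 : ∑ i, a.1 i • f i x = 0 := by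
        refine Submodule.disjoint_def.1 hc.disjoint _ (Submodule.sum_mem _ fun i _ =>
          Submodule.smul_mem _ _ (Submodule.subset_span ⟨i, rfl⟩)) ?_
        rw [eq_neg_of_add_eq_zero_left ha]
        exact Submodule.neg_mem _ (Submodule.sum_mem _ fun i _ =>
          Submodule.smul_mem _ _ (Submodule.subset_span ⟨i, rfl⟩))
      have h2 := ha
      rw [h1, zero_add] at h2
      exact Prod.ext (funext (Fintype.linearIndependent_iff.1 hlf _ h1))
        (funext (Fintype.linearIndependent_iff.1 hlg _ h2))
    have hsurj : Function.Surjective (T x) := by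
      intro v
      obtain ⟨u, hu, w, hw, rfl⟩ := Submodule.mem_sup.1 (hc.sup_eq_top ▸ Submodule.mem_top (x := v))
      obtain ⟨a, rfl⟩ := (Submodule.mem_span_range_iff_exists_fun ℝ).1 hu
      obtain ⟨b, rfl⟩ := (Submodule.mem_span_range_iff_exists_fun ℝ).1 hw
      exact ⟨(a, b), frameMap_apply _ _ _⟩
    let e := (LinearEquiv.ofBijective (T x).toLinearMap ⟨hinj, hsurj⟩).toContinuousLinearEquiv
    exact ⟨e, ContinuousLinearMap.ext fun u => rfl⟩
  have hinv : ∀ᶠ y in 𝓝 x, (T y).IsInvertible := by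
    obtain ⟨e, he⟩ := hTx
    have h1 := hT.continuousAt.eventually_mem (e.nhds |> fun h => by rwa [he] at h)
    exact h1.mono fun y hy => by obtain ⟨e', he'⟩ := hy; exact ⟨e', he'⟩
  have hmain : p =ᶠ[𝓝 x] fun y =>
      ((T y).comp ((ContinuousLinearMap.inl ℝ (Fin k → ℝ) (Fin l → ℝ)).comp
        (ContinuousLinearMap.fst ℝ _ _))).comp (T y).inverse := by
    filter_upwards [hpf, hpg, hinv] with y h1 h2 h3
    ext1 v
    have h4 : T y ((T y).inverse v) = v := h3.self_apply_inverse v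
    change p y v = T y (((T y).inverse v).1, 0)
    conv_lhs => rw [← h4]
    simp only [T, frameMap_apply, map_add, map_sum, map_smul, h1, h2, smul_zero,
      Finset.sum_const_zero, Pi.zero_apply, zero_smul, add_zero]
  exact (((hT.clm_comp contDiffAt_const).clm_comp
    (hT.clm_inverse_of_injective hTx))).congr_of_eventuallyEq hmain

end Frames

/-! ### Projections and metrics read in charts of the base. -/

section Distributions

variable {E : Type*} [NormedAddCommGroup E] [NormedSpace ℝ E]
  {Q : Type*} [TopologicalSpace Q] [ChartedSpace E Q] [IsManifold 𝓘(ℝ, E) ∞ Q]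

/-- The derivative of the chart at `q₀`. -/
def chartD (q₀ q : Q) : E →L[ℝ] E := tangentD 𝓘(ℝ, E) 𝓘(ℝ, E) (extChartAt 𝓘(ℝ, E) q₀) q

theorem chartSymmD_chartD {q₀ q : Q} (hq : q ∈ (extChartAt 𝓘(ℝ, E) q₀).source) (v : E) :
    chartSymmD (E := E) q₀ (extChartAt 𝓘(ℝ, E) q₀ q) (chartD (E := E) q₀ q v) = v :=
  DFunLike.congr_fun (mfderiv_extChartAt_symm_comp 𝓘(ℝ, E) hq) v

theorem chartD_chartSymmD {q₀ q : Q} (hq : q ∈ (extChartAt 𝓘(ℝ, E) q₀).source) (v : E) :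
    chartD (E := E) q₀ q (chartSymmD (E := E) q₀ (extChartAt 𝓘(ℝ, E) q₀ q) v) = v :=
  DFunLike.congr_fun (mfderiv_extChartAt_comp_symm 𝓘(ℝ, E) hq) v

theorem trivializationAt_tangent_snd {q₀ q : Q} (hq : q ∈ (extChartAt 𝓘(ℝ, E) q₀).source)
    (v : TangentSpace 𝓘(ℝ, E) q) :
    (trivializationAt E (TangentSpace 𝓘(ℝ, E)) q₀ ⟨q, v⟩).2 = chartD (E := E) q₀ q v := by
  have : IsManifold 𝓘(ℝ, E) 1 Q := IsManifold.of_le (n := ∞) (by simp)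
  rw [extChartAt_source] at hq
  have h1 := TangentBundle.continuousLinearMapAt_trivializationAt (I := 𝓘(ℝ, E)) (x₀ := q₀) hq
  have h2 := DFunLike.congr_fun h1 v
  refine Eq.trans ?_ h2
  rw [Bundle.Trivialization.continuousLinearMapAt_apply,
    Bundle.Trivialization.linearMapAt_apply, if_pos]
  · exact hq

theorem contMDiffAt_vectorField_iff {q₀ : Q} {s : ∀ q : Q, TangentSpace 𝓘(ℝ, E) q} :
    ContMDiffAt 𝓘(ℝ, E) 𝓘(ℝ, E).tangent ∞ (fun q => (⟨q, s q⟩ : TangentBundle 𝓘(ℝ, E) Q)) q₀ ↔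
      ContMDiffAt 𝓘(ℝ, E) 𝓘(ℝ, E) ∞ (fun q => chartD (E := E) q₀ q (s q)) q₀ := by
  have h := Bundle.contMDiffAt_section (IB := 𝓘(ℝ, E)) (n := ∞) (F := E)
    (E := (TangentSpace 𝓘(ℝ, E) : Q → Type _)) (s := s) q₀
  refine h.trans ?_
  have h2 : (fun q => (trivializationAt E (TangentSpace 𝓘(ℝ, E)) q₀ ⟨q, s q⟩).2) =ᶠ[𝓝 q₀]
      fun q => chartD (E := E) q₀ q (s q) := by
    filter_upwards [(isOpen_extChartAt_source (I := 𝓘(ℝ, E)) q₀).mem_nhds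
      (mem_extChartAt_source _)] with q hq
    exact trivializationAt_tangent_snd hq _
  exact ⟨fun h => h.congr_of_eventuallyEq h2.symm, fun h => h.congr_of_eventuallyEq h2⟩

theorem eventually_extChartAt_symm {q₀ : Q} {P : Q → Prop} (h : ∀ᶠ q in 𝓝 q₀, P q) :
    ∀ᶠ y in 𝓝 (extChartAt 𝓘(ℝ, E) q₀ q₀), P ((extChartAt 𝓘(ℝ, E) q₀).symm y) := by
  have h1 := continuousAt_extChartAt_symm (I := 𝓘(ℝ, E)) q₀
  rw [ContinuousAt, (extChartAt 𝓘(ℝ, E) q₀).left_inv (mem_extChartAt_source _)] at h1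
  exact h1.eventually h

theorem eventually_mem_extChartAt_target (q₀ : Q) :
    ∀ᶠ y in 𝓝 (extChartAt 𝓘(ℝ, E) q₀ q₀), y ∈ (extChartAt 𝓘(ℝ, E) q₀).target :=
  (isOpen_extChartAt_target (I := 𝓘(ℝ, E)) q₀).mem_nhds (mem_extChartAt_target _)

theorem contDiffAt_endoInChart_projection [FiniteDimensional ℝ E]
    {D W : ∀ q : Q, Submodule ℝ (TangentSpace 𝓘(ℝ, E) q)} (hD : IsSmoothDistribution D)
    (hW : IsSmoothDistribution W) (hDW : ∀ q, IsCompl (D q) (W q))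
    {p : ∀ q : Q, TangentSpace 𝓘(ℝ, E) q →L[ℝ] TangentSpace 𝓘(ℝ, E) q}
    (hpD : ∀ q, ∀ v ∈ D q, p q v = v) (hpW : ∀ q, ∀ v ∈ W q, p q v = 0) (q₀ : Q) :
    ContDiffAt ℝ ∞ (endoInChart p q₀) (extChartAt 𝓘(ℝ, E) q₀ q₀) := by
  obtain ⟨u, hu, k, X, hX, hXD⟩ := hD q₀
  obtain ⟨w, hw, l, Y, hY, hYW⟩ := hW q₀
  set φ := extChartAt 𝓘(ℝ, E) q₀
  have hsm : ∀ {s : ∀ q : Q, TangentSpace 𝓘(ℝ, E) q} {u : Set Q} (_ : u ∈ 𝓝 q₀)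
      (_ : ContMDiffOn 𝓘(ℝ, E) 𝓘(ℝ, E).tangent ∞
        (fun q => (⟨q, s q⟩ : TangentBundle 𝓘(ℝ, E) Q)) u),
      ContDiffAt ℝ ∞ (fun y => chartD (E := E) q₀ (φ.symm y) (s (φ.symm y))) (φ q₀) := fun hu h =>
    ContMDiffAt.contDiffAt_comp_extChartAt_symm le_rfl (mem_extChartAt_source q₀)
      (contMDiffAt_vectorField_iff.1 (h.contMDiffAt hu))
  have hφ : φ.symm (φ q₀) = q₀ := φ.left_inv (mem_extChartAt_source q₀)
  have hinj : Function.Injective (chartD (E := E) q₀ q₀) := fun a b h => by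
    rw [← chartSymmD_chartD (mem_extChartAt_source (I := 𝓘(ℝ, E)) q₀) a, h,
      chartSymmD_chartD (mem_extChartAt_source (I := 𝓘(ℝ, E)) q₀) b]
  have hbij : Function.Bijective (chartD (E := E) q₀ q₀) :=
    ⟨hinj, fun v => ⟨_, chartD_chartSymmD (mem_extChartAt_source (I := 𝓘(ℝ, E)) q₀) v⟩⟩
  let e : E ≃ₗ[ℝ] E := LinearEquiv.ofBijective (chartD (E := E) q₀ q₀).toLinearMap hbij
  have hspan : ∀ {n : ℕ} (Z : Fin n → E), Submodule.span ℝ (Set.range fun i => chartD (E := E) q₀ q₀ (Z i))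
      = (Submodule.span ℝ (Set.range Z)).map (e : E →ₗ[ℝ] E) := fun Z => by
    rw [Submodule.map_span, ← Set.range_comp]; rfl
  obtain ⟨hX1, hX2⟩ := hXD q₀ (mem_of_mem_nhds hu)
  obtain ⟨hY1, hY2⟩ := hYW q₀ (mem_of_mem_nhds hw)
  have key : ∀ {n : ℕ} (s : Fin n → ∀ q : Q, TangentSpace 𝓘(ℝ, E) q), 
      (fun i => (chartD (E := E) q₀ (φ.symm (φ q₀)) (s i (φ.symm (φ q₀))) : E)) =
      fun i => chartD (E := E) q₀ q₀ (s i q₀) := fun s => by rw [hφ]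
  refine contDiffAt_projection_of_frames (fun i => hsm hu (hX i)) (fun j => hsm hw (hY j)) ?_ ?_ ?_
    ?_ ?_
  · rw [key X]
    exact LinearIndependent.map' (M := E) hX1 e.toLinearMap e.ker
  · rw [key Y]
    exact LinearIndependent.map' (M := E) hY1 e.toLinearMap e.ker
  · rw [key X, key Y]
    have h1 := hspan fun i => X i q₀
    have h2 := hspan fun i => Y i q₀
    have h3 : IsCompl (Submodule.span ℝ (Set.range fun i => (X i q₀ : E)))
        (Submodule.span ℝ (Set.range fun i => (Y i q₀ : E))) := by
      have := hDW q₀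
      rw [← hX2, ← hY2] at this
      exact this
    rw [h1, h2]
    exact (OrderIso.isCompl_iff (Submodule.orderIsoMapComap e)).1 h3
  · filter_upwards [eventually_mem_extChartAt_target q₀, eventually_extChartAt_symm hu] with y hy hyu i
    have h1 := chartSymmD_chartD (φ.map_target hy) (X i (φ.symm y))
    rw [φ.right_inv hy] at h1
    have h2 := hpD _ _ ((hXD _ hyu).2 ▸ Submodule.subset_span ⟨i, rfl⟩ : X i (φ.symm y) ∈ D _)
    change chartD (E := E) q₀ (φ.symm y) ((show E →L[ℝ] E from p (φ.symm y)) (chartSymmD (E := E) q₀ y _)) = _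
    rw [h1]
    exact congrArg (chartD (E := E) q₀ (φ.symm y)) h2
  · filter_upwards [eventually_mem_extChartAt_target q₀, eventually_extChartAt_symm hw] with y hy hyw i
    have h1 := chartSymmD_chartD (φ.map_target hy) (Y i (φ.symm y))
    rw [φ.right_inv hy] at h1
    have h2 := hpW _ _ ((hYW _ hyw).2 ▸ Submodule.subset_span ⟨i, rfl⟩ : Y i (φ.symm y) ∈ W _)
    change chartD (E := E) q₀ (φ.symm y) ((show E →L[ℝ] E from p (φ.symm y)) (chartSymmD (E := E) q₀ y _)) = _
    rw [h1]
    exact (congrArg (chartD (E := E) q₀ (φ.symm y)) h2).trans (ContinuousLinearMap.map_zero _)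

/-- The metric in the chart at `q₀`. -/
def metricInChart (κ : ∀ q : Q, TangentSpace 𝓘(ℝ, E) q →L[ℝ] TangentSpace 𝓘(ℝ, E) q →L[ℝ] ℝ)
    (q₀ : Q) (y : E) : E →L[ℝ] E →L[ℝ] ℝ :=
  (show E →L[ℝ] E →L[ℝ] ℝ from κ ((extChartAt 𝓘(ℝ, E) q₀).symm y)).bilinearComp
    (chartSymmD (E := E) q₀ y) (chartSymmD (E := E) q₀ y)

theorem contDiffAt_metricInChart [FiniteDimensional ℝ E]
    (g : Bundle.ContMDiffRiemannianMetric 𝓘(ℝ, E) ∞ E (fun q : Q => TangentSpace 𝓘(ℝ, E) q))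
    (q₀ : Q) : ContDiffAt ℝ ∞ (metricInChart g.inner q₀) (extChartAt 𝓘(ℝ, E) q₀ q₀) := by
  set φ := extChartAt 𝓘(ℝ, E) q₀
  -- Coordinate vector fields have constant chart components, so they are smooth sections; the
  -- entries of the metric are its values on them.
  have hs : ∀ a : E, ContMDiffAt 𝓘(ℝ, E) 𝓘(ℝ, E).tangent ∞
      (fun q => (⟨q, chartSymmD (E := E) q₀ (φ q) a⟩ : TangentBundle 𝓘(ℝ, E) Q)) q₀ := fun a => by
    refine contMDiffAt_vectorField_iff.2 ?_
    refine (contMDiffAt_const (c := a)).congr_of_eventuallyEq ?_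
    filter_upwards [(isOpen_extChartAt_source (I := 𝓘(ℝ, E)) q₀).mem_nhds
      (mem_extChartAt_source _)] with q hq
    exact chartD_chartSymmD hq a
  refine contDiffAt_clm_of_apply₂ fun a b => ?_
  have h1 : ContMDiffAt 𝓘(ℝ, E) (𝓘(ℝ, E).prod 𝓘(ℝ)) ∞
      (fun q => Bundle.TotalSpace.mk' ℝ (E := Bundle.Trivial Q ℝ) q
        (g.inner q (chartSymmD (E := E) q₀ (φ q) a) (chartSymmD (E := E) q₀ (φ q) b))) q₀ := by
    apply ContMDiffAt.clm_bundle_apply₂ (F₁ := E) (F₂ := E)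
    · exact g.contMDiff.contMDiffAt
    · exact hs a
    · exact hs b
  simp only [Bundle.contMDiffAt_totalSpace] at h1
  have h2 : ContMDiffAt 𝓘(ℝ, E) 𝓘(ℝ, ℝ) ∞
      (fun q => g.inner q (chartSymmD (E := E) q₀ (φ q) a) (chartSymmD (E := E) q₀ (φ q) b)) q₀ := h1.2
  have h3 := h2.contDiffAt_comp_extChartAt_symm le_rfl (mem_extChartAt_source q₀)
  refine h3.congr_of_eventuallyEq ?_
  filter_upwards [eventually_mem_extChartAt_target q₀] with y hy
  change g.inner _ (chartSymmD (E := E) q₀ y a) (chartSymmD (E := E) q₀ y b) =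
    g.inner _ (chartSymmD (E := E) q₀ (φ (φ.symm y)) a) (chartSymmD (E := E) q₀ (φ (φ.symm y)) b)
  rw [φ.right_inv hy]

end Distributions

theorem isInvertible_of_apply_self_ne_zero {E : Type*} [NormedAddCommGroup E] [NormedSpace ℝ E]
    [FiniteDimensional ℝ E] {L : E →L[ℝ] E →L[ℝ] ℝ} (h : ∀ v, v ≠ 0 → L v v ≠ 0) :
    L.IsInvertible := by
  have hinj : Function.Injective L.toLinearMap := by
    rw [injective_iff_map_eq_zero]
    intro v hv
    by_contra hne
    refine h v hne ?_
    change L.toLinearMap v v = 0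
    rw [hv]; rfl
  have hfr : Module.finrank ℝ E = Module.finrank ℝ (E →L[ℝ] ℝ) := by
    rw [← (LinearMap.toContinuousLinearMap (𝕜 := ℝ) (E := E) (F' := ℝ)).finrank_eq]
    exact Subspace.dual_finrank_eq.symm
  exact ⟨(LinearEquiv.ofInjectiveOfFinrankEq L.toLinearMap hinj hfr).toContinuousLinearEquiv,
    ContinuousLinearMap.ext fun u => rfl⟩

/-! ### Coordinates on the constraint manifold -/

namespace NonholonomicSystem

section Param

variable {E : Type*} [NormedAddCommGroup E] [NormedSpace ℝ E] [FiniteDimensional ℝ E]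
  {Q : Type*} [TopologicalSpace Q] [ChartedSpace E Q] [IsManifold 𝓘(ℝ, E) ∞ Q]
  {EM : Type*} [NormedAddCommGroup EM] [NormedSpace ℝ EM]

/-- The metric, with values in the bilinear forms on the model space. -/
def met (S : NonholonomicSystem E Q) (q : Q) : E →L[ℝ] E →L[ℝ] ℝ := S.metric.inner q

/-- The constraint distribution, with values in the subspaces of the model space. -/
def distD (S : NonholonomicSystem E Q) (q : Q) : Submodule ℝ E := S.D q

/-- The momentum of a point of `𝓜`, as a covector on the model space. -/
def mom {S : NonholonomicSystem E Q} (m : S.M) : E →L[ℝ] ℝ := m.1.2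

theorem exists_met_eq_mom {S : NonholonomicSystem E Q} (m : S.M) :
    ∃ v ∈ S.distD (S.tau m), S.met (S.tau m) v = mom m := m.2

theorem M_ext {S : NonholonomicSystem E Q} {m m' : S.M} (h : S.tau m = S.tau m')
    (h2 : mom m = mom m') : m = m' := Subtype.ext (cotangent_ext h h2)

theorem cotCoord_eq {S : NonholonomicSystem E Q} (q₀ : Q) (m : S.M) :
    cotCoord q₀ m.1 = (mom m).comp (chartSymmD q₀ (extChartAt 𝓘(ℝ, E) q₀ (S.tau m))) := rfl

/-- `P` is the smooth field of projections of `TQ` onto `D` along `W`. -/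
structure IsProjection (S : NonholonomicSystem E Q)
    (W : ∀ q : Q, Submodule ℝ (TangentSpace 𝓘(ℝ, E) q)) (P : Q → E →L[ℝ] E) : Prop where
  mem : ∀ q (v : E), P q v ∈ S.distD q
  sub_mem : ∀ q (v : E), v - P q v ∈ (show Submodule ℝ E from W q)
  apply_mem : ∀ q, ∀ v ∈ S.distD q, P q v = v
  smooth : ∀ q₀, ContDiffAt ℝ ∞ (endoInChart P q₀) (extChartAt 𝓘(ℝ, E) q₀ q₀)

theorem exists_isProjection (S : NonholonomicSystem E Q)
    {W : ∀ q : Q, Submodule ℝ (TangentSpace 𝓘(ℝ, E) q)} (hW : IsSmoothDistribution W)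
    (hDW : ∀ q, IsCompl (S.D q) (W q)) : ∃ P, S.IsProjection W P := by
  let P : ∀ q : Q, E →L[ℝ] E := fun q => LinearMap.toContinuousLinearMap
    (Submodule.projection (E := E) (S.D q) (W q) (hDW q))
  have h1 : ∀ q, ∀ v ∈ S.D q, P q v = v := fun q v hv =>
    Submodule.projection_apply_of_mem_left (E := E) (hDW q) hv
  have h2 : ∀ q, ∀ v ∈ W q, P q v = 0 := fun q v hv =>
    Submodule.projection_apply_of_mem_right (E := E) (hDW q) hv
  have hm : ∀ q (v : E), P q v ∈ S.distD q := fun q v =>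
    Submodule.projection_apply_mem (E := E) (hDW q) v
  refine ⟨P, hm, fun q v => ?_, h1,
    fun q₀ => contDiffAt_endoInChart_projection S.D_smooth hW hDW h1 h2 q₀⟩
  have := Submodule.projection_apply_eq_zero_iff (E := E) (hDW q) (x := v - P q v)
  refine this.1 ?_
  change P q (v - P q v) = 0
  rw [map_sub, h1 q _ (hm q v), sub_self]

variable {S : NonholonomicSystem E Q} {W : ∀ q : Q, Submodule ℝ (TangentSpace 𝓘(ℝ, E) q)}
  {P : Q → E →L[ℝ] E}

variable (S) in
/-- The metric in the chart at `q₀`. -/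
def metChart (q₀ : Q) (y : E) : E →L[ℝ] E →L[ℝ] ℝ := metricInChart S.metric.inner q₀ y

theorem metChart_apply (q₀ : Q) (y u v : E) : S.metChart q₀ y u v =
    S.met ((extChartAt 𝓘(ℝ, E) q₀).symm y) (chartSymmD q₀ y u) (chartSymmD q₀ y v) := rfl

theorem metChart_apply_self_ne_zero (S : NonholonomicSystem E Q) {q₀ : Q} {y : E}
    (hy : y ∈ (extChartAt 𝓘(ℝ, E) q₀).target) {v : E} (hv : v ≠ 0) :
    S.metChart q₀ y v v ≠ 0 := by
  refine (S.metric.pos _ (chartSymmD q₀ y v) fun h => hv ?_).ne'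
  have h1 := chartD_chartSymmD (E := E) ((extChartAt 𝓘(ℝ, E) q₀).map_target hy) v
  rw [(extChartAt 𝓘(ℝ, E) q₀).right_inv hy] at h1
  rw [← h1]
  exact (congrArg (chartD (E := E) q₀ _) h).trans (ContinuousLinearMap.map_zero _)

theorem isInvertible_metChart (S : NonholonomicSystem E Q) {q₀ : Q} {y : E}
    (hy : y ∈ (extChartAt 𝓘(ℝ, E) q₀).target) : (S.metChart q₀ y).IsInvertible :=
  isInvertible_of_apply_self_ne_zero fun _ hv => S.metChart_apply_self_ne_zero hy hv

theorem contDiffAt_metChart (S : NonholonomicSystem E Q) (q₀ : Q) :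
    ContDiffAt ℝ ∞ (S.metChart q₀) (extChartAt 𝓘(ℝ, E) q₀ q₀) :=
  contDiffAt_metricInChart S.metric q₀

/-- The projection in the chart at `q₀`. -/
def projChart (P : Q → E →L[ℝ] E) (q₀ : Q) (y : E) : E →L[ℝ] E :=
  (chartD q₀ ((extChartAt 𝓘(ℝ, E) q₀).symm y)).comp
    ((P ((extChartAt 𝓘(ℝ, E) q₀).symm y)).comp (chartSymmD q₀ y))

theorem chartSymmD_projChart (P : Q → E →L[ℝ] E) {q₀ : Q} {y : E}
    (hy : y ∈ (extChartAt 𝓘(ℝ, E) q₀).target) (v : E) :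
    chartSymmD q₀ y (projChart P q₀ y v) =
      P ((extChartAt 𝓘(ℝ, E) q₀).symm y) (chartSymmD q₀ y v) := by
  have h1 := chartSymmD_chartD (E := E) ((extChartAt 𝓘(ℝ, E) q₀).map_target hy)
    (P ((extChartAt 𝓘(ℝ, E) q₀).symm y) (chartSymmD (E := E) q₀ y v))
  rwa [(extChartAt 𝓘(ℝ, E) q₀).right_inv hy] at h1

theorem IsProjection.contDiffAt_projChart (hP : S.IsProjection W P) (q₀ : Q) :
    ContDiffAt ℝ ∞ (projChart P q₀) (extChartAt 𝓘(ℝ, E) q₀ q₀) := hP.smooth q₀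

/-- The map `(y, v) ↦ κ(P v)` in the chart at `q₀`. -/
def param (hP : S.IsProjection W P) (q₀ : Q) (z : E × E) : S.M :=
  ⟨⟨(extChartAt 𝓘(ℝ, E) q₀).symm z.1, S.met _ (P _ (chartSymmD (E := E) q₀ z.1 z.2))⟩,
    P _ (chartSymmD (E := E) q₀ z.1 z.2), hP.mem _ _, rfl⟩

theorem tau_param (hP : S.IsProjection W P) (q₀ : Q) (z : E × E) :
    S.tau (param hP q₀ z) = (extChartAt 𝓘(ℝ, E) q₀).symm z.1 := rfl

theorem mom_param (hP : S.IsProjection W P) (q₀ : Q) (z : E × E) :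
    mom (param hP q₀ z) = S.met ((extChartAt 𝓘(ℝ, E) q₀).symm z.1)
      (P ((extChartAt 𝓘(ℝ, E) q₀).symm z.1) (chartSymmD (E := E) q₀ z.1 z.2)) := rfl

variable (S) in
/-- The coordinates `(y, v)` of the point `κ(v)` in the chart at `q₀`. -/
def paramInv (q₀ : Q) (m : S.M) : E × E :=
  (extChartAt 𝓘(ℝ, E) q₀ (S.tau m),
    (S.metChart q₀ (extChartAt 𝓘(ℝ, E) q₀ (S.tau m))).inverse (cotCoord q₀ m.1))

variable (S) in
/-- The momentum of `param (y, v)`. -/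
def paramMomentum (P : Q → E →L[ℝ] E) (q₀ : Q) (z : E × E) : E →L[ℝ] ℝ :=
  S.metChart q₀ z.1 (projChart P q₀ z.1 z.2)

theorem cotChart_param (hP : S.IsProjection W P) {q₀ : Q} {z : E × E}
    (hz : z.1 ∈ (extChartAt 𝓘(ℝ, E) q₀).target) :
    cotChart q₀ (param hP q₀ z).1 = (z.1, S.paramMomentum P q₀ z) := by
  have h0 : extChartAt 𝓘(ℝ, E) q₀ ((extChartAt 𝓘(ℝ, E) q₀).symm z.1) = z.1 :=
    (extChartAt 𝓘(ℝ, E) q₀).right_inv hz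
  refine Prod.ext h0 ?_
  change cotCoord q₀ (param hP q₀ z).1 = S.paramMomentum P q₀ z
  ext w
  rw [cotCoord_eq, tau_param, h0, mom_param, paramMomentum, metChart_apply,
    chartSymmD_projChart P hz]
  rfl

theorem paramInv_snd {q₀ : Q} {m : S.M} (hm : S.tau m ∈ (extChartAt 𝓘(ℝ, E) q₀).source)
    {v : E} (hv : S.met (S.tau m) v = mom m) :
    (S.paramInv q₀ m).2 = chartD (E := E) q₀ (S.tau m) v := by
  have h1 := S.isInvertible_metChart ((extChartAt 𝓘(ℝ, E) q₀).map_source hm)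
  have h2 : S.metChart q₀ (extChartAt 𝓘(ℝ, E) q₀ (S.tau m))
      (chartD (E := E) q₀ (S.tau m) v) = cotCoord q₀ m.1 := by
    ext w
    rw [cotCoord_eq, metChart_apply, chartSymmD_chartD (E := E) hm,
      (extChartAt 𝓘(ℝ, E) q₀).left_inv hm, hv]
    rfl
  change ContinuousLinearMap.inverse _ _ = _
  rw [← h2]
  exact h1.inverse_apply_self _

/-- The coordinates (y, v) are redundant: v ranges over all of `E`, while only its projection to D
matters. So `param` is not a chart, but it has the right inverse `paramInv`, which suffices for
computing on T𝓜. -/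
theorem param_paramInv (hP : S.IsProjection W P) {q₀ : Q} {m : S.M}
    (hm : S.tau m ∈ (extChartAt 𝓘(ℝ, E) q₀).source) :
    param hP q₀ (S.paramInv q₀ m) = m := by
  obtain ⟨v, hvD, hv⟩ := exists_met_eq_mom m
  have h0 : (extChartAt 𝓘(ℝ, E) q₀).symm (S.paramInv q₀ m).1 = S.tau m :=
    (extChartAt 𝓘(ℝ, E) q₀).left_inv hm
  refine M_ext h0 ?_
  have h2 : chartSymmD (E := E) q₀ (S.paramInv q₀ m).1 (S.paramInv q₀ m).2 = v := by
    rw [paramInv_snd hm hv]; exact chartSymmD_chartD (E := E) hm v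
  rw [mom_param, h0, h2, hP.apply_mem _ v hvD, hv]

theorem contDiffAt_paramMomentum (hP : S.IsProjection W P) {q₀ : Q} {z : E × E}
    (hz : z.1 = extChartAt 𝓘(ℝ, E) q₀ q₀) : ContDiffAt ℝ ∞ (S.paramMomentum P q₀) z := by
  have h1 := S.contDiffAt_metChart q₀
  have h2 := hP.contDiffAt_projChart q₀
  rw [← hz] at h1 h2
  exact (h1.comp z contDiffAt_fst).clm_apply ((h2.comp z contDiffAt_fst).clm_apply contDiffAt_snd)

theorem contMDiffAt_param_val (hP : S.IsProjection W P) {q₀ : Q} {z : E × E}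
    (hz : z.1 = extChartAt 𝓘(ℝ, E) q₀ q₀) :
    ContMDiffAt 𝓘(ℝ, E × E) (cotModel E) ∞ (fun z => (param hP q₀ z).1) z := by
  have hzt : z.1 ∈ (extChartAt 𝓘(ℝ, E) q₀).target := hz ▸ mem_extChartAt_target q₀
  have h0 : (param hP q₀ z).1.proj = q₀ := by
    change (extChartAt 𝓘(ℝ, E) q₀).symm z.1 = q₀
    rw [hz, (extChartAt 𝓘(ℝ, E) q₀).left_inv (mem_extChartAt_source _)]
  rw [contMDiffAt_cotangent_iff, h0]
  refine ⟨(contMDiffAt_extChartAt_symm 𝓘(ℝ, E) hzt).comp z contDiff_fst.contMDiff.contMDiffAt,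
    ((contDiffAt_paramMomentum hP hz).contMDiffAt).congr_of_eventuallyEq ?_⟩
  filter_upwards [contDiff_fst (𝕜 := ℝ) (n := 0).continuous.continuousAt.eventually_mem
    ((isOpen_extChartAt_target (I := 𝓘(ℝ, E)) q₀).mem_nhds hzt)] with z' hz'
  exact congrArg Prod.snd (cotChart_param hP hz')

variable [ChartedSpace EM S.M] [IsManifold 𝓘(ℝ, EM) ∞ S.M]

/-- 𝓜 is embedded, so continuity into it can be tested in T^*Q, and smoothness along the immersion
then follows. -/
theorem contMDiffAt_into_M
    (hemb : Manifold.IsSmoothEmbedding 𝓘(ℝ, EM) (cotModel E) ∞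
      (Subtype.val : S.M → CotangentBundle E Q))
    {A : Type*} [NormedAddCommGroup A] [NormedSpace ℝ A] {H : Type*} [TopologicalSpace H]
    {J : ModelWithCorners ℝ A H} {X : Type*} [TopologicalSpace X] [ChartedSpace H X]
    {f : X → S.M} {x : X} (hf : ContMDiffAt J (cotModel E) ∞ (fun x => (f x).1) x) :
    ContMDiffAt J 𝓘(ℝ, EM) ∞ f x :=
  (ContMDiffAt.iff_comp_isImmersionAt (hemb.isImmersion.isImmersionAt (f x))).2
    ⟨hemb.isEmbedding.continuousAt_iff.2 hf.continuousAt, hf⟩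

theorem contMDiffAt_param
    (hemb : Manifold.IsSmoothEmbedding 𝓘(ℝ, EM) (cotModel E) ∞
      (Subtype.val : S.M → CotangentBundle E Q)) (hP : S.IsProjection W P) {q₀ : Q} {z : E × E}
    (hz : z.1 = extChartAt 𝓘(ℝ, E) q₀ q₀) :
    ContMDiffAt 𝓘(ℝ, E × E) 𝓘(ℝ, EM) ∞ (param hP q₀) z :=
  contMDiffAt_into_M hemb (contMDiffAt_param_val hP hz)

theorem contMDiff_tau
    (hemb : Manifold.IsSmoothEmbedding 𝓘(ℝ, EM) (cotModel E) ∞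
      (Subtype.val : S.M → CotangentBundle E Q)) :
    ContMDiff 𝓘(ℝ, EM) 𝓘(ℝ, E) ∞ S.tau :=
  (Bundle.contMDiff_proj _).comp hemb.contMDiff

theorem contMDiffAt_cotChart_val
    (hemb : Manifold.IsSmoothEmbedding 𝓘(ℝ, EM) (cotModel E) ∞
      (Subtype.val : S.M → CotangentBundle E Q)) (m : S.M) :
    ContMDiffAt 𝓘(ℝ, EM) 𝓘(ℝ, E × (E →L[ℝ] ℝ)) ∞ (fun m' : S.M => cotChart (S.tau m) m'.1) m :=
  contMDiffAt_cotChart_comp hemb.contMDiff.contMDiffAt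

theorem contMDiffAt_paramInv
    (hemb : Manifold.IsSmoothEmbedding 𝓘(ℝ, EM) (cotModel E) ∞
      (Subtype.val : S.M → CotangentBundle E Q)) (m : S.M) :
    ContMDiffAt 𝓘(ℝ, EM) 𝓘(ℝ, E × E) ∞ (S.paramInv (S.tau m)) m := by
  have h1 := contMDiffAt_cotChart_val hemb m
  have h2 : ContDiffAt ℝ ∞ (fun w : E × (E →L[ℝ] ℝ) =>
      (w.1, (S.metChart (S.tau m) w.1).inverse w.2)) (cotChart (S.tau m) m.1) := by
    have h3 := (S.contDiffAt_metChart (S.tau m)).clm_inverse_of_injective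
      (S.isInvertible_metChart (mem_extChartAt_target _))
    exact contDiffAt_fst.prodMk ((h3.comp (cotChart (S.tau m) m.1) contDiffAt_fst).clm_apply
      contDiffAt_snd)
  exact ContMDiffAt.comp (g := fun w : E × (E →L[ℝ] ℝ) =>
      (w.1, (S.metChart (S.tau m) w.1).inverse w.2)) m h2.contMDiffAt h1

end Param

end NonholonomicSystem

/-! ### The canonical form on the constraint manifold -/

namespace NonholonomicSystem

section Tangent

variable {E : Type*} [NormedAddCommGroup E] [NormedSpace ℝ E] [FiniteDimensional ℝ E]
  {Q : Type*} [TopologicalSpace Q] [ChartedSpace E Q] [IsManifold 𝓘(ℝ, E) ∞ Q]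
  {EM : Type*} [NormedAddCommGroup EM] [NormedSpace ℝ EM]
  {S : NonholonomicSystem E Q} {W : ∀ q : Q, Submodule ℝ (TangentSpace 𝓘(ℝ, E) q)}
  {P : Q → E →L[ℝ] E} [ChartedSpace EM S.M] [IsManifold 𝓘(ℝ, EM) ∞ S.M]

variable (S EM) in
/-- The inclusion `𝓜 → T^*Q` is a smooth embedding. -/
abbrev IsEmbeddedM : Prop :=
  Manifold.IsSmoothEmbedding 𝓘(ℝ, EM) (cotModel E) ∞ (Subtype.val : S.M → CotangentBundle E Q)

variable (EM) in
/-- The derivative of `τ`, as a map between the model spaces. -/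
def tauD (m : S.M) : EM →L[ℝ] E := tangentD 𝓘(ℝ, EM) 𝓘(ℝ, E) S.tau m

variable (EM) in
/-- The derivative of `param` at the coordinates of `m`. -/
def paramD (hP : S.IsProjection W P) (m : S.M) : E × E →L[ℝ] EM :=
  tangentD 𝓘(ℝ, E × E) 𝓘(ℝ, EM) (param hP (S.tau m)) (S.paramInv (S.tau m) m)

variable (EM) in
/-- The derivative of the cotangent coordinates. -/
def cotD (m : S.M) : EM →L[ℝ] E × (E →L[ℝ] ℝ) :=
  tangentD 𝓘(ℝ, EM) 𝓘(ℝ, E × (E →L[ℝ] ℝ)) (fun m' : S.M => cotChart (S.tau m) m'.1) m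

/-- The constraint distribution in coordinates. -/
theorem mem_distC_iff {m : S.M} {X : EM} :
    X ∈ (show Submodule ℝ EM from S.distC EM m) ↔ tauD EM m X ∈ S.distD (S.tau m) := Iff.rfl

theorem param_base (hP : S.IsProjection W P) (m : S.M) :
    param hP (S.tau m) (S.paramInv (S.tau m) m) = m :=
  param_paramInv hP (mem_extChartAt_source _)

theorem mdifferentiableAt_param (hemb : S.IsEmbeddedM EM) (hP : S.IsProjection W P) (m : S.M) :
    MDifferentiableAt 𝓘(ℝ, E × E) 𝓘(ℝ, EM) (param hP (S.tau m)) (S.paramInv (S.tau m) m) :=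
  (contMDiffAt_param hemb hP (z := S.paramInv (S.tau m) m) rfl).mdifferentiableAt (by simp)

/-- Differentiating `param ∘ paramInv = id` near `m` gives surjectivity of `paramD`. Every tangent
vector of 𝓜 can thus be written with a coordinate pair, although not uniquely. -/
theorem exists_paramD_eq (hemb : S.IsEmbeddedM EM) (hP : S.IsProjection W P) (m : S.M) (X : EM) :
    ∃ c, paramD EM hP m c = X := by
  refine ⟨tangentD 𝓘(ℝ, EM) 𝓘(ℝ, E × E) (S.paramInv (S.tau m)) m X, ?_⟩
  have h1 := tangentD_comp_apply (mdifferentiableAt_param hemb hP m)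
    ((contMDiffAt_paramInv hemb m).mdifferentiableAt (by simp)) X
  refine h1.symm.trans ?_
  have h2 : (fun m' => param hP (S.tau m) (S.paramInv (S.tau m) m')) =ᶠ[𝓝 m] fun m' => m' := by
    filter_upwards [(contMDiff_tau hemb).continuous.continuousAt.eventually_mem
      ((isOpen_extChartAt_source (I := 𝓘(ℝ, E)) (S.tau m)).mem_nhds
      (mem_extChartAt_source _))] with m' hm'
    exact param_paramInv hP hm'
  rw [tangentD_congr h2, tangentD_id]
  rfl

theorem tangentD_comp_paramD (hemb : S.IsEmbeddedM EM) (hP : S.IsProjection W P) (m : S.M)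
    {A : Type*} [NormedAddCommGroup A] [NormedSpace ℝ A] {H : Type*} [TopologicalSpace H]
    {J : ModelWithCorners ℝ A H} {X : Type*} [TopologicalSpace X] [ChartedSpace H X] {f : S.M → X}
    (hf : MDifferentiableAt 𝓘(ℝ, EM) J f m) (c : E × E) :
    tangentD 𝓘(ℝ, EM) J f m (paramD EM hP m c) =
      tangentD 𝓘(ℝ, E × E) J (fun z => f (param hP (S.tau m) z)) (S.paramInv (S.tau m) m) c := by
  have hb := param_base hP m
  have h := tangentD_comp_apply (g := f) (I₃ := J) (hb.symm ▸ hf) (mdifferentiableAt_param hemb hP m) c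
  rw [h]
  rw [hb]
  rfl

theorem tauD_paramD (hemb : S.IsEmbeddedM EM) (hP : S.IsProjection W P) (m : S.M) (c : E × E) :
    tauD EM m (paramD EM hP m c) =
      chartSymmD (S.tau m) (extChartAt 𝓘(ℝ, E) (S.tau m) (S.tau m)) c.1 := by
  refine (tangentD_comp_paramD hemb hP m
    ((contMDiff_tau hemb).contMDiffAt.mdifferentiableAt (by simp)) c).trans ?_
  have h := tangentD_comp_apply (g := (extChartAt 𝓘(ℝ, E) (S.tau m)).symm)
    (f := ContinuousLinearMap.fst ℝ E E) (x := S.paramInv (S.tau m) m) (I₁ := 𝓘(ℝ, E × E))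
    (I₂ := 𝓘(ℝ, E)) (I₃ := 𝓘(ℝ, E))
    ((contMDiffAt_extChartAt_symm 𝓘(ℝ, E) (mem_extChartAt_target _)).mdifferentiableAt (by simp))
    (ContinuousLinearMap.mdifferentiableAt _) c
  refine h.trans ?_
  rw [tangentD_eq_fderiv, ContinuousLinearMap.fderiv]
  rfl

theorem cotD_paramD (hemb : S.IsEmbeddedM EM) (hP : S.IsProjection W P) (m : S.M) (c : E × E) :
    cotD EM m (paramD EM hP m c) =
      (c.1, fderiv ℝ (S.paramMomentum P (S.tau m)) (S.paramInv (S.tau m) m) c) := by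
  refine (tangentD_comp_paramD hemb hP m
    ((contMDiffAt_cotChart_val hemb m).mdifferentiableAt (by simp)) c).trans ?_
  have h2 : (fun z => cotChart (S.tau m) (param hP (S.tau m) z).1) =ᶠ[𝓝 (S.paramInv (S.tau m) m)]
      fun z => (z.1, S.paramMomentum P (S.tau m) z) := by
    filter_upwards [contDiff_fst (𝕜 := ℝ) (n := 0).continuous.continuousAt.eventually_mem
      (eventually_mem_extChartAt_target (S.tau m))] with z' hz'
    exact cotChart_param hP hz'
  rw [tangentD_congr h2, tangentD_eq_fderiv]
  have h3 := (hasFDerivAt_fst (𝕜 := ℝ) (E := E) (F := E) (p := S.paramInv (S.tau m) m)).prodMk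
    ((contDiffAt_paramMomentum hP (z := S.paramInv (S.tau m) m) rfl).differentiableAt
      (by simp)).hasFDerivAt
  rw [h3.fderiv]
  rfl

theorem fderiv_paramMomentum_snd (hP : S.IsProjection W P) (m : S.M) (v : E) :
    fderiv ℝ (S.paramMomentum P (S.tau m)) (S.paramInv (S.tau m) m) (0, v) =
      S.metChart (S.tau m) (extChartAt 𝓘(ℝ, E) (S.tau m) (S.tau m))
        (projChart P (S.tau m) (extChartAt 𝓘(ℝ, E) (S.tau m) (S.tau m)) v) := by
  set y := extChartAt 𝓘(ℝ, E) (S.tau m) (S.tau m)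
  set z := S.paramInv (S.tau m) m
  have h1 := ((contDiffAt_paramMomentum hP (z := z) rfl).differentiableAt (by simp)).hasFDerivAt
  have h2 : HasFDerivAt (fun w : E => (y, w)) (ContinuousLinearMap.inr ℝ E E) z.2 :=
    hasFDerivAt_prodMk_right y z.2
  have h3 := HasFDerivAt.comp (g := S.paramMomentum P (S.tau m)) z.2 h1 h2
  have h4 : HasFDerivAt (S.paramMomentum P (S.tau m) ∘ fun w : E => (y, w))
      ((S.metChart (S.tau m) y).comp (projChart P (S.tau m) y)) z.2 :=
    ((S.metChart (S.tau m) y).comp (projChart P (S.tau m) y)).hasFDerivAt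
  exact DFunLike.congr_fun (h3.unique h4) v

/-- Along the line in direction (0, v) the projected velocity does not change, so `param` is
constant there. This describes the redundant directions of the coordinates. -/
theorem paramD_snd_eq_zero (hemb : S.IsEmbeddedM EM) (hP : S.IsProjection W P) {m : S.M} {v : E}
    (hv : projChart P (S.tau m) (extChartAt 𝓘(ℝ, E) (S.tau m) (S.tau m)) v = 0) :
    paramD EM hP m (0, v) = 0 := by
  set y := extChartAt 𝓘(ℝ, E) (S.tau m) (S.tau m)
  set z := S.paramInv (S.tau m) m with hz
  have h2 : HasFDerivAt (fun t : ℝ => (y, z.2 + t • v))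
      ((0 : ℝ →L[ℝ] E).prod (ContinuousLinearMap.toSpanSingleton ℝ v)) 0 :=
    (hasFDerivAt_const y (0 : ℝ)).prodMk
      ((ContinuousLinearMap.toSpanSingleton ℝ v).hasFDerivAt.const_add z.2)
  have hz0 : (y, z.2 + (0 : ℝ) • v) = z := by rw [zero_smul, add_zero]; rfl
  have h3 := tangentD_comp_apply (g := param hP (S.tau m)) (f := fun t : ℝ => (y, z.2 + t • v))
    (x := (0 : ℝ)) (I₁ := 𝓘(ℝ, ℝ)) (I₂ := 𝓘(ℝ, E × E)) (I₃ := 𝓘(ℝ, EM))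
    (by rw [hz0]; exact mdifferentiableAt_param hemb hP m) h2.differentiableAt.mdifferentiableAt 1
  have h4 : (fun t : ℝ => param hP (S.tau m) (y, z.2 + t • v)) = fun _ => m := by
    funext t
    refine Eq.trans ?_ (param_base hP m)
    refine M_ext rfl ?_
    rw [mom_param, mom_param]
    have h5 := chartSymmD_projChart P (mem_extChartAt_target (I := 𝓘(ℝ, E)) (S.tau m)) v
    change S.met _ (P _ (chartSymmD (E := E) (S.tau m) y (z.2 + t • v))) =
      S.met _ (P _ (chartSymmD (E := E) (S.tau m) y z.2))
    rw [map_add, map_smul, map_add, map_smul, ← h5, hv, map_zero, smul_zero, add_zero]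
    rfl
  rw [h4, tangentD_const, tangentD_eq_fderiv, h2.fderiv] at h3
  have h6 : tangentD 𝓘(ℝ, E × E) 𝓘(ℝ, EM) (param hP (S.tau m)) (y, z.2 + (0 : ℝ) • v) =
    paramD EM hP m := by rw [hz0]; rfl
  rw [h6] at h3
  have h7 : ((0 : ℝ →L[ℝ] E).prod (ContinuousLinearMap.toSpanSingleton ℝ v)) 1 = (0, v) := by simp
  rw [h7] at h3
  exact h3.symm

theorem omegaM_val (hemb : S.IsEmbeddedM EM) (m : S.M) (X Y : EM) :
    (S.omegaM EM).val m ![X, Y] =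
      (cotD EM m Y).2 (cotD EM m X).1 - (cotD EM m X).2 (cotD EM m Y).1 := by
  have h : ∀ Z : EM, tangentD (cotModel E) 𝓘(ℝ, E × (E →L[ℝ] ℝ)) (cotChart m.1.proj) m.1
      (tangentD 𝓘(ℝ, EM) (cotModel E) (Subtype.val : S.M → CotangentBundle E Q) m Z) =
        cotD EM m Z := fun Z =>
    (tangentD_comp_apply (g := cotChart m.1.proj)
      (f := (Subtype.val : S.M → CotangentBundle E Q)) (x := m)
      ((contMDiffAt_cotChart m.1).mdifferentiableAt (by simp))
      (hemb.contMDiff.contMDiffAt.mdifferentiableAt (by simp)) Z).symm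
  unfold omegaM
  rw [DForm.pullback_val_two, canonicalForm_val, h, h]

/-- The canonical form, modified by a semibasic form, is nondegenerate on `𝓒`. -/
theorem nondegOn_omegaM_sub (hemb : S.IsEmbeddedM EM) (hP : S.IsProjection W P) (m : S.M)
    (b : EM [⋀^Fin 2]→L[ℝ] ℝ) (hb : ∀ X Y, tauD EM m X = 0 → b ![X, Y] = 0) :
    NondegOn (E := EM) (S.distC EM m) ((S.omegaM EM).val m - b) := by
  intro X hX h
  set y := extChartAt 𝓘(ℝ, E) (S.tau m) (S.tau m) with hy
  have hyt : y ∈ (extChartAt 𝓘(ℝ, E) (S.tau m)).target := mem_extChartAt_target _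
  obtain ⟨c, rfl⟩ := exists_paramD_eq hemb hP m X
  have hval : ∀ d : E × E, (S.omegaM EM).val m ![paramD EM hP m c, paramD EM hP m d] =
      fderiv ℝ (S.paramMomentum P (S.tau m)) (S.paramInv (S.tau m) m) d c.1 -
      fderiv ℝ (S.paramMomentum P (S.tau m)) (S.paramInv (S.tau m) m) c d.1 := fun d => by
    rw [omegaM_val hemb, cotD_paramD hemb, cotD_paramD hemb]
  have h' : ∀ d : E × E, tauD EM m (paramD EM hP m d) ∈ S.distD (S.tau m) →
      fderiv ℝ (S.paramMomentum P (S.tau m)) (S.paramInv (S.tau m) m) d c.1 -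
      fderiv ℝ (S.paramMomentum P (S.tau m)) (S.paramInv (S.tau m) m) c d.1 =
      b ![paramD EM hP m c, paramD EM hP m d] := fun d hd => by
    have h1 := h (paramD EM hP m d) hd
    rw [← hval]
    exact sub_eq_zero.1 h1
  have hs : (extChartAt 𝓘(ℝ, E) (S.tau m)).symm y = S.tau m :=
    (extChartAt 𝓘(ℝ, E) (S.tau m)).left_inv (mem_extChartAt_source _)
  have hproj : ∀ u : E, chartSymmD (S.tau m) y u ∈ S.distD (S.tau m) →
      projChart P (S.tau m) y u = u := fun u hu => by
    have h1 := chartD_chartSymmD (E := E) (mem_extChartAt_source (I := 𝓘(ℝ, E)) (S.tau m)) u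
    unfold projChart
    rw [ContinuousLinearMap.comp_apply, ContinuousLinearMap.comp_apply, hs, hP.apply_mem _ _ hu]
    exact h1
  have hX' : chartSymmD (S.tau m) y c.1 ∈ S.distD (S.tau m) := by
    have := mem_distC_iff.1 hX
    rwa [tauD_paramD hemb] at this
  have hc1 : c.1 = 0 := by
    -- The test vector (0, c.1) is τ-vertical, so it lies in 𝓒 and the semibasic form vanishes on
    -- it. What remains is the metric evaluated on (c.1, c.1).
    by_contra hne
    refine S.metChart_apply_self_ne_zero hyt hne ?_
    have h1 : tauD EM m (paramD EM hP m (0, c.1)) = 0 := by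
      rw [tauD_paramD hemb]; exact map_zero _
    have h2 := h' (0, c.1) (by rw [h1]; exact Submodule.zero_mem _)
    rw [fderiv_paramMomentum_snd hP, ← hy, hproj _ hX', two_form_swap, hb _ _ h1, map_zero,
      sub_zero, neg_zero] at h2
    exact h2
  have hc : c = (0, c.2) := Prod.ext hc1 rfl
  have hτ : tauD EM m (paramD EM hP m c) = 0 := by
    rw [tauD_paramD hemb, hc1, map_zero]
  have hc2 : projChart P (S.tau m) y c.2 = 0 := by
    -- Now the vector itself is τ-vertical, so the semibasic form drops out again. The test vector
    -- (P c.2, 0) lies in 𝓒 and leaves, up to sign, the square of P c.2 in the metric.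
    by_contra hne
    refine S.metChart_apply_self_ne_zero hyt hne ?_
    have h1 : tauD EM m (paramD EM hP m (projChart P (S.tau m) y c.2, 0)) ∈ S.distD (S.tau m) := by
      rw [tauD_paramD hemb, ← hy]
      change chartSymmD (S.tau m) y (projChart P (S.tau m) y c.2) ∈ _
      rw [chartSymmD_projChart P hyt, hs]
      exact hP.mem _ _
    have h2 := h' _ h1
    rw [hb _ _ hτ, hc1, map_zero, zero_sub, neg_eq_zero, hc, fderiv_paramMomentum_snd hP] at h2
    exact h2
  rw [hc]
  exact paramD_snd_eq_zero hemb hP hc2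

theorem isSmooth_thetaM (hemb : S.IsEmbeddedM EM) : DForm.IsSmooth 𝓘(ℝ, EM) (S.thetaM EM) :=
  isSmooth_liouvilleForm.pullback hemb.contMDiff

theorem omegaM_eq (hemb : S.IsEmbeddedM EM) : S.omegaM EM = -DForm.d 𝓘(ℝ, EM) (S.thetaM EM) := by
  funext m
  have h := DForm.d_pullback (I := 𝓘(ℝ, EM)) (x := m) hemb.contMDiff.contMDiffAt
    (isSmooth_liouvilleForm.smoothAt m.1)
  change _ = -(DForm.d 𝓘(ℝ, EM) (S.thetaM EM) m)
  unfold thetaM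
  rw [h]
  refine DForm.ext_val fun v => rfl

theorem isSmooth_omegaM (hemb : S.IsEmbeddedM EM) : DForm.IsSmooth 𝓘(ℝ, EM) (S.omegaM EM) := by
  rw [omegaM_eq hemb]
  exact (isSmooth_thetaM hemb).d.neg

theorem thetaM_val (hemb : S.IsEmbeddedM EM) (m : S.M) (X : EM) :
    (S.thetaM EM).val m ![X] = mom m (tauD EM m X) := by
  unfold thetaM
  rw [DForm.pullback_val_one]
  have h := tangentD_comp_apply (g := (Bundle.TotalSpace.proj : CotangentBundle E Q → Q))
    (f := (Subtype.val : S.M → CotangentBundle E Q)) (x := m) (I₁ := 𝓘(ℝ, EM)) (I₂ := cotModel E)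
    (I₃ := 𝓘(ℝ, E)) ((Bundle.contMDiff_proj _).contMDiffAt.mdifferentiableAt (n := ∞) (by simp))
    (hemb.contMDiff.contMDiffAt.mdifferentiableAt (by simp)) X
  exact (congrArg (mom m) h).symm

/-- The Hamiltonian at `κ(v)`. -/
theorem hamM_eq {m : S.M} {v : E} (hv : S.met (S.tau m) v = mom m) :
    S.hamM m = 1 / 2 * S.met (S.tau m) v v + S.potential (S.tau m) := by
  have h1 : (S.met (S.tau m)).IsInvertible :=
    isInvertible_of_apply_self_ne_zero fun u hu => (S.metric.pos (S.tau m) u hu).ne'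
  have h2 : (S.met (S.tau m)).inverse (mom m) = v := by
    rw [← hv]; exact h1.inverse_apply_self _
  change 1 / 2 * mom m ((S.met (S.tau m)).inverse (mom m)) + S.potential (S.tau m) = _
  rw [h2, hv]

theorem contMDiff_hamM (hemb : S.IsEmbeddedM EM) : ContMDiff 𝓘(ℝ, EM) 𝓘(ℝ, ℝ) ∞ S.hamM := by
  intro m
  have h1 := contMDiffAt_paramInv hemb m
  -- In the coordinates of `paramInv` the kinetic energy is quadratic in the velocity, so no inverse
  -- of the metric appears.
  have h2 : ContDiffAt ℝ ∞ (fun z : E × E => 1 / 2 * S.metChart (S.tau m) z.1 z.2 z.2)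
      (S.paramInv (S.tau m) m) := by
    have h3 := S.contDiffAt_metChart (S.tau m)
    have h4 := h3.comp (S.paramInv (S.tau m) m) contDiffAt_fst
    exact contDiffAt_const.mul ((h4.clm_apply contDiffAt_snd).clm_apply contDiffAt_snd)
  have h5 : ContMDiffAt 𝓘(ℝ, EM) 𝓘(ℝ, ℝ) ∞ (fun m' => 1 / 2 * S.metChart (S.tau m)
      (S.paramInv (S.tau m) m').1 (S.paramInv (S.tau m) m').2 (S.paramInv (S.tau m) m').2) m :=
    ContMDiffAt.comp (g := fun z : E × E => 1 / 2 * S.metChart (S.tau m) z.1 z.2 z.2) m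
      h2.contMDiffAt h1
  have h6 := h5.add (S.potential_smooth.comp (contMDiff_tau hemb)).contMDiffAt
  refine h6.congr_of_eventuallyEq ?_
  filter_upwards [(contMDiff_tau hemb).continuous.continuousAt.eventually_mem
      ((isOpen_extChartAt_source (I := 𝓘(ℝ, E)) (S.tau m)).mem_nhds
      (mem_extChartAt_source _))] with m' hm'
  obtain ⟨v, -, hv⟩ := exists_met_eq_mom m'
  rw [hamM_eq hv]
  have h7 := paramInv_snd hm' hv
  have h8 : (extChartAt 𝓘(ℝ, E) (S.tau m)).symm (S.paramInv (S.tau m) m').1 = S.tau m' :=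
    (extChartAt 𝓘(ℝ, E) (S.tau m)).left_inv hm'
  have h9 : chartSymmD (E := E) (S.tau m) (S.paramInv (S.tau m) m').1 (chartD (E := E) (S.tau m)
    (S.tau m') v) = v := chartSymmD_chartD (E := E) hm' v
  change _ = 1 / 2 * S.metChart (S.tau m) (S.paramInv (S.tau m) m').1 (S.paramInv (S.tau m) m').2
    (S.paramInv (S.tau m) m').2 + S.potential (S.tau m')
  rw [h7, metChart_apply, h8, h9]

end Tangent

end NonholonomicSystem

/-! ### The action on the constraint manifold -/

namespace NonholonomicSystem

section ActionQ

variable {E : Type*} [NormedAddCommGroup E] [NormedSpace ℝ E]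
  {Q : Type*} [TopologicalSpace Q] [ChartedSpace E Q] [IsManifold 𝓘(ℝ, E) ∞ Q]
  {EG : Type*} [NormedAddCommGroup EG] [NormedSpace ℝ EG]
  {G : Type*} [TopologicalSpace G] [ChartedSpace EG G] [Group G] [LieGroup 𝓘(ℝ, EG) ∞ G]
  [MulAction G Q] [ContMDiffSMul 𝓘(ℝ, EG) 𝓘(ℝ, E) ∞ G Q]

variable (E) in
/-- The derivative of the action of `g` on `Q`. -/
def actD {G : Type*} [Group G] [MulAction G Q] (g : G) (q : Q) : E →L[ℝ] E :=
  tangentD 𝓘(ℝ, E) 𝓘(ℝ, E) (fun q : Q => g • q) q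

/-- The action of `g⁻¹` in the charts at `q₁` (source) and `q₀` (target), for `g = χ⁻¹(s)`. -/
def actInvInCharts (g₀ : G) (q₁ q₀ : Q) (p : EG × E) : E :=
  extChartAt 𝓘(ℝ, E) q₀
    (((extChartAt 𝓘(ℝ, EG) g₀).symm p.1)⁻¹ • (extChartAt 𝓘(ℝ, E) q₁).symm p.2)

theorem contMDiffAt_inv_smul_symm {g₀ : G} {q₁ : Q} {p : EG × E}
    (h1 : p.1 ∈ (extChartAt 𝓘(ℝ, EG) g₀).target) (h2 : p.2 ∈ (extChartAt 𝓘(ℝ, E) q₁).target) :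
    ContMDiffAt 𝓘(ℝ, EG × E) 𝓘(ℝ, E) ∞ (fun p : EG × E =>
      ((extChartAt 𝓘(ℝ, EG) g₀).symm p.1)⁻¹ • (extChartAt 𝓘(ℝ, E) q₁).symm p.2) p := by
  have : IsManifold 𝓘(ℝ, EG) ∞ G := inferInstance
  have e1 : ContMDiffAt 𝓘(ℝ, EG × E) 𝓘(ℝ, EG) ∞
      (fun p : EG × E => (extChartAt 𝓘(ℝ, EG) g₀).symm p.1) p :=
    (contMDiffAt_extChartAt_symm 𝓘(ℝ, EG) h1).comp p contDiff_fst.contMDiff.contMDiffAt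
  have e2 : ContMDiffAt 𝓘(ℝ, EG × E) 𝓘(ℝ, E) ∞
      (fun p : EG × E => (extChartAt 𝓘(ℝ, E) q₁).symm p.2) p :=
    (contMDiffAt_extChartAt_symm 𝓘(ℝ, E) h2).comp p contDiff_snd.contMDiff.contMDiffAt
  exact e1.inv.smul e2

theorem contDiffAt_actInvInCharts {g₀ : G} {q₁ q₀ : Q} {p : EG × E}
    (h1 : p.1 ∈ (extChartAt 𝓘(ℝ, EG) g₀).target) (h2 : p.2 ∈ (extChartAt 𝓘(ℝ, E) q₁).target)
    (h3 : ((extChartAt 𝓘(ℝ, EG) g₀).symm p.1)⁻¹ • (extChartAt 𝓘(ℝ, E) q₁).symm p.2 ∈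
      (extChartAt 𝓘(ℝ, E) q₀).source) :
    ContDiffAt ℝ ∞ (actInvInCharts g₀ q₁ q₀) p :=
  ContMDiffAt.contDiffAt (ContMDiffAt.comp (g := extChartAt 𝓘(ℝ, E) q₀) p
    (contMDiffAt_extChartAt_source h3) (contMDiffAt_inv_smul_symm h1 h2))

/-- The cotangent lift of g composes a covector with the derivative of g⁻¹. Writing that derivative
as a partial derivative of a map smooth in (g, q) gives its smoothness in both variables at once. -/
theorem fderiv_actInvInCharts {g₀ : G} {q₁ q₀ : Q} {p : EG × E}
    (h1 : p.1 ∈ (extChartAt 𝓘(ℝ, EG) g₀).target) (h2 : p.2 ∈ (extChartAt 𝓘(ℝ, E) q₁).target)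
    (h3 : ((extChartAt 𝓘(ℝ, EG) g₀).symm p.1)⁻¹ • (extChartAt 𝓘(ℝ, E) q₁).symm p.2 ∈
      (extChartAt 𝓘(ℝ, E) q₀).source) (v : E) :
    fderiv ℝ (actInvInCharts g₀ q₁ q₀) p (0, v) =
      chartD q₀ (((extChartAt 𝓘(ℝ, EG) g₀).symm p.1)⁻¹ • (extChartAt 𝓘(ℝ, E) q₁).symm p.2)
        (actD E ((extChartAt 𝓘(ℝ, EG) g₀).symm p.1)⁻¹ ((extChartAt 𝓘(ℝ, E) q₁).symm p.2)
          (chartSymmD q₁ p.2 v)) := by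
  set g := ((extChartAt 𝓘(ℝ, EG) g₀).symm p.1)⁻¹
  have e1 := ((contDiffAt_actInvInCharts h1 h2 h3).differentiableAt (by simp)).hasFDerivAt
  have e2 : HasFDerivAt (fun w : E => (p.1, w)) (ContinuousLinearMap.inr ℝ EG E) p.2 :=
    hasFDerivAt_prodMk_right p.1 p.2
  have e3 := (HasFDerivAt.comp (g := actInvInCharts g₀ q₁ q₀) p.2 e1 e2).fderiv
  have hg := (contMDiff_smul_const (E := E) EG g).contMDiffAt (x := (extChartAt 𝓘(ℝ, E) q₁).symm p.2)
    |>.mdifferentiableAt (by simp)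
  have hs := (contMDiffAt_extChartAt_symm 𝓘(ℝ, E) h2).mdifferentiableAt (by simp)
  have e4 := tangentD_comp_apply (I₁ := 𝓘(ℝ, E)) (I₂ := 𝓘(ℝ, E)) (I₃ := 𝓘(ℝ, E))
    (g := extChartAt 𝓘(ℝ, E) q₀) (f := fun w => g • (extChartAt 𝓘(ℝ, E) q₁).symm w) (x := p.2)
    ((contMDiffAt_extChartAt_source h3).mdifferentiableAt (by simp))
    (hg.comp _ hs) v
  have e5 := tangentD_comp_apply (I₁ := 𝓘(ℝ, E)) (I₂ := 𝓘(ℝ, E)) (I₃ := 𝓘(ℝ, E))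
    (g := fun q : Q => g • q) (f := (extChartAt 𝓘(ℝ, E) q₁).symm) hg hs v
  have e6 : fderiv ℝ (actInvInCharts g₀ q₁ q₀) p (0, v) =
      fderiv ℝ (actInvInCharts g₀ q₁ q₀ ∘ fun w : E => (p.1, w)) p.2 v := by rw [e3]; rfl
  rw [e6, ← tangentD_eq_fderiv]
  refine e4.trans ?_
  rw [e5]
  rfl

end ActionQ

section ActionM

variable {E : Type*} [NormedAddCommGroup E] [NormedSpace ℝ E]
  {Q : Type*} [TopologicalSpace Q] [ChartedSpace E Q] [IsManifold 𝓘(ℝ, E) ∞ Q]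
  {G : Type*} [Group G] [MulAction G Q]
  {S : NonholonomicSystem E Q} [S.IsSymmetry G]

theorem tau_smul (g : G) (m : S.M) : S.tau (g • m) = g • S.tau m := rfl

theorem actD_inv_actD (S : NonholonomicSystem E Q) [S.IsSymmetry G] (g : G) (q : Q) (v : E) :
    actD E g⁻¹ (g • q) (actD E g q v) = v := by
  have h1 := S.mfderiv_mul_smul g⁻¹ g q
  rw [inv_mul_cancel, S.mfderiv_one_smul] at h1
  exact (DFunLike.congr_fun h1 v).symm

theorem actD_actD_inv (S : NonholonomicSystem E Q) [S.IsSymmetry G] (g : G) (q : Q) (v : E) :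
    actD E g q (actD E g⁻¹ (g • q) v) = v := by
  have h1 := S.actD_inv_actD g⁻¹ (g • q) v
  rwa [inv_inv, inv_smul_smul] at h1

theorem mom_smul (g : G) (m : S.M) : mom (g • m) = (mom m).comp (actD E g⁻¹ (g • S.tau m)) := by
  have h : (actD E g (S.tau m)).inverse = actD E g⁻¹ (g • S.tau m) :=
    ContinuousLinearMap.inverse_eq (ContinuousLinearMap.ext fun v => S.actD_actD_inv g _ v)
      (ContinuousLinearMap.ext fun v => S.actD_inv_actD g _ v)
  rw [← h]
  rfl

theorem met_actD (S : NonholonomicSystem E Q) [S.IsSymmetry G] (g : G) (q : Q) (u v : E) :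
    S.met (g • q) (actD E g q u) (actD E g q v) = S.met q u v :=
  IsSymmetry.metric_invariant g q u v

theorem actD_mem_distD (S : NonholonomicSystem E Q) [S.IsSymmetry G] (g : G) {q : Q} {v : E}
    (hv : v ∈ S.distD q) : actD E g q v ∈ S.distD (g • q) := IsSymmetry.D_invariant g q v hv

theorem hamM_smul [FiniteDimensional ℝ E] (g : G) (m : S.M) : S.hamM (g • m) = S.hamM m := by
  obtain ⟨v, -, hv⟩ := exists_met_eq_mom m
  have h : S.met (S.tau (g • m)) (actD E g (S.tau m) v) = mom (g • m) := by
    rw [mom_smul, ← hv]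
    change S.met (g • S.tau m) _ = _
    ext w
    have h1 := S.met_actD g (S.tau m) v (actD E g⁻¹ (g • S.tau m) w)
    rw [S.actD_actD_inv] at h1
    exact h1
  have h2 : S.tau (g • m) = g • S.tau m := rfl
  rw [hamM_eq hv, hamM_eq h, h2, met_actD]
  exact congrArg _ (IsSymmetry.potential_invariant g (S.tau m))

variable [FiniteDimensional ℝ E] [TopologicalSpace G]
  {EM : Type*} [NormedAddCommGroup EM] [NormedSpace ℝ EM] [ChartedSpace EM S.M]
  [IsManifold 𝓘(ℝ, EM) ∞ S.M]

/-- It is enough to show smoothness into T^*Q. There the momentum coordinate of g • m is that of m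
composed with the partial derivative of (g, q) ↦ g⁻¹ • q at the point (g, g • τ(m)), and inversion
and the action are smooth. -/
theorem contMDiffSMul_M (EG : Type*) [NormedAddCommGroup EG] [NormedSpace ℝ EG]
    [ChartedSpace EG G] [LieGroup 𝓘(ℝ, EG) ∞ G] [ContMDiffSMul 𝓘(ℝ, EG) 𝓘(ℝ, E) ∞ G Q]
    (hemb : S.IsEmbeddedM EM) : ContMDiffSMul 𝓘(ℝ, EG) 𝓘(ℝ, EM) ∞ G S.M := by
  refine ⟨fun ⟨g₀, m₀⟩ => contMDiffAt_into_M hemb ?_⟩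
  have hτ : ContMDiff (𝓘(ℝ, EG).prod 𝓘(ℝ, EM)) 𝓘(ℝ, E) ∞ (fun p : G × S.M => S.tau p.2) :=
    (contMDiff_tau hemb).comp contMDiff_snd
  have hπ : ContMDiff (𝓘(ℝ, EG).prod 𝓘(ℝ, EM)) 𝓘(ℝ, E) ∞ (fun p : G × S.M => p.1 • S.tau p.2) :=
    (contMDiff_fst (I := 𝓘(ℝ, EG)) (J := 𝓘(ℝ, EM)) (M := G) (N := S.M)).smul hτ
  refine contMDiffAt_cotangent_iff.2 ⟨hπ.contMDiffAt, ?_⟩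
  set q₀ := S.tau m₀
  set q₁ := g₀ • q₀ with hq₁
  set χ := extChartAt 𝓘(ℝ, EG) g₀
  have hs : χ.symm (χ g₀) = g₀ := χ.left_inv (mem_extChartAt_source _)
  have hs1 : (extChartAt 𝓘(ℝ, E) q₁).symm (extChartAt 𝓘(ℝ, E) q₁ q₁) = q₁ :=
    (extChartAt 𝓘(ℝ, E) q₁).left_inv (mem_extChartAt_source _)
  have hsmooth : ContDiffAt ℝ ∞ (actInvInCharts g₀ q₁ q₀) (χ g₀, extChartAt 𝓘(ℝ, E) q₁ q₁) := by
    refine contDiffAt_actInvInCharts (mem_extChartAt_target _) (mem_extChartAt_target _) ?_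
    change (χ.symm (χ g₀))⁻¹ • (extChartAt 𝓘(ℝ, E) q₁).symm (extChartAt 𝓘(ℝ, E) q₁ q₁) ∈ _
    rw [hs, hs1, hq₁, inv_smul_smul]
    exact mem_extChartAt_source _
  have hN : ContDiffAt ℝ ∞ (fun p => (fderiv ℝ (actInvInCharts g₀ q₁ q₀) p).comp
      (ContinuousLinearMap.inr ℝ EG E)) (χ g₀, extChartAt 𝓘(ℝ, E) q₁ q₁) :=
    (hsmooth.fderiv_right (m := ∞) (by simp)).clm_comp contDiffAt_const
  have hc1 : ContMDiffAt (𝓘(ℝ, EG).prod 𝓘(ℝ, EM)) 𝓘(ℝ, EG × E) ∞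
      (fun p : G × S.M => (χ p.1, extChartAt 𝓘(ℝ, E) q₁ (p.1 • S.tau p.2))) (g₀, m₀) := by
    refine ContMDiffAt.prodMk_space ?_ ?_
    · exact ContMDiffAt.comp (g := χ) (g₀, m₀) (contMDiffAt_extChartAt_source
        (mem_extChartAt_source _)) contMDiff_fst.contMDiffAt
    · exact ContMDiffAt.comp (g := extChartAt 𝓘(ℝ, E) q₁) (g₀, m₀) (contMDiffAt_extChartAt_source
        (mem_extChartAt_source _)) hπ.contMDiffAt
  have hN' : ContMDiffAt (𝓘(ℝ, EG).prod 𝓘(ℝ, EM)) 𝓘(ℝ, E →L[ℝ] E) ∞ (fun p : G × S.M =>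
      (fderiv ℝ (actInvInCharts g₀ q₁ q₀) (χ p.1, extChartAt 𝓘(ℝ, E) q₁ (p.1 • S.tau p.2))).comp
      (ContinuousLinearMap.inr ℝ EG E)) (g₀, m₀) :=
    ContMDiffAt.comp (g := fun p => (fderiv ℝ (actInvInCharts g₀ q₁ q₀) p).comp
      (ContinuousLinearMap.inr ℝ EG E)) (g₀, m₀) hN.contMDiffAt hc1
  have hp : ContMDiffAt (𝓘(ℝ, EG).prod 𝓘(ℝ, EM)) 𝓘(ℝ, E →L[ℝ] ℝ) ∞
      (fun p : G × S.M => cotCoord q₀ p.2.1) (g₀, m₀) :=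
    ContMDiffAt.comp (g := fun m : S.M => cotCoord q₀ m.1) (g₀, m₀)
      (contMDiffAt_cotangent_iff.1 hemb.contMDiff.contMDiffAt).2 contMDiff_snd.contMDiffAt
  refine (hp.clm_comp hN').congr_of_eventuallyEq ?_
  have e1 : ∀ᶠ p : G × S.M in 𝓝 (g₀, m₀), p.1 ∈ χ.source :=
    continuous_fst.continuousAt.eventually_mem ((isOpen_extChartAt_source (I := 𝓘(ℝ, EG))
      g₀).mem_nhds (mem_extChartAt_source _))
  have e2 : ∀ᶠ p : G × S.M in 𝓝 (g₀, m₀), S.tau p.2 ∈ (extChartAt 𝓘(ℝ, E) q₀).source :=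
    hτ.continuous.continuousAt.eventually_mem ((isOpen_extChartAt_source (I := 𝓘(ℝ, E))
      q₀).mem_nhds (mem_extChartAt_source _))
  have e3 : ∀ᶠ p : G × S.M in 𝓝 (g₀, m₀), p.1 • S.tau p.2 ∈ (extChartAt 𝓘(ℝ, E) q₁).source :=
    hπ.continuous.continuousAt.eventually_mem ((isOpen_extChartAt_source (I := 𝓘(ℝ, E))
      q₁).mem_nhds (mem_extChartAt_source _))
  filter_upwards [e1, e2, e3] with ⟨g, m⟩ h1 h2 h3
  ext v
  change cotCoord q₁ (g • m).1 v = cotCoord q₀ m.1 (fderiv ℝ (actInvInCharts g₀ q₁ q₀)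
    (χ g, extChartAt 𝓘(ℝ, E) q₁ (g • S.tau m)) (0, v))
  have k1 : χ.symm (χ g) = g := χ.left_inv h1
  have k2 : (extChartAt 𝓘(ℝ, E) q₁).symm (extChartAt 𝓘(ℝ, E) q₁ (g • S.tau m)) = g • S.tau m :=
    (extChartAt 𝓘(ℝ, E) q₁).left_inv h3
  have k3 := fderiv_actInvInCharts (g₀ := g₀) (q₁ := q₁) (q₀ := q₀)
    (p := (χ g, extChartAt 𝓘(ℝ, E) q₁ (g • S.tau m)))
    (χ.map_source h1) ((extChartAt 𝓘(ℝ, E) q₁).map_source h3)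
    (by
      change (χ.symm (χ g))⁻¹ • (extChartAt 𝓘(ℝ, E) q₁).symm
        (extChartAt 𝓘(ℝ, E) q₁ (g • S.tau m)) ∈ _
      rw [k1, k2, inv_smul_smul]; exact h2) v
  rw [k3]
  change _ = cotCoord q₀ m.1 (chartD q₀ ((χ.symm (χ g))⁻¹ • (extChartAt 𝓘(ℝ, E) q₁).symm
    (extChartAt 𝓘(ℝ, E) q₁ (g • S.tau m))) (actD E (χ.symm (χ g))⁻¹ ((extChartAt 𝓘(ℝ, E) q₁).symm
    (extChartAt 𝓘(ℝ, E) q₁ (g • S.tau m))) (chartSymmD q₁ _ v)))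
  rw [k1, k2, inv_smul_smul, cotCoord_eq, cotCoord_eq, ContinuousLinearMap.comp_apply,
    ContinuousLinearMap.comp_apply, chartSymmD_chartD (E := E) h2, mom_smul, tau_smul]
  rfl

end ActionM

end NonholonomicSystem

/-! ### Smooth left inverses and pairings with vector-valued forms. -/

section LeftInverse

variable {X F E : Type*} [NormedAddCommGroup X] [NormedSpace ℝ X] [NormedAddCommGroup F]
  [NormedSpace ℝ F] [FiniteDimensional ℝ F] [NormedAddCommGroup E] [NormedSpace ℝ E]
  [FiniteDimensional ℝ E]

/-- The Gram form of a linear map. -/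
def gram (Z : F →L[ℝ] E) : F →L[ℝ] F →L[ℝ] ℝ := (auxInner E).bilinearComp Z Z

theorem gram_apply (Z : F →L[ℝ] E) (u v : F) : gram Z u v = auxInner E (Z u) (Z v) := rfl

/-- A left inverse of an injective linear map, depending smoothly on it. -/
def leftInv (Z : F →L[ℝ] E) : E →L[ℝ] F :=
  (gram Z).inverse.comp (((ContinuousLinearMap.compL ℝ F E ℝ).flip Z).comp (auxInner E))

theorem isInvertible_gram {Z : F →L[ℝ] E} (hZ : Function.Injective Z) : (gram Z).IsInvertible := by
  refine isInvertible_of_apply_self_ne_zero fun v hv h => hv (hZ ?_)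
  rw [map_zero]
  exact auxInner_self_eq_zero h

theorem leftInv_apply {Z : F →L[ℝ] E} (hZ : Function.Injective Z) (v : F) :
    leftInv Z (Z v) = v := (isInvertible_gram hZ).inverse_apply_self v

theorem ContDiffAt.leftInv {Z : X → F →L[ℝ] E} {x : X} (hZ : ContDiffAt ℝ ∞ Z x)
    (h : Function.Injective (Z x)) : ContDiffAt ℝ ∞ (fun y => leftInv (Z y)) x := by
  have h1 : ContDiffAt ℝ ∞ (fun y => gram (Z y)) x := by
    refine contDiffAt_clm_of_apply₂ fun u v => ?_
    simp only [gram_apply]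
    exact ((contDiffAt_const (c := auxInner E)).clm_apply
      (hZ.clm_apply contDiffAt_const)).clm_apply (hZ.clm_apply contDiffAt_const)
  refine (h1.clm_inverse_of_injective (isInvertible_gram h)).clm_comp ?_
  refine contDiffAt_clm_of_apply fun u => ?_
  exact (contDiffAt_const (c := auxInner E u)).clm_comp hZ

theorem ContDiffAt.compContinuousAlternatingMap {k : ℕ} {g : X → F →L[ℝ] ℝ}
    {f : X → E [⋀^Fin k]→L[ℝ] F} {x : X} (hg : ContDiffAt ℝ ∞ g x) (hf : ContDiffAt ℝ ∞ f x) :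
    ContDiffAt ℝ ∞ (fun y => (g y).compContinuousAlternatingMap (f y)) x := by
  let b := Module.finBasis ℝ F
  let L : Fin (Module.finrank ℝ F) → (E [⋀^Fin k]→L[ℝ] F) →L[ℝ] (E [⋀^Fin k]→L[ℝ] ℝ) := fun i =>
    ContinuousLinearMap.compContinuousAlternatingMapCLM ℝ E F ℝ (Fin k)
      (LinearMap.toContinuousLinearMap (b.coord i))
  -- Expansion in a basis of `F` turns the pairing into a finite sum of smooth scalars times
  -- continuous linear images of `f`.
  have : (fun y => (g y).compContinuousAlternatingMap (f y)) = fun y =>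
      ∑ i, g y (b i) • L i (f y) := by
    funext y
    ext v
    have h1 : g y (f y v) = g y (∑ i, b.repr (f y v) i • b i) := by rw [b.sum_repr]
    change g y (f y v) = _
    rw [h1, map_sum, ContinuousAlternatingMap.sum_apply]
    refine Finset.sum_congr rfl fun i _ => ?_
    rw [map_smul, smul_eq_mul, mul_comm]
    rfl
  rw [this]
  refine ContDiffAt.sum fun i _ => ContDiffAt.smul (hg.clm_apply contDiffAt_const) ?_
  exact (ContinuousLinearMap.contDiff (E := E [⋀^Fin k]→L[ℝ] F) (F := E [⋀^Fin k]→L[ℝ] ℝ)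
    (L i)).contDiffAt.comp x hf

end LeftInverse

/-- The infinitesimal generators, as a map between the model spaces. -/
def gen {E : Type*} [NormedAddCommGroup E] [NormedSpace ℝ E] (EG : Type*) [NormedAddCommGroup EG]
    [NormedSpace ℝ EG] (G : Type*) [TopologicalSpace G] [ChartedSpace EG G] [Group G]
    {X : Type*} [TopologicalSpace X] [ChartedSpace E X] [MulAction G X] (x : X) : EG →L[ℝ] E :=
  infGen EG G x

theorem infGenInChart_apply {E : Type*} [NormedAddCommGroup E] [NormedSpace ℝ E]
    {X : Type*} [TopologicalSpace X] [ChartedSpace E X] [IsManifold 𝓘(ℝ, E) ∞ X]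
    {EG : Type*} [NormedAddCommGroup EG]
    [NormedSpace ℝ EG] {G : Type*} [TopologicalSpace G] [ChartedSpace EG G] [Group G]
    [MulAction G X] (x₀ : X) (y : E) (ξ : EG) :
    infGenInChart EG G x₀ y ξ = chartD x₀ ((extChartAt 𝓘(ℝ, E) x₀).symm y)
      (gen (E := E) EG G ((extChartAt 𝓘(ℝ, E) x₀).symm y) ξ) := rfl

theorem injective_gen {E : Type*} [NormedAddCommGroup E] [NormedSpace ℝ E]
    {X : Type*} [TopologicalSpace X] [ChartedSpace E X] [IsManifold 𝓘(ℝ, E) ∞ X]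
    {EG : Type*} [NormedAddCommGroup EG] [NormedSpace ℝ EG] [FiniteDimensional ℝ EG]
    {G : Type*} [TopologicalSpace G] [ChartedSpace EG G] [Group G] [LieGroup 𝓘(ℝ, EG) ∞ G]
    [MulAction G X] [ContMDiffSMul 𝓘(ℝ, EG) 𝓘(ℝ, E) ∞ G X]
    (hfree : ∀ (g : G) (x : X), g • x = x → g = 1) (x : X) :
    Function.Injective (gen (E := E) EG G x) := injective_infGen hfree x

namespace NonholonomicSystem

/-! ### Invariance of Θ_𝓜, Ω_𝓜 and 𝓒 under the lifted action. -/

section Invariance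

variable {E : Type*} [NormedAddCommGroup E] [NormedSpace ℝ E] [FiniteDimensional ℝ E]
  {Q : Type*} [TopologicalSpace Q] [ChartedSpace E Q] [IsManifold 𝓘(ℝ, E) ∞ Q]
  {G : Type*} [TopologicalSpace G] [Group G] [MulAction G Q]
  {S : NonholonomicSystem E Q} [S.IsSymmetry G]
  {EM : Type*} [NormedAddCommGroup EM] [NormedSpace ℝ EM] [ChartedSpace EM S.M]
  [IsManifold 𝓘(ℝ, EM) ∞ S.M]

variable (EM) in
/-- The derivative of the action of `g` on `𝓜`. -/
def actMD {G : Type*} [Group G] [MulAction G Q] [S.IsSymmetry G] (g : G) (m : S.M) : EM →L[ℝ] EM :=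
  tangentD 𝓘(ℝ, EM) 𝓘(ℝ, EM) (fun m : S.M => g • m) m

theorem contMDiff_smul_M (EG : Type*) [NormedAddCommGroup EG] [NormedSpace ℝ EG]
    [ChartedSpace EG G] [LieGroup 𝓘(ℝ, EG) ∞ G] [ContMDiffSMul 𝓘(ℝ, EG) 𝓘(ℝ, E) ∞ G Q]
    (hemb : S.IsEmbeddedM EM) (g : G) :
    ContMDiff 𝓘(ℝ, EM) 𝓘(ℝ, EM) ∞ (fun m : S.M => g • m) := by
  have h := contMDiffSMul_M (G := G) EG hemb
  exact contMDiff_smul_const (E := EM) EG g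

theorem mdifferentiableAt_tau (hemb : S.IsEmbeddedM EM) (m : S.M) :
    MDifferentiableAt 𝓘(ℝ, EM) 𝓘(ℝ, E) S.tau m :=
  (contMDiff_tau hemb).contMDiffAt.mdifferentiableAt (by simp)

end Invariance

section Invariance

variable {E : Type*} [NormedAddCommGroup E] [NormedSpace ℝ E] [FiniteDimensional ℝ E]
  {Q : Type*} [TopologicalSpace Q] [ChartedSpace E Q] [IsManifold 𝓘(ℝ, E) ∞ Q]
  {G : Type*} [Group G] [MulAction G Q]
  {S : NonholonomicSystem E Q} [S.IsSymmetry G]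
  {EM : Type*} [NormedAddCommGroup EM] [NormedSpace ℝ EM] [ChartedSpace EM S.M]
  [IsManifold 𝓘(ℝ, EM) ∞ S.M]

theorem tauD_actMD (hemb : S.IsEmbeddedM EM)
    (hact : ∀ g : G, ContMDiff 𝓘(ℝ, EM) 𝓘(ℝ, EM) ∞ (fun m : S.M => g • m)) (g : G) (m : S.M)
    (v : EM) : tauD EM (g • m) (actMD EM g m v) = actD E g (S.tau m) (tauD EM m v) := by
  have h1 := tangentD_comp_apply (g := S.tau) (f := fun m : S.M => g • m) (x := m)
    (mdifferentiableAt_tau hemb _) ((hact g).contMDiffAt.mdifferentiableAt (by simp)) v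
  have h2 := tangentD_comp_apply (g := fun q : Q => g • q) (f := S.tau) (x := m)
    (S.mdiff_smul g _) (mdifferentiableAt_tau hemb m) v
  exact h1.symm.trans h2

theorem actMD_inv_actMD
    (hact : ∀ g : G, ContMDiff 𝓘(ℝ, EM) 𝓘(ℝ, EM) ∞ (fun m : S.M => g • m)) (g : G) (m : S.M)
    (v : EM) : actMD EM g⁻¹ (g • m) (actMD EM g m v) = v := by
  have h1 := tangentD_comp_apply (g := fun m : S.M => g⁻¹ • m) (f := fun m : S.M => g • m) (x := m)
    ((hact g⁻¹).contMDiffAt.mdifferentiableAt (by simp))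
    ((hact g).contMDiffAt.mdifferentiableAt (by simp)) v
  simp only [inv_smul_smul] at h1
  rw [tangentD_id] at h1
  exact h1.symm

theorem actMD_actMD_inv
    (hact : ∀ g : G, ContMDiff 𝓘(ℝ, EM) 𝓘(ℝ, EM) ∞ (fun m : S.M => g • m)) (g : G) (m : S.M)
    (v : EM) : actMD EM g m (actMD EM g⁻¹ (g • m) v) = v := by
  have h := actMD_inv_actMD hact g⁻¹ (g • m) v
  rwa [inv_inv, inv_smul_smul] at h

theorem thetaM_smul (hemb : S.IsEmbeddedM EM)
    (hact : ∀ g : G, ContMDiff 𝓘(ℝ, EM) 𝓘(ℝ, EM) ∞ (fun m : S.M => g • m)) (g : G) (m : S.M)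
    (v : EM) : (S.thetaM EM).val (g • m) ![actMD EM g m v] = (S.thetaM EM).val m ![v] := by
  rw [thetaM_val hemb, thetaM_val hemb, tauD_actMD hemb hact, mom_smul,
    ContinuousLinearMap.comp_apply, S.actD_inv_actD]

theorem omegaM_smul (hemb : S.IsEmbeddedM EM)
    (hact : ∀ g : G, ContMDiff 𝓘(ℝ, EM) 𝓘(ℝ, EM) ∞ (fun m : S.M => g • m)) (g : G) (m : S.M)
    (u v : EM) : (S.omegaM EM).val (g • m) ![actMD EM g m u, actMD EM g m v] =
      (S.omegaM EM).val m ![u, v] := by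
  have h1 : DForm.pullback 𝓘(ℝ, EM) 𝓘(ℝ, EM) (fun m : S.M => g • m) (S.thetaM EM) = S.thetaM EM := by
    funext m
    refine DForm.ext_val fun v => ?_
    have e : v = ![v 0] := by funext i; fin_cases i; rfl
    rw [e, DForm.pullback_val_one]
    exact thetaM_smul hemb hact g m (v 0)
  have h2 := DForm.d_pullback (x := m) (hact g).contMDiffAt ((isSmooth_thetaM hemb).smoothAt (g • m))
  rw [h1] at h2
  have h3 : (DForm.d 𝓘(ℝ, EM) (S.thetaM EM)).val m ![u, v] =
      (DForm.pullback 𝓘(ℝ, EM) 𝓘(ℝ, EM) (fun m : S.M => g • m)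
        (DForm.d 𝓘(ℝ, EM) (S.thetaM EM))).val m ![u, v] :=
    DFunLike.congr_fun (F := EM [⋀^Fin 2]→L[ℝ] ℝ) h2 _
  rw [DForm.pullback_val_two] at h3
  rw [omegaM_eq hemb]
  change -((DForm.d 𝓘(ℝ, EM) (S.thetaM EM)).val (g • m) ![actMD EM g m u, actMD EM g m v]) =
    -((DForm.d 𝓘(ℝ, EM) (S.thetaM EM)).val m ![u, v])
  rw [h3]
  rfl

variable (S EM) in
/-- The distribution `𝓒`, with values in the subspaces of the model space. -/
def cM (m : S.M) : Submodule ℝ EM := S.distC EM m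

theorem mem_cM {m : S.M} {v : EM} : v ∈ cM S EM m ↔ tauD EM m v ∈ S.distD (S.tau m) := Iff.rfl

theorem actMD_mem_cM (hemb : S.IsEmbeddedM EM)
    (hact : ∀ g : G, ContMDiff 𝓘(ℝ, EM) 𝓘(ℝ, EM) ∞ (fun m : S.M => g • m)) (g : G) {m : S.M}
    {v : EM} (hv : v ∈ cM S EM m) : actMD EM g m v ∈ cM S EM (g • m) := by
  rw [mem_cM, tauD_actMD hemb hact]
  exact S.actD_mem_distD g (mem_cM.1 hv)

end Invariance

/-! ### The connection form on Q induced by the splitting D ⊕ W. -/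

section Connection

variable {E : Type*} [NormedAddCommGroup E] [NormedSpace ℝ E] [FiniteDimensional ℝ E]
  {Q : Type*} [TopologicalSpace Q] [ChartedSpace E Q] [IsManifold 𝓘(ℝ, E) ∞ Q]
  {EG : Type*} [NormedAddCommGroup EG] [NormedSpace ℝ EG] [FiniteDimensional ℝ EG]
  {G : Type*} [TopologicalSpace G] [ChartedSpace EG G] [Group G] [LieGroup 𝓘(ℝ, EG) ∞ G]
  [MulAction G Q] [ContMDiffSMul 𝓘(ℝ, EG) 𝓘(ℝ, E) ∞ G Q]
  {S : NonholonomicSystem E Q}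
  {W : ∀ q : Q, Submodule ℝ (TangentSpace 𝓘(ℝ, E) q)} {P : Q → E →L[ℝ] E}

variable (EG G) in
/-- The `𝔤`-valued form on `Q` with `(A_Q(v))_Q = v - P v`. -/
def connQ (P : Q → E →L[ℝ] E) (q : Q) : E →L[ℝ] EG :=
  (leftInv (gen (E := E) EG G q)).comp (ContinuousLinearMap.id ℝ E - P q)

/-- Since W is vertical, v - P v is a generator, and on generators `leftInv` is a genuine inverse.
Off their range its value depends on the auxiliary inner product. -/
theorem gen_connQ (hfree : ∀ (g : G) (q : Q), g • q = q → g = 1)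
    (hW : S.IsVerticalComplement EG G W) (hP : S.IsProjection W P) (q : Q) (v : E) :
    gen EG G q (connQ EG G P q v) = v - P q v := by
  obtain ⟨ξ, hξ⟩ := hW.vertical q _ (hP.sub_mem q v)
  have h1 : gen (E := E) EG G q ξ = v - P q v := hξ
  have h2 : connQ EG G P q v = leftInv (gen (E := E) EG G q) (v - P q v) := rfl
  rw [h2, ← h1, leftInv_apply (injective_gen hfree q)]

variable (EG G) in
/-- The form `connQ` as a differential form. -/
def connFormQ (P : Q → E →L[ℝ] E) : DForm 𝓘(ℝ, E) Q 1 EG := fun q =>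
  ContinuousAlternatingMap.ofSubsingleton ℝ E EG (0 : Fin 1) (connQ EG G P q)

theorem contDiffAt_ofSubsingleton {X F V : Type*} [NormedAddCommGroup X] [NormedSpace ℝ X]
    [NormedAddCommGroup F] [NormedSpace ℝ F] [NormedAddCommGroup V] [NormedSpace ℝ V]
    {n : WithTop ℕ∞} {f : X → F →L[ℝ] V} {x : X} (hf : ContDiffAt ℝ n f x) :
    ContDiffAt ℝ n (fun x => ContinuousAlternatingMap.ofSubsingleton ℝ F V (0 : Fin 1) (f x)) x :=
  (contDiff_ofSubsingleton contDiff_id).contDiffAt.comp x hf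

theorem isSmooth_connFormQ (hfree : ∀ (g : G) (q : Q), g • q = q → g = 1)
    (hW : S.IsVerticalComplement EG G W) (hP : S.IsProjection W P) :
    DForm.IsSmooth 𝓘(ℝ, E) (connFormQ EG G P) := by
  refine DForm.isSmooth_iff.2 fun q₀ => ?_
  set y₀ := extChartAt 𝓘(ℝ, E) q₀ q₀ with hy₀
  have hinj : ∀ y ∈ (extChartAt 𝓘(ℝ, E) q₀).target,
      Function.Injective (infGenInChart (E := E) EG G q₀ y) := fun y hy a b hab => by
    rw [infGenInChart_apply, infGenInChart_apply] at hab
    refine injective_gen (E := E) hfree ((extChartAt 𝓘(ℝ, E) q₀).symm y) ?_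
    have hs := (extChartAt 𝓘(ℝ, E) q₀).map_target hy
    rw [← chartSymmD_chartD (E := E) hs (gen (E := E) EG G ((extChartAt 𝓘(ℝ, E) q₀).symm y) a), hab,
      chartSymmD_chartD (E := E) hs]
  have hsm : ContDiffAt ℝ ∞ (fun y => (leftInv (infGenInChart (E := E) EG G q₀ y)).comp
      (ContinuousLinearMap.id ℝ E - projChart P q₀ y)) y₀ :=
    (ContDiffAt.leftInv (contDiffAt_infGenInChart (mem_extChartAt_target _))
      (hinj _ (mem_extChartAt_target _))).clm_comp
      (contDiffAt_const.sub (hP.contDiffAt_projChart q₀))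
  refine (contDiffAt_ofSubsingleton hsm).congr_of_eventuallyEq ?_
  filter_upwards [eventually_mem_extChartAt_target q₀] with y hy
  refine ContinuousAlternatingMap.ext fun v => ?_
  change connQ EG G P _ (chartSymmD q₀ y (v 0)) = leftInv (infGenInChart (E := E) EG G q₀ y)
    (v 0 - projChart P q₀ y (v 0))
  have hs := (extChartAt 𝓘(ℝ, E) q₀).map_target hy
  -- The left inverses built in the chart and at the point come from unrelated inner products, but
  -- they agree on the range of the generators, where the argument lies.
  have h1 : v 0 - projChart P q₀ y (v 0) = infGenInChart (E := E) EG G q₀ y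
      (connQ EG G P ((extChartAt 𝓘(ℝ, E) q₀).symm y) (chartSymmD q₀ y (v 0))) := by
    rw [infGenInChart_apply, gen_connQ hfree hW hP, map_sub]
    have h2 := chartD_chartSymmD (E := E) hs (v 0)
    rw [(extChartAt 𝓘(ℝ, E) q₀).right_inv hy] at h2
    rw [h2]
    rfl
  rw [h1, leftInv_apply (hinj y hy)]

end Connection

end NonholonomicSystem

/-! ### The connection and the curvature term on the constraint manifold -/

namespace NonholonomicSystem

section ConnectionM

variable {E : Type*} [NormedAddCommGroup E] [NormedSpace ℝ E] [FiniteDimensional ℝ E]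
  {Q : Type*} [TopologicalSpace Q] [ChartedSpace E Q] [IsManifold 𝓘(ℝ, E) ∞ Q]
  {EG : Type*} [NormedAddCommGroup EG] [NormedSpace ℝ EG] [FiniteDimensional ℝ EG]
  {G : Type*} [TopologicalSpace G] [ChartedSpace EG G] [Group G] [LieGroup 𝓘(ℝ, EG) ∞ G]
  [MulAction G Q] [ContMDiffSMul 𝓘(ℝ, EG) 𝓘(ℝ, E) ∞ G Q]
  {S : NonholonomicSystem E Q} [S.IsSymmetry G]
  {W : ∀ q : Q, Submodule ℝ (TangentSpace 𝓘(ℝ, E) q)} {P : Q → E →L[ℝ] E}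
  {EM : Type*} [NormedAddCommGroup EM] [NormedSpace ℝ EM] [ChartedSpace EM S.M]
  [IsManifold 𝓘(ℝ, EM) ∞ S.M] [ContMDiffSMul 𝓘(ℝ, EG) 𝓘(ℝ, EM) ∞ G S.M]

theorem free_M (hfree : ∀ (g : G) (q : Q), g • q = q → g = 1) (g : G) (m : S.M) (h : g • m = m) :
    g = 1 := hfree g (S.tau m) (congrArg S.tau h)

theorem isInducing_orbit_M [T2Space Q] [ProperSMul G Q] (hemb : S.IsEmbeddedM EM)
    (EG : Type*) [NormedAddCommGroup EG] [NormedSpace ℝ EG] [ChartedSpace EG G]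
    [ContMDiffSMul 𝓘(ℝ, EG) 𝓘(ℝ, EM) ∞ G S.M]
    (hfree : ∀ (g : G) (q : Q), g • q = q → g = 1) (m : S.M) :
    Topology.IsInducing (fun g : G => g • m) :=
  Topology.IsInducing.of_comp (g := S.tau)
    (contMDiff_smul_orbit (E := EM) (EG := EG) m).continuous (contMDiff_tau hemb).continuous
    (isInducing_orbit_of_properSMul hfree (S.tau m))

theorem tauD_gen (hemb : S.IsEmbeddedM EM) (m : S.M) (ξ : EG) :
    tauD EM m (gen EG G m ξ) = gen EG G (S.tau m) ξ := by
  have h := tangentD_comp_apply (g := S.tau) (f := fun g : G => g • m) (x := (1 : G))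
    (mdifferentiableAt_tau hemb _)
    ((contMDiff_smul_orbit (E := EM) (EG := EG) m).contMDiffAt.mdifferentiableAt (by simp)) ξ
  have h2 : tangentD 𝓘(ℝ, EM) 𝓘(ℝ, E) S.tau ((1 : G) • m) = tauD EM m := by
    rw [one_smul]; rfl
  rw [h2] at h
  exact h.symm

theorem mem_distW_gen (hemb : S.IsEmbeddedM EM) (m : S.M) (ξ : EG) :
    infGen EG G m ξ ∈ S.distW EM EG G W m ↔ (gen EG G (S.tau m) ξ : E) ∈
      (show Submodule ℝ E from W (S.tau m)) := by
  rw [← tauD_gen (EM := EM) hemb]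
  exact ⟨fun h => h.2, fun h => ⟨⟨ξ, rfl⟩, h⟩⟩

theorem IsProjection.apply_eq_zero (hP : S.IsProjection W P)
    (hc : ∀ q, IsCompl (S.D q) (W q)) {q : Q} {v : E} (hv : v ∈ (show Submodule ℝ E from W q)) :
    P q v = 0 := by
  refine Submodule.disjoint_def.1 (hc q).disjoint _ (hP.mem q v) ?_
  have h1 := Submodule.sub_mem (show Submodule ℝ E from W q) hv (hP.sub_mem q v)
  rw [sub_sub_cancel] at h1
  exact h1

theorem connQ_iff (hemb : S.IsEmbeddedM EM) (hfree : ∀ (g : G) (q : Q), g • q = q → g = 1)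
    (hW : S.IsVerticalComplement EG G W) (hP : S.IsProjection W P) (m : S.M) (v : EM) (ξ : EG) :
    connQ EG G P (S.tau m) (tauD EM m v) = ξ ↔
      ((gen EG G (S.tau m) ξ : E) ∈ (show Submodule ℝ E from W (S.tau m)) ∧
        tauD EM m v - gen EG G (S.tau m) ξ ∈ S.distD (S.tau m)) := by
  constructor
  · rintro rfl
    rw [gen_connQ hfree hW hP]
    refine ⟨hP.sub_mem _ _, ?_⟩
    rw [sub_sub_cancel]
    exact hP.mem _ _
  · rintro ⟨h1, h2⟩
    refine injective_gen (E := E) hfree (S.tau m) ?_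
    rw [gen_connQ hfree hW hP]
    have h3 := hP.apply_mem _ _ h2
    rw [map_sub, hP.apply_eq_zero hW.isCompl h1, sub_zero] at h3
    rw [h3, sub_sub_cancel]

/-- The witness is the connection on Q composed with Tτ: membership in 𝓒 depends only on Tτ, and so
does membership in 𝓦 for vectors of the form ξ_𝓜(m). -/
theorem connW_spec (hemb : S.IsEmbeddedM EM) (hfree : ∀ (g : G) (q : Q), g • q = q → g = 1)
    (hW : S.IsVerticalComplement EG G W) (hP : S.IsProjection W P) (m : S.M) :
    ∀ v ξ, S.connW EM EG G W m v = ξ ↔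
      (infGen EG G m ξ ∈ S.distW EM EG G W m ∧ v - infGen EG G m ξ ∈ S.distC EM m) := by
  have hex : ∃ A : TangentSpace 𝓘(ℝ, EM) m →L[ℝ] EG, ∀ v ξ, A v = ξ ↔
      (infGen EG G m ξ ∈ S.distW EM EG G W m ∧ v - infGen EG G m ξ ∈ S.distC EM m) := by
    refine ⟨(connQ EG G P (S.tau m)).comp (tauD EM m), fun v ξ => ?_⟩
    rw [mem_distW_gen hemb]
    refine (connQ_iff hemb hfree hW hP m v ξ).trans (and_congr_right fun _ => ?_)
    have h : tauD EM m ((show EM from v) - gen EG G m ξ) =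
        tauD EM m v - gen EG G (S.tau m) ξ := by rw [map_sub, tauD_gen hemb]
    rw [← h]
    exact mem_distC_iff.symm
  have h : S.connW EM EG G W m = hex.choose := dif_pos hex
  rw [h]
  exact hex.choose_spec

variable (EM EG G W) in
/-- The connection `𝓐_𝓦`, as a map between the model spaces. -/
def connM (m : S.M) : EM →L[ℝ] EG := S.connW EM EG G W m

theorem connM_eq (hemb : S.IsEmbeddedM EM) (hfree : ∀ (g : G) (q : Q), g • q = q → g = 1)
    (hW : S.IsVerticalComplement EG G W) (hP : S.IsProjection W P) (m : S.M) (v : EM) :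
    connM EG G W EM m v = connQ EG G P (S.tau m) (tauD EM m v) := by
  refine (connW_spec hemb hfree hW hP m v _).2 ?_
  rw [mem_distW_gen hemb]
  obtain ⟨h1, h2⟩ := (connQ_iff hemb hfree hW hP m v _).1 rfl
  refine ⟨h1, ?_⟩
  rw [← tauD_gen hemb, ← map_sub] at h2
  exact h2

variable (S EM EG G W) in
/-- The connection as a differential form. -/
def connForm : DForm 𝓘(ℝ, EM) S.M 1 EG := fun m =>
  ContinuousAlternatingMap.ofSubsingleton ℝ _ EG (0 : Fin 1) (S.connW EM EG G W m)

theorem connForm_val (m : S.M) (v : EM) :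
    (connForm EG G S W EM).val m ![v] = connM EG G W EM m v := rfl

/-- Being a pullback from Q is the source of two facts: 𝓐_𝓦 is smooth, and d𝓐_𝓦 vanishes when one
argument is τ-vertical. -/
theorem connForm_eq (hemb : S.IsEmbeddedM EM) (hfree : ∀ (g : G) (q : Q), g • q = q → g = 1)
    (hW : S.IsVerticalComplement EG G W) (hP : S.IsProjection W P) :
    connForm EG G S W EM = DForm.pullback 𝓘(ℝ, EM) 𝓘(ℝ, E) S.tau (connFormQ EG G P) := by
  funext m
  refine DForm.ext_val fun v => ?_
  have e : v = ![v 0] := by funext i; fin_cases i; rfl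
  rw [e, DForm.pullback_val_one, connForm_val, connM_eq hemb hfree hW hP]
  rfl

theorem isSmooth_connForm (hemb : S.IsEmbeddedM EM) (hfree : ∀ (g : G) (q : Q), g • q = q → g = 1)
    (hW : S.IsVerticalComplement EG G W) (hP : S.IsProjection W P) :
    DForm.IsSmooth 𝓘(ℝ, EM) (connForm EG G S W EM) := by
  rw [connForm_eq hemb hfree hW hP]
  exact (isSmooth_connFormQ hfree hW hP).pullback (contMDiff_tau hemb)

theorem d_connForm_eq_zero (hemb : S.IsEmbeddedM EM)
    (hfree : ∀ (g : G) (q : Q), g • q = q → g = 1) (hW : S.IsVerticalComplement EG G W)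
    (hP : S.IsProjection W P) (m : S.M) {X : EM} (hX : tauD EM m X = 0) (Y : EM) :
    (DForm.d 𝓘(ℝ, EM) (connForm EG G S W EM)).val m ![X, Y] = 0 := by
  rw [connForm_eq hemb hfree hW hP]
  have h := DForm.d_pullback (x := m) (contMDiff_tau hemb).contMDiffAt
    ((isSmooth_connFormQ hfree hW hP).smoothAt (S.tau m))
  have h2 := DFunLike.congr_fun (F := EM [⋀^Fin 2]→L[ℝ] EG) h ![X, Y]
  refine h2.trans ((DForm.pullback_val_two _ _ _ _ _).trans ?_)
  have h3 : tangentD 𝓘(ℝ, EM) 𝓘(ℝ, E) S.tau m X = 0 := hX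
  rw [h3]
  exact ContinuousAlternatingMap.map_coord_zero (ι := Fin 2) (M := E) (N := EG)
    ((DForm.d 𝓘(ℝ, E) (connFormQ EG G P)).val (S.tau m)) (0 : Fin 2) rfl

variable (EM EG G W) in
/-- The projection onto `𝓒`, as a map of the model space. -/
def projM (m : S.M) : EM →L[ℝ] EM := S.projC EM EG G W m

theorem projM_apply (m : S.M) (v : EM) :
    projM EG G W EM m v = v - gen EG G m (connM EG G W EM m v) := rfl

theorem connM_eq_zero_iff (hemb : S.IsEmbeddedM EM)
    (hfree : ∀ (g : G) (q : Q), g • q = q → g = 1) (hW : S.IsVerticalComplement EG G W)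
    (hP : S.IsProjection W P) {m : S.M} {v : EM} :
    connM EG G W EM m v = 0 ↔ v ∈ cM S EM m := by
  refine (connW_spec hemb hfree hW hP m v 0).trans ?_
  have h0 : gen EG G m (0 : EG) = (0 : EM) := map_zero _
  have h1 : v - gen EG G m (0 : EG) = v := by rw [h0, sub_zero]
  refine Iff.trans (and_iff_right ?_) (iff_of_eq (congrArg (· ∈ cM S EM m) h1))
  exact (congrArg (· ∈ (show Submodule ℝ EM from S.distW EM EG G W m)) h0).mpr
    (Submodule.zero_mem _)

theorem gen_connM_mem (hemb : S.IsEmbeddedM EM) (hfree : ∀ (g : G) (q : Q), g • q = q → g = 1)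
    (hW : S.IsVerticalComplement EG G W) (hP : S.IsProjection W P) (m : S.M) (v : EM) :
    gen EG G m (connM EG G W EM m v) ∈ (show Submodule ℝ EM from S.distW EM EG G W m) :=
  ((connW_spec hemb hfree hW hP m v _).1 rfl).1

theorem projM_mem (hemb : S.IsEmbeddedM EM) (hfree : ∀ (g : G) (q : Q), g • q = q → g = 1)
    (hW : S.IsVerticalComplement EG G W) (hP : S.IsProjection W P) (m : S.M) (v : EM) :
    projM EG G W EM m v ∈ cM S EM m :=
  ((connW_spec hemb hfree hW hP m v _).1 rfl).2

theorem connM_gen (hemb : S.IsEmbeddedM EM) (hfree : ∀ (g : G) (q : Q), g • q = q → g = 1)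
    (hW : S.IsVerticalComplement EG G W) (hP : S.IsProjection W P) {m : S.M} {ξ : EG}
    (hξ : infGen EG G m ξ ∈ S.distW EM EG G W m) :
    connM EG G W EM m (gen EG G m ξ) = ξ := by
  refine (connW_spec hemb hfree hW hP m _ _).2 ⟨hξ, ?_⟩
  have h : (infGen EG G m ξ : TangentSpace 𝓘(ℝ, EM) m) - infGen EG G m ξ = 0 := sub_self _
  exact (congrArg (· ∈ S.distC EM m) h).mpr (Submodule.zero_mem _)

theorem projM_apply_mem (hemb : S.IsEmbeddedM EM) (hfree : ∀ (g : G) (q : Q), g • q = q → g = 1)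
    (hW : S.IsVerticalComplement EG G W) (hP : S.IsProjection W P) {m : S.M} {v : EM}
    (hv : v ∈ cM S EM m) : projM EG G W EM m v = v := by
  rw [projM_apply, (connM_eq_zero_iff hemb hfree hW hP).2 hv, map_zero, sub_zero]

theorem contDiffAt_connM_inChart (hemb : S.IsEmbeddedM EM)
    (hfree : ∀ (g : G) (q : Q), g • q = q → g = 1) (hW : S.IsVerticalComplement EG G W)
    (hP : S.IsProjection W P) [FiniteDimensional ℝ EM] {x₀ : S.M} {y : EM}
    (hy : y ∈ (extChartAt 𝓘(ℝ, EM) x₀).target) :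
    ContDiffAt ℝ ∞ (fun y => (connM EG G W EM ((extChartAt 𝓘(ℝ, EM) x₀).symm y)).comp
      (chartSymmD x₀ y)) y := by
  have h := (isSmooth_connForm hemb hfree hW hP x₀).contDiffAt
    ((isOpen_extChartAt_target (I := 𝓘(ℝ, EM)) x₀).mem_nhds hy)
  refine contDiffAt_clm_of_apply fun u => ?_
  exact (ContinuousAlternatingMap.apply ℝ EM EG ![u]).contDiff.contDiffAt.comp y h

theorem endoInChart_projM {x₀ : S.M} {y : EM} (hy : y ∈ (extChartAt 𝓘(ℝ, EM) x₀).target) (u : EM) :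
    endoInChart (projM EG G W EM) x₀ y u = u - infGenInChart (E := EM) EG G x₀ y
      (connM EG G W EM ((extChartAt 𝓘(ℝ, EM) x₀).symm y) (chartSymmD x₀ y u)) := by
  have h3 := chartD_chartSymmD (E := EM) ((extChartAt 𝓘(ℝ, EM) x₀).map_target hy) u
  rw [(extChartAt 𝓘(ℝ, EM) x₀).right_inv hy] at h3
  change chartD x₀ _ (projM EG G W EM ((extChartAt 𝓘(ℝ, EM) x₀).symm y) (chartSymmD x₀ y u)) = _
  rw [projM_apply, map_sub, h3, infGenInChart_apply]

theorem chartSymmD_endoInChart_projM {x₀ : S.M} {y : EM}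
    (hy : y ∈ (extChartAt 𝓘(ℝ, EM) x₀).target) (u : EM) :
    chartSymmD x₀ y (endoInChart (projM EG G W EM) x₀ y u) =
      projM EG G W EM ((extChartAt 𝓘(ℝ, EM) x₀).symm y) (chartSymmD x₀ y u) := by
  have h := chartSymmD_chartD (E := EM) ((extChartAt 𝓘(ℝ, EM) x₀).map_target hy)
    (projM EG G W EM ((extChartAt 𝓘(ℝ, EM) x₀).symm y) (chartSymmD x₀ y u))
  rwa [(extChartAt 𝓘(ℝ, EM) x₀).right_inv hy] at h

theorem contDiffAt_projM_inChart (hemb : S.IsEmbeddedM EM)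
    (hfree : ∀ (g : G) (q : Q), g • q = q → g = 1) (hW : S.IsVerticalComplement EG G W)
    (hP : S.IsProjection W P) [FiniteDimensional ℝ EM] {x₀ : S.M} {y : EM}
    (hy : y ∈ (extChartAt 𝓘(ℝ, EM) x₀).target) :
    ContDiffAt ℝ ∞ (endoInChart (projM EG G W EM) x₀) y := by
  have h1 := contDiffAt_connM_inChart hemb hfree hW hP hy
  have h2 := contDiffAt_infGenInChart (E := EM) (EG := EG) (G := G) hy
  refine (((contDiffAt_const (c := ContinuousLinearMap.id ℝ EM)).sub
    (h2.clm_comp h1))).congr_of_eventuallyEq ?_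
  filter_upwards [(isOpen_extChartAt_target (I := 𝓘(ℝ, EM)) x₀).mem_nhds hy] with z hz
  exact ContinuousLinearMap.ext fun u => endoInChart_projM hz u

/-- The momentum map in terms of the Liouville form. -/
theorem momentum_apply (m : S.M) (ξ : EG) :
    S.momentum EM EG G m ξ = (S.thetaM EM).val m ![gen EG G m ξ] := by
  have e : (![gen EG G m ξ] : Fin 1 → EM) = fun _ => gen EG G m ξ := by
    funext i; fin_cases i; rfl
  rw [e]
  rfl

theorem formJK_val (m : S.M) (u v : EM) : (S.formJK EM EG G W).val m ![u, v] =
    S.momentum EM EG G m ((DForm.d 𝓘(ℝ, EM) (connForm EG G S W EM)).val m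
      ![projM EG G W EM m u, projM EG G W EM m v]) := by
  rw [← comp_cons_two (projM EG G W EM m) u v]
  rfl

/-- A τ-vertical vector lies in 𝓒, so P_𝓒 fixes it, and then d𝓐_𝓦 annihilates it. This semibasicity
makes the gauge transformation by -⟨𝓙, 𝓚_𝓦⟩ defined. -/
theorem formJK_eq_zero (hemb : S.IsEmbeddedM EM)
    (hfree : ∀ (g : G) (q : Q), g • q = q → g = 1) (hW : S.IsVerticalComplement EG G W)
    (hP : S.IsProjection W P) (m : S.M) {X : EM} (hX : tauD EM m X = 0) (Y : EM) :
    (S.formJK EM EG G W).val m ![X, Y] = 0 := by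
  have hXC : X ∈ cM S EM m := by rw [mem_cM, hX]; exact Submodule.zero_mem _
  rw [formJK_val, projM_apply_mem hemb hfree hW hP hXC, d_connForm_eq_zero hemb hfree hW hP m hX]
  exact map_zero _

theorem formJK_gen_connM (hemb : S.IsEmbeddedM EM)
    (hfree : ∀ (g : G) (q : Q), g • q = q → g = 1) (hW : S.IsVerticalComplement EG G W)
    (hP : S.IsProjection W P) {m : S.M} {ξ : EG}
    (hξ : infGen EG G m ξ ∈ S.distW EM EG G W m) (Y : EM) :
    (S.formJK EM EG G W).val m ![gen EG G m ξ, Y] = 0 := by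
  have h : projM EG G W EM m (gen EG G m ξ) = 0 := by
    rw [projM_apply, connM_gen hemb hfree hW hP hξ, sub_self]
  rw [formJK_val, h]
  have h2 : (DForm.d 𝓘(ℝ, EM) (connForm EG G S W EM)).val m ![0, projM EG G W EM m Y] = 0 :=
    ContinuousAlternatingMap.map_coord_zero (ι := Fin 2) (M := EM) (N := EG)
      ((DForm.d 𝓘(ℝ, EM) (connForm EG G S W EM)).val m) (0 : Fin 2) rfl
  rw [h2]
  exact map_zero _

theorem contMDiff_momentum_apply (hemb : S.IsEmbeddedM EM) (ξ : EG) :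
    ContMDiff 𝓘(ℝ, EM) 𝓘(ℝ, ℝ) ∞ (fun m : S.M => S.momentum EM EG G m ξ) := fun m =>
  (contMDiffAt_apply_infGen ((isSmooth_thetaM hemb).smoothAt m) ξ).congr_of_eventuallyEq
    (Filter.Eventually.of_forall fun m' => momentum_apply m' ξ)

theorem contDiffAt_momentum_inChart (hemb : S.IsEmbeddedM EM) {x₀ : S.M} {y : EM}
    (hy : y ∈ (extChartAt 𝓘(ℝ, EM) x₀).target) :
    ContDiffAt ℝ ∞ (fun z => (S.momentum EM EG G ((extChartAt 𝓘(ℝ, EM) x₀).symm z)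
      : EG →L[ℝ] ℝ)) y := by
  refine contDiffAt_clm_of_apply fun ξ => ?_
  have := (contMDiff_momentum_apply (G := G) hemb ξ).contMDiffAt.contDiffAt_comp_extChartAt_symm
    le_rfl ((extChartAt 𝓘(ℝ, EM) x₀).map_target hy)
  rwa [(extChartAt 𝓘(ℝ, EM) x₀).right_inv hy] at this

theorem isSmooth_formJK [FiniteDimensional ℝ EM] (hemb : S.IsEmbeddedM EM)
    (hfree : ∀ (g : G) (q : Q), g • q = q → g = 1) (hW : S.IsVerticalComplement EG G W)
    (hP : S.IsProjection W P) : DForm.IsSmooth 𝓘(ℝ, EM) (S.formJK EM EG G W) := by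
  intro x₀ y hy
  have hy' := (isOpen_extChartAt_target (I := 𝓘(ℝ, EM)) x₀).mem_nhds hy
  have h1 := contDiffAt_momentum_inChart (EG := EG) (G := G) hemb hy
  have h2 := (((isSmooth_connForm hemb hfree hW hP).d) x₀).contDiffAt hy'
  have h3 := contDiffAt_projM_inChart hemb hfree hW hP hy
  refine ((h1.compContinuousAlternatingMap (h2.alternating_comp h3)).congr_of_eventuallyEq
    ?_).contDiffWithinAt
  filter_upwards [hy'] with z hz
  refine ContinuousAlternatingMap.ext fun v => ?_
  change S.momentum EM EG G _ ((DForm.d 𝓘(ℝ, EM) (connForm EG G S W EM)).val _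
      (fun i => projM EG G W EM _ (chartSymmD x₀ z (v i)))) =
    S.momentum EM EG G _ ((DForm.d 𝓘(ℝ, EM) (connForm EG G S W EM)).val _
      (fun i => chartSymmD x₀ z (endoInChart (projM EG G W EM) x₀ z (v i))))
  simp only [chartSymmD_endoInChart_projM hz]

/-- `i_{ξ_𝓜} Ω_𝓜 = d⟨𝓙, ξ⟩`. -/
theorem omegaM_gen (hemb : S.IsEmbeddedM EM) (m : S.M) (ξ : EG) (v : EM) :
    (S.omegaM EM).val m ![gen EG G m ξ, v] =
      tangentD 𝓘(ℝ, EM) 𝓘(ℝ, ℝ) (fun m : S.M => S.momentum EM EG G m ξ) m v := by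
  have h := DForm.d_apply_infGen (E := EM) (G := G) ((isSmooth_thetaM hemb).smoothAt m) ξ v
    (fun g => thetaM_smul hemb (fun g => contMDiff_smul_const (E := EM) EG g) g m v)
  rw [omegaM_eq hemb]
  change -((DForm.d 𝓘(ℝ, EM) (S.thetaM EM)).val m ![gen EG G m ξ, v]) = _
  have h2 : (fun m : S.M => S.momentum EM EG G m ξ) =
      fun m => (S.thetaM EM).val m ![infGen (E := EM) EG G m ξ] :=
    funext fun m => momentum_apply m ξ
  rw [h2]
  exact neg_eq_iff_eq_neg.2 h

/-- `i_{ξ_𝓜} d𝓐_𝓦 = -d(𝓐_𝓦(ξ_𝓜))` on `𝓒`. -/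
theorem d_connForm_gen (hemb : S.IsEmbeddedM EM)
    (hfree : ∀ (g : G) (q : Q), g • q = q → g = 1) (hW : S.IsVerticalComplement EG G W)
    (hP : S.IsProjection W P) {m : S.M} (ξ : EG) {v : EM} (hv : v ∈ cM S EM m) :
    (DForm.d 𝓘(ℝ, EM) (connForm EG G S W EM)).val m ![gen EG G m ξ, v] =
      -tangentD 𝓘(ℝ, EM) 𝓘(ℝ, EG) (fun m : S.M => connM EG G W EM m (gen EG G m ξ)) m v := by
  refine DForm.d_apply_infGen (E := EM) (G := G) ((isSmooth_connForm hemb hfree hW hP).smoothAt m)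
    ξ v fun g => ?_
  -- Both sides vanish because 𝓒 is invariant, so no equivariance of 𝓐_𝓦 under the adjoint action
  -- has to be proved.
  change connM EG G W EM (g • m) (actMD EM g m v) = connM EG G W EM m v
  rw [(connM_eq_zero_iff hemb hfree hW hP).2 hv, (connM_eq_zero_iff hemb hfree hW hP).2
    (actMD_mem_cM hemb (fun g => contMDiff_smul_const (E := EM) EG g) g hv)]

/-- For a fixed ξ whose generator lies in 𝓦 everywhere, 𝓐_𝓦(ξ_𝓜) is the constant ξ, with zero
derivative. This is how vertical symmetry enters the Jacobi identity and the conservation law. -/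
theorem d_connForm_gen_eq_zero (hemb : S.IsEmbeddedM EM)
    (hfree : ∀ (g : G) (q : Q), g • q = q → g = 1) (hW : S.IsVerticalComplement EG G W)
    (hP : S.IsProjection W P) {m : S.M} {ξ : EG}
    (hξ : ∀ m : S.M, infGen EG G m ξ ∈ S.distW EM EG G W m) {v : EM} (hv : v ∈ cM S EM m) :
    (DForm.d 𝓘(ℝ, EM) (connForm EG G S W EM)).val m ![gen EG G m ξ, v] = 0 := by
  rw [d_connForm_gen hemb hfree hW hP ξ hv]
  have h : (fun m : S.M => connM EG G W EM m (gen EG G m ξ)) = fun _ => ξ :=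
    funext fun m => connM_gen hemb hfree hW hP (hξ m)
  rw [h, tangentD_const]
  exact neg_zero

end ConnectionM

end NonholonomicSystem

/-! ### The nonholonomic bivector, its gauge transformations and their reduction -/

theorem SharpField.isSharp_gauge {E : Type*} [NormedAddCommGroup E] [NormedSpace ℝ E]
    {M : Type*} [TopologicalSpace M] [ChartedSpace E M]
    {π : SharpField 𝓘(ℝ, E) M} {b : DForm 𝓘(ℝ, E) M 2 ℝ} {C : Submodule ℝ E}
    {w : E [⋀^Fin 2]→L[ℝ] ℝ} (hb : GaugeDefined 𝓘(ℝ, E) π b) {x : M}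
    (h : IsSharp C w (SharpField.val π x)) :
    IsSharp C (w - b.val x) (SharpField.val (π.gauge 𝓘(ℝ, E) b) x) := h.gauge (hb x)

theorem IsSharp.unique {E : Type*} [NormedAddCommGroup E] [NormedSpace ℝ E] {C : Submodule ℝ E}
    {w : E [⋀^Fin 2]→L[ℝ] ℝ} {P P' : (E →L[ℝ] ℝ) →L[ℝ] E} (h : IsSharp C w P)
    (h' : IsSharp C w P') : P = P' := by
  ext α
  rw [(h α (-P' α)).1 ((h' α (-P' α)).2 (neg_neg _).symm), neg_neg]

namespace NonholonomicSystem

section Reduction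

variable {E : Type*} [NormedAddCommGroup E] [NormedSpace ℝ E] [FiniteDimensional ℝ E]
  {Q : Type*} [TopologicalSpace Q] [ChartedSpace E Q] [IsManifold 𝓘(ℝ, E) ∞ Q]
  {EG : Type*} [NormedAddCommGroup EG] [NormedSpace ℝ EG] [FiniteDimensional ℝ EG]
  {G : Type*} [TopologicalSpace G] [ChartedSpace EG G] [Group G] [LieGroup 𝓘(ℝ, EG) ∞ G]
  [MulAction G Q] [ContMDiffSMul 𝓘(ℝ, EG) 𝓘(ℝ, E) ∞ G Q]
  {S : NonholonomicSystem E Q} [S.IsSymmetry G]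
  {W : ∀ q : Q, Submodule ℝ (TangentSpace 𝓘(ℝ, E) q)} {P : Q → E →L[ℝ] E}
  {EM : Type*} [NormedAddCommGroup EM] [NormedSpace ℝ EM] [FiniteDimensional ℝ EM]
  [ChartedSpace EM S.M] [IsManifold 𝓘(ℝ, EM) ∞ S.M] [ContMDiffSMul 𝓘(ℝ, EG) 𝓘(ℝ, EM) ∞ G S.M]

theorem isSharp_nhSharp (hemb : S.IsEmbeddedM EM) (hP : S.IsProjection W P) (m : S.M) :
    IsSharp (cM S EM m) ((S.omegaM EM).val m) ((S.nhSharp EM).val m) := by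
  have h0 := nondegOn_omegaM_sub hemb hP m 0 (fun _ _ _ => rfl)
  rw [sub_zero] at h0
  have hex : ∃ P : (TangentSpace 𝓘(ℝ, EM) m →L[ℝ] ℝ) →L[ℝ] TangentSpace 𝓘(ℝ, EM) m,
      ∀ α X, (X ∈ S.distC EM m ∧ ∀ Y ∈ S.distC EM m, S.omegaM EM m ![X, Y] = α Y) ↔ P α = -X :=
    exists_isSharp (E := EM) (C := cM S EM m) (w := (S.omegaM EM).val m) h0
  have h : S.nhSharp EM m = hex.choose := dif_pos hex
  have h2 := hex.choose_spec
  rw [← h] at h2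
  exact h2

theorem nhField_spec (hemb : S.IsEmbeddedM EM) (hP : S.IsProjection W P) (m : S.M) :
    S.nhField EM m ∈ S.distC EM m ∧ ∀ Y ∈ S.distC EM m,
      S.omegaM EM m ![S.nhField EM m, Y] = diffAt 𝓘(ℝ, EM) S.hamM m Y := by
  have h0 := isSharp_nhSharp hemb hP m
  have hex : ∃ X ∈ S.distC EM m, ∀ Y ∈ S.distC EM m,
      S.omegaM EM m ![X, Y] = diffAt 𝓘(ℝ, EM) S.hamM m Y :=
    ⟨-S.nhSharp EM m (diffAt 𝓘(ℝ, EM) S.hamM m), h0.neg_mem _, fun Y hY => h0.apply_eq _ hY⟩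
  have h : S.nhField EM m = hex.choose := dif_pos hex
  rw [h]
  exact hex.choose_spec

theorem gaugeDefined_nhSharp (hemb : S.IsEmbeddedM EM) (hP : S.IsProjection W P)
    {b : DForm 𝓘(ℝ, EM) S.M 2 ℝ}
    (hb : ∀ (m : S.M) X Y, tauD EM m X = 0 → b.val m ![X, Y] = 0) :
    GaugeDefined 𝓘(ℝ, EM) (S.nhSharp EM) b := fun m =>
  (isSharp_nhSharp hemb hP m).gauge_isInvertible (b := b.val m)
    (nondegOn_omegaM_sub hemb hP m _ (hb m))

variable (S EM) in
/-- The gauge transformation of the nonholonomic bivector. -/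
def nhGauge (b : DForm 𝓘(ℝ, EM) S.M 2 ℝ) : SharpField 𝓘(ℝ, EM) S.M :=
  (S.nhSharp EM).gauge 𝓘(ℝ, EM) b

theorem isSharp_nhGauge (hemb : S.IsEmbeddedM EM) (hP : S.IsProjection W P)
    {b : DForm 𝓘(ℝ, EM) S.M 2 ℝ} (hb : GaugeDefined 𝓘(ℝ, EM) (S.nhSharp EM) b) (m : S.M) :
    IsSharp (cM S EM m) ((S.omegaM EM).val m - b.val m) ((nhGauge S EM b).val m) :=
  SharpField.isSharp_gauge hb (isSharp_nhSharp hemb hP m)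

theorem smoothAt_nhGauge (hemb : S.IsEmbeddedM EM) (hfree : ∀ (g : G) (q : Q), g • q = q → g = 1)
    (hW : S.IsVerticalComplement EG G W) (hP : S.IsProjection W P)
    {b : DForm 𝓘(ℝ, EM) S.M 2 ℝ} (hb : GaugeDefined 𝓘(ℝ, EM) (S.nhSharp EM) b)
    (hbs : DForm.IsSmooth 𝓘(ℝ, EM) b) {x₀ : S.M} {y : EM}
    (hy : y ∈ (extChartAt 𝓘(ℝ, EM) x₀).target) :
    ContDiffAt ℝ ∞ ((nhGauge S EM b).inChart x₀) y :=
  SharpField.contDiffAt_inChart (C := S.distC EM) (w := S.omegaM EM + -b)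
    (p := projM EG G W EM) hy ((isSmooth_omegaM hemb).add hbs.neg)
    (contDiffAt_projM_inChart hemb hfree hW hP hy) (projM_mem hemb hfree hW hP)
    (fun _ _ hv => projM_apply_mem hemb hfree hW hP hv)
    (fun m => (congrArg (fun w => IsSharp (cM S EM m) w ((nhGauge S EM b).val m))
      (sub_eq_add_neg ((S.omegaM EM).val m) (b.val m))).mp (isSharp_nhGauge hemb hP hb m))

theorem val_smul_of_isInvariantForm {b : DForm 𝓘(ℝ, EM) S.M 2 ℝ} (hb : S.IsInvariantForm EM G b)
    (g : G) (m : S.M) (u v : EM) :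
    b.val (g • m) ![actMD EM g m u, actMD EM g m v] = b.val m ![u, v] := by
  have h : (DForm.pullback 𝓘(ℝ, EM) 𝓘(ℝ, EM) (fun m : S.M => g • m) b).val m = b.val m :=
    congrFun (hb g) m
  rw [← h, DForm.pullback_val_two]
  rfl

/-- The sharp map is determined by 𝓒, Ω_𝓜 and `b`, all three of which are invariant. -/
theorem nhGauge_smul (hemb : S.IsEmbeddedM EM) (hP : S.IsProjection W P)
    (hact : ∀ g : G, ContMDiff 𝓘(ℝ, EM) 𝓘(ℝ, EM) ∞ (fun m : S.M => g • m))
    {b : DForm 𝓘(ℝ, EM) S.M 2 ℝ} (hb : GaugeDefined 𝓘(ℝ, EM) (S.nhSharp EM) b)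
    (hbi : ∀ (g : G) (m : S.M) (u v : EM),
      b.val (g • m) ![actMD EM g m u, actMD EM g m v] = b.val m ![u, v])
    (g : G) (m : S.M) (α : EM →L[ℝ] ℝ) :
    actMD EM g m ((nhGauge S EM b).val m (α.comp (actMD EM g m))) =
      (nhGauge S EM b).val (g • m) α := by
  have h := isSharp_nhGauge hemb hP hb m
  set Z := (nhGauge S EM b).val m (α.comp (actMD EM g m)) with hZ
  have h1 : -Z ∈ cM S EM m := h.neg_mem _
  have h2 := (isSharp_nhGauge hemb hP hb (g • m) α (actMD EM g m (-Z))).1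
    ⟨actMD_mem_cM hemb hact g h1, fun Y hY => ?_⟩
  · rw [h2, map_neg, neg_neg]
  · have hY' : actMD EM g⁻¹ (g • m) Y ∈ cM S EM m := by
      have := actMD_mem_cM hemb hact g⁻¹ hY
      rwa [inv_smul_smul] at this
    have h3 := h.apply_eq (α.comp (actMD EM g m)) hY'
    have h4 := actMD_actMD_inv hact g m Y
    change (S.omegaM EM).val m ![-Z, actMD EM g⁻¹ (g • m) Y] -
      b.val m ![-Z, actMD EM g⁻¹ (g • m) Y] = α (actMD EM g m (actMD EM g⁻¹ (g • m) Y)) at h3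
    rw [h4, ← omegaM_smul hemb hact g, ← hbi g, h4] at h3
    exact h3

variable {EP : Type*} [NormedAddCommGroup EP] [NormedSpace ℝ EP]
  [ChartedSpace EP (S.Reduced G)] [IsManifold 𝓘(ℝ, EP) ∞ (S.Reduced G)]

variable (S G EM EP) in
/-- The derivative of the orbit projection. -/
def rhoD (m : S.M) : EM →L[ℝ] EP := tangentD 𝓘(ℝ, EM) 𝓘(ℝ, EP) (S.rho G) m

theorem surjective_rho : Function.Surjective (S.rho G) := Quotient.mk_surjective

theorem rho_smul (g : G) (m : S.M) : S.rho G (g • m) = S.rho G m :=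
  Quotient.sound ⟨g, rfl⟩

theorem exists_smul_eq_of_rho_eq {m m' : S.M} (h : S.rho G m' = S.rho G m) :
    ∃ g : G, g • m = m' := Quotient.exact h

theorem rhoD_actMD (hsub : Manifold.IsSubmersion 𝓘(ℝ, EM) 𝓘(ℝ, EP) ∞ (S.rho G))
    (hact : ∀ g : G, ContMDiff 𝓘(ℝ, EM) 𝓘(ℝ, EM) ∞ (fun m : S.M => g • m)) (g : G) (m : S.M)
    (v : EM) : rhoD G S EM EP (g • m) (actMD EM g m v) = rhoD G S EM EP m v := by
  have h := tangentD_comp_apply (g := S.rho G) (f := fun m : S.M => g • m) (x := m)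
    (hsub.isSubmersionAt (g • m)).mdifferentiableAt_self
    ((hact g).contMDiffAt.mdifferentiableAt (by simp)) v
  have h2 : (fun m : S.M => S.rho G (g • m)) = S.rho G := funext fun m => rho_smul g m
  rw [h2] at h
  exact h.symm

theorem exists_gen_eq_of_rhoD_eq_zero [T2Space Q] [ProperSMul G Q] (hemb : S.IsEmbeddedM EM)
    (hfree : ∀ (g : G) (q : Q), g • q = q → g = 1)
    (hsub : Manifold.IsSubmersion 𝓘(ℝ, EM) 𝓘(ℝ, EP) ∞ (S.rho G)) {m : S.M} {v : EM}
    (hv : rhoD G S EM EP m v = 0) : ∃ ξ : EG, gen EG G m ξ = v :=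
  exists_infGen_eq_of_tangentD_eq_zero (E := EM) (EG := EG) (free_M hfree)
    (hsub.isSubmersionAt m) (fun _ h => exists_smul_eq_of_rho_eq h)
    (isInducing_orbit_M hemb EG hfree m) hv

theorem exists_form_of_basic [T2Space Q] [ProperSMul G Q] (hemb : S.IsEmbeddedM EM)
    (hfree : ∀ (g : G) (q : Q), g • q = q → g = 1)
    (hsub : Manifold.IsSubmersion 𝓘(ℝ, EM) 𝓘(ℝ, EP) ∞ (S.rho G))
    (hact : ∀ g : G, ContMDiff 𝓘(ℝ, EM) 𝓘(ℝ, EM) ∞ (fun m : S.M => g • m))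
    {b : DForm 𝓘(ℝ, EM) S.M 2 ℝ} (hbs : DForm.IsSmooth 𝓘(ℝ, EM) b)
    (hbi : ∀ (g : G) (m : S.M) (u v : EM),
      b.val (g • m) ![actMD EM g m u, actMD EM g m v] = b.val m ![u, v])
    (hbv : ∀ (m : S.M) (ξ : EG) (v : EM), b.val m ![gen EG G m ξ, v] = 0) :
    ∃ BB : DForm 𝓘(ℝ, EP) (S.Reduced G) 2 ℝ, DForm.IsSmooth 𝓘(ℝ, EP) BB ∧
      DForm.pullback 𝓘(ℝ, EM) 𝓘(ℝ, EP) (S.rho G) BB = b := by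
  refine DForm.exists_descent hsub surjective_rho hbs fun m m' u v u' v' hm hu hv => ?_
  obtain ⟨g, rfl⟩ := exists_smul_eq_of_rho_eq hm.symm
  have key : ∀ a a' c : EM, tangentD 𝓘(ℝ, EM) 𝓘(ℝ, EP) (S.rho G) m a =
      tangentD 𝓘(ℝ, EM) 𝓘(ℝ, EP) (S.rho G) (g • m) a' →
      b.val (g • m) ![a', c] = b.val (g • m) ![actMD EM g m a, c] := by
    intro a a' c h
    -- Two lifts of one vector, moved to the same point, differ by an element of ker Tρ. That
    -- element is a generator, which `b` annihilates.
    have h1 : rhoD G S EM EP (g • m) (a' - actMD EM g m a) = 0 := by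
      rw [map_sub, rhoD_actMD hsub hact]
      exact sub_eq_zero.2 h.symm
    obtain ⟨ξ, hξ⟩ := exists_gen_eq_of_rhoD_eq_zero (EG := EG) hemb hfree hsub h1
    have h2 := hbv (g • m) ξ c
    rw [hξ, ← altFlat_apply, map_sub] at h2
    rw [← altFlat_apply, ← altFlat_apply]
    exact sub_eq_zero.1 h2
  rw [key u u' v' hu, two_form_swap (b.val (g • m)), key v v' _ hv,
    ← two_form_swap (b.val (g • m)), hbi]

theorem exists_reduction_nhGauge (hemb : S.IsEmbeddedM EM) (hP : S.IsProjection W P)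
    (hsub : Manifold.IsSubmersion 𝓘(ℝ, EM) 𝓘(ℝ, EP) ∞ (S.rho G))
    (hact : ∀ g : G, ContMDiff 𝓘(ℝ, EM) 𝓘(ℝ, EM) ∞ (fun m : S.M => g • m))
    {b : DForm 𝓘(ℝ, EM) S.M 2 ℝ} (hb : GaugeDefined 𝓘(ℝ, EM) (S.nhSharp EM) b)
    (hbi : ∀ (g : G) (m : S.M) (u v : EM),
      b.val (g • m) ![actMD EM g m u, actMD EM g m v] = b.val m ![u, v]) :
    ∃ Λ : SharpField 𝓘(ℝ, EP) (S.Reduced G),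
      IsReduction 𝓘(ℝ, EM) 𝓘(ℝ, EP) (S.rho G) (nhGauge S EM b) Λ := by
  refine exists_isReduction surjective_rho fun m m' α hm => ?_
  obtain ⟨g, rfl⟩ := exists_smul_eq_of_rho_eq hm.symm
  have h1 : (rhoD G S EM EP (g • m)).comp (actMD EM g m) = rhoD G S EM EP m :=
    ContinuousLinearMap.ext fun v => rhoD_actMD hsub hact g m v
  change rhoD G S EM EP m ((nhGauge S EM b).val m (α.comp (rhoD G S EM EP m))) =
    rhoD G S EM EP (g • m) ((nhGauge S EM b).val (g • m) (α.comp (rhoD G S EM EP (g • m))))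
  rw [← nhGauge_smul hemb hP hact hb hbi, rhoD_actMD hsub hact, ContinuousLinearMap.comp_assoc, h1]

theorem isBivectorField_of_isReduction (hemb : S.IsEmbeddedM EM)
    (hfree : ∀ (g : G) (q : Q), g • q = q → g = 1)
    (hW : S.IsVerticalComplement EG G W) (hP : S.IsProjection W P)
    (hsub : Manifold.IsSubmersion 𝓘(ℝ, EM) 𝓘(ℝ, EP) ∞ (S.rho G))
    {b : DForm 𝓘(ℝ, EM) S.M 2 ℝ} (hb : GaugeDefined 𝓘(ℝ, EM) (S.nhSharp EM) b)
    (hbs : DForm.IsSmooth 𝓘(ℝ, EM) b) {Λ : SharpField 𝓘(ℝ, EP) (S.Reduced G)}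
    (h : IsReduction 𝓘(ℝ, EM) 𝓘(ℝ, EP) (S.rho G) (nhGauge S EM b) Λ) :
    IsBivectorField 𝓘(ℝ, EP) Λ :=
  h.isBivectorField hsub surjective_rho (fun m => (isSharp_nhGauge hemb hP hb m).skew)
    fun m => SharpField.smoothAt_of_inChart (mem_extChartAt_source m)
      (smoothAt_nhGauge hemb hfree hW hP hb hbs (mem_extChartAt_target m))

/-- Gauging by -c and then by b + c leads to the pair (𝓒, Ω_𝓜 - b), as gauging by b does, and the
pair determines the sharp map. For c = ⟨𝓙, 𝓚_𝓦⟩ the second step uses a basic form, which is what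
descends. -/
theorem nhGauge_neg_add (hemb : S.IsEmbeddedM EM) (hP : S.IsProjection W P)
    {b c : DForm 𝓘(ℝ, EM) S.M 2 ℝ} (hb : GaugeDefined 𝓘(ℝ, EM) (S.nhSharp EM) b)
    (hc : GaugeDefined 𝓘(ℝ, EM) (S.nhSharp EM) (-c)) :
    GaugeDefined 𝓘(ℝ, EM) (nhGauge S EM (-c)) (b + c) ∧
      (nhGauge S EM (-c)).gauge 𝓘(ℝ, EM) (b + c) = nhGauge S EM b := by
  have h : ∀ m, (S.omegaM EM).val m - b.val m =
      (S.omegaM EM).val m - DForm.val (-c) m - DForm.val (b + c) m := fun m => by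
    change _ = (S.omegaM EM).val m - -c.val m - (b.val m + c.val m)
    abel
  have hg : GaugeDefined 𝓘(ℝ, EM) (nhGauge S EM (-c)) (b + c) := fun m => by
    have h1 := (isSharp_nhGauge hemb hP hb m).nondegOn
    rw [h m] at h1
    exact (isSharp_nhGauge hemb hP hc m).gauge_isInvertible h1
  refine ⟨hg, funext fun m => ?_⟩
  have h1 := SharpField.isSharp_gauge hg (isSharp_nhGauge hemb hP hc m)
  rw [← h m] at h1
  exact h1.unique (isSharp_nhGauge hemb hP hb m)

/-- Since i_{X_nh} b = 0, the same vector field solves the Hamiltonian equation for Ω_𝓜 - b on 𝓒. -/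
theorem nhGauge_diffAt_hamM (hemb : S.IsEmbeddedM EM) (hP : S.IsProjection W P)
    {b : DForm 𝓘(ℝ, EM) S.M 2 ℝ} (hb : GaugeDefined 𝓘(ℝ, EM) (S.nhSharp EM) b)
    (hX : ∀ m v, b m ![S.nhField EM m, v] = 0) (m : S.M) :
    nhGauge S EM b m (diffAt 𝓘(ℝ, EM) S.hamM m) = -S.nhField EM m := by
  obtain ⟨h1, h2⟩ := nhField_spec hemb hP m
  refine (isSharp_nhGauge hemb hP hb m _ _).1 ⟨h1, fun Y hY => ?_⟩
  exact (congrArg₂ (· - ·) (h2 Y hY) (hX m Y)).trans (sub_zero _)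

theorem exists_reduced_hamM (hemb : S.IsEmbeddedM EM)
    (hsub : Manifold.IsSubmersion 𝓘(ℝ, EM) 𝓘(ℝ, EP) ∞ (S.rho G)) :
    ∃ Hred : S.Reduced G → ℝ, ContMDiff 𝓘(ℝ, EP) 𝓘(ℝ, ℝ) ∞ Hred ∧
      ∀ m, Hred (S.rho G m) = S.hamM m := by
  refine ⟨Quotient.lift S.hamM fun m m' h => ?_, fun n => ?_, fun m => rfl⟩
  · obtain ⟨g, rfl⟩ := h
    exact hamM_smul g m'
  · obtain ⟨m, rfl⟩ := surjective_rho (S := S) (G := G) n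
    exact contMDiffAt_of_comp_submersion (hsub.isSubmersionAt m) (contMDiff_hamM hemb m)

theorem rhoD_nhField (hemb : S.IsEmbeddedM EM) (hP : S.IsProjection W P)
    (hsub : Manifold.IsSubmersion 𝓘(ℝ, EM) 𝓘(ℝ, EP) ∞ (S.rho G))
    {b : DForm 𝓘(ℝ, EM) S.M 2 ℝ} (hb : GaugeDefined 𝓘(ℝ, EM) (S.nhSharp EM) b)
    (hX : ∀ m v, b m ![S.nhField EM m, v] = 0) {π : SharpField 𝓘(ℝ, EP) (S.Reduced G)}
    (h : IsReduction 𝓘(ℝ, EM) 𝓘(ℝ, EP) (S.rho G) (nhGauge S EM b) π)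
    {Hred : S.Reduced G → ℝ} (hH : ContMDiff 𝓘(ℝ, EP) 𝓘(ℝ, ℝ) ∞ Hred)
    (hHM : ∀ m, Hred (S.rho G m) = S.hamM m) (m : S.M) :
    mfderiv 𝓘(ℝ, EM) 𝓘(ℝ, EP) (S.rho G) m (S.nhField EM m) =
      -π (S.rho G m) (diffAt 𝓘(ℝ, EP) Hred (S.rho G m)) := by
  have h1 : diffAt 𝓘(ℝ, EM) S.hamM m = (diffAt 𝓘(ℝ, EP) Hred (S.rho G m)).comp
      (mfderiv 𝓘(ℝ, EM) 𝓘(ℝ, EP) (S.rho G) m) := by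
    rw [← diffAt_comp (hsub.isSubmersionAt m).mdifferentiableAt_self
      (hH.contMDiffAt.mdifferentiableAt (by simp))]
    exact congrArg (fun f => diffAt 𝓘(ℝ, EM) f m) (funext hHM).symm
  rw [← h, ← h1, nhGauge_diffAt_hamM hemb hP hb hX]
  have h2 : rhoD G S EM EP m (-(show EM from S.nhField EM m)) =
      -rhoD G S EM EP m (S.nhField EM m) := map_neg _ _
  exact (neg_eq_iff_eq_neg.2 h2).symm

end Reduction

end NonholonomicSystem

/-! ### The Jacobi identity in a chart -/

section JacobiChart

open VectorField

variable {E : Type*} [NormedAddCommGroup E] [NormedSpace ℝ E]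
  {F : Type*} [NormedAddCommGroup F] [NormedSpace ℝ F]

theorem extDeriv_apply_vectorField_one {a : E → E [⋀^Fin 1]→L[ℝ] F} {x : E} {X Y : E → E}
    (ha : DifferentiableAt ℝ a x) (hX : DifferentiableAt ℝ X x) (hY : DifferentiableAt ℝ Y x) :
    extDeriv a x ![X x, Y x] = fderiv ℝ (fun y => a y ![Y y]) x (X x) -
      fderiv ℝ (fun y => a y ![X y]) x (Y x) - a x ![lieBracket ℝ X Y x] := by
  have h := extDeriv_apply_vectorField (V := ![X, Y]) ha (fun i => by fin_cases i <;> assumption)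
  have e : (fun i => (![X, Y] : Fin 2 → E → E) i x) = ![X x, Y x] := by
    funext i; fin_cases i <;> rfl
  have e0 : (fun y => a y (Fin.removeNth 0 (fun i => (![X, Y] : Fin 2 → E → E) i y))) =
      fun y => a y ![Y y] := by
    funext y; congr 1; funext i; fin_cases i; rfl
  have e1 : (fun y => a y (Fin.removeNth 1 (fun i => (![X, Y] : Fin 2 → E → E) i y))) =
      fun y => a y ![X y] := by
    funext y; congr 1; funext i; fin_cases i; rfl
  rw [e] at h
  rw [h, Fin.sum_univ_two, e0, e1]
  have e2 : Finset.Ici (0 : Fin 1) = {0} := rfl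
  have e4 : (Fin.removeNth (0 : Fin 1) (Fin.removeNth (0 : Fin 2) ![X x, Y x])) = ![] :=
    Subsingleton.elim _ _
  have e5 : (0 : Fin 1).castSucc = (0 : Fin 2) := rfl
  have e6 : (0 : Fin 1).succ = (1 : Fin 2) := rfl
  have e7 : (Finset.univ : Finset (Fin (0 + 1))) = {0} := rfl
  rw [e7, Finset.sum_singleton, e2, Finset.sum_singleton, e5, e4, e6]
  simp [sub_eq_add_neg]

theorem extDeriv_apply_vectorField_two {a : E → E [⋀^Fin 2]→L[ℝ] F} {x : E} {X Y Z : E → E}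
    (ha : DifferentiableAt ℝ a x) (hX : DifferentiableAt ℝ X x) (hY : DifferentiableAt ℝ Y x)
    (hZ : DifferentiableAt ℝ Z x) :
    extDeriv a x ![X x, Y x, Z x] = fderiv ℝ (fun y => a y ![Y y, Z y]) x (X x) -
      fderiv ℝ (fun y => a y ![X y, Z y]) x (Y x) + fderiv ℝ (fun y => a y ![X y, Y y]) x (Z x)
      - a x ![lieBracket ℝ X Y x, Z x] + a x ![lieBracket ℝ X Z x, Y x]
      - a x ![lieBracket ℝ Y Z x, X x] := by
  have h := extDeriv_apply_vectorField (V := ![X, Y, Z]) ha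
    (fun i => by fin_cases i <;> assumption)
  have e : (fun i => (![X, Y, Z] : Fin 3 → E → E) i x) = ![X x, Y x, Z x] := by
    funext i; fin_cases i <;> rfl
  have e0 : (fun y => a y (Fin.removeNth 0 (fun i => (![X, Y, Z] : Fin 3 → E → E) i y))) =
      fun y => a y ![Y y, Z y] := by
    funext y; congr 1; funext i; fin_cases i <;> rfl
  have e1 : (fun y => a y (Fin.removeNth 1 (fun i => (![X, Y, Z] : Fin 3 → E → E) i y))) =
      fun y => a y ![X y, Z y] := by
    funext y; congr 1; funext i; fin_cases i <;> rfl
  have e2 : (fun y => a y (Fin.removeNth 2 (fun i => (![X, Y, Z] : Fin 3 → E → E) i y))) =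
      fun y => a y ![X y, Y y] := by
    funext y; congr 1; funext i; fin_cases i <;> rfl
  rw [e] at h
  rw [h, Fin.sum_univ_three, e0, e1, e2]
  have e3 : Finset.Ici (0 : Fin 2) = {0, 1} := rfl
  have e4 : Finset.Ici (1 : Fin 2) = {1} := rfl
  have r1 : Fin.removeNth (0 : Fin 2) (Fin.removeNth (0 : Fin 3) ![X x, Y x, Z x]) = ![Z x] := by
    funext i; fin_cases i; rfl
  have r2 : Fin.removeNth (1 : Fin 2) (Fin.removeNth (0 : Fin 3) ![X x, Y x, Z x]) = ![Y x] := by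
    funext i; fin_cases i; rfl
  have r3 : Fin.removeNth (1 : Fin 2) (Fin.removeNth (1 : Fin 3) ![X x, Y x, Z x]) = ![X x] := by
    funext i; fin_cases i; rfl
  have c0 : (0 : Fin 2).castSucc = (0 : Fin 3) := rfl
  have c1 : (1 : Fin 2).castSucc = (1 : Fin 3) := rfl
  have c2 : (0 : Fin 2).succ = (1 : Fin 3) := rfl
  have c3 : (1 : Fin 2).succ = (2 : Fin 3) := rfl
  rw [Fin.sum_univ_two, e3, e4, Finset.sum_singleton, Finset.sum_pair zero_ne_one,
    c0, c1, c2, c3, r1, r2, r3]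
  simp only [Fin.val_zero, Fin.val_one, Fin.val_two, pow_zero, pow_one, one_smul, neg_smul,
    zero_add, add_zero, Matrix.cons_val_zero, Matrix.cons_val_one, Matrix.cons_val]
  norm_num
  abel

variable {g : Type*} [NormedAddCommGroup g] [NormedSpace ℝ g]

/-- The bracket acts on functions as a commutator: the second-derivative terms cancel by symmetry.
-/
theorem fderiv_fderiv_apply_lieBracket {f : E → ℝ} {x : E} {X Y : E → E}
    (hf : ContDiffAt ℝ ∞ f x) (hX : DifferentiableAt ℝ X x) (hY : DifferentiableAt ℝ Y x) :
    fderiv ℝ f x (lieBracket ℝ X Y x) = fderiv ℝ (fun y => fderiv ℝ f y (Y y)) x (X x) -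
      fderiv ℝ (fun y => fderiv ℝ f y (X y)) x (Y x) := by
  have hf' : DifferentiableAt ℝ (fderiv ℝ f) x :=
    (hf.fderiv_right (m := ∞) (by simp)).differentiableAt (by simp)
  have key : ∀ {V : E → E} (_ : DifferentiableAt ℝ V x) (u : E),
      fderiv ℝ (fun y => fderiv ℝ f y (V y)) x u =
        fderiv ℝ (fderiv ℝ f) x u (V x) + fderiv ℝ f x (fderiv ℝ V x u) := fun {V} hV u => by
    rw [fderiv_clm_apply hf' hV]
    simp [add_comm]
  have hsymm : IsSymmSndFDerivAt ℝ f x := hf.isSymmSndFDerivAt (by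
    simpa using minSmoothness_two_le)
  rw [key hY, key hX, hsymm (X x) (Y x), lieBracket, map_sub]
  abel

/-- The Jacobi identity for the vector fields of an almost symplectic distribution given as the
kernel of a connection, up to the differentials of the gauge 2-form and of the curvature term. -/
theorem jacobi_chart {x : E} {Ω b jk : E → E [⋀^Fin 2]→L[ℝ] ℝ} {a : E → E [⋀^Fin 1]→L[ℝ] g}
    {Z : g →L[ℝ] E} {J : E → g →L[ℝ] ℝ} {Pr : E → E →L[ℝ] E} {X : Fin 3 → E → E} {f : Fin 3 → E → ℝ}
    (hΩ : DifferentiableAt ℝ Ω x) (hb : DifferentiableAt ℝ b x) (hjk : DifferentiableAt ℝ jk x)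
    (ha : ContDiffAt ℝ ∞ a x) (hJ : DifferentiableAt ℝ J x)
    (hX : ∀ i, DifferentiableAt ℝ (X i) x) (hf : ∀ i, ContDiffAt ℝ ∞ (f i) x)
    (hdΩ : extDeriv Ω x = 0)
    (haX : ∀ i, ∀ᶠ y in 𝓝 x, a y ![X i y] = 0)
    (hXf : ∀ i, ∀ᶠ y in 𝓝 x, ∀ v, a y ![v] = 0 →
      Ω y ![X i y, v] - b y ![X i y, v] = fderiv ℝ (f i) y v)
    (hPr : ∀ᶠ y in 𝓝 x, ∀ v, a y ![v] = 0 → Pr y v = v)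
    (hPrx : ∀ v, Pr x v = v - Z (a x ![v]))
    (haZ : ∀ v, a x ![Z (a x ![v])] = a x ![v])
    (hfZ : ∀ i ξ, fderiv ℝ (f i) x (Z ξ) = 0)
    (hbZ : ∀ u v, b x ![Z (a x ![u]), v] = 0)
    (hΩZ : ∀ ξ v, Ω x ![Z ξ, v] = fderiv ℝ (fun y => J y ξ) x v)
    (hdaZ : ∀ u v, a x ![v] = 0 → extDeriv a x ![Z (a x ![u]), v] = 0)
    (hjkv : ∀ᶠ y in 𝓝 x, ∀ u v, jk y ![u, v] = J y (extDeriv a y ![Pr y u, Pr y v])) :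
    fderiv ℝ (fun y => fderiv ℝ (f 2) y (X 1 y)) x (X 0 x) +
      fderiv ℝ (fun y => fderiv ℝ (f 0) y (X 2 y)) x (X 1 x) +
      fderiv ℝ (fun y => fderiv ℝ (f 1) y (X 0 y)) x (X 2 x) =
      -(extDeriv b x ![X 0 x, X 1 x, X 2 x] + extDeriv jk x ![X 0 x, X 1 x, X 2 x]) := by
  have hda : DifferentiableAt ℝ (extDeriv a) x :=
    (contDiffAt_extDeriv ha).differentiableAt (by simp)
  have hda' : DifferentiableAt ℝ a x := ha.differentiableAt (by simp)
  -- the basic relations between the vector fields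
  have hanti : ∀ i j, ∀ᶠ y in 𝓝 x, Ω y ![X i y, X j y] =
      b y ![X i y, X j y] + fderiv ℝ (f i) y (X j y) := fun i j => by
    filter_upwards [hXf i, haX j] with y h1 h2
    rw [← h1 _ h2]; ring
  have hskew' : ∀ i j u, fderiv ℝ (fun y => fderiv ℝ (f i) y (X j y)) x u =
      -fderiv ℝ (fun y => fderiv ℝ (f j) y (X i y)) x u := fun i j u => by
    have h : (fun y => fderiv ℝ (f i) y (X j y)) =ᶠ[𝓝 x] -fun y => fderiv ℝ (f j) y (X i y) := by
      filter_upwards [hanti i j, hanti j i] with y h1 h2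
      rw [two_form_swap (Ω y), two_form_swap (b y)] at h1
      change _ = -fderiv ℝ (f j) y (X i y)
      linarith
    rw [h.fderiv_eq, fderiv_neg]
    rfl
  -- The fields lie in the kernel of `a`, so only the bracket term survives in the formula for `da`:
  -- the curvature measures how far the bracket leaves the kernel.
  have hAbr : ∀ i j, a x ![lieBracket ℝ (X i) (X j) x] = -extDeriv a x ![X i x, X j x] := by
    intro i j
    have h0 : ∀ k, fderiv ℝ (fun y => a y ![X k y]) x = 0 := fun k => by
      have h : (fun y => a y ![X k y]) =ᶠ[𝓝 x] fun _ => 0 := haX k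
      rw [h.fderiv_eq, fderiv_fun_const]; rfl
    rw [extDeriv_apply_vectorField_one hda' (hX i) (hX j), h0, h0]
    simp
  have hPrA : ∀ v, a x ![v - Z (a x ![v])] = 0 := fun v => by
    have h1 : ∀ u w : E, a x ![u - w] = a x ![u] - a x ![w] := fun u w => by
      have := (a x).toAlternatingMap.map_update_sub ![u] 0 u w
      simpa using this
    rw [h1, haZ, sub_self]
  have hadd : ∀ (c : E [⋀^Fin 2]→L[ℝ] ℝ) (u v w : E), c ![u - v, w] = c ![u, w] - c ![v, w] :=
    fun c u v w => by simp only [← altFlat_apply, map_sub]; rfl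
  have hadd' : ∀ (c : E [⋀^Fin 2]→L[ℝ] g) (u v w : E), c ![u - v, w] = c ![u, w] - c ![v, w] :=
    fun c u v w => by
      have := c.toAlternatingMap.map_update_sub ![u, w] 0 u v
      simpa using this
  -- the bracket terms
  have hbr : ∀ i j k, Ω x ![lieBracket ℝ (X i) (X j) x, X k x] -
      b x ![lieBracket ℝ (X i) (X j) x, X k x] =
      -(fderiv ℝ (fun y => fderiv ℝ (f k) y (X j y)) x (X i x) -
        fderiv ℝ (fun y => fderiv ℝ (f k) y (X i y)) x (X j x)) -
      fderiv ℝ (fun y => J y (extDeriv a x ![X i x, X j x])) x (X k x) := by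
    intro i j k
    rw [← fderiv_fderiv_apply_lieBracket (hf k) (hX i) (hX j)]
    set u := lieBracket ℝ (X i) (X j) x
    -- The bracket `u` is split as (u - Z a(u)) + Z a(u). The first part lies in the kernel and
    -- pairs with `X k` through `f k`, which is blind to `Z`. The second is invisible to `b` and
    -- enters `Ω` through the derivative of `J`.
    have h1 := (hXf k).self_of_nhds _ (hPrA u)
    rw [two_form_swap (Ω x), two_form_swap (b x), hadd, hadd, map_sub, hfZ, hbZ, hΩZ] at h1
    have h2 : fderiv ℝ (fun y => J y (a x ![u])) x (X k x) =
        -fderiv ℝ (fun y => J y (extDeriv a x ![X i x, X j x])) x (X k x) := by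
      rw [hAbr i j]
      simp only [map_neg]
      rw [fderiv_fun_neg]
      rfl
    rw [h2] at h1
    linarith
  -- The projection in the curvature term may be dropped even for the bracket, since `hdaZ` kills
  -- its vertical part.
  have hjkbr : ∀ i j k, jk x ![lieBracket ℝ (X i) (X j) x, X k x] =
      J x (extDeriv a x ![lieBracket ℝ (X i) (X j) x, X k x]) := by
    intro i j k
    rw [hjkv.self_of_nhds, hPrx, hPr.self_of_nhds _ (haX k).self_of_nhds, hadd',
      hdaZ _ _ (haX k).self_of_nhds, sub_zero]
  -- The product rule separates the derivative of `J`, with the curvature frozen at `x`, from the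
  -- derivative of the curvature paired with `J`.
  have hjkX : ∀ i j u, fderiv ℝ (fun y => jk y ![X i y, X j y]) x u =
      fderiv ℝ (fun y => J y (extDeriv a x ![X i x, X j x])) x u +
        J x (fderiv ℝ (fun y => extDeriv a y ![X i y, X j y]) x u) := by
    intro i j u
    have h : (fun y => jk y ![X i y, X j y]) =ᶠ[𝓝 x]
        fun y => J y (extDeriv a y ![X i y, X j y]) := by
      filter_upwards [hjkv, hPr, haX i, haX j] with y h1 h2 h3 h4
      rw [h1, h2 _ h3, h2 _ h4]
    have hd : DifferentiableAt ℝ (fun y => extDeriv a y ![X i y, X j y]) x := by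
      refine hda.continuousAlternatingMap_apply (fun k => ?_)
      fin_cases k
      · exact hX i
      · exact hX j
    rw [h.fderiv_eq, fderiv_clm_apply hJ hd, fderiv_clm_apply hJ (differentiableAt_const _)]
    simp [add_comm]
  -- Pairing d(da) = 0 with `J` cancels the terms of d(jk) in which the curvature is differentiated
  -- or takes a bracket. The derivatives of `J` that remain match those from the brackets in dΩ = 0.
  have hJbr := congrArg (J x) (congrArg (fun c => c ![X 0 x, X 1 x, X 2 x])
    (extDeriv_extDeriv_apply ha minSmoothness_two_le))
  have e1 := extDeriv_apply_vectorField_two hΩ (hX 0) (hX 1) (hX 2)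
  have e2 := extDeriv_apply_vectorField_two hb (hX 0) (hX 1) (hX 2)
  have e3 := extDeriv_apply_vectorField_two hjk (hX 0) (hX 1) (hX 2)
  have e4 := extDeriv_apply_vectorField_two hda (hX 0) (hX 1) (hX 2)
  have hΩb : ∀ i j u, fderiv ℝ (fun y => Ω y ![X i y, X j y]) x u =
      fderiv ℝ (fun y => b y ![X i y, X j y]) x u +
        fderiv ℝ (fun y => fderiv ℝ (f i) y (X j y)) x u := by
    intro i j u
    have h : (fun y => Ω y ![X i y, X j y]) =ᶠ[𝓝 x]
        fun y => b y ![X i y, X j y] + fderiv ℝ (f i) y (X j y) := hanti i j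
    rw [h.fderiv_eq, fderiv_fun_add]
    · rfl
    · refine hb.continuousAlternatingMap_apply (fun k => ?_)
      fin_cases k
      · exact hX i
      · exact hX j
    · exact (((hf i).fderiv_right (m := ∞) (by simp)).differentiableAt (by simp)).clm_apply (hX j)
  rw [e4] at hJbr
  simp only [ContinuousAlternatingMap.coe_zero, Pi.zero_apply, map_zero, map_sub, map_add] at hJbr
  rw [hdΩ, ContinuousAlternatingMap.coe_zero, Pi.zero_apply, hΩb, hΩb, hΩb] at e1
  rw [hjkX, hjkX, hjkX, hjkbr, hjkbr, hjkbr] at e3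
  have b1 := hbr 0 1 2
  have b2 := hbr 0 2 1
  have b3 := hbr 1 2 0
  have s1 := hskew' 2 0 (X 1 x)
  have s2 := hskew' 1 2 (X 0 x)
  have s3 := hskew' 0 1 (X 2 x)
  linarith

end JacobiChart

/-! ### The Jacobiator of the reduced bivectors -/

section JacobiatorGeneral

variable {E : Type*} [NormedAddCommGroup E] [NormedSpace ℝ E]
  {M : Type*} [TopologicalSpace M] [ChartedSpace E M] [IsManifold 𝓘(ℝ, E) ∞ M]
  {EP : Type*} [NormedAddCommGroup EP] [NormedSpace ℝ EP]
  {N : Type*} [TopologicalSpace N] [ChartedSpace EP N] [IsManifold 𝓘(ℝ, EP) ∞ N] {ρ : M → N}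

/-- The Hamiltonian vector field `-π♯(df)` in the chart at `x₀`. -/
def SharpField.hamInChart (π : SharpField 𝓘(ℝ, E) M) (x₀ : M) (f : M → ℝ) (y : E) : E :=
  -π.inChart x₀ y (fderiv ℝ (f ∘ (extChartAt 𝓘(ℝ, E) x₀).symm) y)

theorem SharpField.hamInChart_self (π : SharpField 𝓘(ℝ, E) M) {x : M} {f : M → ℝ}
    (hf : MDifferentiableAt 𝓘(ℝ, E) 𝓘(ℝ, ℝ) f x) :
    π.hamInChart x f (extChartAt 𝓘(ℝ, E) x x) =
      chartD (E := E) x x (-π.val x (diffAt 𝓘(ℝ, E) f x)) := by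
  have hx := mem_extChartAt_source (I := 𝓘(ℝ, E)) x
  unfold SharpField.hamInChart SharpField.inChart
  rw [(extChartAt 𝓘(ℝ, E) x).left_inv hx, map_neg, diffAt_eq_fderiv_comp hx hf]
  rfl

/-- With X_f = -π♯(df) each bracket is minus a derivative along a Hamiltonian field; the two signs
cancel, and {f, {g, h}} = X_f(X_g(h)). -/
theorem SharpField.bracket_bracket {π : SharpField 𝓘(ℝ, E) M} {x : M} {f g h : M → ℝ}
    (hπ : π.SmoothAt x) (hf : ContMDiffAt 𝓘(ℝ, E) 𝓘(ℝ, ℝ) ∞ f x)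
    (hg : ContMDiffAt 𝓘(ℝ, E) 𝓘(ℝ, ℝ) ∞ g x) (hh : ContMDiffAt 𝓘(ℝ, E) 𝓘(ℝ, ℝ) ∞ h x) :
    π.bracket 𝓘(ℝ, E) f (π.bracket 𝓘(ℝ, E) g h) x =
      fderiv ℝ (fun y => fderiv ℝ (h ∘ (extChartAt 𝓘(ℝ, E) x).symm) y (π.hamInChart x g y))
        (extChartAt 𝓘(ℝ, E) x x) (π.hamInChart x f (extChartAt 𝓘(ℝ, E) x x)) := by
  have hx := mem_extChartAt_source (I := 𝓘(ℝ, E)) x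
  have hx' := mem_extChartAt_target (I := 𝓘(ℝ, E)) x
  rw [(SharpField.bracket_eventuallyEq hx hf (hπ g h hg hh)).self_of_nhds]
  have h1 : π.bracket 𝓘(ℝ, E) g h ∘ (extChartAt 𝓘(ℝ, E) x).symm =ᶠ[𝓝 (extChartAt 𝓘(ℝ, E) x x)]
      -fun y => fderiv ℝ (h ∘ (extChartAt 𝓘(ℝ, E) x).symm) y (π.hamInChart x g y) := by
    have h2 := SharpField.bracket_eventuallyEq hx hg hh (π := π)
    filter_upwards [eventually_extChartAt_symm h2, (isOpen_extChartAt_target x).mem_nhds hx']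
      with y h3 h4
    rw [Function.comp_apply, h3, (extChartAt 𝓘(ℝ, E) x).right_inv h4]
    change _ = -(fderiv ℝ (h ∘ (extChartAt 𝓘(ℝ, E) x).symm) y (π.hamInChart x g y))
    rw [SharpField.hamInChart, map_neg, neg_neg]
  rw [h1.fderiv_eq, fderiv_neg, SharpField.hamInChart, map_neg]
  rfl

theorem IsReduction.bracket_bracket (hρ : Manifold.IsSubmersion 𝓘(ℝ, E) 𝓘(ℝ, EP) ∞ ρ)
    {π : SharpField 𝓘(ℝ, E) M} {Λ : SharpField 𝓘(ℝ, EP) N}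
    (hred : IsReduction 𝓘(ℝ, E) 𝓘(ℝ, EP) ρ π Λ) {m : M} (hsm : π.SmoothAt m) {f g h : N → ℝ}
    (hf : ContMDiff 𝓘(ℝ, EP) 𝓘(ℝ, ℝ) ∞ f) (hg : ContMDiff 𝓘(ℝ, EP) 𝓘(ℝ, ℝ) ∞ g)
    (hh : ContMDiff 𝓘(ℝ, EP) 𝓘(ℝ, ℝ) ∞ h) :
    Λ.bracket 𝓘(ℝ, EP) f (Λ.bracket 𝓘(ℝ, EP) g h) (ρ m) =
      π.bracket 𝓘(ℝ, E) (fun x => f (ρ x))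
        (π.bracket 𝓘(ℝ, E) (fun x => g (ρ x)) (fun x => h (ρ x))) m := by
  have hd := fun x => (hρ.isSubmersionAt x).mdifferentiableAt_self
  have h1 : (fun x => Λ.bracket 𝓘(ℝ, EP) g h (ρ x)) =
      π.bracket 𝓘(ℝ, E) (fun x => g (ρ x)) (fun x => h (ρ x)) := funext fun x =>
    hred.bracket (hd x) (hg.mdifferentiable (by simp) _) (hh.mdifferentiable (by simp) _)
  rw [hred.bracket (hd m) (hf.mdifferentiable (by simp) _)
    ((hred.smoothAt hρ hsm _ _ hg.contMDiffAt hh.contMDiffAt).mdifferentiableAt (by simp)), h1]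

theorem DForm.inChart_val {V : Type*} [NormedAddCommGroup V] [NormedSpace ℝ V] {k : ℕ}
    (α : DForm 𝓘(ℝ, E) M k V) (x₀ : M) (y : E) (v : Fin k → E) :
    DForm.inChart 𝓘(ℝ, E) α x₀ y v =
      α.val ((extChartAt 𝓘(ℝ, E) x₀).symm y) (fun i => chartSymmD (E := E) x₀ y (v i)) := rfl

theorem DForm.inChart_val_two {V : Type*} [NormedAddCommGroup V] [NormedSpace ℝ V]
    (α : DForm 𝓘(ℝ, E) M 2 V) (x₀ : M) (y : E) (u v : E) :
    DForm.inChart 𝓘(ℝ, E) α x₀ y ![u, v] =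
      α.val ((extChartAt 𝓘(ℝ, E) x₀).symm y) ![chartSymmD (E := E) x₀ y u,
        chartSymmD (E := E) x₀ y v] := by
  rw [DForm.inChart_val, comp_cons_two (chartSymmD (E := E) x₀ y)]

theorem DForm.inChart_val_one {V : Type*} [NormedAddCommGroup V] [NormedSpace ℝ V]
    (α : DForm 𝓘(ℝ, E) M 1 V) (x₀ : M) (y : E) (u : E) :
    DForm.inChart 𝓘(ℝ, E) α x₀ y ![u] =
      α.val ((extChartAt 𝓘(ℝ, E) x₀).symm y) ![chartSymmD (E := E) x₀ y u] := by
  rw [DForm.inChart_val, comp_cons_one (chartSymmD (E := E) x₀ y)]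

theorem DForm.d_val_three (α : DForm 𝓘(ℝ, E) M 2 ℝ) (x : M) (u v w : E) :
    (DForm.d 𝓘(ℝ, E) α).val x ![u, v, w] =
      extDeriv (DForm.inChart 𝓘(ℝ, E) α x) (extChartAt 𝓘(ℝ, E) x x)
        ![chartD (E := E) x x u, chartD (E := E) x x v, chartD (E := E) x x w] := by
  rw [← comp_cons_three (chartD (E := E) x x)]
  rfl

theorem extDeriv_inChart_of_d_eq_zero {α : DForm 𝓘(ℝ, E) M 2 ℝ} (hα : DForm.IsSmooth 𝓘(ℝ, E) α)
    (h : ∀ x, DForm.d 𝓘(ℝ, E) α x = 0) {x₀ : M} {y : E}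
    (hy : y ∈ (extChartAt 𝓘(ℝ, E) x₀).target) : extDeriv (DForm.inChart 𝓘(ℝ, E) α x₀) y = 0 := by
  rw [← DForm.inChart_d hy (hα.smoothAt _)]
  refine ContinuousAlternatingMap.ext fun v => ?_
  rw [DForm.inChart_val]
  exact DFunLike.congr_fun (F := E [⋀^Fin 3]→L[ℝ] ℝ) (h _) _

theorem DForm.d_neg {V : Type*} [NormedAddCommGroup V] [NormedSpace ℝ V] {k : ℕ}
    (α : DForm 𝓘(ℝ, E) M k V) : DForm.d 𝓘(ℝ, E) (-α) = -DForm.d 𝓘(ℝ, E) α := by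
  funext x
  -- Negation is treated as a scalar multiple, for which `d` is compatible without any
  -- differentiability assumption.
  have h : DForm.inChart 𝓘(ℝ, E) (-α) x = (-1 : ℝ) • DForm.inChart 𝓘(ℝ, E) α x := by
    funext y
    refine ContinuousAlternatingMap.ext fun v => ?_
    change -(DForm.inChart 𝓘(ℝ, E) α x y v) = (-1 : ℝ) • (DForm.inChart 𝓘(ℝ, E) α x y v)
    rw [neg_one_smul]
  refine DForm.ext_val fun v => ?_
  change extDeriv (DForm.inChart 𝓘(ℝ, E) (-α) x) _ _ =
    -(extDeriv (DForm.inChart 𝓘(ℝ, E) α x) _ _)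
  rw [h, extDeriv_smul]
  exact neg_one_smul ℝ _

theorem DForm.d_add {V : Type*} [NormedAddCommGroup V] [NormedSpace ℝ V] {k : ℕ}
    {α β : DForm 𝓘(ℝ, E) M k V} (hα : DForm.IsSmooth 𝓘(ℝ, E) α) (hβ : DForm.IsSmooth 𝓘(ℝ, E) β) :
    DForm.d 𝓘(ℝ, E) (α + β) = DForm.d 𝓘(ℝ, E) α + DForm.d 𝓘(ℝ, E) β := by
  funext x
  have hx := mem_extChartAt_target (I := 𝓘(ℝ, E)) x
  have h1 := ((hα.smoothAt _).contDiffAt_inChart hx).differentiableAt (by simp)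
  have h2 := ((hβ.smoothAt _).contDiffAt_inChart hx).differentiableAt (by simp)
  refine DForm.ext_val fun v => ?_
  change extDeriv (DForm.inChart 𝓘(ℝ, E) α x + DForm.inChart 𝓘(ℝ, E) β x) _ _ = _
  rw [extDeriv_add h1 h2]
  rfl

end JacobiatorGeneral

/-! ### The Jacobiator under the vertical-symmetry condition -/

namespace NonholonomicSystem

section VerticalSymmetry

variable {E : Type*} [NormedAddCommGroup E] [NormedSpace ℝ E] [FiniteDimensional ℝ E]
  {Q : Type*} [TopologicalSpace Q] [ChartedSpace E Q] [IsManifold 𝓘(ℝ, E) ∞ Q]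
  {EG : Type*} [NormedAddCommGroup EG] [NormedSpace ℝ EG] [FiniteDimensional ℝ EG]
  {G : Type*} [TopologicalSpace G] [ChartedSpace EG G] [Group G] [LieGroup 𝓘(ℝ, EG) ∞ G]
  [MulAction G Q] [ContMDiffSMul 𝓘(ℝ, EG) 𝓘(ℝ, E) ∞ G Q]
  {S : NonholonomicSystem E Q} [S.IsSymmetry G]
  {W : ∀ q : Q, Submodule ℝ (TangentSpace 𝓘(ℝ, E) q)} {P : Q → E →L[ℝ] E}
  {EM : Type*} [NormedAddCommGroup EM] [NormedSpace ℝ EM] [FiniteDimensional ℝ EM]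
  [ChartedSpace EM S.M] [IsManifold 𝓘(ℝ, EM) ∞ S.M] [ContMDiffSMul 𝓘(ℝ, EG) 𝓘(ℝ, EM) ∞ G S.M]
  {gW : Submodule ℝ EG}

theorem d_omegaM (hemb : S.IsEmbeddedM EM) (m : S.M) : DForm.d 𝓘(ℝ, EM) (S.omegaM EM) m = 0 := by
  rw [omegaM_eq hemb, DForm.d_neg]
  exact neg_eq_zero.2 (DForm.d_d (isSmooth_thetaM hemb) m)

/-- The generator of 𝓐_𝓦(v) lies in 𝓦, so it is also generated by an element of 𝔤_W; injectivity of
the generators identifies the two. -/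
theorem connM_mem_gW (hemb : S.IsEmbeddedM EM) (hfree : ∀ (g : G) (q : Q), g • q = q → g = 1)
    (hW : S.IsVerticalComplement EG G W) (hP : S.IsProjection W P)
    (hvs : S.VerticalSymmetry EM EG G W gW) (m : S.M) (v : EM) : connM EG G W EM m v ∈ gW := by
  have h : gen EG G m (connM EG G W EM m v) ∈
      gW.map (gen (E := EM) EG G m).toLinearMap :=
    (congrArg (gen EG G m (connM EG G W EM m v) ∈ ·) (hvs m)).mp
      (gen_connM_mem hemb hfree hW hP m v)
  obtain ⟨ξ, hξ, h2⟩ := h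
  rwa [← injective_gen (E := EM) (free_M hfree) m h2]

theorem infGen_mem_distW (hvs : S.VerticalSymmetry EM EG G W gW) {ξ : EG} (hξ : ξ ∈ gW) (m : S.M) :
    infGen EG G m ξ ∈ S.distW EM EG G W m := by
  rw [hvs m]
  exact ⟨ξ, hξ, rfl⟩

/-- This is `jacobi_chart` in the chart at `m`. Invariance of the functions, vanishing of `b` on 𝓦,
the momentum identity for Ω_𝓜 and vertical symmetry supply the hypotheses on `Z`. These concern only
the base point, so `Z` can be the generator map frozen at `m`. -/
theorem jacobi_nhGauge (hemb : S.IsEmbeddedM EM) (hfree : ∀ (g : G) (q : Q), g • q = q → g = 1)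
    (hW : S.IsVerticalComplement EG G W) (hP : S.IsProjection W P)
    (hvs : S.VerticalSymmetry EM EG G W gW)
    {b : DForm 𝓘(ℝ, EM) S.M 2 ℝ} (hb : GaugeDefined 𝓘(ℝ, EM) (S.nhSharp EM) b)
    (hbs : DForm.IsSmooth 𝓘(ℝ, EM) b)
    (hbW : ∀ (m : S.M), ∀ Z ∈ S.distW EM EG G W m, ∀ v, b m ![Z, v] = 0)
    {F : Fin 3 → S.M → ℝ} (hF : ∀ i, ContMDiff 𝓘(ℝ, EM) 𝓘(ℝ, ℝ) ∞ (F i))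
    (hFG : ∀ i (m : S.M) (ξ : EG), tangentD 𝓘(ℝ, EM) 𝓘(ℝ, ℝ) (F i) m (gen EG G m ξ) = 0)
    (m : S.M) :
    (nhGauge S EM b).jacobiator 𝓘(ℝ, EM) (F 0) (F 1) (F 2) m =
      -((DForm.d 𝓘(ℝ, EM) b).val m
        ![-(nhGauge S EM b).val m (tangentD 𝓘(ℝ, EM) 𝓘(ℝ, ℝ) (F 0) m),
          -(nhGauge S EM b).val m (tangentD 𝓘(ℝ, EM) 𝓘(ℝ, ℝ) (F 1) m),
          -(nhGauge S EM b).val m (tangentD 𝓘(ℝ, EM) 𝓘(ℝ, ℝ) (F 2) m)] +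
        (DForm.d 𝓘(ℝ, EM) (S.formJK EM EG G W)).val m
        ![-(nhGauge S EM b).val m (tangentD 𝓘(ℝ, EM) 𝓘(ℝ, ℝ) (F 0) m),
          -(nhGauge S EM b).val m (tangentD 𝓘(ℝ, EM) 𝓘(ℝ, ℝ) (F 1) m),
          -(nhGauge S EM b).val m (tangentD 𝓘(ℝ, EM) 𝓘(ℝ, ℝ) (F 2) m)]) := by
  set φ := extChartAt 𝓘(ℝ, EM) m with hφ
  have hx : φ m ∈ φ.target := mem_extChartAt_target m
  have hnhds : ∀ᶠ y in 𝓝 (φ m), y ∈ φ.target := (isOpen_extChartAt_target m).mem_nhds hx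
  set π := nhGauge S EM b with hπ
  have hπc := smoothAt_nhGauge hemb hfree hW hP hb hbs hx
  have hπs : π.SmoothAt m := SharpField.smoothAt_of_inChart (mem_extChartAt_source m) hπc
  have hω : DForm.IsSmooth 𝓘(ℝ, EM) (S.omegaM EM) := isSmooth_omegaM hemb
  have hα : DForm.IsSmooth 𝓘(ℝ, EM) (connForm EG G S W EM) := isSmooth_connForm hemb hfree hW hP
  have hJK : DForm.IsSmooth 𝓘(ℝ, EM) (S.formJK EM EG G W) := isSmooth_formJK hemb hfree hW hP
  have hFc : ∀ i, ContDiffAt ℝ ∞ (F i ∘ φ.symm) (φ m) := fun i =>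
    (hF i m).contDiffAt_comp_extChartAt_symm le_rfl (mem_extChartAt_source m)
  have hXc : ∀ i, ContDiffAt ℝ ∞ (π.hamInChart m (F i)) (φ m) := fun i =>
    (hπc.clm_apply ((hFc i).fderiv_right (m := ∞) (by simp))).neg
  -- the Hamiltonian vector fields are sections of `𝓒`
  have hX : ∀ i, ∀ y ∈ φ.target, chartSymmD m y (π.hamInChart m (F i) y) ∈ cM S EM (φ.symm y) ∧
      ∀ v, chartSymmD m y v ∈ cM S EM (φ.symm y) →
        DForm.inChart 𝓘(ℝ, EM) (S.omegaM EM) m y ![π.hamInChart m (F i) y, v] -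
        DForm.inChart 𝓘(ℝ, EM) b m y ![π.hamInChart m (F i) y, v] =
          fderiv ℝ (F i ∘ φ.symm) y v := by
    intro i y hy
    have h1 : IsSharp (E := EM) (cM S EM (φ.symm y)) (DForm.val (S.omegaM EM + -b) (φ.symm y))
        (π.val (φ.symm y)) :=
      (congrArg (fun w => IsSharp (cM S EM (φ.symm y)) w (π.val (φ.symm y)))
        (sub_eq_add_neg ((S.omegaM EM).val _) (b.val _))).mp (isSharp_nhGauge hemb hP hb _)
    have h2 := isSharp_inChart (C := S.distC EM) (w := S.omegaM EM + -b) hy h1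
    refine ⟨h2.neg_mem _, fun v hv => ?_⟩
    have h3 := h2.apply_eq (fderiv ℝ (F i ∘ φ.symm) y) (Y := v) hv
    rw [← h3, sub_eq_add_neg]
    rfl
  have hconn : ∀ y u, DForm.inChart 𝓘(ℝ, EM) (connForm EG G S W EM) m y ![u] =
      connM EG G W EM (φ.symm y) (chartSymmD m y u) := fun y u => DForm.inChart_val_one _ _ _ _
  have hconn0 : ∀ y u, DForm.inChart 𝓘(ℝ, EM) (connForm EG G S W EM) m y ![u] = 0 ↔
      chartSymmD m y u ∈ cM S EM (φ.symm y) := fun y u => by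
    rw [hconn, connM_eq_zero_iff hemb hfree hW hP]
  have hgen : ∀ ξ, chartSymmD m (φ m) (infGenInChart (E := EM) EG G m (φ m) ξ) =
      gen EG G (φ.symm (φ m)) ξ := fun ξ => by
    rw [infGenInChart_apply]
    have h := chartSymmD_chartD (E := EM) (q₀ := m) (φ.map_target hx) (gen EG G (φ.symm (φ m)) ξ)
    rwa [φ.right_inv hx] at h
  have hd : ∀ y ∈ φ.target, extDeriv (DForm.inChart 𝓘(ℝ, EM) (connForm EG G S W EM) m) y =
      DForm.inChart 𝓘(ℝ, EM) (DForm.d 𝓘(ℝ, EM) (connForm EG G S W EM)) m y := fun y hy =>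
    (DForm.inChart_d hy (hα.smoothAt _)).symm
  have hfd : ∀ f : S.M → ℝ, ContMDiff 𝓘(ℝ, EM) 𝓘(ℝ, ℝ) ∞ f → ∀ v,
      fderiv ℝ (f ∘ φ.symm) (φ m) v =
        tangentD 𝓘(ℝ, EM) 𝓘(ℝ, ℝ) f (φ.symm (φ m)) (chartSymmD m (φ m) v) := fun f hf v => by
    rw [← tangentD_eq_fderiv]
    exact tangentD_comp_apply (hf.mdifferentiable (by simp) _)
      ((contMDiffAt_extChartAt_symm 𝓘(ℝ, EM) hx).mdifferentiableAt (by simp)) v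
  have key := jacobi_chart (x := φ m) (Ω := DForm.inChart 𝓘(ℝ, EM) (S.omegaM EM) m)
    (b := DForm.inChart 𝓘(ℝ, EM) b m) (jk := DForm.inChart 𝓘(ℝ, EM) (S.formJK EM EG G W) m)
    (a := DForm.inChart 𝓘(ℝ, EM) (connForm EG G S W EM) m)
    (Z := infGenInChart (E := EM) EG G m (φ m)) (J := fun y => S.momentum EM EG G (φ.symm y))
    (Pr := endoInChart (projM EG G W EM) m) (X := fun i => π.hamInChart m (F i))
    (f := fun i => F i ∘ φ.symm)
    (((hω.smoothAt _).contDiffAt_inChart hx).differentiableAt (by simp))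
    (((hbs.smoothAt _).contDiffAt_inChart hx).differentiableAt (by simp))
    (((hJK.smoothAt _).contDiffAt_inChart hx).differentiableAt (by simp))
    ((hα.smoothAt _).contDiffAt_inChart hx)
    ((contDiffAt_momentum_inChart hemb hx).differentiableAt (by simp))
    (fun i => (hXc i).differentiableAt (by simp)) hFc
    (extDeriv_inChart_of_d_eq_zero hω (d_omegaM hemb) hx)
    (fun i => hnhds.mono fun y hy => (hconn0 _ _).2 (hX i y hy).1)
    (fun i => hnhds.mono fun y hy v hv => (hX i y hy).2 v ((hconn0 _ _).1 hv))
    (hnhds.mono fun y hy v hv => by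
      rw [endoInChart_projM hy, ← hconn, hv, map_zero, sub_zero])
    (fun v => by rw [endoInChart_projM hx, ← hconn])
    (fun v => by
      rw [hconn, hgen, hconn]
      exact connM_gen hemb hfree hW hP (gen_connM_mem hemb hfree hW hP _ _))
    (fun i ξ => by rw [hfd _ (hF i), hgen]; exact hFG i _ ξ)
    (fun u v => by
      rw [DForm.inChart_val_two, hgen, hconn]
      exact hbW _ _ (gen_connM_mem hemb hfree hW hP _ _) _)
    (fun ξ v => by
      rw [DForm.inChart_val_two, hgen, omegaM_gen hemb]
      exact (hfd _ (contMDiff_momentum_apply hemb ξ) v).symm)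
    (fun u v hv => by
      rw [hd _ hx, DForm.inChart_val_two, hgen, hconn]
      exact d_connForm_gen_eq_zero hemb hfree hW hP
        (infGen_mem_distW hvs (connM_mem_gW hemb hfree hW hP hvs _ _)) ((hconn0 _ _).1 hv))
    (hnhds.mono fun y hy u v => by
      rw [hd _ hy, DForm.inChart_val_two, DForm.inChart_val_two, formJK_val,
        chartSymmD_endoInChart_projM hy, chartSymmD_endoInChart_projM hy])
  have hself : ∀ i, π.hamInChart m (F i) (φ m) =
      chartD m m (-π.val m (tangentD 𝓘(ℝ, EM) 𝓘(ℝ, ℝ) (F i) m)) := fun i =>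
    π.hamInChart_self ((hF i).mdifferentiable (by simp) m)
  unfold SharpField.jacobiator
  rw [SharpField.bracket_bracket hπs (hF 0 m) (hF 1 m) (hF 2 m),
    SharpField.bracket_bracket hπs (hF 1 m) (hF 2 m) (hF 0 m),
    SharpField.bracket_bracket hπs (hF 2 m) (hF 0 m) (hF 1 m)]
  refine key.trans ?_
  rw [DForm.d_val_three, DForm.d_val_three, ← hself, ← hself, ← hself]

end VerticalSymmetry

end NonholonomicSystem

/-! ### The nonholonomic momentum map -/

theorem tangentD_gen_eq_zero_of_invariant {E : Type*} [NormedAddCommGroup E] [NormedSpace ℝ E]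
    {M : Type*} [TopologicalSpace M] [ChartedSpace E M] [IsManifold 𝓘(ℝ, E) ∞ M]
    {EG : Type*} [NormedAddCommGroup EG] [NormedSpace ℝ EG]
    {G : Type*} [TopologicalSpace G] [ChartedSpace EG G] [Group G] [LieGroup 𝓘(ℝ, EG) ∞ G]
    [MulAction G M] [ContMDiffSMul 𝓘(ℝ, EG) 𝓘(ℝ, E) ∞ G M]
    {f : M → ℝ} (hf : MDifferentiable 𝓘(ℝ, E) 𝓘(ℝ, ℝ) f) (hinv : ∀ (g : G) m, f (g • m) = f m)
    (m : M) (ξ : EG) : tangentD 𝓘(ℝ, E) 𝓘(ℝ, ℝ) f m (gen EG G m ξ) = 0 := by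
  have h := tangentD_comp_apply (g := f) (f := fun g : G => g • m) (x := (1 : G)) (hf _)
    ((contMDiff_smul_orbit (E := E) (EG := EG) m).contMDiffAt.mdifferentiableAt (by simp)) ξ
  have h1 : (fun g : G => f (g • m)) = fun _ => f m := funext fun g => hinv g m
  have h2 : tangentD 𝓘(ℝ, E) 𝓘(ℝ, ℝ) f ((1 : G) • m) = tangentD 𝓘(ℝ, E) 𝓘(ℝ, ℝ) f m := by
    rw [one_smul]
  rw [h1, tangentD_const, h2] at h
  exact h.symm

theorem tangentD_clm_apply {E : Type*} [NormedAddCommGroup E] [NormedSpace ℝ E]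
    {M : Type*} [TopologicalSpace M] [ChartedSpace E M] [IsManifold 𝓘(ℝ, E) ∞ M]
    {F : Type*} [NormedAddCommGroup F] [NormedSpace ℝ F] {L : M → F →L[ℝ] ℝ} {z : M → F} {x : M}
    (hL : MDifferentiableAt 𝓘(ℝ, E) 𝓘(ℝ, F →L[ℝ] ℝ) L x)
    (hz : MDifferentiableAt 𝓘(ℝ, E) 𝓘(ℝ, F) z x) (v : E) :
    tangentD 𝓘(ℝ, E) 𝓘(ℝ, ℝ) (fun y => L y (z y)) x v =
      tangentD 𝓘(ℝ, E) 𝓘(ℝ, ℝ) (fun y => L y (z x)) x v +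
        L x (tangentD 𝓘(ℝ, E) 𝓘(ℝ, F) z x v) := by
  have hx := mem_extChartAt_source (I := 𝓘(ℝ, E)) x
  set φ := extChartAt 𝓘(ℝ, E) x with hφ
  have hx' : φ.symm (φ x) = x := φ.left_inv hx
  have hs : MDifferentiableAt 𝓘(ℝ, E) 𝓘(ℝ, E) φ.symm (φ x) :=
    (contMDiffAt_extChartAt_symm 𝓘(ℝ, E) (φ.map_source hx)).mdifferentiableAt (by simp)
  have hL' : DifferentiableAt ℝ (L ∘ φ.symm) (φ x) := by
    have h : MDifferentiableAt 𝓘(ℝ, E) 𝓘(ℝ, F →L[ℝ] ℝ) L (φ.symm (φ x)) := by rwa [hx']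
    exact mdifferentiableAt_iff_differentiableAt.1 (h.comp _ hs)
  have hz' : DifferentiableAt ℝ (z ∘ φ.symm) (φ x) := by
    have h : MDifferentiableAt 𝓘(ℝ, E) 𝓘(ℝ, F) z (φ.symm (φ x)) := by rwa [hx']
    exact mdifferentiableAt_iff_differentiableAt.1 (h.comp _ hs)
  have key : ∀ w : M → F, MDifferentiableAt 𝓘(ℝ, E) 𝓘(ℝ, F) w x →
      DifferentiableAt ℝ (w ∘ φ.symm) (φ x) →
      tangentD 𝓘(ℝ, E) 𝓘(ℝ, ℝ) (fun y => L y (w y)) x v =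
        (fderiv ℝ (L ∘ φ.symm) (φ x) (chartD (E := E) x x v)) (w x) +
          L x (tangentD 𝓘(ℝ, E) 𝓘(ℝ, F) w x v) := by
    intro w hw hw'
    have e1 : tangentD 𝓘(ℝ, E) 𝓘(ℝ, ℝ) (fun y => L y (w y)) x v =
        fderiv ℝ ((fun y => L y (w y)) ∘ φ.symm) (φ x) (chartD (E := E) x x v) := 
      DFunLike.congr_fun (mfderiv_eq_fderiv_comp hx (hL.clm_apply hw)) v
    have e2 : tangentD 𝓘(ℝ, E) 𝓘(ℝ, F) w x v =
        fderiv ℝ (w ∘ φ.symm) (φ x) (chartD (E := E) x x v) :=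
      DFunLike.congr_fun (mfderiv_eq_fderiv_comp hx hw) v
    have e3 : ((fun y => L y (w y)) ∘ φ.symm) = fun y => (L ∘ φ.symm) y ((w ∘ φ.symm) y) := rfl
    rw [e1, e2, e3, fderiv_clm_apply hL' hw']
    simp [hx', add_comm]
  rw [key z hz hz', key (fun _ => z x) mdifferentiableAt_const (differentiableAt_const _),
    tangentD_const]
  simp

theorem IsMIntegralCurveOn.eq_of_tangentD_eq_zero {E : Type*} [NormedAddCommGroup E]
    [NormedSpace ℝ E] {M : Type*} [TopologicalSpace M] [ChartedSpace E M]
    {X : ∀ m : M, TangentSpace 𝓘(ℝ, E) m} {f : M → ℝ} (hf : MDifferentiable 𝓘(ℝ, E) 𝓘(ℝ, ℝ) f)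
    (hfX : ∀ m, tangentD 𝓘(ℝ, E) 𝓘(ℝ, ℝ) f m (X m) = 0) {γ : ℝ → M} {a b : ℝ}
    (hγ : IsMIntegralCurveOn (I := 𝓘(ℝ, E)) γ X (Set.Ioo a b)) {s t : ℝ} (hs : s ∈ Set.Ioo a b)
    (ht : t ∈ Set.Ioo a b) : f (γ s) = f (γ t) := by
  have hd : ∀ u ∈ Set.Ioo a b, HasDerivAt (fun u => f (γ u)) 0 u := fun u hu => by
    have h1 := (hγ u hu).hasMFDerivAt (isOpen_Ioo.mem_nhds hu)
    have h2 : HasFDerivAt (fun u => f (γ u)) ((tangentD 𝓘(ℝ, E) 𝓘(ℝ, ℝ) f (γ u)).comp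
        ((1 : ℝ →L[ℝ] ℝ).smulRight (show E from X (γ u)))) u :=
      ((hf (γ u)).hasMFDerivAt.comp u h1).hasFDerivAt
    have h3 : tangentD 𝓘(ℝ, E) 𝓘(ℝ, ℝ) f (γ u) ((1 : ℝ) • X (γ u)) = 0 := by
      rw [one_smul]; exact hfX _
    exact (congrArg (fun c : ℝ => HasDerivAt (fun u => f (γ u)) c u) h3).mp h2.hasDerivAt
  exact isOpen_Ioo.is_const_of_deriv_eq_zero isPreconnected_Ioo
    (fun u hu => (hd u hu).differentiableAt.differentiableWithinAt)
    (fun u hu => (hd u hu).deriv) hs ht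

namespace NonholonomicSystem

section Momentum

variable {E : Type*} [NormedAddCommGroup E] [NormedSpace ℝ E] [FiniteDimensional ℝ E]
  {Q : Type*} [TopologicalSpace Q] [ChartedSpace E Q] [IsManifold 𝓘(ℝ, E) ∞ Q]
  {EG : Type*} [NormedAddCommGroup EG] [NormedSpace ℝ EG] [FiniteDimensional ℝ EG]
  {G : Type*} [TopologicalSpace G] [ChartedSpace EG G] [Group G] [LieGroup 𝓘(ℝ, EG) ∞ G]
  [MulAction G Q] [ContMDiffSMul 𝓘(ℝ, EG) 𝓘(ℝ, E) ∞ G Q]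
  {S : NonholonomicSystem E Q} [S.IsSymmetry G]
  {W : ∀ q : Q, Submodule ℝ (TangentSpace 𝓘(ℝ, E) q)} {P : Q → E →L[ℝ] E}
  {EM : Type*} [NormedAddCommGroup EM] [NormedSpace ℝ EM] [FiniteDimensional ℝ EM]
  [ChartedSpace EM S.M] [IsManifold 𝓘(ℝ, EM) ∞ S.M] [ContMDiffSMul 𝓘(ℝ, EG) 𝓘(ℝ, EM) ∞ G S.M]
  {gW : Submodule ℝ EG}

theorem mem_algS_iff {m : S.M} {ξ : EG} :
    ξ ∈ S.algS EM EG G m ↔ gen EG G m ξ ∈ cM S EM m :=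
  ⟨fun h => h.1, fun h => ⟨h, ξ, rfl⟩⟩

theorem sub_connM_mem_algS (hemb : S.IsEmbeddedM EM)
    (hfree : ∀ (g : G) (q : Q), g • q = q → g = 1)
    (hW : S.IsVerticalComplement EG G W) (hP : S.IsProjection W P) (m : S.M) (η : EG) :
    η - connM EG G W EM m (gen EG G m η) ∈ S.algS EM EG G m := by
  rw [mem_algS_iff, map_sub]
  exact projM_mem hemb hfree hW hP m (gen EG G m η)

theorem isCompl_algS (hemb : S.IsEmbeddedM EM) (hfree : ∀ (g : G) (q : Q), g • q = q → g = 1)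
    (hW : S.IsVerticalComplement EG G W) (hP : S.IsProjection W P)
    (hvs : S.VerticalSymmetry EM EG G W gW) (m : S.M) : IsCompl (S.algS EM EG G m) gW := by
  refine ⟨Submodule.disjoint_def.2 fun ξ h1 h2 => ?_, codisjoint_iff.2 (Submodule.eq_top_iff'.2 fun η => ?_)⟩
  · rw [← connM_gen hemb hfree hW hP (infGen_mem_distW hvs h2 m)]
    exact (connM_eq_zero_iff hemb hfree hW hP).2 (mem_algS_iff.1 h1)
  · exact Submodule.mem_sup.2 ⟨_, sub_connM_mem_algS hemb hfree hW hP m η, _,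
      connM_mem_gW hemb hfree hW hP hvs m (gen EG G m η), sub_add_cancel _ _⟩

/-- Since 𝓐_𝓦(η_𝓜) ∈ 𝔤_W, the 𝔤_𝓢-component of η is η - 𝓐_𝓦(η_𝓜). This replaces a functional on a
fibre varying with m by the full momentum map, which can be differentiated. -/
theorem nhMomentum_projectionOnto (hemb : S.IsEmbeddedM EM)
    (hfree : ∀ (g : G) (q : Q), g • q = q → g = 1)
    (hW : S.IsVerticalComplement EG G W) (hP : S.IsProjection W P)
    (hvs : S.VerticalSymmetry EM EG G W gW) (m : S.M) (h : IsCompl (S.algS EM EG G m) gW) (η : EG) :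
    S.nhMomentum EM EG G m (Submodule.projectionOnto (S.algS EM EG G m) gW h η) =
      S.momentum EM EG G m (η - connM EG G W EM m (gen EG G m η)) := by
  have h1 : Submodule.projectionOnto (S.algS EM EG G m) gW h η =
      ⟨_, sub_connM_mem_algS hemb hfree hW hP m η⟩ := by
    rw [← Submodule.projectionOnto_apply_of_mem_left h (sub_connM_mem_algS hemb hfree hW hP m η),
      map_sub, Submodule.projectionOnto_apply_of_mem_right h
        (connM_mem_gW hemb hfree hW hP hvs m (gen EG G m η)), sub_zero]
  rw [h1]
  rfl

theorem contMDiff_momentum (hemb : S.IsEmbeddedM EM) :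
    ContMDiff 𝓘(ℝ, EM) 𝓘(ℝ, EG →L[ℝ] ℝ) ∞ (fun m : S.M => (S.momentum EM EG G m : EG →L[ℝ] ℝ)) := by
  intro m
  have hx := mem_extChartAt_source (I := 𝓘(ℝ, EM)) m
  refine ((contDiffAt_momentum_inChart (EG := EG) (G := G) hemb
    (mem_extChartAt_target m)).contMDiffAt.comp m
    (contMDiffAt_extChartAt_source hx)).congr_of_eventuallyEq ?_
  filter_upwards [(isOpen_extChartAt_source (I := 𝓘(ℝ, EM)) m).mem_nhds hx] with z hz
  exact congrArg (fun m => (S.momentum EM EG G m : EG →L[ℝ] ℝ))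
    ((extChartAt 𝓘(ℝ, EM) m).left_inv hz).symm

theorem contMDiff_connM_gen (hemb : S.IsEmbeddedM EM)
    (hfree : ∀ (g : G) (q : Q), g • q = q → g = 1)
    (hW : S.IsVerticalComplement EG G W) (hP : S.IsProjection W P) (η : EG) :
    ContMDiff 𝓘(ℝ, EM) 𝓘(ℝ, EG) ∞ (fun m : S.M => connM EG G W EM m (gen EG G m η)) := fun m =>
  contMDiffAt_apply_infGen ((isSmooth_connForm hemb hfree hW hP).smoothAt m) η

theorem contMDiff_reduced_momentum (hemb : S.IsEmbeddedM EM)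
    (hfree : ∀ (g : G) (q : Q), g • q = q → g = 1)
    (hW : S.IsVerticalComplement EG G W) (hP : S.IsProjection W P) (η : EG) :
    ContMDiff 𝓘(ℝ, EM) 𝓘(ℝ, ℝ) ∞
      (fun m : S.M => S.momentum EM EG G m (η - connM EG G W EM m (gen EG G m η))) :=
  (contMDiff_momentum hemb).clm_apply
    (contMDiff_const.sub (contMDiff_connM_gen hemb hfree hW hP η))

/-- Write ζ = η - 𝓐_𝓦(η_𝓜). By the product rule there are two terms. With ζ frozen, the first is
Ω_𝓜(ζ_𝓜, X_nh) = -dH_𝓜(ζ_𝓜), which is zero as ζ_𝓜 ∈ 𝓒 and H_𝓜 is invariant. The second is ⟨𝓙,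
d𝓐_𝓦(η_𝓜, X_nh)⟩; vertical symmetry identifies it with ⟨𝓙, 𝓚_𝓦⟩(η_𝓜, X_nh), and basicness with
-b(η_𝓜, X_nh) = 0. -/
theorem tangentD_reduced_momentum_nhField (hemb : S.IsEmbeddedM EM)
    (hfree : ∀ (g : G) (q : Q), g • q = q → g = 1)
    (hW : S.IsVerticalComplement EG G W) (hP : S.IsProjection W P)
    (hvs : S.VerticalSymmetry EM EG G W gW) {b : DForm 𝓘(ℝ, EM) S.M 2 ℝ}
    (hX : ∀ m v, b m ![S.nhField EM m, v] = 0)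
    (hbasic : ∀ (m : S.M), ∀ Z ∈ S.vertM EM EG G m, ∀ v,
      (b + S.formJK EM EG G W) m ![Z, v] = 0) (η : EG) (m : S.M) :
    tangentD 𝓘(ℝ, EM) 𝓘(ℝ, ℝ)
      (fun m : S.M => S.momentum EM EG G m (η - connM EG G W EM m (gen EG G m η))) m
      (S.nhField EM m) = 0 := by
  obtain ⟨hXC, hXH⟩ := nhField_spec hemb hP m
  set X : EM := S.nhField EM m with hXdef
  have hXC' : X ∈ cM S EM m := hXC
  set ζ : S.M → EG := fun m => connM EG G W EM m (gen EG G m η) with hζ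
  have hζd : MDifferentiableAt 𝓘(ℝ, EM) 𝓘(ℝ, EG) ζ m :=
    (contMDiff_connM_gen hemb hfree hW hP η).mdifferentiable (by simp) m
  have h1 := tangentD_clm_apply (L := fun m : S.M => (S.momentum EM EG G m : EG →L[ℝ] ℝ))
    (z := fun m => η - ζ m) (x := m) ((contMDiff_momentum hemb).mdifferentiable (by simp) m)
    (mdifferentiableAt_const.sub hζd) X
  refine h1.trans ?_
  -- the derivative of the momentum map along a vertical vector of the constraint distribution
  have h2 : tangentD 𝓘(ℝ, EM) 𝓘(ℝ, ℝ) (fun y : S.M => S.momentum EM EG G y (η - ζ m)) m X = 0 := by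
    rw [← omegaM_gen hemb, two_form_swap]
    have h3 : gen EG G m (η - ζ m) ∈ cM S EM m :=
      mem_algS_iff.1 (sub_connM_mem_algS hemb hfree hW hP m η)
    have h4 : (S.omegaM EM).val m ![X, gen EG G m (η - ζ m)] =
        tangentD 𝓘(ℝ, EM) 𝓘(ℝ, ℝ) S.hamM m (gen EG G m (η - ζ m)) := hXH _ h3
    rw [h4, tangentD_gen_eq_zero_of_invariant ((contMDiff_hamM hemb).mdifferentiable (by simp))
      hamM_smul, neg_zero]
  -- The variation of the splitting along X_nh is a value of d𝓐_𝓦, by the formula for i_{η_𝓜} d𝓐_𝓦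
  -- on 𝓒.
  have h5 : tangentD 𝓘(ℝ, EM) 𝓘(ℝ, EG) (fun m => η - ζ m) m X =
      (DForm.d 𝓘(ℝ, EM) (connForm EG G S W EM)).val m ![gen EG G m η, X] := by
    rw [d_connForm_gen hemb hfree hW hP η hXC']
    have h6 : tangentD 𝓘(ℝ, EM) 𝓘(ℝ, EG) (fun m => η - ζ m) m =
        tangentD 𝓘(ℝ, EM) 𝓘(ℝ, EG) (fun _ => η) m - tangentD 𝓘(ℝ, EM) 𝓘(ℝ, EG) ζ m :=
      (mdifferentiableAt_const (c := η)).hasMFDerivAt.sub hζd.hasMFDerivAt |>.mfderiv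
    rw [h6, tangentD_const, zero_sub]
    rfl
  -- the curvature term
  have h7 : (S.formJK EM EG G W).val m ![gen EG G m η, X] = 0 := by
    have h8 : b.val m ![gen EG G m η, X] + (S.formJK EM EG G W).val m ![gen EG G m η, X] = 0 :=
      hbasic m _ ⟨η, rfl⟩ X
    have h9 : b.val m ![X, gen EG G m η] = 0 := hX m _
    rwa [two_form_swap, h9, neg_zero, zero_add] at h8
  rw [formJK_val, projM_apply_mem hemb hfree hW hP hXC', projM_apply] at h7
  -- The 𝓦-part of η_𝓜 is generated by an element of 𝔤_W, so removing it by P_𝓒 does not change d𝓐_𝓦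
  -- against X_nh.
  have h10 := d_connForm_gen_eq_zero hemb hfree hW hP
    (infGen_mem_distW hvs (connM_mem_gW hemb hfree hW hP hvs m (gen EG G m η))) hXC'
  have h11 : ∀ (c : EM [⋀^Fin 2]→L[ℝ] EG) (u v w : EM), c ![u - v, w] = c ![u, w] - c ![v, w] :=
    fun c u v w => by
      have := c.toAlternatingMap.map_update_sub ![u, w] 0 u v
      simpa using this
  rw [h11, h10, sub_zero] at h7
  rw [h2, h5, zero_add]
  exact h7

end Momentum

end NonholonomicSystem

theorem DForm.d_zero {E : Type*} [NormedAddCommGroup E] [NormedSpace ℝ E]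
    {M : Type*} [TopologicalSpace M] [ChartedSpace E M] {V : Type*} [NormedAddCommGroup V]
    [NormedSpace ℝ V] {k : ℕ} : DForm.d 𝓘(ℝ, E) (0 : DForm 𝓘(ℝ, E) M k V) = 0 := by
  funext x
  have h : DForm.inChart 𝓘(ℝ, E) (0 : DForm 𝓘(ℝ, E) M k V) x =
      (0 : ℝ) • DForm.inChart 𝓘(ℝ, E) (0 : DForm 𝓘(ℝ, E) M k V) x := by
    rw [zero_smul]; rfl
  refine DForm.ext_val fun v => ?_
  change extDeriv (DForm.inChart 𝓘(ℝ, E) (0 : DForm 𝓘(ℝ, E) M k V) x) _ _ = 0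
  rw [h, extDeriv_smul]
  exact zero_smul ℝ _

theorem DForm.isSmooth_zero {E : Type*} [NormedAddCommGroup E] [NormedSpace ℝ E]
    {M : Type*} [TopologicalSpace M] [ChartedSpace E M] {V : Type*} [NormedAddCommGroup V]
    [NormedSpace ℝ V] {k : ℕ} : DForm.IsSmooth 𝓘(ℝ, E) (0 : DForm 𝓘(ℝ, E) M k V) :=
  fun _ => contDiffOn_const (c := (0 : E [⋀^Fin k]→L[ℝ] V))

namespace NonholonomicSystem

/-! ### Jacobiators on the quotient and conservation of the momenta. -/

section ReducedJacobiator

variable {E : Type*} [NormedAddCommGroup E] [NormedSpace ℝ E] [FiniteDimensional ℝ E]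
  {Q : Type*} [TopologicalSpace Q] [ChartedSpace E Q] [IsManifold 𝓘(ℝ, E) ∞ Q]
  {EG : Type*} [NormedAddCommGroup EG] [NormedSpace ℝ EG] [FiniteDimensional ℝ EG]
  {G : Type*} [TopologicalSpace G] [ChartedSpace EG G] [Group G] [LieGroup 𝓘(ℝ, EG) ∞ G]
  [MulAction G Q] [ContMDiffSMul 𝓘(ℝ, EG) 𝓘(ℝ, E) ∞ G Q]
  {S : NonholonomicSystem E Q} [S.IsSymmetry G]
  {W : ∀ q : Q, Submodule ℝ (TangentSpace 𝓘(ℝ, E) q)} {P : Q → E →L[ℝ] E}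
  {EM : Type*} [NormedAddCommGroup EM] [NormedSpace ℝ EM] [FiniteDimensional ℝ EM]
  [ChartedSpace EM S.M] [IsManifold 𝓘(ℝ, EM) ∞ S.M] [ContMDiffSMul 𝓘(ℝ, EG) 𝓘(ℝ, EM) ∞ G S.M]
  {EP : Type*} [NormedAddCommGroup EP] [NormedSpace ℝ EP]
  [ChartedSpace EP (S.Reduced G)] [IsManifold 𝓘(ℝ, EP) ∞ (S.Reduced G)]
  {gW : Submodule ℝ EG}

/-- If `b + ⟨𝓙, 𝓚_𝓦⟩` is the pullback of `BB`, then the reduction of the gauge transformation by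
`b` has Jacobiator `-dBB`. -/
theorem jacobiator_of_isReduction (hemb : S.IsEmbeddedM EM)
    (hfree : ∀ (g : G) (q : Q), g • q = q → g = 1)
    (hW : S.IsVerticalComplement EG G W) (hP : S.IsProjection W P)
    (hvs : S.VerticalSymmetry EM EG G W gW)
    (hsub : Manifold.IsSubmersion 𝓘(ℝ, EM) 𝓘(ℝ, EP) ∞ (S.rho G))
    {b : DForm 𝓘(ℝ, EM) S.M 2 ℝ} (hb : GaugeDefined 𝓘(ℝ, EM) (S.nhSharp EM) b)
    (hbs : DForm.IsSmooth 𝓘(ℝ, EM) b)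
    (hbW : ∀ (m : S.M), ∀ Z ∈ S.distW EM EG G W m, ∀ v, b m ![Z, v] = 0)
    {Λ : SharpField 𝓘(ℝ, EP) (S.Reduced G)}
    (hred : IsReduction 𝓘(ℝ, EM) 𝓘(ℝ, EP) (S.rho G) (nhGauge S EM b) Λ)
    {BB : DForm 𝓘(ℝ, EP) (S.Reduced G) 2 ℝ} (hBBs : DForm.IsSmooth 𝓘(ℝ, EP) BB)
    (hBB : DForm.pullback 𝓘(ℝ, EM) 𝓘(ℝ, EP) (S.rho G) BB = b + S.formJK EM EG G W)
    {f g h : S.Reduced G → ℝ} (hf : ContMDiff 𝓘(ℝ, EP) 𝓘(ℝ, ℝ) ∞ f)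
    (hg : ContMDiff 𝓘(ℝ, EP) 𝓘(ℝ, ℝ) ∞ g) (hh : ContMDiff 𝓘(ℝ, EP) 𝓘(ℝ, ℝ) ∞ h)
    (x : S.Reduced G) :
    Λ.jacobiator 𝓘(ℝ, EP) f g h x = (-DForm.d 𝓘(ℝ, EP) BB) x
      ![-Λ x (diffAt 𝓘(ℝ, EP) f x), -Λ x (diffAt 𝓘(ℝ, EP) g x), -Λ x (diffAt 𝓘(ℝ, EP) h x)] := by
  obtain ⟨m, rfl⟩ := surjective_rho (S := S) (G := G) x
  have hρ : ContMDiff 𝓘(ℝ, EM) 𝓘(ℝ, EP) ∞ (S.rho G) := fun m =>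
    (hsub.isSubmersionAt m).contMDiffAt_self
  have hπ : (nhGauge S EM b).SmoothAt m :=
    SharpField.smoothAt_of_inChart (mem_extChartAt_source m)
      (smoothAt_nhGauge hemb hfree hW hP hb hbs (mem_extChartAt_target m))
  have hJK := isSmooth_formJK hemb hfree hW hP
  have hX : ∀ k : S.Reduced G → ℝ, ContMDiff 𝓘(ℝ, EP) 𝓘(ℝ, ℝ) ∞ k →
      -Λ.val (S.rho G m) (tangentD 𝓘(ℝ, EP) 𝓘(ℝ, ℝ) k (S.rho G m)) =
        rhoD G S EM EP m (-(nhGauge S EM b).val m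
          (tangentD 𝓘(ℝ, EM) 𝓘(ℝ, ℝ) (fun m => k (S.rho G m)) m)) := by
    intro k hk
    have h1 : tangentD 𝓘(ℝ, EM) 𝓘(ℝ, ℝ) (fun m => k (S.rho G m)) m =
        (tangentD 𝓘(ℝ, EP) 𝓘(ℝ, ℝ) k (S.rho G m)).comp (rhoD G S EM EP m) :=
      tangentD_comp (hk.mdifferentiable (by simp) _) (hρ.mdifferentiable (by simp) _)
    rw [h1, map_neg]
    exact congrArg Neg.neg (hred m _).symm
  have hd : (DForm.pullback 𝓘(ℝ, EM) 𝓘(ℝ, EP) (S.rho G) (DForm.d 𝓘(ℝ, EP) BB)).val m =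
      (DForm.d 𝓘(ℝ, EM) b).val m + (DForm.d 𝓘(ℝ, EM) (S.formJK EM EG G W)).val m := by
    have h1 := DForm.d_pullback (x := m) hρ.contMDiffAt (hBBs.smoothAt (S.rho G m))
    rw [hBB, DForm.d_add hbs hJK] at h1
    exact h1.symm
  -- Functions lifted from the quotient are G-invariant, so their differentials kill the generators,
  -- as the computation on 𝓜 requires.
  have hinv : ∀ k : S.Reduced G → ℝ, ContMDiff 𝓘(ℝ, EP) 𝓘(ℝ, ℝ) ∞ k → ∀ (m : S.M) (ξ : EG),
      tangentD 𝓘(ℝ, EM) 𝓘(ℝ, ℝ) (fun m => k (S.rho G m)) m (gen EG G m ξ) = 0 := fun k hk =>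
    tangentD_gen_eq_zero_of_invariant ((hk.comp hρ).mdifferentiable (by simp))
      fun g m => congrArg k (rho_smul g m)
  have h1 := jacobi_nhGauge hemb hfree hW hP hvs hb hbs hbW
    (F := ![fun m => f (S.rho G m), fun m => g (S.rho G m), fun m => h (S.rho G m)])
    (fun i => by fin_cases i <;> [exact hf.comp hρ; exact hg.comp hρ; exact hh.comp hρ])
    (fun i m ξ => by
      fin_cases i
      · exact hinv f hf m ξ
      · exact hinv g hg m ξ
      · exact hinv h hh m ξ) m
  have h2 : Λ.jacobiator 𝓘(ℝ, EP) f g h (S.rho G m) = (nhGauge S EM b).jacobiator 𝓘(ℝ, EM)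
      (fun m => f (S.rho G m)) (fun m => g (S.rho G m)) (fun m => h (S.rho G m)) m := by
    unfold SharpField.jacobiator
    rw [hred.bracket_bracket hsub hπ hf hg hh, hred.bracket_bracket hsub hπ hg hh hf,
      hred.bracket_bracket hsub hπ hh hf hg]
  rw [h2]
  refine h1.trans ?_
  change _ = -((DForm.d 𝓘(ℝ, EP) BB).val (S.rho G m)
    ![-Λ.val (S.rho G m) (tangentD 𝓘(ℝ, EP) 𝓘(ℝ, ℝ) f (S.rho G m)),
      -Λ.val (S.rho G m) (tangentD 𝓘(ℝ, EP) 𝓘(ℝ, ℝ) g (S.rho G m)),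
      -Λ.val (S.rho G m) (tangentD 𝓘(ℝ, EP) 𝓘(ℝ, ℝ) h (S.rho G m))])
  rw [hX f hf, hX g hg, hX h hh]
  have h3 := DForm.pullback_val_three (I₁ := 𝓘(ℝ, EM)) (S.rho G) (DForm.d 𝓘(ℝ, EP) BB) m
  refine congrArg Neg.neg (Eq.trans ?_ (h3 _ _ _))
  rw [hd]
  rfl

/-- The reduction of the gauge transformation by `-⟨𝓙, 𝓚_𝓦⟩` satisfies the Jacobi identity. -/
theorem isPoisson_of_isReduction (hemb : S.IsEmbeddedM EM)
    (hfree : ∀ (g : G) (q : Q), g • q = q → g = 1)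
    (hW : S.IsVerticalComplement EG G W) (hP : S.IsProjection W P)
    (hvs : S.VerticalSymmetry EM EG G W gW)
    (hsub : Manifold.IsSubmersion 𝓘(ℝ, EM) 𝓘(ℝ, EP) ∞ (S.rho G))
    (hgJK : GaugeDefined 𝓘(ℝ, EM) (S.nhSharp EM) (-S.formJK EM EG G W))
    {Λ : SharpField 𝓘(ℝ, EP) (S.Reduced G)} (hΛb : IsBivectorField 𝓘(ℝ, EP) Λ)
    (hΛ : IsReduction 𝓘(ℝ, EM) 𝓘(ℝ, EP) (S.rho G) (nhGauge S EM (-S.formJK EM EG G W)) Λ) :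
    IsPoisson 𝓘(ℝ, EP) Λ := by
  refine ⟨hΛb, fun f g h hf hg hh x => ?_⟩
  have hJKW : ∀ (m : S.M), ∀ Z ∈ S.distW EM EG G W m, ∀ v,
      (-S.formJK EM EG G W) m ![Z, v] = 0 := by
    rintro m Z hZ v
    obtain ⟨ξ, rfl⟩ := hZ.1
    exact neg_eq_zero.2 (formJK_gen_connM hemb hfree hW hP hZ v)
  -- For b = -⟨𝓙, 𝓚_𝓦⟩ the basic form is zero, so the Jacobiator formula with `BB = 0` is the Jacobi
  -- identity.
  have h0 : DForm.pullback 𝓘(ℝ, EM) 𝓘(ℝ, EP) (S.rho G)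
      (0 : DForm 𝓘(ℝ, EP) (S.Reduced G) 2 ℝ) = -S.formJK EM EG G W + S.formJK EM EG G W := by
    rw [neg_add_cancel]; rfl
  rw [jacobiator_of_isReduction hemb hfree hW hP hvs hsub hgJK
    (isSmooth_formJK hemb hfree hW hP).neg hJKW hΛ DForm.isSmooth_zero h0 hf hg hh x, DForm.d_zero]
  exact neg_zero

theorem nhMomentum_conserved (hemb : S.IsEmbeddedM EM)
    (hfree : ∀ (g : G) (q : Q), g • q = q → g = 1)
    (hW : S.IsVerticalComplement EG G W) (hP : S.IsProjection W P)
    (hvs : S.VerticalSymmetry EM EG G W gW) {b : DForm 𝓘(ℝ, EM) S.M 2 ℝ}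
    (hX : ∀ m v, b m ![S.nhField EM m, v] = 0)
    (hbasic : ∀ (m : S.M), ∀ Z ∈ S.vertM EM EG G m, ∀ v,
      (b + S.formJK EM EG G W) m ![Z, v] = 0)
    (hsplit : ∀ m : S.M, IsCompl (S.algS EM EG G m) gW) (η : EG) {f : S.M → ℝ}
    (hf : f = fun m => S.nhMomentum EM EG G m
      (Submodule.projectionOnto (S.algS EM EG G m) gW (hsplit m) η)) :
    ContMDiff 𝓘(ℝ, EM) 𝓘(ℝ, ℝ) ∞ f ∧ ∀ (γ : ℝ → S.M) (a b : ℝ),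
      IsMIntegralCurveOn (I := 𝓘(ℝ, EM)) γ (S.nhField EM) (Set.Ioo a b) →
      ∀ s ∈ Set.Ioo a b, ∀ t ∈ Set.Ioo a b, f (γ s) = f (γ t) := by
  have h : f = fun m => S.momentum EM EG G m (η - connM EG G W EM m (gen EG G m η)) :=
    hf.trans (funext fun m => nhMomentum_projectionOnto hemb hfree hW hP hvs m _ η)
  have hs := contMDiff_reduced_momentum hemb hfree hW hP η
  rw [← h] at hs
  refine ⟨hs, fun γ a b hγ s hs' t ht' => ?_⟩
  refine hγ.eq_of_tangentD_eq_zero (hs.mdifferentiable (by simp)) (fun m => ?_) hs' ht'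
  rw [h]
  exact tangentD_reduced_momentum_nhField hemb hfree hW hP hvs hX hbasic η m

end ReducedJacobiator

end NonholonomicSystem

/-! ### The main theorem. -/

set_option maxHeartbeats 800000 in
open NonholonomicSystem in
theorem mainTheorem12
    -- the configuration manifold
    {E : Type*} [NormedAddCommGroup E] [NormedSpace ℝ E] [FiniteDimensional ℝ E]
    {Q : Type*} [TopologicalSpace Q] [T2Space Q] [SecondCountableTopology Q]
    [ChartedSpace E Q] [IsManifold 𝓘(ℝ, E) ∞ Q]
    -- the Lie group, acting smoothly, freely and properly
    {EG : Type*} [NormedAddCommGroup EG] [NormedSpace ℝ EG] [FiniteDimensional ℝ EG]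
    {G : Type*} [TopologicalSpace G] [ChartedSpace EG G] [Group G] [LieGroup 𝓘(ℝ, EG) ∞ G]
    [MulAction G Q] [ContMDiffSMul 𝓘(ℝ, EG) 𝓘(ℝ, E) ∞ G Q] [ProperSMul G Q]
    (hfree : ∀ (g : G) (q : Q), g • q = q → g = 1)
    -- the nonholonomic system with symmetry group `G`
    (S : NonholonomicSystem E Q) [S.IsSymmetry G]
    -- `𝓜` with its structure of embedded submanifold of `T^*Q`
    {EM : Type*} [NormedAddCommGroup EM] [NormedSpace ℝ EM] [FiniteDimensional ℝ EM]
    [ChartedSpace EM S.M] [IsManifold 𝓘(ℝ, EM) ∞ S.M]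
    (hemb : Manifold.IsSmoothEmbedding 𝓘(ℝ, EM) (cotModel E) ∞
      (Subtype.val : S.M → CotangentBundle E Q))
    -- `𝓜 / G` with its structure of quotient manifold
    {EP : Type*} [NormedAddCommGroup EP] [NormedSpace ℝ EP] [FiniteDimensional ℝ EP]
    [ChartedSpace EP (S.Reduced G)] [IsManifold 𝓘(ℝ, EP) ∞ (S.Reduced G)]
    (hsub : Manifold.IsSubmersion 𝓘(ℝ, EM) 𝓘(ℝ, EP) ∞ (S.rho G))
    -- the vertical complement
    (W : ∀ q : Q, Submodule ℝ (TangentSpace 𝓘(ℝ, E) q)) (hW : S.IsVerticalComplement EG G W)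
    -- the dynamical gauge 2-form
    (B : DForm 𝓘(ℝ, EM) S.M 2 ℝ) (hB : DForm.IsSmooth 𝓘(ℝ, EM) B)
    (hBinv : S.IsInvariantForm EM G B)
    (hBW : ∀ (m : S.M), ∀ Z ∈ S.distW EM EG G W m, ∀ v, B m ![Z, v] = 0)
    (hBdyn : S.IsDynamicalGauge EM B)
    (hbasic : S.IsBasicForm EM EG G (B + S.formJK EM EG G W)) :
    -- `X_nh`, `π_nh` and `𝓐_𝓦` are well defined by their characterisations
    (∀ m, S.nhField EM m ∈ S.distC EM m ∧ ∀ Y ∈ S.distC EM m,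
      S.omegaM EM m ![S.nhField EM m, Y] = diffAt 𝓘(ℝ, EM) S.hamM m Y) ∧
    (∀ m α X, (X ∈ S.distC EM m ∧ ∀ Y ∈ S.distC EM m, S.omegaM EM m ![X, Y] = α Y) ↔
      S.nhSharp EM m α = -X) ∧
    (∀ m v ξ, S.connW EM EG G W m v = ξ ↔
      (infGen EG G m ξ ∈ S.distW EM EG G W m ∧ v - infGen EG G m ξ ∈ S.distC EM m)) ∧
    -- the gauge transformation `π_𝓙𝓚` is defined
    GaugeDefined 𝓘(ℝ, EM) (S.nhSharp EM) (-S.formJK EM EG G W) ∧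
    -- the 2-form `𝓑` on the quotient
    ∃ BB : DForm 𝓘(ℝ, EP) (S.Reduced G) 2 ℝ,
      DForm.IsSmooth 𝓘(ℝ, EP) BB ∧
      DForm.pullback 𝓘(ℝ, EM) 𝓘(ℝ, EP) (S.rho G) BB = B + S.formJK EM EG G W ∧
    -- the reductions `Λ` of `π_𝓙𝓚` and `π_red^B` of `π_B`
    ∃ Λ πred : SharpField 𝓘(ℝ, EP) (S.Reduced G),
      IsBivectorField 𝓘(ℝ, EP) Λ ∧
      IsReduction 𝓘(ℝ, EM) 𝓘(ℝ, EP) (S.rho G) (S.sharpJK EM EG G W) Λ ∧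
      IsBivectorField 𝓘(ℝ, EP) πred ∧
      IsReduction 𝓘(ℝ, EM) 𝓘(ℝ, EP) (S.rho G) ((S.nhSharp EM).gauge 𝓘(ℝ, EM) B) πred ∧
      -- `π_red^B` describes the reduced dynamics
      (∃ Hred : S.Reduced G → ℝ, ContMDiff 𝓘(ℝ, EP) 𝓘(ℝ, ℝ) ∞ Hred ∧
        (∀ m, Hred (S.rho G m) = S.hamM m) ∧
        ∀ m, mfderiv 𝓘(ℝ, EM) 𝓘(ℝ, EP) (S.rho G) m (S.nhField EM m) =
          -πred (S.rho G m) (diffAt 𝓘(ℝ, EP) Hred (S.rho G m))) ∧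
      -- `π_red^B` is the gauge transformation of `Λ` by `𝓑`
      GaugeDefined 𝓘(ℝ, EP) Λ BB ∧ πred = Λ.gauge 𝓘(ℝ, EP) BB ∧
      -- under the vertical-symmetry condition
      ∀ gW : Submodule ℝ EG, S.VerticalSymmetry EM EG G W gW →
        IsPoisson 𝓘(ℝ, EP) Λ ∧
        IsTwistedPoisson 𝓘(ℝ, EP) πred (-DForm.d 𝓘(ℝ, EP) BB) ∧
        -- conserved quantities, with respect to the splitting `𝔤 = 𝔤_𝓢|_m ⊕ 𝔤_W`
        ∃ hsplit : ∀ m : S.M, IsCompl (S.algS EM EG G m) gW,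
          ∀ η : EG,
            let f : S.M → ℝ := fun m => S.nhMomentum EM EG G m
              (Submodule.projectionOnto (S.algS EM EG G m) gW (hsplit m) η)
            ContMDiff 𝓘(ℝ, EM) 𝓘(ℝ, ℝ) ∞ f ∧
            ∀ (γ : ℝ → S.M) (a b : ℝ),
              IsMIntegralCurveOn (I := 𝓘(ℝ, EM)) γ (S.nhField EM) (Set.Ioo a b) →
              ∀ s ∈ Set.Ioo a b, ∀ t ∈ Set.Ioo a b, f (γ s) = f (γ t) := by
  haveI := contMDiffSMul_M (G := G) EG hemb
  obtain ⟨P, hP⟩ := exists_isProjection S hW.smooth hW.isCompl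
  have hact : ∀ g : G, ContMDiff 𝓘(ℝ, EM) 𝓘(ℝ, EM) ∞ (fun m : S.M => g • m) :=
    contMDiff_smul_M EG hemb
  have hρ : ContMDiff 𝓘(ℝ, EM) 𝓘(ℝ, EP) ∞ (S.rho G) := fun m =>
    (hsub.isSubmersionAt m).contMDiffAt_self
  set JK := S.formJK EM EG G W with hJKdef
  have hJKs : DForm.IsSmooth 𝓘(ℝ, EM) JK := isSmooth_formJK hemb hfree hW hP
  have hBv := val_smul_of_isInvariantForm (EM := EM) hBinv
  -- Invariance of ⟨𝓙, 𝓚_𝓦⟩ is read off as that of the difference of the invariant forms B + ⟨𝓙,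
  -- 𝓚_𝓦⟩ and B, without using the adjoint action.
  have hJKv : ∀ (g : G) (m : S.M) (u v : EM),
      DForm.val (-JK) (g • m) ![actMD EM g m u, actMD EM g m v] = DForm.val (-JK) m ![u, v] := by
    intro g m u v
    have h1 := val_smul_of_isInvariantForm (EM := EM) hbasic.1 g m u v
    change B.val (g • m) _ + JK.val (g • m) _ = B.val m _ + JK.val m _ at h1
    rw [hBv] at h1
    change -(JK.val (g • m) _) = -(JK.val m _)
    rw [add_left_cancel h1]
  have hgJK : GaugeDefined 𝓘(ℝ, EM) (S.nhSharp EM) (-JK) :=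
    gaugeDefined_nhSharp hemb hP fun m X Y hX =>
      neg_eq_zero.2 (formJK_eq_zero hemb hfree hW hP m hX Y)
  refine ⟨nhField_spec hemb hP, isSharp_nhSharp hemb hP, connW_spec hemb hfree hW hP, hgJK, ?_⟩
  obtain ⟨BB, hBBs, hBB⟩ := exists_form_of_basic (EP := EP) hemb hfree hsub hact (hB.add hJKs)
    (val_smul_of_isInvariantForm (EM := EM) hbasic.1) (fun m ξ v => hbasic.2 m _ ⟨ξ, rfl⟩ v)
  obtain ⟨Λ, hΛ⟩ := exists_reduction_nhGauge (EP := EP) hemb hP hsub hact hgJK hJKv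
  have hΛb := isBivectorField_of_isReduction hemb hfree hW hP hsub hgJK hJKs.neg hΛ
  -- π_B is the gauge of π_𝓙𝓚 by ρ^*𝓑. Hence the gauge of Λ by 𝓑 is a reduction of π_B and can serve
  -- as π_red^B by definition.
  obtain ⟨hg1, hg2⟩ := nhGauge_neg_add hemb hP hBdyn.1 hgJK
  rw [← hBB] at hg1 hg2
  obtain ⟨hΛG, hπ⟩ := hΛ.gauge hsub surjective_rho hg1
  rw [hg2] at hπ
  have hπb := isBivectorField_of_isReduction hemb hfree hW hP hsub hBdyn.1 hB hπ
  obtain ⟨Hred, hH, hHM⟩ := exists_reduced_hamM (EP := EP) (G := G) hemb hsub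
  refine ⟨BB, hBBs, hBB, Λ, Λ.gauge 𝓘(ℝ, EP) BB, hΛb, hΛ, hπb, hπ, ⟨Hred, hH, hHM,
    rhoD_nhField hemb hP hsub hBdyn.1 hBdyn.2 hπ hH hHM⟩, hΛG, rfl, fun gW hvs =>
    ⟨isPoisson_of_isReduction hemb hfree hW hP hvs hsub hgJK hΛb hΛ,
      ⟨hπb, hBBs.d.neg, fun x => ?_, fun f g h hf hg hh x =>
      jacobiator_of_isReduction hemb hfree hW hP hvs hsub hBdyn.1 hB hBW hπ hBBs hBB hf hg hh x⟩,
      isCompl_algS hemb hfree hW hP hvs, fun η =>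
      nhMomentum_conserved hemb hfree hW hP hvs hBdyn.2 hbasic.2 _ η rfl⟩⟩
  rw [DForm.d_neg]
  exact neg_eq_zero.2 (DForm.d_d hBBs x)

end
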